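/- Let $R$ be a commutative ring, and let complexes be chain complexes of $R$-modules, graded by $\mathbb Z$ or by $\mathbb Z/2$ (more generally by $\mathbb Z/2N$, $N\ge 0$). By a multicategory we mean a symmetric multicategory enriched in complexes (a dg multicategory): it has complexes of multimorphisms $\mathcal M(x_1,\dots,x_n;y)$ for non-empty sequences of inputs, symmetry isomorphisms, units and compositions; an operad is a multicategory with one object, written $\star$. An $\mathcal M$-algebra $A$ consists of complexes $A(x)$, for the objects $x$, with chain maps $A(x_1)\otimes\dots\otimes A(x_n)\otimes\mathcal M(x_1,\dots,x_n;y)\to A(y)$ compatible with composition, units and symmetries. Write $U$ for the functor from $\mathcal M$-algebras to families of complexes $(C_x)_{x\in\mathrm{Ob}\,\mathcal M}$, and $\mathbb F_{\mathcal M}$ for its left adjoint. Let $\mathcal M$ be a multicategory with a total order on its objects, $\mathcal O$ an operad, $\pi:\mathcal M\to\mathcal O$ a multifunctor and $A$ an $\mathcal M$-algebra. **Operadic extension.** For a family $C$ over $\mathrm{Ob}\,\mathcal M$ let $\mathrm{Col}(\pi)_*C=\bigoplus_{x}C_x$. The operadic left Kan extension $L'=\mathbb L\pi_*A(\star)$ is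 the realization (the direct sum of the complexes of $n$-simplices shifted by $n$, with the alternating sum of the face maps added to the differential) of the simplicial object $$n\mapsto \mathbb F_{\mathcal O}\,\mathrm{Col}(\pi)_*\,U(\mathbb F_{\mathcal M}U)^n(A),$$ whose face maps are given by the algebra structures (counits) and by the natural map $\mathbb F_{\mathcal O}\mathrm{Col}(\pi)_*U\mathbb F_{\mathcal M}\to\mathbb F_{\mathcal O}\mathrm{Col}(\pi)_*$ induced by $\pi$ and the composition of $\mathcal O$. **Categorical extension.** The PROP category $P\mathcal M$ has as objects the finite non-decreasing sequences of objects of $\mathcal M$, and as morphism complexes $$P\mathcal M(\vec x,\vec y)=\bigoplus_{f:[n]\to[m]}\ \bigotimes_{j=1}^m\mathcal M(\vec x|_{f^{-1}(j)};y_j)$$ (the multimorphisms with no inputs being $0$), with the composition induced by that of $\mathcal M$. The algebra $A$ gives a $P\mathcal M$-module $PA(\vec x)=A(x_1)\otimes\dots\otimes A(x_n)$, and $\pi$ gives a dg functor $P\pi:P\mathcal M\to P\mathcal O$. The categorical left Kan extension at the unit of $P\mathcal O$ (the sequence $\star$ of length one) is the realization $L=\mathbb LP\pi_*PA(\star)$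 of the bar construction with $n$-simplices $$\bigoplus_{\vec x_0,\dots,\vec x_n}PA(\vec x_0)\otimes P\mathcal M(\vec x_0,\vec x_1)\otimes\dots\otimes P\mathcal M(\vec x_{n-1},\vec x_n)\otimes P\mathcal O(P\pi(\vec x_n),\star).$$ **Comparison.** For a family $D$ put $(PD)(\vec x)=D_{x_1}\otimes\dots\otimes D_{x_n}$. The natural maps $\mathbb F_{P\mathcal M}(PD)\to P(\mathbb F_{\mathcal M}D)$ and $\mathbb F_{P\mathcal O}(\mathrm{Col}(P\pi)_*PD)(\star)\to\mathbb F_{\mathcal O}(\mathrm{Col}(\pi)_*D)(\star)$, extending the inclusions of generators, induce a chain map $\Phi:L\to L'$. Let $F_mL\subset L$ be the subcomplex formed by the summands with at most $m$ indices $0\le i<n$ such that $\vec x_i\ne\vec x_{i+1}$, let $F_mL'=\Phi(F_mL)\subset L'$, and let $F_m\Phi:F_mL\to F_mL'$ be the restriction of $\Phi$. **Freeness hypothesis.** For a sequence $\vec x=(x_1,\dots,x_n)$ let $\mathrm{Aut}(\vec x)\subset S_n$ be the group of permutations which preserve $\vec x$; it acts from the right on $P\mathcal M(\vec x,\vec y)$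 by precomposition with the permutation morphisms. For a group $G$, a complex with a right $G$-action is called bounded below and free over $R[G]$ if it is obtained, by collapsing the grading, from a $\mathbb Z$-graded complex of free $R[G]$-modules that vanishes in all sufficiently small degrees. Assume that 1. for every object $\vec x$ of $P\mathcal M$ the permutation morphisms identify $P\mathcal M(\vec x,\vec x)$ with $R[\mathrm{Aut}(\vec x)]$, concentrated in degree $0$; 2. for all objects $\vec x,\vec y$ of $P\mathcal M$ the complex $P\mathcal M(\vec x,\vec y)$ is bounded below and free over $R[\mathrm{Aut}(\vec x)]$; 3. for every $n\ge1$ the complex $\mathcal O(n)$ is bounded below and free over $R[S_n]$. **Conclusion.** The complexes $L=\mathbb LP\pi_*PA(\star)$ and $L'=\mathbb L\pi_*A(\star)$ are chain homotopy equivalent. Moreover $\Phi:L\to L'$ is a quasi-isomorphism, and $F_m\Phi:F_mL\to F_mL'$ is a quasi-isomorphism for every $m\ge0$. -/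

import Mathlib

set_option linter.unusedVariables false
set_option linter.unusedSectionVars false

open CategoryTheory

universe u

noncomputable section

/-- The grading group: `ℤ` for `N = 0`, `ℤ/2` for `N = 1`, and `ℤ/2N` in general. -/
abbrev Deg (N : ℕ) : Type := ZMod (2 * N)

/-- The category of chain complexes of `R`-modules graded by `ℤ/2N`; differentials lower
the degree by one. -/
abbrev Ch (R : Type u) [CommRing R] (N : ℕ) : Type (u + 1) :=
  HomologicalComplex (ModuleCat.{u} R) (ComplexShape.down (Deg N))

/-- The parity of a degree. -/
def par {N : ℕ} : Deg N →+* ZMod 2 := ZMod.castHom (dvd_mul_right 2 N) (ZMod 2)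

/-- The sign `(-1) ^ a`. -/
def sg (R : Type u) [CommRing R] (a : ZMod 2) : R := if a = 0 then 1 else -1

section Elements

variable {R : Type u} [CommRing R] {N : ℕ}

theorem sg_zero : sg R 0 = 1 := by simp [sg]

theorem sg_one : sg R 1 = -1 := by simp [sg]

theorem sg_add (a b : ZMod 2) : sg R (a + b) = sg R a * sg R b := by
  have h : ∀ c : ZMod 2, c = 0 ∨ c = 1 := by decide
  have h2 : (1 : ZMod 2) + 1 = 0 := by decide
  rcases h a with rfl | rfl <;> rcases h b with rfl | rfl <;> simp [sg, h2]

/-- The differential of a complex, on elements. -/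
def del (K : Ch R N) (a b : Deg N) : K.X a →ₗ[R] K.X b := (K.d a b).hom

/-- Transport of elements between equal degrees (zero between distinct degrees). -/
def tr (K : Ch R N) (a b : Deg N) : K.X a →ₗ[R] K.X b :=
  if h : a = b then h ▸ LinearMap.id else 0

/-- A chain map, on elements. -/
def app {K L : Ch R N} (f : K ⟶ L) (a : Deg N) : K.X a →ₗ[R] L.X a := (f.f a).hom

theorem tr_self (K : Ch R N) (a : Deg N) (x : K.X a) : tr K a a x = x := by simp [tr]

theorem del_del (K : Ch R N) (a b c : Deg N) (x : K.X a) : del K b c (del K a b x) = 0 := by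
  have := congrArg (fun f => f.hom x) (K.d_comp_d a b c)
  exact this

theorem del_shape (K : Ch R N) (a b : Deg N) (h : b + 1 ≠ a) : del K a b = 0 := by
  have := K.shape a b h
  simp [del, this]

theorem app_del {K L : Ch R N} (f : K ⟶ L) (a b : Deg N) (x : K.X a) :
    app f b (del K a b x) = del L a b (app f a x) := by
  have := congrArg (fun f => f.hom x) (f.comm a b)
  exact this.symm

theorem app_tr {K L : Ch R N} (f : K ⟶ L) (a b : Deg N) (x : K.X a) :
    app f b (tr K a b x) = tr L a b (app f a x) := by
  unfold tr
  split_ifs with h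
  · subst h; rfl
  · simp

theorem app_id (K : Ch R N) (a : Deg N) (x : K.X a) : app (𝟙 K) a x = x := rfl

theorem app_comp {K L M : Ch R N} (f : K ⟶ L) (g : L ⟶ M) (a : Deg N) (x : K.X a) :
    app (f ≫ g) a x = app g a (app f a x) := rfl

theorem hom_ext_app {K L : Ch R N} {f g : K ⟶ L} (h : ∀ a x, app f a x = app g a x) : f = g := by
  ext a x
  exact h a x

/-- A complex from its modules and its differential. -/
def mkCh (X : Deg N → Type u) [∀ a, AddCommGroup (X a)] [∀ a, Module R (X a)]
    (d : ∀ a b, X a →ₗ[R] X b) (shape : ∀ a b, b + 1 ≠ a → d a b = 0)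
    (sq : ∀ a b c x, d b c (d a b x) = 0) : Ch R N where
  X a := ModuleCat.of R (X a)
  d a b := ModuleCat.ofHom (d a b)
  shape a b h := by rw [shape a b h]; rfl
  d_comp_d' a b c _ _ := by ext x; exact sq a b c x

/-- A chain map from its components. -/
def mkHom {K L : Ch R N} (f : ∀ a, K.X a →ₗ[R] L.X a)
    (comm : ∀ a b x, f b (del K a b x) = del L a b (f a x)) : K ⟶ L where
  f a := ModuleCat.ofHom (f a)
  comm' a b _ := by ext x; exact (comm a b x).symm

theorem app_mkHom {K L : Ch R N} (f : ∀ a, K.X a →ₗ[R] L.X a) (comm) (a : Deg N) (x : K.X a) :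
    app (mkHom f comm) a x = f a x := rfl

end Elements

section Families

variable {R : Type u} [CommRing R] {N : ℕ} {J : Type} [Fintype J] [LinearOrder J]

/-- The multidegree `g` lowered by one in position `j`. -/
def low (g : J → Deg N) (j : J) : J → Deg N := Function.update g j (g j - 1)

/-- The parity of the total degree of the entries that precede position `j`. -/
def before (g : J → Deg N) (j : J) : ZMod 2 := ∑ i, if i < j then par (g i) else 0

/-- The differential in position `j`, and the identity in the other positions. -/
def dmap (K : J → Ch R N) (g g' : J → Deg N) (j i : J) : (K i).X (g i) →ₗ[R] (K i).X (g' i) :=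
  if i = j then del (K i) (g i) (g' i) else tr (K i) (g i) (g' i)

/-- The Koszul sign exponent of reordering a family indexed by `J'`, of degrees `g`, along
a bijection `e : J ≃ J'` of ordered sets. -/
def kz {J' : Type} [LinearOrder J'] (e : J ≃ J') (g : J' → Deg N) : ZMod 2 :=
  ∑ i, ∑ j, if i < j ∧ e j < e i then par (g (e i)) * par (g (e j)) else 0

theorem sum_low (g : J → Deg N) (j : J) : ∑ i, low g j i = ∑ i, g i - 1 := by
  unfold low
  rw [Finset.sum_update_of_mem (Finset.mem_univ j),
    ← Finset.add_sum_erase Finset.univ g (Finset.mem_univ j), Finset.sdiff_singleton_eq_erase]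
  ring

theorem sum_low_add {g : J → Deg N} {h c : Deg N} (hc : ∑ i, g i + h = c) (j : J) :
    ∑ i, low g j i + h = c - 1 := by rw [sum_low, ← hc]; ring

end Families

theorem app_dmap {R : Type u} [CommRing R] {N : ℕ} {J : Type} [LinearOrder J] {K L : J → Ch R N} (f : ∀ j, K j ⟶ L j) (g g' : J → Deg N) (j i : J)
    (x : (K i).X (g i)) : app (f i) (g' i) (dmap K g g' j i x) = dmap L g g' j i (app (f i) (g i) x) := by
  unfold dmap
  split_ifs
  · exact app_del _ _ _ _
  · exact app_tr _ _ _ _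

theorem sum_add_low {N : ℕ} {J : Type} [Fintype J] {g : J → Deg N} {h c : Deg N} (hc : ∑ i, g i + h = c) :
    ∑ i, g i + (h - 1) = c - 1 := by rw [← hc]; ring

/-- The reassociation bijection of iterated ordered sums. -/
def lexAssoc {K : Type} {J : K → Type} (I : ∀ k, J k → Type) :
    (Σₗ k, Σₗ j : J k, I k j) ≃ (Σₗ q : (Σₗ k, J k), I (ofLex q).1 (ofLex q).2) where
  toFun p := toLex ⟨toLex ⟨(ofLex p).1, (ofLex (ofLex p).2).1⟩, (ofLex (ofLex p).2).2⟩
  invFun p := toLex ⟨(ofLex (ofLex p).1).1, toLex ⟨(ofLex (ofLex p).1).2, (ofLex p).2⟩⟩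
  left_inv _ := rfl
  right_inv _ := rfl

/-- The bijection of ordered sums induced by a bijection of the outer index sets. -/
def lexOuter {J J' : Type} (e : J ≃ J') (I : J' → Type) :
    (Σₗ j, I (e j)) ≃ (Σₗ j', I j') :=
  ofLex.trans ((Equiv.sigmaCongrLeft (β := I) e).trans toLex)

/-- The bijection of ordered sums induced by bijections of the inner index sets. -/
def lexInner {J : Type} {I I' : J → Type} (e : ∀ j, I j ≃ I' j) :
    (Σₗ j, I j) ≃ (Σₗ j, I' j) :=
  ofLex.trans ((Equiv.sigmaCongrRight e).trans toLex)

/-- An ordered sum over a point. -/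
def lexUnitLeft (I : Type) : (Σₗ _ : Unit, I) ≃ I where
  toFun p := (ofLex p).2
  invFun i := toLex ⟨(), i⟩
  left_inv _ := rfl
  right_inv _ := rfl

/-- An ordered sum of points. -/
def lexUnitRight (J : Type) : (Σₗ _ : J, Unit) ≃ J where
  toFun p := (ofLex p).1
  invFun j := toLex ⟨j, ()⟩
  left_inv _ := rfl
  right_inv _ := rfl

/-- A differential graded (symmetric) multicategory over `R`. -/
structure DGMulticat (R : Type u) [CommRing R] (N : ℕ) where
  Ob : Type u
  Hom : ∀ {I : Type} [Fintype I] [LinearOrder I], (I → Ob) → Ob → Ch R N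
  hom_empty : ∀ {I : Type} [Fintype I] [LinearOrder I] [IsEmpty I] (x : I → Ob) (y : Ob)
    (a : Deg N) (m : (Hom x y).X a), m = 0
  perm : ∀ {I I' : Type} [Fintype I] [LinearOrder I] [Fintype I'] [LinearOrder I']
    {x : I → Ob} {x' : I' → Ob} (e : I ≃ I') (_ : ∀ i, x i = x' (e i)) (y : Ob), Hom x' y ⟶ Hom x y
  one : ∀ x : Ob, (Hom (fun _ : Unit => x) x).X 0
  comp : ∀ {J : Type} {I : J → Type} [Fintype J] [LinearOrder J] [∀ j, Fintype (I j)]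
    [∀ j, LinearOrder (I j)] {x : ∀ j, I j → Ob} {y : J → Ob} {z : Ob}
    (g : J → Deg N) (h c : Deg N) (_ : ∑ j, g j + h = c),
    MultilinearMap R (fun j => (Hom (x j) (y j)).X (g j))
      ((Hom y z).X h →ₗ[R]
        (Hom (fun p : Σₗ j, I j => x (ofLex p).1 (ofLex p).2) z).X c)
  perm_refl : ∀ {I : Type} [Fintype I] [LinearOrder I] (x : I → Ob) (y : Ob),
    perm (Equiv.refl I) (fun _ => rfl) y = 𝟙 (Hom x y)
  perm_trans : ∀ {I I' I'' : Type} [Fintype I] [LinearOrder I] [Fintype I'] [LinearOrder I']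
    [Fintype I''] [LinearOrder I''] (x : I'' → Ob) (e : I ≃ I') (e' : I' ≃ I'') (y : Ob),
    perm (x' := x) e' (fun _ => rfl) y ≫ perm (x := fun i => x (e' (e i))) e (fun _ => rfl) y =
      perm (e.trans e') (fun _ => rfl) y
  del_one : ∀ (x : Ob) (c : Deg N), del _ 0 c (one x) = 0
  del_comp : ∀ {J : Type} {I : J → Type} [Fintype J] [LinearOrder J] [∀ j, Fintype (I j)]
    [∀ j, LinearOrder (I j)] {x : ∀ j, I j → Ob} {y : J → Ob} {z : Ob}
    (g : J → Deg N) (h c : Deg N) (hc : ∑ j, g j + h = c)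
    (f : ∀ j, (Hom (x j) (y j)).X (g j)) (p : (Hom y z).X h),
    del _ c (c - 1) (comp g h c hc f p) =
      ∑ j, sg R (before g j) • comp (low g j) h (c - 1) (sum_low_add hc j)
        (fun i => dmap (fun i => Hom (x i) (y i)) g (low g j) j i (f i)) p +
      sg R (∑ j, par (g j)) • comp g (h - 1) (c - 1) (sum_add_low hc) f (del _ h (h - 1) p)
  one_comp : ∀ {J : Type} [Fintype J] [LinearOrder J] (y : J → Ob) (z : Ob) (h : Deg N)
    (hc : ∑ _ : J, (0 : Deg N) + h = h) (p : (Hom y z).X h),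
    comp (fun _ => 0) h h hc (fun j => one (y j)) p =
      app (perm (lexUnitRight J) (fun _ => rfl) z) h p
  comp_one : ∀ {I : Type} [Fintype I] [LinearOrder I] (x : I → Ob) (y : Ob) (h : Deg N)
    (hc : ∑ _ : Unit, h + 0 = h) (m : (Hom x y).X h),
    comp (fun _ => h) 0 h hc (fun _ : Unit => m) (one y) =
      app (perm (lexUnitLeft I) (fun _ => rfl) y) h m
  comp_comp : ∀ {K : Type} {J : K → Type} {I : ∀ k, J k → Type} [Fintype K] [LinearOrder K]
    [∀ k, Fintype (J k)] [∀ k, LinearOrder (J k)] [∀ k j, Fintype (I k j)]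
    [∀ k j, LinearOrder (I k j)] {x : ∀ k j, I k j → Ob} {y : ∀ k, J k → Ob} {z : K → Ob} {w : Ob}
    (f : ∀ k, J k → Deg N) (g : K → Deg N) (h : Deg N) (fg : K → Deg N) (gh c : Deg N)
    (h₁ : ∀ k, ∑ j, f k j + g k = fg k) (h₂ : ∑ k, fg k + h = c)
    (h₃ : ∑ k, g k + h = gh) (h₄ : ∑ q : Σₗ k, J k, f (ofLex q).1 (ofLex q).2 + gh = c)
    (a : ∀ k j, (Hom (x k j) (y k j)).X (f k j)) (b : ∀ k, (Hom (y k) (z k)).X (g k))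
    (p : (Hom z w).X h),
    comp fg h c h₂ (fun k => comp (f k) (g k) (fg k) (h₁ k) (a k) (b k)) p =
      sg R (∑ k, ∑ k', if k < k' then par (g k) * ∑ j, par (f k' j) else 0) •
        app (perm (lexAssoc I) (fun _ => rfl) w) c
          (comp (fun q : Σₗ k, J k => f (ofLex q).1 (ofLex q).2) gh c h₄
            (fun q => a (ofLex q).1 (ofLex q).2) (comp g h gh h₃ b p))
  comp_perm_inner : ∀ {J : Type} {I I' : J → Type} [Fintype J] [LinearOrder J]
    [∀ j, Fintype (I j)] [∀ j, LinearOrder (I j)] [∀ j, Fintype (I' j)] [∀ j, LinearOrder (I' j)]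
    {x : ∀ j, I' j → Ob} {y : J → Ob} {z : Ob} (e : ∀ j, I j ≃ I' j)
    (g : J → Deg N) (h c : Deg N) (hc : ∑ j, g j + h = c)
    (f : ∀ j, (Hom (x j) (y j)).X (g j)) (p : (Hom y z).X h),
    comp g h c hc
        (fun j => app (perm (x := fun i => x j (e j i)) (e j) (fun _ => rfl) (y j)) (g j) (f j)) p =
      app (perm (lexInner e) (fun _ => rfl) z) c (comp g h c hc f p)
  comp_perm_outer : ∀ {J J' : Type} {I : J' → Type} [Fintype J] [LinearOrder J] [Fintype J']
    [LinearOrder J'] [∀ j, Fintype (I j)] [∀ j, LinearOrder (I j)]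
    {x : ∀ j, I j → Ob} {y : J' → Ob} {z : Ob} (e : J ≃ J')
    (g : J' → Deg N) (h c : Deg N) (hc : ∑ j, g j + h = c) (hc' : ∑ j, g (e j) + h = c)
    (f : ∀ j, (Hom (x j) (y j)).X (g j)) (p : (Hom y z).X h),
    comp (fun j => g (e j)) h c hc' (fun j => f (e j))
        (app (perm (x := fun j => y (e j)) e (fun _ => rfl) z) h p) =
      sg R (kz e g) • app (perm (lexOuter e I) (fun _ => rfl) z) c (comp g h c hc f p)

/-- An algebra over a differential graded multicategory: a family of complexes with operations
`A (x 1) ⊗ ⋯ ⊗ A (x n) ⊗ M (x; y) ⟶ A y`. -/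
structure DGAlg {R : Type u} [CommRing R] {N : ℕ} (M : DGMulticat R N) where
  obj : M.Ob → Ch R N
  act : ∀ {J : Type} [Fintype J] [LinearOrder J] {x : J → M.Ob} {y : M.Ob}
    (g : J → Deg N) (h c : Deg N) (_ : ∑ j, g j + h = c),
    MultilinearMap R (fun j => (obj (x j)).X (g j)) ((M.Hom x y).X h →ₗ[R] (obj y).X c)
  del_act : ∀ {J : Type} [Fintype J] [LinearOrder J] {x : J → M.Ob} {y : M.Ob}
    (g : J → Deg N) (h c : Deg N) (hc : ∑ j, g j + h = c)
    (a : ∀ j, (obj (x j)).X (g j)) (m : (M.Hom x y).X h),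
    del _ c (c - 1) (act g h c hc a m) =
      ∑ j, sg R (before g j) • act (low g j) h (c - 1) (sum_low_add hc j)
        (fun i => dmap (fun i => obj (x i)) g (low g j) j i (a i)) m +
      sg R (∑ j, par (g j)) • act g (h - 1) (c - 1) (sum_add_low hc) a (del _ h (h - 1) m)
  act_one : ∀ (y : M.Ob) (h : Deg N) (hc : ∑ _ : Unit, h + 0 = h) (a : (obj y).X h),
    act (fun _ => h) 0 h hc (fun _ : Unit => a) (M.one y) = a
  act_act : ∀ {J : Type} {I : J → Type} [Fintype J] [LinearOrder J]
    [∀ j, Fintype (I j)] [∀ j, LinearOrder (I j)] {x : ∀ j, I j → M.Ob} {y : J → M.Ob} {z : M.Ob}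
    (f : ∀ j, I j → Deg N) (g : J → Deg N) (h : Deg N) (fg : J → Deg N) (gh c : Deg N)
    (h₁ : ∀ j, ∑ i, f j i + g j = fg j) (h₂ : ∑ j, fg j + h = c)
    (h₃ : ∑ j, g j + h = gh) (h₄ : ∑ q : Σₗ j, I j, f (ofLex q).1 (ofLex q).2 + gh = c)
    (a : ∀ j i, (obj (x j i)).X (f j i)) (b : ∀ j, (M.Hom (x j) (y j)).X (g j))
    (p : (M.Hom y z).X h),
    act fg h c h₂ (fun j => act (f j) (g j) (fg j) (h₁ j) (a j) (b j)) p =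
      sg R (∑ j, ∑ j', if j < j' then par (g j) * ∑ i, par (f j' i) else 0) •
        act (fun q : Σₗ j, I j => f (ofLex q).1 (ofLex q).2) gh c h₄
          (fun q => a (ofLex q).1 (ofLex q).2) (M.comp g h gh h₃ b p)
  act_perm : ∀ {J J' : Type} [Fintype J] [LinearOrder J] [Fintype J'] [LinearOrder J']
    {x : J' → M.Ob} {y : M.Ob} (e : J ≃ J') (g : J' → Deg N) (h c : Deg N)
    (hc : ∑ j, g j + h = c) (hc' : ∑ j, g (e j) + h = c)
    (a : ∀ j, (obj (x j)).X (g j)) (m : (M.Hom x y).X h),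
    act (fun j => g (e j)) h c hc' (fun j => a (e j))
        (app (M.perm (x := fun j => x (e j)) e (fun _ => rfl) y) h m) =
      sg R (kz e g) • act g h c hc a m

/-- A morphism of algebras. -/
@[ext]
structure DGAlgHom {R : Type u} [CommRing R] {N : ℕ} {M : DGMulticat R N} (A B : DGAlg M) where
  hom : ∀ x, A.obj x ⟶ B.obj x
  map_act : ∀ {J : Type} [Fintype J] [LinearOrder J] {x : J → M.Ob} {y : M.Ob}
    (g : J → Deg N) (h c : Deg N) (hc : ∑ j, g j + h = c)
    (a : ∀ j, (A.obj (x j)).X (g j)) (m : (M.Hom x y).X h),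
    app (hom y) c (A.act g h c hc a m) =
      B.act g h c hc (fun j => app (hom (x j)) (g j) (a j)) m

instance {R : Type u} [CommRing R] {N : ℕ} {M : DGMulticat R N} : Category (DGAlg M) where
  Hom := DGAlgHom
  id A := ⟨fun x => 𝟙 _, fun _ _ _ _ _ _ => rfl⟩
  comp F G := ⟨fun x => F.hom x ≫ G.hom x, fun g h c hc a m => by
    simp only [app_comp, F.map_act, G.map_act]⟩

/-- A multifunctor of differential graded multicategories. -/
structure DGMultifunctor {R : Type u} [CommRing R] {N : ℕ} (M O : DGMulticat R N) where
  obj : M.Ob → O.Ob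
  map : ∀ {I : Type} [Fintype I] [LinearOrder I] (x : I → M.Ob) (y : M.Ob),
    M.Hom x y ⟶ O.Hom (fun i => obj (x i)) (obj y)
  map_perm : ∀ {I I' : Type} [Fintype I] [LinearOrder I] [Fintype I'] [LinearOrder I']
    (x : I' → M.Ob) (e : I ≃ I') (y : M.Ob),
    M.perm (x := fun i => x (e i)) e (fun _ => rfl) y ≫ map (fun i => x (e i)) y =
      map x y ≫ O.perm e (fun _ => rfl) (obj y)
  map_one : ∀ x : M.Ob, app (map (fun _ : Unit => x) x) 0 (M.one x) = O.one (obj x)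
  map_comp : ∀ {J : Type} {I : J → Type} [Fintype J] [LinearOrder J] [∀ j, Fintype (I j)]
    [∀ j, LinearOrder (I j)] {x : ∀ j, I j → M.Ob} {y : J → M.Ob} {z : M.Ob}
    (g : J → Deg N) (h c : Deg N) (hc : ∑ j, g j + h = c)
    (f : ∀ j, (M.Hom (x j) (y j)).X (g j)) (p : (M.Hom y z).X h),
    app (map _ z) c (M.comp g h c hc f p) =
      O.comp g h c hc (fun j => app (map (x j) (y j)) (g j) (f j)) (app (map y z) h p)

section FreeAlgebra

variable {R : Type u} [CommRing R] {N : ℕ} {M : DGMulticat R N}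

/-- Formal terms of the language of `M`-algebras, with constants from the collection `C`. -/
inductive Term (C : M.Ob → Ch R N) : M.Ob → Deg N → Type u
  | of (y : M.Ob) (a : Deg N) (c : (C y).X a) : Term C y a
  | zero (y : M.Ob) (a : Deg N) : Term C y a
  | add {y : M.Ob} {a : Deg N} (s t : Term C y a) : Term C y a
  | smul {y : M.Ob} {a : Deg N} (r : R) (t : Term C y a) : Term C y a
  | del {y : M.Ob} {a : Deg N} (b : Deg N) (t : Term C y a) : Term C y b
  | op {n : ℕ} {x : Fin n → M.Ob} {y : M.Ob} {g : Fin n → Deg N} {h c : Deg N}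
      (hc : ∑ j, g j + h = c) (t : ∀ j, Term C (x j) (g j)) (m : (M.Hom x y).X h) : Term C y c

/-- The value of a term in an `M`-algebra `D` under an interpretation of the constants. -/
def Term.eval {C : M.Ob → Ch R N} (D : DGAlg M) (φ : ∀ y, C y ⟶ D.obj y) :
    ∀ {y : M.Ob} {a : Deg N}, Term C y a → (D.obj y).X a
  | _, _, .of y a c => app (φ y) a c
  | _, _, .zero _ _ => 0
  | _, _, .add s t => s.eval D φ + t.eval D φ
  | _, _, .smul r t => r • t.eval D φ
  | _, _, .del b t => _root_.del _ _ b (t.eval D φ)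
  | _, _, .op hc t m => D.act _ _ _ hc (fun j => (t j).eval D φ) m

/-- The module of natural elements: those families, indexed by all `M`-algebras `D` under `C`,
that are given by a term. -/
def freeSub (C : M.Ob → Ch R N) (y : M.Ob) (a : Deg N) :
    Submodule R (∀ (D : DGAlg M) (_ : ∀ y, C y ⟶ D.obj y), (D.obj y).X a) where
  carrier := {s | ∃ t : Term C y a, ∀ D φ, s D φ = t.eval D φ}
  add_mem' := by
    rintro s s' ⟨t, ht⟩ ⟨t', ht'⟩
    exact ⟨.add t t', fun D φ => by simp [ht, ht', Term.eval]⟩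
  zero_mem' := ⟨.zero y a, fun D φ => by simp [Term.eval]⟩
  smul_mem' := by
    rintro r s ⟨t, ht⟩
    exact ⟨.smul r t, fun D φ => by simp [ht, Term.eval]⟩

instance (C : M.Ob → Ch R N) (y : M.Ob) (a : Deg N) : Small.{u} (freeSub C y a) :=
  small_of_surjective (α := Term C y a)
    (f := fun t => ⟨fun D φ => t.eval D φ, ⟨t, fun _ _ => rfl⟩⟩)
    (fun s => ⟨s.2.choose, Subtype.ext (by
      funext D φ; exact (s.2.choose_spec D φ).symm)⟩)

/-- The module of elements of degree `a` over the object `y` in the free `M`-algebra on `C`: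
formal terms, two terms being identified when they have the same value in every `M`-algebra
under `C`. -/
abbrev FreeX (C : M.Ob → Ch R N) (y : M.Ob) (a : Deg N) : Type u := Shrink.{u} (freeSub C y a)

/-- The value of an element of the free algebra in an algebra under `C`. -/
def evalF {C : M.Ob → Ch R N} (D : DGAlg M) (φ : ∀ y, C y ⟶ D.obj y) (y : M.Ob) (a : Deg N) :
    FreeX C y a →ₗ[R] (D.obj y).X a :=
  LinearMap.proj φ ∘ₗ LinearMap.proj D ∘ₗ (freeSub C y a).subtype ∘ₗ
    (Shrink.linearEquiv R (freeSub C y a)).toLinearMap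

theorem evalF_ext {C : M.Ob → Ch R N} {y : M.Ob} {a : Deg N} {q q' : FreeX C y a}
    (h : ∀ D φ, evalF D φ y a q = evalF D φ y a q') : q = q' := by
  apply (Shrink.linearEquiv R (freeSub C y a)).injective
  apply Subtype.ext
  funext D φ
  exact h D φ

theorem exists_term {C : M.Ob → Ch R N} {y : M.Ob} {a : Deg N} (q : FreeX C y a) :
    ∃ t : Term C y a, ∀ D φ, evalF D φ y a q = t.eval D φ :=
  ((Shrink.linearEquiv R (freeSub C y a)) q).2

theorem evalF_mk {C : M.Ob → Ch R N} {y : M.Ob} {a : Deg N}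
    (s : ∀ (D : DGAlg M) (_ : ∀ y, C y ⟶ D.obj y), (D.obj y).X a)
    (hs : s ∈ freeSub C y a) (D : DGAlg M) (φ : ∀ y, C y ⟶ D.obj y) :
    evalF D φ y a ((Shrink.linearEquiv R (freeSub C y a)).symm ⟨s, hs⟩) = s D φ := by
  simp [evalF]

/-- The class of a term. -/
def mkF {C : M.Ob → Ch R N} {y : M.Ob} {a : Deg N} (t : Term C y a) : FreeX C y a :=
  (Shrink.linearEquiv R (freeSub C y a)).symm ⟨fun D φ => t.eval D φ, ⟨t, fun _ _ => rfl⟩⟩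

theorem evalF_mkF {C : M.Ob → Ch R N} {y : M.Ob} {a : Deg N} (t : Term C y a)
    (D : DGAlg M) (φ : ∀ y, C y ⟶ D.obj y) : evalF D φ y a (mkF t) = t.eval D φ :=
  evalF_mk _ _ D φ

theorem act_chart (D : DGAlg M) {J : Type} [Fintype J] [LinearOrder J] {x : J → M.Ob} {y : M.Ob}
    (g : J → Deg N) (h c : Deg N) (hc : ∑ j, g j + h = c)
    {n : ℕ} (e : Fin n ≃o J) (hc' : ∑ i, g (e i) + h = c)
    (a : ∀ j, (D.obj (x j)).X (g j)) (m : (M.Hom x y).X h) :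
    D.act (fun i => g (e i)) h c hc' (fun i => a (e i))
      (app (M.perm (x := fun i => x (e i)) e.toEquiv (fun _ => rfl) y) h m) = D.act g h c hc a m := by
  have hk : kz e.toEquiv g = 0 := by
    unfold kz
    refine Finset.sum_eq_zero fun i _ => Finset.sum_eq_zero fun j _ => if_neg ?_
    rintro ⟨h1, h2⟩
    exact absurd (e.lt_iff_lt.mp h2) (not_lt.mpr h1.le)
  have := D.act_perm e.toEquiv g h c hc hc' a m
  rw [hk, sg_zero, one_smul] at this
  exact this

/-- The increasing enumeration of a finite ordered set. -/
def chart (J : Type) [Fintype J] [LinearOrder J] : Fin (Fintype.card J) ≃o J :=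
  Finset.univ.orderIsoOfFin rfl |>.trans
    ((OrderIso.setCongr _ _ (by simp)).trans OrderIso.Set.univ)

theorem chart_sum {J : Type} [Fintype J] [LinearOrder J] {g : J → Deg N} {h c : Deg N}
    (hc : ∑ j, g j + h = c) : ∑ i, g (chart J i) + h = c := by
  rw [← hc]; congr 1; exact Equiv.sum_comp (chart J).toEquiv g

/-- The differential of the free algebra. -/
def delF (C : M.Ob → Ch R N) (y : M.Ob) (a b : Deg N) (q : FreeX C y a) : FreeX C y b :=
  mkF (.del b (exists_term q).choose)

theorem evalF_delF {C : M.Ob → Ch R N} (y : M.Ob) (a b : Deg N) (q : FreeX C y a)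
    (D : DGAlg M) (φ : ∀ y, C y ⟶ D.obj y) :
    evalF D φ y b (delF C y a b q) = del _ a b (evalF D φ y a q) := by
  rw [delF, evalF_mkF, Term.eval, (exists_term q).choose_spec D φ]

/-- The complexes underlying the free algebra. -/
def freeCh (C : M.Ob → Ch R N) (y : M.Ob) : Ch R N :=
  mkCh (FreeX C y)
    (fun a b =>
      { toFun := delF C y a b
        map_add' := fun q q' => evalF_ext fun D φ => by simp [evalF_delF]
        map_smul' := fun r q => evalF_ext fun D φ => by simp [evalF_delF] })
    (fun a b h => LinearMap.ext fun q => evalF_ext fun D φ => by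
      simp [evalF_delF, del_shape _ a b h])
    (fun a b c q => evalF_ext fun D φ => by simp [evalF_delF, del_del])

/-- The evaluation of the free algebra in an algebra under `C`, as a chain map. -/
def evalHom {C : M.Ob → Ch R N} (D : DGAlg M) (φ : ∀ y, C y ⟶ D.obj y) (y : M.Ob) :
    freeCh C y ⟶ D.obj y :=
  mkHom (fun a => evalF D φ y a) (fun a b q => evalF_delF y a b q D φ)

theorem freeCh_ext {C : M.Ob → Ch R N} {y : M.Ob} {a : Deg N} {q q' : (freeCh C y).X a}
    (h : ∀ D φ, app (evalHom D φ y) a q = app (evalHom D φ y) a q') : q = q' :=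
  evalF_ext h

theorem exists_term' {C : M.Ob → Ch R N} {y : M.Ob} {a : Deg N} (q : (freeCh C y).X a) :
    ∃ t : Term C y a, ∀ D φ, app (evalHom D φ y) a q = t.eval D φ :=
  exists_term q

/-- The class of a term, as an element of the free algebra. -/
def mkC {C : M.Ob → Ch R N} {y : M.Ob} {a : Deg N} (t : Term C y a) : (freeCh C y).X a := mkF t

theorem eval_mkC {C : M.Ob → Ch R N} {y : M.Ob} {a : Deg N} (t : Term C y a)
    (D : DGAlg M) (φ : ∀ y, C y ⟶ D.obj y) : app (evalHom D φ y) a (mkC t) = t.eval D φ :=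
  evalF_mkF t D φ

/-- The operations of the free algebra. -/
def actF (C : M.Ob → Ch R N) {J : Type} [Fintype J] [LinearOrder J] {x : J → M.Ob} {y : M.Ob}
    (g : J → Deg N) (h c : Deg N) (hc : ∑ j, g j + h = c)
    (q : ∀ j, (freeCh C (x j)).X (g j)) (m : (M.Hom x y).X h) : (freeCh C y).X c :=
  mkC (.op (chart_sum hc) (fun i => (exists_term' (q (chart J i))).choose)
    (app (M.perm (x := fun i => x (chart J i)) (chart J).toEquiv (fun _ => rfl) y) h m))

theorem eval_actF {C : M.Ob → Ch R N} {J : Type} [Fintype J] [LinearOrder J] {x : J → M.Ob}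
    {y : M.Ob} (g : J → Deg N) (h c : Deg N) (hc : ∑ j, g j + h = c)
    (q : ∀ j, (freeCh C (x j)).X (g j)) (m : (M.Hom x y).X h)
    (D : DGAlg M) (φ : ∀ y, C y ⟶ D.obj y) :
    app (evalHom D φ y) c (actF C g h c hc q m) =
      D.act g h c hc (fun j => app (evalHom D φ (x j)) (g j) (q j)) m := by
  refine (eval_mkC _ D φ).trans ?_
  rw [Term.eval, ← act_chart D g h c hc (chart J) (chart_sum hc)]
  congr 2
  funext i
  exact ((exists_term' (q (chart J i))).choose_spec D φ).symm

theorem eval_actF_update {C : M.Ob → Ch R N} {J : Type} [Fintype J] [LinearOrder J] [DecidableEq J]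
    {x : J → M.Ob}
    {y : M.Ob} (g : J → Deg N) (h c : Deg N) (hc : ∑ j, g j + h = c)
    (q : ∀ j, (freeCh C (x j)).X (g j)) (m : (M.Hom x y).X h)
    (D : DGAlg M) (φ : ∀ y, C y ⟶ D.obj y) (j : J) (v : (freeCh C (x j)).X (g j)) :
    app (evalHom D φ y) c (actF C g h c hc (Function.update q j v) m) =
      D.act g h c hc (Function.update (fun j => app (evalHom D φ (x j)) (g j) (q j)) j
        (app (evalHom D φ (x j)) (g j) v)) m := by
  rw [eval_actF]
  congr 2
  funext i
  exact Function.apply_update (fun i => app (evalHom D φ (x i)) (g i)) q j v i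

/-- The operations of the free algebra, as multilinear maps. -/
def actM (C : M.Ob → Ch R N) {J : Type} [Fintype J] [LinearOrder J] {x : J → M.Ob} {y : M.Ob}
    (g : J → Deg N) (h c : Deg N) (hc : ∑ j, g j + h = c) :
    MultilinearMap R (fun j => (freeCh C (x j)).X (g j))
      ((M.Hom x y).X h →ₗ[R] (freeCh C y).X c) where
  toFun q :=
    { toFun := fun m => actF C g h c hc q m
      map_add' := fun m m' => freeCh_ext fun D φ => by simp [eval_actF]
      map_smul' := fun r m => freeCh_ext fun D φ => by simp [eval_actF] }
  map_update_add' q j v w := by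
    refine LinearMap.ext fun m => freeCh_ext fun D φ => ?_
    simp [eval_actF_update]
  map_update_smul' q j r v := by
    refine LinearMap.ext fun m => freeCh_ext fun D φ => ?_
    simp [eval_actF_update]

theorem eval_actM {C : M.Ob → Ch R N} {J : Type} [Fintype J] [LinearOrder J] {x : J → M.Ob}
    {y : M.Ob} (g : J → Deg N) (h c : Deg N) (hc : ∑ j, g j + h = c)
    (q : ∀ j, (freeCh C (x j)).X (g j)) (m : (M.Hom x y).X h)
    (D : DGAlg M) (φ : ∀ y, C y ⟶ D.obj y) :
    app (evalHom D φ y) c (actM C g h c hc q m) =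
      D.act g h c hc (fun j => app (evalHom D φ (x j)) (g j) (q j)) m :=
  eval_actF g h c hc q m D φ

/-- The free `M`-algebra on a collection of complexes. -/
def freeAlg (C : M.Ob → Ch R N) : DGAlg M where
  obj := freeCh C
  act g h c hc := actM C g h c hc
  del_act {J _ _ x y} g h c hc q m := by
    refine freeCh_ext fun D φ => ?_
    simp only [app_del, eval_actM, D.del_act, map_add, map_sum, map_smul]
    simp only [← app_dmap (K := fun i => freeCh C (x i)) (fun i => evalHom D φ (x i))]
  act_one y h hc q := by
    refine freeCh_ext fun D φ => ?_
    simp only [eval_actM, D.act_one]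
  act_act f g h fg gh c h₁ h₂ h₃ h₄ a b p := by
    refine freeCh_ext fun D φ => ?_
    simp only [eval_actM, map_smul]
    exact D.act_act f g h fg gh c h₁ h₂ h₃ h₄ _ b p
  act_perm e g h c hc hc' a m := by
    refine freeCh_ext fun D φ => ?_
    simp only [eval_actM, map_smul]
    exact D.act_perm e g h c hc hc' (fun j => app (evalHom D φ _) (g j) (a j)) m

/-- The morphism from the free algebra induced by a morphism of collections. -/
def freeLift {C : M.Ob → Ch R N} {D : DGAlg M} (φ : ∀ y, C y ⟶ D.obj y) : freeAlg C ⟶ D where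
  hom y := evalHom D φ y
  map_act g h c hc a m := eval_actM g h c hc a m D φ

/-- The inclusion of the generators in the free algebra. -/
def freeUnit (C : M.Ob → Ch R N) (y : M.Ob) : C y ⟶ (freeAlg C).obj y :=
  mkHom (K := C y) (L := freeCh C y)
    (fun a =>
      { toFun := fun x => mkC (.of y a x)
        map_add' := fun x x' => freeCh_ext fun D φ => by simp [eval_mkC, Term.eval]
        map_smul' := fun r x => freeCh_ext fun D φ => by simp [eval_mkC, Term.eval] })
    (fun a b x => freeCh_ext fun D φ => by
      rw [app_del]
      refine (eval_mkC _ D φ).trans ?_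
      rw [Term.eval, app_del]
      exact congrArg _ (eval_mkC (.of y a x) D φ).symm)

theorem freeUnit_lift {C : M.Ob → Ch R N} {D : DGAlg M} (φ : ∀ y, C y ⟶ D.obj y) (y : M.Ob) :
    freeUnit C y ≫ (freeLift φ).hom y = φ y :=
  hom_ext_app fun _ _ => eval_mkC _ D φ

theorem freeHom_mkC {C : M.Ob → Ch R N} {D : DGAlg M} (F : freeAlg C ⟶ D) {y : M.Ob} {a : Deg N}
    (t : Term C y a) :
    app (F.hom y) a (mkC t) = t.eval D (fun y => freeUnit C y ≫ F.hom y) := by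
  induction t with
  | of y a c => rfl
  | zero y a =>
    have : (mkC (.zero y a) : (freeCh C y).X a) = 0 := freeCh_ext fun D φ => by
      simp [eval_mkC, Term.eval]
    rw [this]; exact map_zero (app (F.hom y) a)
  | @add y a s t hs ht =>
    have : (mkC (.add s t) : (freeCh C y).X a) = mkC s + mkC t := freeCh_ext fun D φ => by
      simp [eval_mkC, Term.eval]
    rw [this]
    exact (map_add (app (F.hom y) a) (mkC s) (mkC t)).trans
      (congrArg₂ (· + ·) hs ht)
  | @smul y a r t ht =>
    have : (mkC (.smul r t) : (freeCh C y).X a) = r • mkC t := freeCh_ext fun D φ => by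
      simp [eval_mkC, Term.eval]
    rw [this]
    exact (map_smul (app (F.hom y) a) r (mkC t)).trans (congrArg (r • ·) ht)
  | @del y a b t ht =>
    have : (mkC (.del b t) : (freeCh C y).X b) = del (freeCh C y) a b (mkC t) :=
      freeCh_ext fun D φ => by
        rw [app_del]
        refine (eval_mkC _ D φ).trans ?_
        rw [Term.eval]
        exact congrArg _ (eval_mkC t D φ).symm
    rw [this]
    exact (app_del (F.hom y) a b (mkC t)).trans (by rw [ht]; rfl)
  | @op n x y g h c hc t m ht =>
    have : (mkC (.op hc t m) : (freeCh C y).X c) =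
        (freeAlg C).act g h c hc (fun j => mkC (t j)) m :=
      freeCh_ext fun D φ => by
        refine (eval_mkC _ D φ).trans ?_
        refine Eq.trans ?_ (eval_actM g h c hc _ m D φ).symm
        rw [Term.eval]
        congr 2
        funext j
        exact (eval_mkC (t j) D φ).symm
    rw [this]
    refine (F.map_act g h c hc _ m).trans ?_
    rw [Term.eval]
    congr 2
    funext j
    exact ht j

theorem freeHom_ext {C : M.Ob → Ch R N} {D : DGAlg M} {F G : freeAlg C ⟶ D}
    (h : ∀ y, freeUnit C y ≫ F.hom y = freeUnit C y ≫ G.hom y) : F = G := by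
  refine DGAlgHom.ext (funext fun y => hom_ext_app fun a q => ?_)
  obtain ⟨t, ht⟩ := exists_term' q
  have hq : q = mkC t := freeCh_ext fun D φ => (ht D φ).trans (eval_mkC t D φ).symm
  rw [hq, freeHom_mkC, freeHom_mkC]
  congr 1
  funext y
  exact h y

variable (M) in
/-- The forgetful functor from `M`-algebras to collections of complexes. -/
def algForget : DGAlg M ⥤ (M.Ob → Ch R N) where
  obj A := A.obj
  map f := f.hom

/-- Morphisms from the free algebra on `C` are morphisms of collections from `C`. -/
def freeEquiv (C : M.Ob → Ch R N) (D : DGAlg M) :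
    (freeAlg C ⟶ D) ≃ (C ⟶ (algForget M).obj D) where
  toFun F := fun y => freeUnit C y ≫ F.hom y
  invFun φ := freeLift φ
  left_inv _ := freeHom_ext fun y => freeUnit_lift _ y
  right_inv φ := funext fun y => freeUnit_lift φ y

variable (M) in
/-- The free algebra functor. -/
def algFree : (M.Ob → Ch R N) ⥤ DGAlg M :=
  Adjunction.leftAdjointOfEquiv (G := algForget M) (F_obj := freeAlg) freeEquiv
    (fun _ _ _ _ _ => rfl)

/-- The free algebra functor is left adjoint to the forgetful functor. -/
def algAdj {R : Type u} [CommRing R] {N : ℕ} (M : DGMulticat R N) : algFree M ⊣ algForget M :=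
  Adjunction.adjunctionOfEquivLeft (G := algForget M) (F_obj := freeAlg) freeEquiv (fun _ _ _ _ _ => rfl)

end FreeAlgebra

section Bar

universe v₁ v₂ v₃ v₄ u₁ u₂ u₃ u₄

variable {𝒞 : Type u₁} [Category.{v₁} 𝒞] {𝒜 : Type u₂} [Category.{v₂} 𝒜]
  {ℬ : Type u₃} [Category.{v₃} ℬ] {𝒱 : Type u₄} [Category.{v₄} 𝒱] [Preadditive 𝒱]
  {F : 𝒞 ⥤ 𝒜} {U : 𝒜 ⥤ 𝒞} {G : 𝒞 ⥤ ℬ} {H : ℬ ⥤ 𝒜}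

/-- The iterates `(F U) ^ n A` of a free-forgetful comonad. -/
def resObj (F : 𝒞 ⥤ 𝒜) (U : 𝒜 ⥤ 𝒞) (A : 𝒜) : ℕ → 𝒜
  | 0 => A
  | n + 1 => F.obj (U.obj (resObj F U A n))

/-- The face maps `(F U) ^ (n + 1) A ⟶ (F U) ^ n A`, induced by the counit. -/
def resFace (adj : F ⊣ U) (A : 𝒜) : ∀ n, Fin (n + 1) → (resObj F U A (n + 1) ⟶ resObj F U A n)
  | 0 => fun _ => adj.counit.app A
  | n + 1 => Fin.cons (adj.counit.app (resObj F U A (n + 1)))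
      (fun i => F.map (U.map (resFace adj A n i)))

/-- The action `G U F ⟶ G` of the monad `U F` on a left adjoint `G` of a functor that factors
through `U`. -/
def barAct (adj : F ⊣ U) (adjG : G ⊣ H ⋙ U) (D : 𝒞) : G.obj (U.obj (F.obj D)) ⟶ G.obj D :=
  (adjG.homEquiv _ _).symm (U.map ((adj.homEquiv _ _).symm (adjG.unit.app D)))

/-- The face maps of the simplicial object `n ↦ G U (F U) ^ n A`. -/
def barFace (adj : F ⊣ U) (adjG : G ⊣ H ⋙ U) (A : 𝒜) (n : ℕ) :
    Fin (n + 2) → (G.obj (U.obj (resObj F U A (n + 1))) ⟶ G.obj (U.obj (resObj F U A n))) :=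
  Fin.cons (barAct adj adjG (U.obj (resObj F U A n)))
    (fun i => G.map (U.map (resFace adj A n i)))

theorem resFace_zero (adj : F ⊣ U) (A : 𝒜) (n : ℕ) :
    resFace adj A n 0 = adj.counit.app (resObj F U A n) := by
  cases n <;> rfl

theorem resFace_resFace (adj : F ⊣ U) (A : 𝒜) (n : ℕ) (i j : Fin (n + 1)) (hij : i ≤ j) :
    resFace adj A (n + 1) j.succ ≫ resFace adj A n i =
      resFace adj A (n + 1) i.castSucc ≫ resFace adj A n j := by
  induction n with
  | zero =>
    obtain rfl : i = 0 := Subsingleton.elim (α := Fin 1) _ _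
    obtain rfl : j = 0 := Subsingleton.elim (α := Fin 1) _ _
    exact adj.counit.naturality (adj.counit.app A)
  | succ n ih =>
    refine Fin.cases (fun j _ => ?_) (fun i j hij => ?_) i j hij
    · rw [resFace_zero]
      exact adj.counit.naturality (resFace adj A (n + 1) j)
    · induction j using Fin.cases with
      | zero => exact absurd hij (by simp)
      | succ j =>
        have := ih i j (by simpa using hij)
        exact ((U ⋙ F).map_comp _ _).symm.trans
          ((congrArg (U ⋙ F).map this).trans ((U ⋙ F).map_comp _ _))

theorem barAct_naturality (adj : F ⊣ U) (adjG : G ⊣ H ⋙ U) {D D' : 𝒞} (f : D ⟶ D') :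
    G.map (U.map (F.map f)) ≫ barAct adj adjG D' = barAct adj adjG D ≫ G.map f := by
  unfold barAct
  rw [← Adjunction.homEquiv_naturality_left_symm, ← Adjunction.homEquiv_naturality_right_symm]
  congr 1
  rw [← Functor.map_comp, ← Adjunction.homEquiv_naturality_left_symm]
  have h1 := adjG.unit.naturality f
  simp only [Functor.id_map] at h1
  rw [h1]
  simp only [Functor.comp_map, Functor.comp_obj]
  rw [Adjunction.homEquiv_naturality_right_symm, Functor.map_comp]

theorem barAct_assoc (adj : F ⊣ U) (adjG : G ⊣ H ⋙ U) (D : 𝒞) :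
    G.map (U.map (adj.counit.app (F.obj D))) ≫ barAct adj adjG D =
      barAct adj adjG (U.obj (F.obj D)) ≫ barAct adj adjG D := by
  apply (adjG.homEquiv _ _).injective
  have e1 : (adjG.homEquiv _ _) (G.map (U.map (adj.counit.app (F.obj D))) ≫ barAct adj adjG D) =
      U.map (adj.counit.app (F.obj D)) ≫ U.map ((adj.homEquiv _ _).symm (adjG.unit.app D)) := by
    rw [Adjunction.homEquiv_naturality_left]
    simp [barAct]
  have e2 : (adjG.homEquiv _ _) (barAct adj adjG (U.obj (F.obj D)) ≫ barAct adj adjG D) =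
      U.map ((adj.homEquiv _ _).symm (adjG.unit.app (U.obj (F.obj D)))) ≫
        U.map (H.map (barAct adj adjG D)) := by
    rw [Adjunction.homEquiv_naturality_right]
    simp [barAct]
  refine e1.trans (Eq.trans ?_ e2.symm)
  rw [← Functor.map_comp, ← Functor.map_comp]
  congr 1
  have e3 : adj.counit.app (F.obj D) ≫ (adj.homEquiv _ _).symm (adjG.unit.app D) =
      (adj.homEquiv _ _).symm (U.map ((adj.homEquiv _ _).symm (adjG.unit.app D))) := by
    rw [Adjunction.homEquiv_counit (g := U.map _)]
    exact (adj.counit.naturality _).symm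
  rw [e3, ← Adjunction.homEquiv_naturality_right_symm]
  congr 1
  have := adjG.homEquiv_unit (f := barAct adj adjG D)
  rw [barAct, Equiv.apply_symm_apply] at this
  exact this

theorem barFace_barFace (adj : F ⊣ U) (adjG : G ⊣ H ⋙ U) (A : 𝒜) (n : ℕ) (i j : Fin (n + 2))
    (hij : i ≤ j) :
    barFace adj adjG A (n + 1) j.succ ≫ barFace adj adjG A n i =
      barFace adj adjG A (n + 1) i.castSucc ≫ barFace adj adjG A n j := by
  refine Fin.cases (fun j _ => ?_) (fun i j hij => ?_) i j hij
  · refine Fin.cases ?_ (fun j => ?_) j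
    · have h := barAct_assoc adj adjG (U.obj (resObj F U A n))
      have h1 : barFace adj adjG A (n + 1) (Fin.succ 0) =
          G.map (U.map (adj.counit.app (F.obj (U.obj (resObj F U A n))))) :=
        congrArg (fun f => G.map (U.map f)) (resFace_zero adj A (n + 1))
      rw [h1]
      exact h
    · exact barAct_naturality adj adjG (U.map (resFace adj A n j))
  · induction j using Fin.cases with
    | zero => exact absurd hij (by simp)
    | succ j =>
      have := resFace_resFace adj A n i j (by simpa using hij)
      exact ((U ⋙ G).map_comp _ _).symm.trans
        ((congrArg (U ⋙ G).map this).trans ((U ⋙ G).map_comp _ _))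

/-- The complex of a family of face maps satisfying the simplicial identities, with the
alternating sum of the face maps as differential. -/
def altFace (X : ℕ → 𝒱) (δ : ∀ n, Fin (n + 2) → (X (n + 1) ⟶ X n))
    (hδ : ∀ n (i j : Fin (n + 2)), i ≤ j → δ (n + 1) j.succ ≫ δ n i = δ (n + 1) i.castSucc ≫ δ n j) :
    ChainComplex 𝒱 ℕ :=
  ChainComplex.of X (fun n => ∑ i : Fin (n + 2), (-1 : ℤ) ^ (i : ℕ) • δ n i) (by
    intro n
    simp only [Preadditive.sum_comp, Preadditive.comp_sum, Preadditive.zsmul_comp,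
      Preadditive.comp_zsmul, Finset.smul_sum]
    rw [← Finset.sum_product']
    let S : Finset (Fin (n + 2) × Fin (n + 3)) := {ij | (ij.2 : ℕ) ≤ (ij.1 : ℕ)}
    rw [Finset.univ_product_univ, ← Finset.sum_add_sum_compl S, ← eq_neg_iff_add_eq_zero,
      ← Finset.sum_neg_distrib]
    refine Finset.sum_bij (fun ij hij => (Fin.castLT ij.2
      (lt_of_le_of_lt (Finset.mem_filter.mp hij).right (Fin.is_lt ij.1)), ij.1.succ)) ?_ ?_ ?_ ?_
    · intro ij hij
      simp only [S, Finset.compl_filter, Finset.mem_filter_univ, Fin.val_succ,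
        Fin.val_castLT] at hij ⊢
      lia
    · rintro ⟨i, j⟩ hij ⟨i', j'⟩ hij' h
      simp only [Prod.mk.injEq, Fin.ext_iff, Fin.val_castLT, Fin.val_succ] at h ⊢
      lia
    · rintro ⟨i', j'⟩ hij'
      simp only [S, Finset.compl_filter, Finset.mem_filter_univ, not_le] at hij'
      refine ⟨(j'.pred ?_, Fin.castSucc i'), ?_, ?_⟩
      · rintro rfl
        simp at hij'
      · simp only [S, Finset.mem_filter_univ, Fin.val_castSucc, Fin.val_pred]
        lia
      · simp
    · rintro ⟨i, j⟩ hij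
      simp only [S, Finset.mem_filter_univ] at hij
      obtain ⟨j, rfl⟩ : ∃ j' : Fin (n + 2), j = j'.castSucc :=
        ⟨j.castLT (lt_of_le_of_lt hij i.is_lt), by simp⟩
      simp only [Fin.castLT_castSucc, Fin.val_succ, Fin.val_castSucc]
      rw [hδ n j i hij, smul_smul, smul_smul, ← neg_smul]
      congr 1
      ring)

/-- The two-sided bar construction: the complex, in a preadditive category, of the
(semi)simplicial object `n ↦ E (G U (F U) ^ n A)`. -/
def barCx (adj : F ⊣ U) (adjG : G ⊣ H ⋙ U) (E : ℬ ⥤ 𝒱) (A : 𝒜) : ChainComplex 𝒱 ℕ :=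
  altFace (fun n => E.obj (G.obj (U.obj (resObj F U A n))))
    (fun n i => E.map (barFace adj adjG A n i))
    (fun n i j hij => by
      rw [← Functor.map_comp, ← Functor.map_comp, barFace_barFace adj adjG A n i j hij])

end Bar

section Realization

variable {R : Type u} [CommRing R] {N : ℕ}

/-- The total degree of a complex of `ℤ/2N`-graded complexes. -/
instance : TotalComplexShape (ComplexShape.down ℕ) (ComplexShape.down (Deg N))
    (ComplexShape.down (Deg N)) where
  π p := (p.1 : Deg N) + p.2
  ε₁ _ := 1
  ε₂ p := (-1) ^ p.1
  rel₁ := by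
    rintro i i' (h : i' + 1 = i) a
    change ((i' : Deg N) + a) + 1 = (i : Deg N) + a
    rw [← h]; push_cast; ring
  rel₂ := by
    rintro i a a' (h : a' + 1 = a)
    change ((i : Deg N) + a') + 1 = (i : Deg N) + a
    rw [← h]; ring
  ε₂_ε₁ := by
    rintro i i' a a' (h : i' + 1 = i) _
    subst h
    simp [pow_succ]

/-- The geometric realization of a (semi)simplicial complex with complex of alternating sums
of faces `K`: the direct sum of the complexes `K.X n` shifted by `n`, with the sum of the internal
differentials (with sign) and of the differentials of `K`. -/
def realize (K : ChainComplex (Ch R N) ℕ) : Ch R N :=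
  HomologicalComplex₂.total K (ComplexShape.down (Deg N))

end Realization

section Collections

variable {R : Type u} [CommRing R] {N : ℕ} {X Y : Type u}

/-- Morphisms out of the direct sums over the fibres of `f`. -/
def pushEquiv (f : X → Y) (C : X → Ch R N) (D : Y → Ch R N) :
    ((fun y => ∐ fun x : {x // f x = y} => C x.1) ⟶ D) ≃
      (C ⟶ (Pi.comap (fun _ : Y => Ch R N) f).obj D) where
  toFun φ := fun x => Limits.Sigma.ι (fun x' : {x' // f x' = f x} => C x'.1) ⟨x, rfl⟩ ≫ φ (f x)
  invFun ψ := fun y => Limits.Sigma.desc fun x => ψ x.1 ≫ eqToHom (congrArg D x.2)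
  left_inv φ := by
    funext y
    refine Limits.Sigma.hom_ext _ _ fun ⟨x, hx⟩ => ?_
    subst hx
    simp
  right_inv ψ := by
    funext x
    simp

/-- The direct image of collections of complexes: the value at `y` is the direct sum of
the values at the points of the fibre `f ⁻¹ y`. -/
def colPush (f : X → Y) : (X → Ch R N) ⥤ (Y → Ch R N) :=
  Adjunction.leftAdjointOfEquiv (G := Pi.comap (fun _ : Y => Ch R N) f)
    (F_obj := fun C y => ∐ fun x : {x // f x = y} => C x.1) (pushEquiv f)
    (fun _ _ _ _ _ => by funext x; simp [pushEquiv])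

/-- The direct image of collections is left adjoint to the inverse image. -/
def colAdj {R : Type u} [CommRing R] {N : ℕ} (f : X → Y) :
    colPush (R := R) (N := N) f ⊣ Pi.comap (fun _ : Y => Ch R N) f :=
  Adjunction.adjunctionOfEquivLeft (G := Pi.comap (fun _ : Y => Ch R N) f)
    (F_obj := fun C y => ∐ fun x : {x // f x = y} => C x.1) (pushEquiv f)
    (fun _ _ _ _ _ => by funext x; simp [pushEquiv])

end Collections

section OperadicExtension

variable {R : Type u} [CommRing R] {N : ℕ} {M O : DGMulticat R N}

/-- The operations of the restriction of an algebra along a multifunctor. -/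
def resAct (π : DGMultifunctor M O) (B : DGAlg O) {J : Type} [Fintype J] [LinearOrder J]
    {x : J → M.Ob} {y : M.Ob} (g : J → Deg N) (h c : Deg N) (hc : ∑ j, g j + h = c) :
    MultilinearMap R (fun j => (B.obj (π.obj (x j))).X (g j))
      ((M.Hom x y).X h →ₗ[R] (B.obj (π.obj y)).X c) :=
  (LinearMap.lcomp R _ (app (π.map x y) h)).compMultilinearMap
    (B.act (x := fun j => π.obj (x j)) (y := π.obj y) g h c hc)

theorem resAct_apply (π : DGMultifunctor M O) (B : DGAlg O) {J : Type} [Fintype J] [LinearOrder J]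
    {x : J → M.Ob} {y : M.Ob} (g : J → Deg N) (h c : Deg N) (hc : ∑ j, g j + h = c)
    (a : ∀ j, (B.obj (π.obj (x j))).X (g j)) (m : (M.Hom x y).X h) :
    resAct π B g h c hc a m = B.act g h c hc a (app (π.map x y) h m) := rfl

/-- Restriction of algebras along a multifunctor. -/
def algRes (π : DGMultifunctor M O) : DGAlg O ⥤ DGAlg M where
  obj B :=
    { obj := fun x => B.obj (π.obj x)
      act := resAct π B
      del_act := fun g h c hc a m => by
        simp only [resAct_apply, B.del_act, app_del]
      act_one := fun y h hc a => by
        rw [resAct_apply, π.map_one]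
        exact B.act_one _ _ _ _
      act_act := fun f g h fg gh c h₁ h₂ h₃ h₄ a b p => by
        simp only [resAct_apply, π.map_comp]
        exact B.act_act f g h fg gh c h₁ h₂ h₃ h₄ a _ _
      act_perm := fun {J J' _ _ _ _ x y} e g h c hc hc' a m => by
        simp only [resAct_apply]
        rw [← app_comp, π.map_perm x e y, app_comp]
        exact B.act_perm e g h c hc hc' a _ }
  map F :=
    { hom := fun x => F.hom (π.obj x)
      map_act := fun g h c hc a m => F.map_act g h c hc a _ }

/-- The adjunction between the free `O`-algebra on the direct image of a collection, and the
collection underlying the restriction of an `O`-algebra. -/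
def opAdj {R : Type u} [CommRing R] {N : ℕ} {M O : DGMulticat R N} (π : DGMultifunctor M O) :
    colPush π.obj ⋙ algFree O ⊣ algRes π ⋙ algForget M :=
  ((colAdj π.obj).comp (algAdj O)).ofNatIsoRight (Iso.refl _)

/-- The complex over `y` of the (homotopical, operadic) left Kan extension `𝕃π_* A`: the realization
of the simplicial `O`-algebra with `n`-simplices `F_O (Col(π)_* (U ((F_M U) ^ n A)))`. -/
def opLan {R : Type u} [CommRing R] {N : ℕ} {M O : DGMulticat R N} (π : DGMultifunctor M O)
    (A : DGAlg M) (y : O.Ob) : Ch R N :=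
  realize (barCx (algAdj M) (opAdj π) (algForget O ⋙ Pi.eval _ y) A)

end OperadicExtension

/-- A differential graded category over `R`. -/
structure DGCat (R : Type u) [CommRing R] (N : ℕ) where
  Ob : Type u
  Hom : Ob → Ob → Ch R N
  one : ∀ x : Ob, (Hom x x).X 0
  comp : ∀ {x y z : Ob} (g h c : Deg N) (_ : g + h = c),
    (Hom x y).X g →ₗ[R] (Hom y z).X h →ₗ[R] (Hom x z).X c
  del_one : ∀ (x : Ob) (c : Deg N), del _ 0 c (one x) = 0
  del_comp : ∀ {x y z : Ob} (g h c : Deg N) (hc : g + h = c) (f : (Hom x y).X g)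
    (p : (Hom y z).X h),
    del _ c (c - 1) (comp g h c hc f p) =
      comp (g - 1) h (c - 1) (by rw [← hc]; ring) (del _ g (g - 1) f) p +
      sg R (par g) • comp g (h - 1) (c - 1) (by rw [← hc]; ring) f (del _ h (h - 1) p)
  one_comp : ∀ {x y : Ob} (h : Deg N) (hc : 0 + h = h) (p : (Hom x y).X h),
    comp 0 h h hc (one x) p = p
  comp_one : ∀ {x y : Ob} (h : Deg N) (hc : h + 0 = h) (p : (Hom x y).X h),
    comp h 0 h hc p (one y) = p
  comp_comp : ∀ {x y z w : Ob} (f g h fg gh c : Deg N) (h₁ : f + g = fg) (h₂ : fg + h = c)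
    (h₃ : g + h = gh) (h₄ : f + gh = c) (a : (Hom x y).X f) (b : (Hom y z).X g)
    (p : (Hom z w).X h),
    comp fg h c h₂ (comp f g fg h₁ a b) p = comp f gh c h₄ a (comp g h gh h₃ b p)

/-- A differential graded functor. -/
structure DGFunctor {R : Type u} [CommRing R] {N : ℕ} (𝒞 𝒟 : DGCat R N) where
  obj : 𝒞.Ob → 𝒟.Ob
  map : ∀ x y : 𝒞.Ob, 𝒞.Hom x y ⟶ 𝒟.Hom (obj x) (obj y)
  map_one : ∀ x : 𝒞.Ob, app (map x x) 0 (𝒞.one x) = 𝒟.one (obj x)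
  map_comp : ∀ {x y z : 𝒞.Ob} (g h c : Deg N) (hc : g + h = c) (f : (𝒞.Hom x y).X g)
    (p : (𝒞.Hom y z).X h),
    app (map x z) c (𝒞.comp g h c hc f p) =
      𝒟.comp g h c hc (app (map x y) g f) (app (map y z) h p)

/-- A module over (that is, a differential graded functor to complexes on) a differential graded
category. -/
structure DGMod {R : Type u} [CommRing R] {N : ℕ} (𝒞 : DGCat R N) where
  obj : 𝒞.Ob → Ch R N
  act : ∀ {x y : 𝒞.Ob} (g h c : Deg N) (_ : g + h = c),
    (obj x).X g →ₗ[R] (𝒞.Hom x y).X h →ₗ[R] (obj y).X c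
  del_act : ∀ {x y : 𝒞.Ob} (g h c : Deg N) (hc : g + h = c) (a : (obj x).X g)
    (m : (𝒞.Hom x y).X h),
    del _ c (c - 1) (act g h c hc a m) =
      act (g - 1) h (c - 1) (by rw [← hc]; ring) (del _ g (g - 1) a) m +
      sg R (par g) • act g (h - 1) (c - 1) (by rw [← hc]; ring) a (del _ h (h - 1) m)
  act_one : ∀ {x : 𝒞.Ob} (h : Deg N) (hc : h + 0 = h) (a : (obj x).X h),
    act h 0 h hc a (𝒞.one x) = a
  act_act : ∀ {x y z : 𝒞.Ob} (f g h fg gh c : Deg N) (h₁ : f + g = fg) (h₂ : fg + h = c)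
    (h₃ : g + h = gh) (h₄ : f + gh = c) (a : (obj x).X f) (b : (𝒞.Hom x y).X g)
    (p : (𝒞.Hom y z).X h),
    act fg h c h₂ (act f g fg h₁ a b) p = act f gh c h₄ a (𝒞.comp g h gh h₃ b p)

/-- A morphism of modules. -/
@[ext]
structure DGModHom {R : Type u} [CommRing R] {N : ℕ} {𝒞 : DGCat R N} (A B : DGMod 𝒞) where
  hom : ∀ x, A.obj x ⟶ B.obj x
  map_act : ∀ {x y : 𝒞.Ob} (g h c : Deg N) (hc : g + h = c) (a : (A.obj x).X g)
    (m : (𝒞.Hom x y).X h),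
    app (hom y) c (A.act g h c hc a m) = B.act g h c hc (app (hom x) g a) m

instance {R : Type u} [CommRing R] {N : ℕ} {𝒞 : DGCat R N} : Category (DGMod 𝒞) where
  Hom := DGModHom
  id A := ⟨fun x => 𝟙 _, fun _ _ _ _ _ _ => rfl⟩
  comp F G := ⟨fun x => F.hom x ≫ G.hom x, fun g h c hc a m => by
    simp only [app_comp, F.map_act, G.map_act]⟩

section SumTensor

open scoped TensorProduct DirectSum

variable {R : Type u} [CommRing R] {N : ℕ} {ι : Type u} (K L : ι → Ch R N)

/-- The degree `c` part of the direct sum of the tensor products `K i ⊗ L i`. -/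
abbrev SumTenX (c : Deg N) : Type u :=
  ⨁ s : ι × {p : Deg N × Deg N // p.1 + p.2 = c}, (K s.1).X s.2.1.1 ⊗[R] (L s.1).X s.2.1.2

open Classical in
/-- The pure tensors. -/
def stX (i : ι) (a b c : Deg N) (hc : a + b = c) : (K i).X a →ₗ[R] (L i).X b →ₗ[R] SumTenX K L c :=
  (TensorProduct.mk R ((K i).X a) ((L i).X b)).compr₂
    (DirectSum.lof R (ι × {p : Deg N × Deg N // p.1 + p.2 = c})
      (fun s => (K s.1).X s.2.1.1 ⊗[R] (L s.1).X s.2.1.2) (i, ⟨(a, b), hc⟩))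

variable {K L}

open Classical in
/-- Linear maps out of a sum of tensor products. -/
def stLift {W : Type u} [AddCommGroup W] [Module R W] {c : Deg N}
    (φ : ∀ (i : ι) (a b : Deg N), a + b = c → (K i).X a →ₗ[R] (L i).X b →ₗ[R] W) :
    SumTenX K L c →ₗ[R] W :=
  DirectSum.toModule R _ W fun s => TensorProduct.lift (φ s.1 s.2.1.1 s.2.1.2 s.2.2)

theorem stLift_stX {W : Type u} [AddCommGroup W] [Module R W] {c : Deg N}
    (φ : ∀ (i : ι) (a b : Deg N), a + b = c → (K i).X a →ₗ[R] (L i).X b →ₗ[R] W)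
    (i : ι) (a b : Deg N) (hc : a + b = c) (x : (K i).X a) (y : (L i).X b) :
    stLift φ (stX K L i a b c hc x y) = φ i a b hc x y := by
  classical
  simp only [stLift, stX, LinearMap.compr₂_apply, TensorProduct.mk_apply]
  erw [DirectSum.toModule_lof]
  simp

theorem stX_ext {W : Type u} [AddCommGroup W] [Module R W] {c : Deg N}
    {φ ψ : SumTenX K L c →ₗ[R] W}
    (h : ∀ (i : ι) (a b : Deg N) (hc : a + b = c) (x : (K i).X a) (y : (L i).X b),
      φ (stX K L i a b c hc x y) = ψ (stX K L i a b c hc x y)) : φ = ψ := by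
  classical
  refine DirectSum.linearMap_ext R fun s => TensorProduct.ext' fun x y => ?_
  exact h s.1 s.2.1.1 s.2.1.2 s.2.2 x y

variable (K L)

/-- The differential of a sum of tensor products:
`d (x ⊗ y) = d x ⊗ y + (-1) ^ |x| x ⊗ d y`. -/
def stDel (c c' : Deg N) : SumTenX K L c →ₗ[R] SumTenX K L c' :=
  if hc' : c' + 1 = c then
    stLift fun i a b hc =>
      (stX K L i (a - 1) b c' (by rw [← add_left_inj 1, hc', ← hc]; ring)).comp (del (K i) a (a - 1)) +
      sg R (par a) • ((stX K L i a (b - 1) c' (by rw [← add_left_inj 1, hc', ← hc]; ring)).compl₂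
        (del (L i) b (b - 1)))
  else 0

theorem par_sub_one (a : Deg N) : par (a - 1) = par a + 1 := by
  rw [map_sub, map_one]
  generalize (par a : ZMod 2) = b
  revert b
  decide

/-- The direct sum of the complexes `K i ⊗ L i`. -/
def sumTen : Ch R N :=
  mkCh (SumTenX K L) (stDel K L) (fun a b h => by simp [stDel, h]) (fun a b c x => by
    by_cases hb : b + 1 = a
    · by_cases hc : c + 1 = b
      · have : stDel K L b c ∘ₗ stDel K L a b = 0 := stX_ext fun i p q h x y => by
          simp only [stDel, hb, hc, dite_true, LinearMap.comp_apply, stLift_stX, LinearMap.add_apply,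
            LinearMap.smul_apply, LinearMap.compl₂_apply, map_add, map_smul, del_del,
            LinearMap.zero_apply, par_sub_one, sg_add, sg_one]
          simp
        exact LinearMap.congr_fun this x
      · simp [stDel, hc]
    · simp [stDel, hb])

end SumTensor

section FreeModule

variable {R : Type u} [CommRing R] {N : ℕ} {𝒞 : DGCat R N}

/-- The pure tensors `a ⊗ m`, in `⨁ x, D x ⊗ 𝒞 (x, y)`. -/
def fm (D : 𝒞.Ob → Ch R N) (y x : 𝒞.Ob) (a b c : Deg N) (hc : a + b = c) :
    (D x).X a →ₗ[R] (𝒞.Hom x y).X b →ₗ[R] (sumTen D fun x => 𝒞.Hom x y).X c :=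
  stX D (fun x => 𝒞.Hom x y) x a b c hc

theorem del_fm (D : 𝒞.Ob → Ch R N) (y x : 𝒞.Ob) (a b c : Deg N) (hc : a + b = c)
    (d : (D x).X a) (m : (𝒞.Hom x y).X b) :
    del _ c (c - 1) (fm D y x a b c hc d m) =
      fm D y x (a - 1) b (c - 1) (by rw [← hc]; ring) (del _ a (a - 1) d) m +
      sg R (par a) • fm D y x a (b - 1) (c - 1) (by rw [← hc]; ring) d (del _ b (b - 1) m) := by
  change stDel D (fun x => 𝒞.Hom x y) c (c - 1) (stX D (fun x => 𝒞.Hom x y) x a b c hc d m) = _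
  simp only [stDel, sub_add_cancel, dite_true, stLift_stX]
  rfl

theorem fm_ext {D : 𝒞.Ob → Ch R N} {y : 𝒞.Ob} {c : Deg N} {W : Type u} [AddCommGroup W] [Module R W]
    {φ ψ : (sumTen D fun x => 𝒞.Hom x y).X c →ₗ[R] W}
    (h : ∀ x a b hc d m, φ (fm D y x a b c hc d m) = ψ (fm D y x a b c hc d m)) : φ = ψ :=
  stX_ext h

/-- Linear maps out of `⨁ x, D x ⊗ 𝒞 (x, y)`. -/
def fmLift {D : 𝒞.Ob → Ch R N} {y : 𝒞.Ob} {c : Deg N} {W : Type u} [AddCommGroup W] [Module R W]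
    (φ : ∀ x (a b : Deg N), a + b = c → (D x).X a →ₗ[R] (𝒞.Hom x y).X b →ₗ[R] W) :
    (sumTen D fun x => 𝒞.Hom x y).X c →ₗ[R] W :=
  stLift φ

theorem fmLift_fm {D : 𝒞.Ob → Ch R N} {y : 𝒞.Ob} {c : Deg N} {W : Type u} [AddCommGroup W] [Module R W]
    (φ : ∀ x (a b : Deg N), a + b = c → (D x).X a →ₗ[R] (𝒞.Hom x y).X b →ₗ[R] W)
    (x : 𝒞.Ob) (a b : Deg N) (hc : a + b = c) (d : (D x).X a) (m : (𝒞.Hom x y).X b) :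
    fmLift φ (fm D y x a b c hc d m) = φ x a b hc d m :=
  stLift_stX φ x a b hc d m

/-- The action on a free module: `(d ⊗ m) p = d ⊗ m p`. -/
def fmAct (D : 𝒞.Ob → Ch R N) {y z : 𝒞.Ob} (g h c : Deg N) (hc : g + h = c) :
    (sumTen D fun x => 𝒞.Hom x y).X g →ₗ[R] (𝒞.Hom y z).X h →ₗ[R]
      (sumTen D fun x => 𝒞.Hom x z).X c :=
  fmLift fun x a b hab => LinearMap.mk₂ R
    (fun d m => fm D z x a (b + h) c (by rw [← hc, ← hab]; ring) d ∘ₗ 𝒞.comp b h (b + h) rfl m)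
    (fun _ _ _ => by ext; simp) (fun _ _ _ => by ext; simp)
    (fun _ _ _ => by ext; simp) (fun _ _ _ => by ext; simp)

theorem fmAct_fm (D : 𝒞.Ob → Ch R N) {y z : 𝒞.Ob} (g h c : Deg N) (hc : g + h = c)
    (x : 𝒞.Ob) (a b : Deg N) (hab : a + b = g) (d : (D x).X a) (m : (𝒞.Hom x y).X b)
    (p : (𝒞.Hom y z).X h) (e : Deg N) (he : b + h = e) (hc' : a + e = c) :
    fmAct D g h c hc (fm D y x a b g hab d m) p = fm D z x a e c hc' d (𝒞.comp b h e he m p) := by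
  subst he
  simp [fmAct, fmLift_fm]

/-- The free module on a collection of complexes `D`, with value `⨁ x, D x ⊗ 𝒞 (x, y)` at `y`. -/
def freeMod (D : 𝒞.Ob → Ch R N) : DGMod 𝒞 where
  obj y := sumTen D fun x => 𝒞.Hom x y
  act g h c hc := fmAct D g h c hc
  del_act {y z} g h c hc q p := by
    suffices H : del (sumTen D fun x => 𝒞.Hom x z) c (c - 1) ∘ₗ (fmAct D g h c hc).flip p =
        (fmAct D (g - 1) h (c - 1) (by rw [← hc]; ring)).flip p ∘ₗ
          del (sumTen D fun x => 𝒞.Hom x y) g (g - 1) +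
        sg R (par g) • (fmAct D g (h - 1) (c - 1) (by rw [← hc]; ring)).flip (del _ h (h - 1) p) from
      LinearMap.congr_fun H q
    refine fm_ext fun x a b hab d m => ?_
    have hp : par a + par b = par g := by rw [← map_add, hab]
    simp only [LinearMap.comp_apply, LinearMap.flip_apply, LinearMap.add_apply, LinearMap.smul_apply]
    rw [fmAct_fm D g h c hc x a b hab d m p (b + h) rfl (by rw [← hc, ← hab]; ring), del_fm, del_fm,
      map_add, map_smul, LinearMap.add_apply, LinearMap.smul_apply,
      fmAct_fm _ _ _ _ _ _ _ _ _ _ _ _ (b + h) rfl (by rw [← hc, ← hab]; ring),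
      fmAct_fm _ _ _ _ _ _ _ _ _ _ _ _ (b + h - 1) (by ring) (by rw [← hc, ← hab]; ring),
      fmAct_fm _ _ _ _ _ _ _ _ _ _ _ _ (b + h - 1) (by ring) (by rw [← hc, ← hab]; ring),
      𝒞.del_comp, map_add, map_smul, smul_add, smul_smul, ← sg_add, hp]
    exact (add_assoc _ _ _).symm
  act_one {y} h hc q := by
    suffices H : (fmAct D h 0 h hc).flip (𝒞.one y) = LinearMap.id from LinearMap.congr_fun H q
    refine fm_ext fun x a b hab d m => ?_
    simp only [LinearMap.flip_apply, LinearMap.id_apply]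
    rw [fmAct_fm _ _ _ _ _ _ _ _ _ _ _ _ b (add_zero b) hab, 𝒞.comp_one]
  act_act {y z w} f g h fg gh c h₁ h₂ h₃ h₄ q b p := by
    suffices H : (fmAct D fg h c h₂).flip p ∘ₗ (fmAct D f g fg h₁).flip b =
        (fmAct D f gh c h₄).flip (𝒞.comp g h gh h₃ b p) from LinearMap.congr_fun H q
    refine fm_ext fun x a e hae d m => ?_
    simp only [LinearMap.comp_apply, LinearMap.flip_apply]
    rw [fmAct_fm _ _ _ _ _ _ _ _ _ _ _ _ (e + g) rfl (by rw [← h₁, ← hae]; ring),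
      fmAct_fm _ _ _ _ _ _ _ _ _ _ _ _ (e + g + h) rfl (by rw [← h₂, ← h₁, ← hae]; ring),
      fmAct_fm _ _ _ _ _ _ _ _ _ _ _ _ (e + g + h) (by rw [← h₃]; ring)
        (by rw [← h₂, ← h₁, ← hae]; ring),
      𝒞.comp_comp _ _ _ _ gh _ rfl rfl h₃ (by rw [← h₃]; ring)]

variable (𝒞) in
/-- The forgetful functor from modules to collections of complexes. -/
def modForget : DGMod 𝒞 ⥤ (𝒞.Ob → Ch R N) where
  obj A := A.obj
  map f := f.hom

/-- The linear map `⨁ x, D x ⊗ 𝒞 (x, y) → A y`, `d ⊗ m ↦ φ (d) m`, in each degree. -/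
def fmEval {D : 𝒞.Ob → Ch R N} {A : DGMod 𝒞} (φ : ∀ x, D x ⟶ A.obj x) (y : 𝒞.Ob) (c : Deg N) :
    (sumTen D fun x => 𝒞.Hom x y).X c →ₗ[R] (A.obj y).X c :=
  fmLift fun x a b hc => A.act a b c hc ∘ₗ app (φ x) a

theorem fmEval_fm {D : 𝒞.Ob → Ch R N} {A : DGMod 𝒞} (φ : ∀ x, D x ⟶ A.obj x) (y x : 𝒞.Ob)
    (a b c : Deg N) (hc : a + b = c) (d : (D x).X a) (m : (𝒞.Hom x y).X b) :
    fmEval φ y c (fm D y x a b c hc d m) = A.act a b c hc (app (φ x) a d) m :=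
  fmLift_fm _ _ _ _ _ _ _

theorem fmEval_del {D : 𝒞.Ob → Ch R N} {A : DGMod 𝒞} (φ : ∀ x, D x ⟶ A.obj x) (y : 𝒞.Ob)
    (c c' : Deg N) (q : (sumTen D fun x => 𝒞.Hom x y).X c) :
    fmEval φ y c' (del _ c c' q) = del _ c c' (fmEval φ y c q) := by
  by_cases hcc : c' + 1 = c
  · obtain rfl : c' = c - 1 := by rw [← hcc]; ring
    suffices H : fmEval φ y (c - 1) ∘ₗ del _ c (c - 1) = del _ c (c - 1) ∘ₗ fmEval φ y c from
      LinearMap.congr_fun H q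
    refine fm_ext fun x a b hc d m => ?_
    simp only [LinearMap.comp_apply, del_fm, map_add, map_smul, fmEval_fm, A.del_act, app_del]
  · rw [del_shape _ c c' hcc, del_shape _ c c' hcc]
    simp

/-- The module morphism induced by a morphism of collections. -/
def freeModHom {D : 𝒞.Ob → Ch R N} {A : DGMod 𝒞} (φ : D ⟶ A.obj) : freeMod D ⟶ A where
  hom y := mkHom (K := sumTen D fun x => 𝒞.Hom x y) (fmEval φ y) (fmEval_del φ y)
  map_act {y z} g h c hc q p := by
    suffices H : fmEval φ z c ∘ₗ (fmAct D g h c hc).flip p =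
        (A.act g h c hc).flip p ∘ₗ fmEval φ y g from LinearMap.congr_fun H q
    refine fm_ext fun x a b hab d m => ?_
    simp only [LinearMap.comp_apply, LinearMap.flip_apply, fmEval_fm]
    rw [fmAct_fm _ _ _ _ _ _ _ _ _ _ _ _ (b + h) rfl (by rw [← hc, ← hab]; ring), fmEval_fm,
      A.act_act _ _ _ _ (b + h) _ _ _ rfl]

/-- The unit `D ⟶ ⨁ x, D x ⊗ 𝒞 (x, -)`, `d ↦ d ⊗ 1`. -/
def freeModUnit (D : 𝒞.Ob → Ch R N) : D ⟶ (freeMod D).obj := fun x =>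
  mkHom (L := sumTen D fun x' => 𝒞.Hom x' x)
    (fun a => (fm D x x a 0 a (add_zero a)).flip (𝒞.one x))
    (fun a a' d => by
      simp only [LinearMap.flip_apply]
      by_cases h : a' + 1 = a
      · obtain rfl : a' = a - 1 := by rw [← h]; ring
        rw [del_fm, 𝒞.del_one]
        simp
      · rw [del_shape _ a a' h, del_shape _ a a' h]
        simp)

theorem freeModUnit_app (D : 𝒞.Ob → Ch R N) (x : 𝒞.Ob) (a : Deg N) (d : (D x).X a) :
    app (freeModUnit D x) a d = fm D x x a 0 a (add_zero a) d (𝒞.one x) := rfl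

/-- The universal property of the free module. -/
def freeModEquiv (D : 𝒞.Ob → Ch R N) (A : DGMod 𝒞) :
    (freeMod D ⟶ A) ≃ (D ⟶ (modForget 𝒞).obj A) where
  toFun f := fun x => freeModUnit D x ≫ f.hom x
  invFun φ := freeModHom φ
  left_inv f := by
    refine DGModHom.ext (funext fun y => hom_ext_app fun c q => ?_)
    suffices H : fmEval (fun x => freeModUnit D x ≫ f.hom x) y c = app (f.hom y) c from
      LinearMap.congr_fun H q
    refine fm_ext fun x a b hc d m => ?_
    rw [fmEval_fm, app_comp, ← f.map_act, freeModUnit_app]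
    refine congrArg (app (f.hom y) c) ?_
    refine (fmAct_fm D a b c hc x a 0 (add_zero a) d _ m b (zero_add b) hc).trans ?_
    rw [𝒞.one_comp]
  right_inv φ := by
    funext x
    refine hom_ext_app fun a d => ?_
    refine (app_comp (freeModUnit D x) ((freeModHom φ).hom x) a d).trans ?_
    rw [freeModUnit_app]
    refine (fmEval_fm φ x x a 0 a (add_zero a) d (𝒞.one x)).trans ?_
    exact A.act_one a (add_zero a) _

variable (𝒞) in
/-- The free module functor. -/
def modFree : (𝒞.Ob → Ch R N) ⥤ DGMod 𝒞 :=
  Adjunction.leftAdjointOfEquiv (G := modForget 𝒞) (F_obj := freeMod) freeModEquiv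
    (fun _ _ _ _ _ => rfl)

end FreeModule

/-- The free module functor is left adjoint to the forgetful functor. -/
def modAdj {R : Type u} [CommRing R] {N : ℕ} (𝒞 : DGCat R N) : modFree 𝒞 ⊣ modForget 𝒞 :=
  Adjunction.adjunctionOfEquivLeft (G := modForget 𝒞) (F_obj := freeMod) freeModEquiv
    (fun _ _ _ _ _ => rfl)

section CategoricalExtension

variable {R : Type u} [CommRing R] {N : ℕ} {𝒞 𝒟 : DGCat R N}

/-- Restriction of modules along a functor. -/
def modRes (p : DGFunctor 𝒞 𝒟) : DGMod 𝒟 ⥤ DGMod 𝒞 where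
  obj B :=
    { obj := fun x => B.obj (p.obj x)
      act := fun {x y} g h c hc => (B.act g h c hc).compl₂ (app (p.map x y) h)
      del_act := fun g h c hc a m => by
        simp only [LinearMap.compl₂_apply, B.del_act, app_del]
      act_one := fun h hc a => by
        rw [LinearMap.compl₂_apply, p.map_one]
        exact B.act_one _ _ _
      act_act := fun f g h fg gh c h₁ h₂ h₃ h₄ a b m => by
        simp only [LinearMap.compl₂_apply, p.map_comp]
        exact B.act_act f g h fg gh c h₁ h₂ h₃ h₄ a _ _ }
  map F :=
    { hom := fun x => F.hom (p.obj x)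
      map_act := fun g h c hc a m => F.map_act g h c hc a _ }

/-- The adjunction between the free `𝒟`-module on the direct image of a collection, and the
collection underlying the restriction of a `𝒟`-module. -/
def catAdj {R : Type u} [CommRing R] {N : ℕ} {𝒞 𝒟 : DGCat R N} (p : DGFunctor 𝒞 𝒟) :
    colPush p.obj ⋙ modFree 𝒟 ⊣ modRes p ⋙ modForget 𝒞 :=
  ((colAdj p.obj).comp (modAdj 𝒟)).ofNatIsoRight (Iso.refl _)

/-- The complex over `y` of the (homotopical, categorical) left Kan extension `𝕃p_* A`: the
realization of the simplicial `𝒟`-module that is the two-sided bar construction of `A`. -/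
def catLan {R : Type u} [CommRing R] {N : ℕ} {𝒞 𝒟 : DGCat R N} (p : DGFunctor 𝒞 𝒟)
    (A : DGMod 𝒞) (y : 𝒟.Ob) : Ch R N :=
  realize (barCx (modAdj 𝒞) (catAdj p) (modForget 𝒟 ⋙ Pi.eval _ y) A)

end CategoricalExtension

open scoped DirectSum

section Transport

variable {R : Type u} [CommRing R] {N : ℕ}

theorem tr_del (K : Ch R N) {a b b' : Deg N} (h : b = b') (x : K.X a) :
    tr K b b' (del K a b x) = del K a b' x := by
  subst h; rw [tr_self]

theorem del_tr (K : Ch R N) {a a' b : Deg N} (h : a = a') (x : K.X a) :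
    del K a' b (tr K a a' x) = del K a b x := by
  subst h; rw [tr_self]

theorem tr_tr (K : Ch R N) {a b c : Deg N} (h : a = b) (x : K.X a) :
    tr K b c (tr K a b x) = tr K a c x := by
  subst h; rw [tr_self]

theorem sg_mul_self (a : ZMod 2) : sg R a * sg R a = 1 := by
  unfold sg; split_ifs <;> simp

variable {J : Type} [LinearOrder J]

theorem low_self (g : J → Deg N) (j : J) : low g j j = g j - 1 := by simp [low]

theorem low_ne (g : J → Deg N) {i j : J} (h : i ≠ j) : low g j i = g i := by simp [low, h]

theorem low_comm (g : J → Deg N) (i j : J) : low (low g i) j = low (low g j) i := by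
  by_cases h : i = j
  · rw [h]
  · unfold low
    rw [Function.update_of_ne (Ne.symm h), Function.update_of_ne h, Function.update_comm h]

theorem dmap_self (K : J → Ch R N) (g g' : J → Deg N) (j : J) :
    dmap K g g' j j = del (K j) (g j) (g' j) := by simp [dmap]

theorem dmap_ne (K : J → Ch R N) (g g' : J → Deg N) {i j : J} (h : i ≠ j) :
    dmap K g g' j i = tr (K i) (g i) (g' i) := by simp [dmap, h]

theorem before_low [Fintype J] (g : J → Deg N) (i j : J) :
    before (low g i) j = before g j + if i < j then 1 else 0 := by
  unfold before
  rw [← Finset.add_sum_erase _ _ (Finset.mem_univ i),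
    ← Finset.add_sum_erase (a := i) _ (fun k => if k < j then par (g k) else 0) (Finset.mem_univ i)]
  have : ∑ k ∈ Finset.univ.erase i, (if k < j then par (low g i k) else 0) =
      ∑ k ∈ Finset.univ.erase i, if k < j then par (g k) else 0 :=
    Finset.sum_congr rfl fun k hk => by rw [low_ne g (Finset.ne_of_mem_erase hk)]
  rw [this, low_self]
  split_ifs
  · rw [par_sub_one]; ring
  · ring

end Transport

section Tensor

variable {R : Type u} [CommRing R] {N : ℕ} {J : Type} [Fintype J] [LinearOrder J]
  (K : J → Ch R N)

/-- The degree `γ` part of the tensor product of a finite ordered family of complexes. -/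
abbrev TensX (γ : Deg N) : Type u :=
  ⨁ g : {g : J → Deg N // ∑ j, g j = γ}, PiTensorProduct R fun j => (K j).X (g.1 j)

open Classical in
/-- The pure tensors. -/
def tpX (g : J → Deg N) (γ : Deg N) (h : ∑ j, g j = γ) :
    MultilinearMap R (fun j => (K j).X (g j)) (TensX K γ) :=
  (DirectSum.lof R {g : J → Deg N // ∑ j, g j = γ}
    (fun g => PiTensorProduct R fun j => (K j).X (g.1 j)) ⟨g, h⟩).compMultilinearMap
      (PiTensorProduct.tprod R)

variable {K}

open Classical in
/-- Linear maps out of a tensor product. -/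
def tlX {W : Type u} [AddCommGroup W] [Module R W] {γ : Deg N}
    (φ : ∀ g : J → Deg N, ∑ j, g j = γ → MultilinearMap R (fun j => (K j).X (g j)) W) :
    TensX K γ →ₗ[R] W :=
  DirectSum.toModule R _ W fun g => PiTensorProduct.lift (φ g.1 g.2)

theorem tlX_tpX {W : Type u} [AddCommGroup W] [Module R W] {γ : Deg N}
    (φ : ∀ g : J → Deg N, ∑ j, g j = γ → MultilinearMap R (fun j => (K j).X (g j)) W)
    (g : J → Deg N) (h : ∑ j, g j = γ) (x : ∀ j, (K j).X (g j)) :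
    tlX φ (tpX K g γ h x) = φ g h x := by
  classical
  simp only [tlX, tpX, LinearMap.compMultilinearMap_apply]
  erw [DirectSum.toModule_lof]
  simp

theorem tpX_ext {W : Type u} [AddCommGroup W] [Module R W] {γ : Deg N} {φ ψ : TensX K γ →ₗ[R] W}
    (H : ∀ (g : J → Deg N) (h : ∑ j, g j = γ) (x : ∀ j, (K j).X (g j)),
      φ (tpX K g γ h x) = ψ (tpX K g γ h x)) : φ = ψ := by
  classical
  refine DirectSum.linearMap_ext R fun g => PiTensorProduct.ext (MultilinearMap.ext fun x => ?_)
  exact H g.1 g.2 x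

theorem tpX_congr {γ : Deg N} {g g' : J → Deg N} (h : ∑ j, g j = γ) (h' : ∑ j, g' j = γ)
    (hg : g = g') {x : ∀ j, (K j).X (g j)} {x' : ∀ j, (K j).X (g' j)}
    (hx : ∀ j, tr (K j) (g j) (g' j) (x j) = x' j) : tpX K g γ h x = tpX K g' γ h' x' := by
  subst hg
  congr 1
  funext j
  rw [← hx, tr_self]

theorem tpX_zero {γ : Deg N} {g : J → Deg N} (h : ∑ j, g j = γ) {x : ∀ j, (K j).X (g j)} (j : J)
    (hx : x j = 0) : tpX K g γ h x = 0 :=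
  MultilinearMap.map_coord_zero _ j hx

variable (K)

theorem low_sum {c c' : Deg N} (hc : c' + 1 = c) {g : J → Deg N} (h : ∑ j, g j = c) (j : J) :
    ∑ i, low g j i = c' := by rw [sum_low, h, ← hc]; ring

/-- The differential of a tensor product:
`d (x₁ ⊗ ⋯ ⊗ xₙ) = ∑ j, (-1) ^ (|x₁| + ⋯ + |xⱼ₋₁|) x₁ ⊗ ⋯ ⊗ d xⱼ ⊗ ⋯ ⊗ xₙ`. -/
def tDel (c c' : Deg N) : TensX K c →ₗ[R] TensX K c' :=
  if hc : c' + 1 = c then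
    tlX fun g h => ∑ j, sg R (before g j) • (tpX K (low g j) c' (low_sum hc h j)).compLinearMap
      (fun i => dmap K g (low g j) j i)
  else 0

theorem tDel_tpX {c c' : Deg N} (hc : c' + 1 = c) (g : J → Deg N) (h : ∑ j, g j = c)
    (x : ∀ j, (K j).X (g j)) :
    tDel K c c' (tpX K g c h x) = ∑ j, sg R (before g j) • tpX K (low g j) c' (low_sum hc h j)
      (fun i => dmap K g (low g j) j i (x i)) := by
  simp only [tDel, hc, dite_true, tlX_tpX, _root_.sum_apply, _root_.smul_apply,
    MultilinearMap.compLinearMap_apply]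

theorem tDel_tDel {a b c : Deg N} (hb : b + 1 = a) (hc : c + 1 = b) :
    tDel K b c ∘ₗ tDel K a b = 0 := by
  refine tpX_ext fun g h x => ?_
  rw [LinearMap.comp_apply, tDel_tpX K hb, map_sum]
  simp only [map_smul, tDel_tpX K hc, Finset.smul_sum, smul_smul, ← sg_add, LinearMap.zero_apply]
  rw [← Finset.sum_product']
  refine Finset.sum_involution (fun p _ => (p.2, p.1)) ?_ ?_ (fun _ _ => Finset.mem_univ _)
    (fun _ _ => rfl)
  · rintro ⟨i, j⟩ -
    dsimp only
    by_cases hij : i = j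
    · subst hij
      rw [tpX_zero _ i (by rw [dmap_self, dmap_self, del_del]), smul_zero, add_zero]
    · rw [tpX_congr (low_sum hc (low_sum hb h j) i) (low_sum hc (low_sum hb h i) j) (low_comm g j i)
        (x' := fun k => dmap K (low g i) (low (low g i) j) j k (dmap K g (low g i) i k (x k)))]
      · rw [← add_smul]
        convert zero_smul R _
        rw [before_low, before_low]
        rcases lt_or_gt_of_ne hij with h1 | h1 <;> rw [if_pos h1, if_neg h1.not_gt] <;>
          simp only [sg_add, sg_zero, sg_one] <;> ring
      · intro k
        have hji : j ≠ i := Ne.symm hij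
        by_cases h1 : k = i
        · subst h1
          rw [dmap_self, dmap_self, dmap_ne _ _ _ hij, dmap_ne _ _ _ hij, tr_del,
            del_tr _ (low_ne g hij).symm, tr_del _ (low_ne _ hij).symm]
          rw [low_comm]
        · by_cases h2 : k = j
          · subst h2
            rw [dmap_self, dmap_self, dmap_ne _ _ _ h1, dmap_ne _ _ _ h1,
              tr_tr _ (low_ne _ h1).symm, tr_del _ (by rw [low_comm, low_ne _ h1]),
              del_tr _ (low_ne g h1).symm, low_comm]
          · simp only [dmap_ne _ _ _ h1, dmap_ne _ _ _ h2]
            rw [tr_tr _ (low_ne g h2).symm, tr_tr, tr_tr _ (low_ne g h1).symm]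
            · rw [low_ne _ h1, low_ne _ h2]
  · rintro ⟨i, j⟩ - hne heq
    obtain rfl : j = i := congrArg Prod.fst heq
    apply hne
    dsimp only
    rw [tpX_zero _ j (by rw [dmap_self, dmap_self, del_del]), smul_zero]

/-- The tensor product of a finite ordered family of complexes. -/
def tens : Ch R N :=
  mkCh (TensX K) (tDel K) (fun a b h => by simp [tDel, h]) (fun a b c x => by
    by_cases hb : b + 1 = a
    · by_cases hc : c + 1 = b
      · exact LinearMap.congr_fun (tDel_tDel K hb hc) x
      · simp [tDel, hc]
    · simp [tDel, hb])

end Tensor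

section TensorElements

variable {R : Type u} [CommRing R] {N : ℕ} {J : Type} [Fintype J] [LinearOrder J]

/-- The pure tensor `x₁ ⊗ ⋯ ⊗ xₙ`. -/
def tp (K : J → Ch R N) (g : J → Deg N) (γ : Deg N) (h : ∑ j, g j = γ) :
    MultilinearMap R (fun j => (K j).X (g j)) ((tens K).X γ) := tpX K g γ h

/-- Linear maps out of a tensor product. -/
def tLift {K : J → Ch R N} {W : Type u} [AddCommGroup W] [Module R W] {γ : Deg N}
    (φ : ∀ g : J → Deg N, ∑ j, g j = γ → MultilinearMap R (fun j => (K j).X (g j)) W) :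
    (tens K).X γ →ₗ[R] W := tlX φ

theorem tLift_tp {K : J → Ch R N} {W : Type u} [AddCommGroup W] [Module R W] {γ : Deg N}
    (φ : ∀ g : J → Deg N, ∑ j, g j = γ → MultilinearMap R (fun j => (K j).X (g j)) W)
    (g : J → Deg N) (h : ∑ j, g j = γ) (x : ∀ j, (K j).X (g j)) :
    tLift φ (tp K g γ h x) = φ g h x := tlX_tpX φ g h x

theorem tp_ext {K : J → Ch R N} {W : Type u} [AddCommGroup W] [Module R W] {γ : Deg N}
    {φ ψ : (tens K).X γ →ₗ[R] W}
    (H : ∀ (g : J → Deg N) (h : ∑ j, g j = γ) (x : ∀ j, (K j).X (g j)),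
      φ (tp K g γ h x) = ψ (tp K g γ h x)) : φ = ψ := tpX_ext H

theorem tp_congr {K : J → Ch R N} {γ : Deg N} {g g' : J → Deg N} (h : ∑ j, g j = γ)
    (h' : ∑ j, g' j = γ) (hg : g = g') {x : ∀ j, (K j).X (g j)} {x' : ∀ j, (K j).X (g' j)}
    (hx : ∀ j, tr (K j) (g j) (g' j) (x j) = x' j) : tp K g γ h x = tp K g' γ h' x' :=
  tpX_congr h h' hg hx

theorem tp_zero {K : J → Ch R N} {γ : Deg N} {g : J → Deg N} (h : ∑ j, g j = γ)
    {x : ∀ j, (K j).X (g j)} (j : J) (hx : x j = 0) : tp K g γ h x = 0 := tpX_zero h j hx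

theorem del_tp (K : J → Ch R N) {c c' : Deg N} (hc : c' + 1 = c) (g : J → Deg N)
    (h : ∑ j, g j = c) (x : ∀ j, (K j).X (g j)) :
    del (tens K) c c' (tp K g c h x) = ∑ j, sg R (before g j) • tp K (low g j) c' (low_sum hc h j)
      (fun i => dmap K g (low g j) j i (x i)) := tDel_tpX K hc g h x

/-- Functoriality of tensor products, in each degree. -/
def tMapX {K L : J → Ch R N} (f : ∀ j, K j ⟶ L j) (γ : Deg N) : (tens K).X γ →ₗ[R] (tens L).X γ :=
  tLift fun g h => (tp L g γ h).compLinearMap fun j => app (f j) (g j)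

theorem tMapX_tp {K L : J → Ch R N} (f : ∀ j, K j ⟶ L j) (γ : Deg N) (g : J → Deg N)
    (h : ∑ j, g j = γ) (x : ∀ j, (K j).X (g j)) :
    tMapX f γ (tp K g γ h x) = tp L g γ h (fun j => app (f j) (g j) (x j)) := tLift_tp _ _ _ _

/-- Functoriality of tensor products. -/
def tMap {K L : J → Ch R N} (f : ∀ j, K j ⟶ L j) : tens K ⟶ tens L :=
  mkHom (tMapX f) (fun c c' q => by
    by_cases hc : c' + 1 = c
    · suffices H : tMapX f c' ∘ₗ del _ c c' = del _ c c' ∘ₗ tMapX f c from LinearMap.congr_fun H q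
      refine tp_ext fun g h x => ?_
      simp only [LinearMap.comp_apply, del_tp _ hc, map_sum, map_smul, tMapX_tp, app_dmap]
    · rw [del_shape _ c c' hc, del_shape _ c c' hc]
      simp)

theorem tMap_tp {K L : J → Ch R N} (f : ∀ j, K j ⟶ L j) (γ : Deg N) (g : J → Deg N)
    (h : ∑ j, g j = γ) (x : ∀ j, (K j).X (g j)) :
    app (tMap f) γ (tp K g γ h x) = tp L g γ h (fun j => app (f j) (g j) (x j)) :=
  tMapX_tp f γ g h x

end TensorElements

section Grouping

variable {R : Type u} [CommRing R] {N : ℕ} {B C : Type} [Fintype B] [LinearOrder B]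
  [Fintype C] [LinearOrder C]

/-- A family of operations `(⨂ g j = k, K j) ⊗ L k ⟶ Q k`, for a map `g : B → C`. -/
structure Ops (g : B → C) (K : B → Ch R N) (L Q : C → Ch R N) where
  op : ∀ (k : C) (u : {j // g j = k} → Deg N) (h c : Deg N) (_ : ∑ j, u j + h = c),
    MultilinearMap R (fun j : {j // g j = k} => (K j.1).X (u j)) ((L k).X h →ₗ[R] (Q k).X c)
  del_op : ∀ (k : C) (u : {j // g j = k} → Deg N) (h c : Deg N) (hc : ∑ j, u j + h = c)
    (m : ∀ j : {j // g j = k}, (K j.1).X (u j)) (l : (L k).X h),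
    del _ c (c - 1) (op k u h c hc m l) =
      ∑ j, sg R (before u j) • op k (low u j) h (c - 1) (sum_low_add hc j)
        (fun i => dmap (fun i : {j // g j = k} => K i.1) u (low u j) j i (m i)) l +
      sg R (∑ j, par (u j)) • op k u (h - 1) (c - 1) (sum_add_low hc) m (del _ h (h - 1) l)

/-- The sign exponent of the reordering of `⨂ j, K j ⊗ ⨂ k, L k` into
`⨂ k, ((⨂ g j = k, K j) ⊗ L k)`. -/
def gsg (g : B → C) (m : B → Deg N) (l : C → Deg N) : ZMod 2 :=
  ∑ j, ∑ j', (if j < j' ∧ g j' < g j then par (m j) * par (m j') else 0) +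
    ∑ k, ∑ j, if k < g j then par (l k) * par (m j) else 0

variable {g : B → C} {K : B → Ch R N} {L Q : C → Ch R N} (E : Ops g K L Q)

theorem Ops.op_congr (E : Ops g K L Q) {k : C} {u u' : {j // g j = k} → Deg N} {h h' c c' : Deg N}
    (hc : ∑ j, u j + h = c) (hc' : ∑ j, u' j + h' = c') (hu : u = u') (hh : h = h')
    {m : ∀ j : {j // g j = k}, (K j.1).X (u j)} {m' : ∀ j : {j // g j = k}, (K j.1).X (u' j)}
    {l : (L k).X h} {l' : (L k).X h'} (hm : ∀ j, tr (K j.1) (u j) (u' j) (m j) = m' j)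
    (hl : tr (L k) h h' l = l') :
    tr (Q k) c c' (E.op k u h c hc m l) = E.op k u' h' c' hc' m' l' := by
  subst hu hh
  obtain rfl : c = c' := by rw [← hc, ← hc']
  rw [tr_self]
  congr 1
  · congr 1
    funext j
    rw [← hm, tr_self]
  · rw [← hl, tr_self]

/-- The total degree of the inputs over `k`. -/
def fibDeg (g : B → C) (m : B → Deg N) (l : C → Deg N) (k : C) : Deg N :=
  ∑ j : {j // g j = k}, m j.1 + l k

theorem fibDeg_eq (g : B → C) (m : B → Deg N) (l : C → Deg N) (k : C) :
    ∑ j : {j // g j = k}, m j.1 + l k = fibDeg g m l k := rfl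

theorem sum_fibDeg (g : B → C) (m : B → Deg N) (l : C → Deg N) :
    ∑ k, fibDeg g m l k = ∑ j, m j + ∑ k, l k := by
  unfold fibDeg
  rw [Finset.sum_add_distrib, ← Fintype.sum_fiberwise g]

theorem op_update_self {g : B → C} {K : B → Ch R N} {L Q : C → Ch R N} (E : Ops g K L Q)
    [DecidableEq B] {m : B → Deg N} {h c : Deg N} (j₀ : B)
    (hc : ∑ j : {j // g j = g j₀}, m j.1 + h = c) (x : ∀ j, (K j).X (m j)) (v : (K j₀).X (m j₀)) :
    E.op (g j₀) (fun j => m j.1) h c hc (fun j => Function.update x j₀ v j.1) =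
      E.op (g j₀) (fun j => m j.1) h c hc
        (Function.update (β := fun j : {j // g j = g j₀} => (K j.1).X (m j.1))
          (fun j => x j.1) ⟨j₀, rfl⟩ v) := by
  congr 1
  funext j
  by_cases hj : j = ⟨j₀, rfl⟩
  · subst hj; simp
  · rw [Function.update_of_ne hj, Function.update_of_ne (fun h => hj (Subtype.ext h))]

theorem op_update_ne {g : B → C} {K : B → Ch R N} {L Q : C → Ch R N} (E : Ops g K L Q)
    [DecidableEq B] {m : B → Deg N} {h c : Deg N} (j₀ : B) {k : C} (hk : k ≠ g j₀)
    (hc : ∑ j : {j // g j = k}, m j.1 + h = c) (x : ∀ j, (K j).X (m j)) (v : (K j₀).X (m j₀)) :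
    E.op k (fun j => m j.1) h c hc (fun j => Function.update x j₀ v j.1) =
      E.op k (fun j => m j.1) h c hc (fun j => x j.1) := by
  congr 1
  funext j
  rw [Function.update_of_ne]
  intro hj
  exact hk (by rw [← j.2, hj])

/-- The tensor product of the operations, as a function of the left-hand factors `x`. -/
def grpL (m : B → Deg N) (q c : Deg N) (hc : ∑ j, m j + q = c) (x : ∀ j, (K j).X (m j)) :
    (tens L).X q →ₗ[R] (tens Q).X c :=
  tLift fun l hl => sg R (gsg g m l) •
    (tp Q (fibDeg g m l) c (by rw [sum_fibDeg, hl, hc])).compLinearMap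
      (fun k => E.op k (fun j => m j.1) (l k) (fibDeg g m l k) (fibDeg_eq g m l k) fun j => x j.1)

theorem grpL_tp (m : B → Deg N) (q c : Deg N) (hc : ∑ j, m j + q = c) (x : ∀ j, (K j).X (m j))
    (l : C → Deg N) (hl : ∑ k, l k = q) (y : ∀ k, (L k).X (l k)) :
    grpL E m q c hc x (tp L l q hl y) = sg R (gsg g m l) • tp Q (fibDeg g m l) c
      (by rw [sum_fibDeg, hl, hc])
      (fun k => E.op k (fun j => m j.1) (l k) (fibDeg g m l k) (fibDeg_eq g m l k) (fun j => x j.1) (y k)) :=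
  tLift_tp _ _ _ _

theorem fam_update {g : B → C} {K : B → Ch R N} {L Q : C → Ch R N} (E : Ops g K L Q)
    [DecidableEq B] {m : B → Deg N} {l c : C → Deg N} (j₀ : B)
    (hc : ∀ k, ∑ j : {j // g j = k}, m j.1 + l k = c k) (x : ∀ j, (K j).X (m j))
    (v : (K j₀).X (m j₀)) (y : ∀ k, (L k).X (l k)) :
    (fun k => E.op k (fun j => m j.1) (l k) (c k) (hc k) (fun j => Function.update x j₀ v j.1) (y k)) =
      Function.update (fun k => E.op k (fun j => m j.1) (l k) (c k) (hc k) (fun j => x j.1) (y k))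
        (g j₀) (E.op (g j₀) (fun j => m j.1) (l (g j₀)) (c (g j₀)) (hc (g j₀))
          (Function.update (β := fun j : {j // g j = g j₀} => (K j.1).X (m j.1))
            (fun j => x j.1) ⟨j₀, rfl⟩ v) (y (g j₀))) := by
  funext k
  by_cases hk : k = g j₀
  · subst hk
    rw [Function.update_self, op_update_self]
  · rw [Function.update_of_ne hk, op_update_ne E j₀ hk]

/-- The tensor product of the operations, as a multilinear map. -/
def grpM (m : B → Deg N) (q c : Deg N) (hc : ∑ j, m j + q = c) :
    MultilinearMap R (fun j => (K j).X (m j)) ((tens L).X q →ₗ[R] (tens Q).X c) where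
  toFun x := grpL E m q c hc x
  map_update_add' x j₀ v w := by
    refine tp_ext fun l hl y => ?_
    rw [LinearMap.add_apply, grpL_tp, grpL_tp, grpL_tp, fam_update E j₀ (fibDeg_eq g m l),
      fam_update E j₀ (fibDeg_eq g m l), fam_update E j₀ (fibDeg_eq g m l),
      MultilinearMap.map_update_add, LinearMap.add_apply, MultilinearMap.map_update_add, smul_add]
  map_update_smul' x j₀ r v := by
    refine tp_ext fun l hl y => ?_
    rw [LinearMap.smul_apply, grpL_tp, grpL_tp, fam_update E j₀ (fibDeg_eq g m l),
      fam_update E j₀ (fibDeg_eq g m l),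
      MultilinearMap.map_update_smul, LinearMap.smul_apply, MultilinearMap.map_update_smul,
      smul_comm]

/-- The tensor product of the operations: the composite
`⨂ j, K j ⊗ ⨂ k, L k ≅ ⨂ k, ((⨂ g j = k, K j) ⊗ L k) ⟶ ⨂ k, Q k`. -/
def grp (p q c : Deg N) (hc : p + q = c) :
    (tens K).X p →ₗ[R] (tens L).X q →ₗ[R] (tens Q).X c :=
  tLift fun m hm => grpM E m q c (by rw [hm, hc])

theorem grp_tp (p q c : Deg N) (hc : p + q = c) (m : B → Deg N) (hm : ∑ j, m j = p)
    (x : ∀ j, (K j).X (m j)) (l : C → Deg N) (hl : ∑ k, l k = q) (y : ∀ k, (L k).X (l k))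
    (d : C → Deg N) (hd : ∀ k, ∑ j : {j // g j = k}, m j.1 + l k = d k) (hd' : ∑ k, d k = c) :
    grp E p q c hc (tp K m p hm x) (tp L l q hl y) = sg R (gsg g m l) • tp Q d c hd'
      (fun k => E.op k (fun j => m j.1) (l k) (d k) (hd k) (fun j => x j.1) (y k)) := by
  obtain rfl : d = fibDeg g m l := funext fun k => (hd k).symm
  unfold grp
  rw [tLift_tp]
  exact grpL_tp E m q c (by rw [hm, hc]) x l hl y

theorem fib_sum (g : B → C) {m : B → Deg N} {l : C → Deg N} {p q c : Deg N} (hc : p + q = c)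
    (hm : ∑ j, m j = p) (hl : ∑ k, l k = q) {d : C → Deg N}
    (hd : ∀ k, ∑ j : {j // g j = k}, m j.1 + l k = d k) : ∑ k, d k = c := by
  obtain rfl : d = fibDeg g m l := funext fun k => (hd k).symm
  rw [sum_fibDeg, hm, hl, hc]

end Grouping

section SignIdentities

theorem par_low {N : ℕ} {J : Type} [LinearOrder J] (g : J → Deg N) (j i : J) :
    par (low g j i) = par (g i) + if i = j then 1 else 0 := by
  by_cases h : i = j
  · subst h; rw [low_self, par_sub_one, if_pos rfl]
  · rw [low_ne g h, if_neg h, add_zero]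

theorem sum_ite_shift {A B : Type} [Fintype A] [Fintype B] (r : A → B → Prop)
    [∀ a b, Decidable (r a b)] (P : A → ZMod 2) (Q e : B → ZMod 2) :
    ∑ a, ∑ b, (if r a b then P a * (Q b + e b) else 0) =
      ∑ a, ∑ b, (if r a b then P a * Q b else 0) + ∑ a, ∑ b, (if r a b then P a * e b else 0) := by
  simp only [← Finset.sum_add_distrib]
  refine Finset.sum_congr rfl fun a _ => Finset.sum_congr rfl fun b _ => ?_
  split_ifs <;> ring

theorem sum_ite_shift' {A B : Type} [Fintype A] [Fintype B] (r : A → B → Prop)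
    [∀ a b, Decidable (r a b)] (P e : A → ZMod 2) (Q : B → ZMod 2) :
    ∑ a, ∑ b, (if r a b then (P a + e a) * Q b else 0) =
      ∑ a, ∑ b, (if r a b then P a * Q b else 0) + ∑ a, ∑ b, (if r a b then e a * Q b else 0) := by
  simp only [← Finset.sum_add_distrib]
  refine Finset.sum_congr rfl fun a _ => Finset.sum_congr rfl fun b _ => ?_
  split_ifs <;> ring

theorem sum_ite_point {A B : Type} [Fintype A] [Fintype B] [DecidableEq B] (r : A → B → Prop)
    [∀ a b, Decidable (r a b)] (P : A → ZMod 2) (j : B) :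
    ∑ a, ∑ b, (if r a b then P a * (if b = j then 1 else 0) else 0) =
      ∑ a, (if r a j then P a else 0) := by
  refine Finset.sum_congr rfl fun a _ => ?_
  rw [Finset.sum_eq_single j] <;> simp +contextual

theorem sum_ite_point' {A B : Type} [Fintype A] [Fintype B] [DecidableEq A] (r : A → B → Prop)
    [∀ a b, Decidable (r a b)] (Q : B → ZMod 2) (j : A) :
    ∑ a, ∑ b, (if r a b then (if a = j then 1 else 0) * Q b else 0) =
      ∑ b, (if r j b then Q b else 0) := by
  rw [Finset.sum_comm]
  refine Finset.sum_congr rfl fun b _ => ?_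
  rw [Finset.sum_eq_single j] <;> simp +contextual

theorem sum_fib {B C : Type} [Fintype B] [Fintype C] [DecidableEq C] (g : B → C)
    (F : C → B → ZMod 2) :
    ∑ k, ∑ j : {j // g j = k}, F k j.1 = ∑ j, F (g j) j := by
  rw [← Fintype.sum_fiberwise g (fun j => F (g j) j)]
  refine Finset.sum_congr rfl fun k _ => Finset.sum_congr rfl fun j _ => ?_
  rw [j.2]

variable {N : ℕ} {B C : Type} [Fintype B] [LinearOrder B] [Fintype C] [LinearOrder C]

theorem before_fibDeg (g : B → C) (m : B → Deg N) (l : C → Deg N) (k : C) :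
    before (fibDeg g m l) k =
      ∑ j, (if g j < k then par (m j) else 0) + ∑ i, if i < k then par (l i) else 0 := by
  unfold before fibDeg
  rw [← sum_fib g (fun i j => if i < k then par (m j) else 0), ← Finset.sum_add_distrib]
  refine Finset.sum_congr rfl fun i _ => ?_
  split_ifs
  · rw [map_add, map_sum]
  · simp

theorem before_fib (g : B → C) (m : B → Deg N) (j : B) :
    before (fun i : {i // g i = g j} => m i.1) ⟨j, rfl⟩ =
      ∑ i, if g i = g j ∧ i < j then par (m i) else 0 := by
  unfold before
  simp only [ite_and]
  refine Eq.trans ?_ (Finset.sum_filter (s := Finset.univ) (fun i => g i = g j)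
    (fun i => if i < j then par (m i) else 0))
  exact (Finset.sum_subtype (p := fun i => g i = g j) (Finset.univ.filter fun i => g i = g j)
    (fun i => by simp) (fun i => if i < j then par (m i) else 0)).symm

theorem zmod_aux₁ (s t a b c d e f : ZMod 2) (h : a + b + c + d + e = 0) :
    s + t + (a + f) + b = c + (s + e + (d + 0) + (t + f)) := by
  have h2 : (2 : ZMod 2) = 0 := rfl
  linear_combination h - (c + d + e) * h2

theorem gsg_low_left (g : B → C) (m : B → Deg N) (l : C → Deg N) (j : B) :
    gsg g m l + before (fibDeg g m l) (g j) + before (fun i : {i // g i = g j} => m i.1) ⟨j, rfl⟩ =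
      before m j + gsg g (low m j) l := by
  rw [before_fibDeg, before_fib]
  unfold gsg before
  simp only [par_low, sum_ite_shift, sum_ite_shift', sum_ite_point, sum_ite_point']
  have key : ∑ i, (if g i < g j then par (m i) else 0) +
      ∑ i, (if g i = g j ∧ i < j then par (m i) else 0) +
      ∑ i, (if i < j then par (m i) else 0) +
      ∑ i, (if i < j ∧ g j < g i then par (m i) else 0) +
      ∑ i, (if j < i ∧ g i < g j then par (m i) else 0) = (0 : ZMod 2) := by
    simp only [← Finset.sum_add_distrib]
    refine Finset.sum_eq_zero fun i _ => ?_
    generalize par (m i) = v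
    have hv : v + v = 0 := by revert v; decide
    rcases lt_trichotomy i j with h | h | h <;> rcases lt_trichotomy (g i) (g j) with h' | h' | h' <;>
      simp_all [not_lt_of_gt, ne_of_lt, ne_of_gt]
  have e0 : ∑ a, (if a < j ∧ g j < g a then (if a = j then 1 else 0) else 0) = (0 : ZMod 2) :=
    Finset.sum_eq_zero fun a _ => by
      by_cases h : a = j <;> simp [h]
  rw [e0]
  exact zmod_aux₁ _ _ _ _ _ _ _ _ key

theorem zmod_aux₂ (s a b c d f : ZMod 2) (h : a + b + c + d = 0) :
    s + (a + f) + b = c + f + (s + d) := by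
  have h2 : (2 : ZMod 2) = 0 := rfl
  linear_combination h - (c + d) * h2

theorem gsg_low_right (g : B → C) (m : B → Deg N) (l : C → Deg N) (k : C) :
    gsg g m l + before (fibDeg g m l) k + ∑ j : {j // g j = k}, par (m j.1) =
      ∑ j, par (m j) + before l k + gsg g m (low l k) := by
  rw [before_fibDeg]
  have e : ∑ j : {j // g j = k}, (par (m j.1) : ZMod 2) = ∑ j, if g j = k then par (m j) else 0 :=
    (Finset.sum_subtype (p := fun i => g i = k) (Finset.univ.filter fun i => g i = k)
      (fun i => by simp) (fun i => (par (m i) : ZMod 2))).symm.trans (Finset.sum_filter _ _)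
  rw [e]
  unfold gsg before
  simp only [par_low, sum_ite_shift, sum_ite_shift', sum_ite_point, sum_ite_point', ← add_assoc]
  have key : ∑ i, (if g i < k then par (m i) else 0) + ∑ i, (if g i = k then par (m i) else 0) +
      ∑ i, par (m i) + ∑ i, (if k < g i then par (m i) else 0) = (0 : ZMod 2) := by
    simp only [← Finset.sum_add_distrib]
    refine Finset.sum_eq_zero fun i _ => ?_
    generalize par (m i) = v
    have hv : v + v = 0 := by revert v; decide
    rcases lt_trichotomy (g i) k with h' | h' | h' <;>
      simp_all [not_lt_of_gt, ne_of_lt, ne_of_gt]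
  have := zmod_aux₂ (∑ j, ∑ j', (if j < j' ∧ g j' < g j then par (m j) * par (m j') else 0) +
    ∑ k, ∑ j, if k < g j then par (l k) * par (m j) else 0) _ _ _ _
    (∑ i, if i < k then par (l i) else 0) key
  simpa only [← add_assoc] using this

theorem sum_fibL (g : B → C) {A : Type} [Fintype A] (r : C → A → Prop) [∀ a b, Decidable (r a b)]
    (P : B → ZMod 2) (Q : A → ZMod 2) :
    ∑ k, ∑ a, (if r k a then (∑ j : {j // g j = k}, P j.1) * Q a else 0) =
      ∑ j, ∑ a, if r (g j) a then P j * Q a else 0 := by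
  rw [← sum_fib g (fun k j => ∑ a, if r k a then P j * Q a else 0)]
  refine Finset.sum_congr rfl fun k _ => ?_
  rw [Finset.sum_comm]
  refine Finset.sum_congr rfl fun a _ => ?_
  split_ifs
  · rw [Finset.sum_mul]
  · simp

theorem sum_fibR (g : B → C) {A : Type} [Fintype A] (r : A → C → Prop) [∀ a b, Decidable (r a b)]
    (P : B → ZMod 2) (Q : A → ZMod 2) :
    ∑ a, ∑ k, (if r a k then Q a * (∑ j : {j // g j = k}, P j.1) else 0) =
      ∑ a, ∑ j, if r a (g j) then Q a * P j else 0 := by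
  refine Finset.sum_congr rfl fun a _ => ?_
  rw [← sum_fib g (fun k j => if r a k then Q a * P j else 0)]
  refine Finset.sum_congr rfl fun k _ => ?_
  split_ifs
  · rw [Finset.mul_sum]
  · simp

theorem sum_fib_pair (g : B → C) (F : B → B → ZMod 2) :
    ∑ k, ∑ i : {j // g j = k}, ∑ j : {j // g j = k}, F i.1 j.1 =
      ∑ i, ∑ j, if g j = g i then F i j else 0 := by
  rw [sum_fib g (fun k i => ∑ j : {j // g j = k}, F i j.1)]
  refine Finset.sum_congr rfl fun i _ => ?_
  exact (Finset.sum_subtype (p := fun j => g j = g i) (Finset.univ.filter fun j => g j = g i)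
      (fun j => by simp) (fun j => F i j)).symm.trans (Finset.sum_filter _ _)

theorem sum_sym (r : B → B → Prop) [∀ a b, Decidable (r a b)] (hr : ∀ a, ¬ r a a) (P : B → ZMod 2) :
    ∑ i, ∑ j, (if r i j then P i * P j else 0) =
      ∑ i, ∑ j, (if i < j ∧ r i j then P i * P j else 0) +
        ∑ i, ∑ j, (if i < j ∧ r j i then P i * P j else 0) := by
  rw [Finset.sum_comm (f := fun i j => if i < j ∧ r j i then P i * P j else 0)]
  simp only [← Finset.sum_add_distrib]
  refine Finset.sum_congr rfl fun i _ => Finset.sum_congr rfl fun j _ => ?_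
  rcases lt_trichotomy i j with h | h | h
  · simp [h, not_lt_of_gt h]
  · subst h; simp [hr]
  · simp [h, not_lt_of_gt h, mul_comm]

theorem zmod_aux₃ (x₁ y₁ x₂ y₂ y₃ a b c y₄ x₃ x₄ y₅ : ZMod 2) (hx : x₁ + x₂ + x₃ + x₄ = 0)
    (hy : y₁ + y₂ + y₃ + y₄ + y₅ = 0) :
    x₁ + y₁ + (x₂ + y₂ + (y₃ + a) + (b + c)) + (y₄ + x₃) = a + c + (x₄ + (y₅ + b)) := by
  have h2 : (2 : ZMod 2) = 0 := rfl
  linear_combination hx + hy - (x₄ + y₅) * h2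

theorem gsg_assoc_aux {D : Type} [Fintype D] [LinearOrder D] (g : B → C) (h : C → D)
    (P : B → ZMod 2) (L : C → ZMod 2) (T : D → ZMod 2) :
    ∑ j, ∑ j', (if j < j' ∧ g j' < g j then P j * P j' else 0) +
        ∑ k, ∑ j, (if k < g j then L k * P j else 0) +
      (∑ k, ∑ k', (if k < k' ∧ h k' < h k then (∑ j : {j // g j = k}, P j.1 + L k) *
          (∑ j : {j // g j = k'}, P j.1 + L k') else 0) +
        ∑ d, ∑ k, (if d < h k then T d * (∑ j : {j // g j = k}, P j.1 + L k) else 0)) +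
      (∑ k, ∑ k', (if h k' = h k ∧ k < k' then L k * ∑ j : {j // g j = k'}, P j.1 else 0) +
        ∑ j, ∑ j', if h (g j') = h (g j) ∧ j < j' ∧ g j' < g j then P j * P j' else 0) =
      ∑ k, ∑ k', (if k < k' ∧ h k' < h k then L k * L k' else 0) +
        ∑ d, ∑ k, (if d < h k then T d * L k else 0) +
      (∑ j, ∑ j', (if j < j' ∧ h (g j') < h (g j) then P j * P j' else 0) +
        ∑ d, ∑ j, if d < h (g j) then (∑ k : {k // h k = d}, L k.1 + T d) * P j else 0) := by
  rw [sum_ite_shift' (fun k k' => k < k' ∧ h k' < h k) (fun k => ∑ j : {j // g j = k}, P j.1) L,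
    sum_fibL g (fun k k' => k < k' ∧ h k' < h k) P (fun k' => ∑ j : {j // g j = k'}, P j.1 + L k'),
    sum_ite_shift (fun j k' => g j < k' ∧ h k' < h (g j)) P (fun k => ∑ j : {j // g j = k}, P j.1) L,
    sum_ite_shift (fun k k' => k < k' ∧ h k' < h k) L (fun k => ∑ j : {j // g j = k}, P j.1) L,
    sum_ite_shift (fun d k => d < h k) T (fun k => ∑ j : {j // g j = k}, P j.1) L,
    sum_ite_shift' (fun d j => d < h (g j)) (fun d => ∑ k : {k // h k = d}, L k.1) T P,
    sum_fibR g (fun j k' => g j < k' ∧ h k' < h (g j)) P P,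
    sum_fibR g (fun k k' => k < k' ∧ h k' < h k) P L,
    sum_fibR g (fun d k => d < h k) P T,
    sum_fibR g (fun k k' => h k' = h k ∧ k < k') P L,
    sum_fibL h (fun d j => d < h (g j)) L P,
    Finset.sum_comm (f := fun j k => if g j < k ∧ h k < h (g j) then P j * L k else 0),
    sum_sym (fun j j' => g j < g j' ∧ h (g j') < h (g j)) (fun a ha => lt_irrefl _ ha.1)]
  have key₁ : ∑ j, ∑ j', (if j < j' ∧ g j' < g j then P j * P j' else 0) +
      (∑ j, ∑ j', (if j < j' ∧ g j < g j' ∧ h (g j') < h (g j) then P j * P j' else 0) +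
        ∑ j, ∑ j', (if j < j' ∧ g j' < g j ∧ h (g j) < h (g j') then P j * P j' else 0)) +
      ∑ j, ∑ j', (if h (g j') = h (g j) ∧ j < j' ∧ g j' < g j then P j * P j' else 0) +
      ∑ j, ∑ j', (if j < j' ∧ h (g j') < h (g j) then P j * P j' else 0) = 0 := by
    simp only [← Finset.sum_add_distrib]
    refine Finset.sum_eq_zero fun j _ => Finset.sum_eq_zero fun j' _ => ?_
    generalize P j * P j' = v
    have hv : v + v = 0 := by revert v; decide
    by_cases h0 : j < j'
    · rcases lt_trichotomy (g j) (g j') with h1 | h1 | h1 <;>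
        rcases lt_trichotomy (h (g j)) (h (g j')) with h2 | h2 | h2 <;>
        simp_all [not_lt_of_gt, ne_of_lt, ne_of_gt]
    · simp [h0]
  have key₂ : ∑ k, ∑ j, (if k < g j then L k * P j else 0) +
      ∑ k, ∑ j, (if g j < k ∧ h k < h (g j) then P j * L k else 0) +
      ∑ k, ∑ j, (if k < g j ∧ h (g j) < h k then L k * P j else 0) +
      ∑ k, ∑ j, (if h (g j) = h k ∧ k < g j then L k * P j else 0) +
      ∑ k, ∑ j, (if h k < h (g j) then L k * P j else 0) = 0 := by
    simp only [← Finset.sum_add_distrib]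
    refine Finset.sum_eq_zero fun k _ => Finset.sum_eq_zero fun j _ => ?_
    rw [mul_comm (P j)]
    generalize L k * P j = v
    have hv : v + v = 0 := by revert v; decide
    rcases lt_trichotomy (g j) k with h1 | h1 | h1 <;>
      rcases lt_trichotomy (h (g j)) (h k) with h2 | h2 | h2 <;>
      simp_all [not_lt_of_gt, ne_of_lt, ne_of_gt]
  exact zmod_aux₃ _ _ _ _ _ _ _ _ _ _ _ _ key₁ key₂

theorem gsg_assoc {D : Type} [Fintype D] [LinearOrder D] (g : B → C) (h : C → D)
    (m : B → Deg N) (l : C → Deg N) (t : D → Deg N) :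
    gsg g m l + gsg h (fibDeg g m l) t +
        ∑ d, (∑ k : {k // h k = d}, ∑ k' : {k // h k = d},
            (if k < k' then par (l k.1) * ∑ j : {j // g j = k'.1}, par (m j.1) else 0) +
          ∑ j : {j // h (g j) = d}, ∑ j' : {j // h (g j) = d},
            if j < j' ∧ g j'.1 < g j.1 then par (m j.1) * par (m j'.1) else 0) =
      gsg h l t + gsg (fun j => h (g j)) m (fibDeg h l t) := by
  have e1 := sum_fib_pair h (fun k k' =>
    if k < k' then par (l k) * ∑ j : {j // g j = k'}, par (m j.1) else 0)
  have e2 := sum_fib_pair (fun j => h (g j)) (fun j j' =>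
    if j < j' ∧ g j' < g j then par (m j) * par (m j') else 0)
  rw [Finset.sum_add_distrib]
  refine (congrArg₂ (fun x y => gsg g m l + gsg h (fibDeg g m l) t + (x + y)) e1 e2).trans ?_
  unfold gsg fibDeg
  simp only [map_add, map_sum, ← ite_and]
  exact gsg_assoc_aux g h _ _ _

end SignIdentities

section GroupingLaws

variable {R : Type u} [CommRing R] {N : ℕ} {B C : Type} [Fintype B] [LinearOrder B]
  [Fintype C] [LinearOrder C] {g : B → C} {K : B → Ch R N} {L Q : C → Ch R N}

theorem low_restrict {P : B → Prop} (m : B → Deg N) (j : {j // P j}) :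
    low (fun i : {j // P j} => m i.1) j = fun i => low m j.1 i.1 := by
  funext i
  by_cases h : i = j
  · subst h; rw [low_self, low_self]
  · rw [low_ne _ h, low_ne _ (fun h' => h (Subtype.ext h'))]

theorem op_del (E : Ops g K L Q) (k : C) (u : {j // g j = k} → Deg N) (h c c' : Deg N)
    (hc : ∑ j, u j + h = c) (hc' : c' + 1 = c)
    (m : ∀ j : {j // g j = k}, (K j.1).X (u j)) (l : (L k).X h) :
    del _ c c' (E.op k u h c hc m l) =
      ∑ j, sg R (before u j) • E.op k (low u j) h c'
        (by rw [sum_low_add hc, ← hc']; ring)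
        (fun i => dmap (fun i : {j // g j = k} => K i.1) u (low u j) j i (m i)) l +
      sg R (∑ j, par (u j)) • E.op k u (h - 1) c' (by rw [sum_add_low hc, ← hc']; ring) m
        (del _ h (h - 1) l) := by
  obtain rfl : c' = c - 1 := by rw [← hc']; ring
  exact E.del_op k u h c hc m l

theorem op_congr' (E : Ops g K L Q) {k : C} {u u' : {j // g j = k} → Deg N} {h h' c : Deg N}
    (hc : ∑ j, u j + h = c) (hc' : ∑ j, u' j + h' = c) (hu : u = u') (hh : h = h')
    {m : ∀ j : {j // g j = k}, (K j.1).X (u j)} {m' : ∀ j : {j // g j = k}, (K j.1).X (u' j)}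
    {l : (L k).X h} {l' : (L k).X h'} (hm : ∀ j, tr (K j.1) (u j) (u' j) (m j) = m' j)
    (hl : tr (L k) h h' l = l') :
    E.op k u h c hc m l = E.op k u' h' c hc' m' l' := by
  rw [← E.op_congr hc hc' hu hh hm hl, tr_self]

/-- The transported operations. -/
theorem fib_low_left {m : B → Deg N} {l d : C → Deg N} {j₀ : B}
    (hd : ∀ k, ∑ j : {j // g j = k}, m j.1 + l k = d k) (k : C) :
    ∑ j : {j // g j = k}, low m j₀ j.1 + l k = low d (g j₀) k := by
  by_cases hk : k = g j₀
  · subst hk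
    have := low_restrict (P := fun j => g j = g j₀) m ⟨j₀, rfl⟩
    rw [← this, sum_low, low_self, ← hd]
    ring
  · rw [low_ne d hk, ← hd]
    congr 1
    refine Finset.sum_congr rfl fun i _ => low_ne m fun h => hk ?_
    rw [← i.2, h]

theorem fib_low_right {m : B → Deg N} {l d : C → Deg N} {k₀ : C}
    (hd : ∀ k, ∑ j : {j // g j = k}, m j.1 + l k = d k) (k : C) :
    ∑ j : {j // g j = k}, m j.1 + low l k₀ k = low d k₀ k := by
  by_cases hk : k = k₀
  · subst hk
    rw [low_self, low_self, ← hd]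
    ring
  · rw [low_ne d hk, low_ne l hk, ← hd]

theorem fam_left (E : Ops g K L Q) {m : B → Deg N} {l d : C → Deg N} (j₀ : B)
    (hd : ∀ k, ∑ j : {j // g j = k}, m j.1 + l k = d k) (x : ∀ j, (K j).X (m j))
    (y : ∀ k, (L k).X (l k)) (p) :
    Function.update (fun i => tr (Q i) (d i) (low d (g j₀) i)
        (E.op i (fun j => m j.1) (l i) (d i) (hd i) (fun j => x j.1) (y i))) (g j₀)
      (E.op (g j₀) (low (fun j => m j.1) ⟨j₀, rfl⟩) (l (g j₀)) (low d (g j₀) (g j₀)) p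
        (fun i => dmap (fun i : {j // g j = g j₀} => K i.1) (fun j => m j.1)
          (low (fun j => m j.1) ⟨j₀, rfl⟩) ⟨j₀, rfl⟩ i (x i.1)) (y (g j₀))) =
      fun i => E.op i (fun j => low m j₀ j.1) (l i) (low d (g j₀) i) (fib_low_left hd i)
        (fun j => dmap K m (low m j₀) j₀ j.1 (x j.1)) (y i) := by
  funext i
  by_cases hi : i = g j₀
  · subst hi
    rw [Function.update_self]
    have hl := low_restrict (P := fun j => g j = g j₀) m ⟨j₀, rfl⟩
    refine op_congr' E _ _ hl rfl (fun j => ?_) (tr_self _ _ _)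
    have e : low (fun i : {j // g j = g j₀} => m i.1) ⟨j₀, rfl⟩ j = low m j₀ j.1 := congrFun hl j
    by_cases hj : j = ⟨j₀, rfl⟩
    · subst hj
      rw [dmap_self, dmap_self, tr_del _ e]
    · rw [dmap_ne _ _ _ hj, dmap_ne _ _ _ (fun h => hj (Subtype.ext h)),
        tr_tr _ (low_ne _ hj).symm]
  · rw [Function.update_of_ne hi]
    have hne : ∀ j : {j // g j = i}, j.1 ≠ j₀ := fun j h => hi (by rw [← j.2, h])
    refine E.op_congr _ _ (funext fun j => (low_ne m (hne j)).symm) rfl (fun j => ?_)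
      (tr_self _ _ _)
    rw [dmap_ne _ _ _ (hne j)]

theorem fam_right (E : Ops g K L Q) {m : B → Deg N} {l d : C → Deg N} (k : C)
    (hd : ∀ k, ∑ j : {j // g j = k}, m j.1 + l k = d k) (x : ∀ j, (K j).X (m j))
    (y : ∀ k, (L k).X (l k)) (p) :
    Function.update (fun i => tr (Q i) (d i) (low d k i)
        (E.op i (fun j => m j.1) (l i) (d i) (hd i) (fun j => x j.1) (y i))) k
      (E.op k (fun j => m j.1) (l k - 1) (low d k k) p (fun j => x j.1) (del _ _ _ (y k))) =
      fun i => E.op i (fun j => m j.1) (low l k i) (low d k i) (fib_low_right hd i)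
        (fun j => x j.1) (dmap L l (low l k) k i (y i)) := by
  funext i
  by_cases hi : i = k
  · subst hi
    rw [Function.update_self]
    refine op_congr' E _ _ rfl (low_self _ _).symm (fun j => tr_self _ _ _) ?_
    rw [dmap_self, tr_del _ (low_self _ _).symm]
  · rw [Function.update_of_ne hi]
    refine E.op_congr _ _ rfl (low_ne _ hi).symm (fun j => tr_self _ _ _) ?_
    rw [dmap_ne _ _ _ hi]

theorem dmap_update (d : C → Deg N) (k : C) (z : ∀ i, (Q i).X (d i)) :
    (fun i => dmap Q d (low d k) k i (z i)) =
      Function.update (fun i => tr (Q i) (d i) (low d k i) (z i)) k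
        (del (Q k) (d k) (low d k k) (z k)) := by
  funext i
  by_cases hi : i = k
  · subst hi; rw [Function.update_self, dmap_self]
  · rw [Function.update_of_ne hi, dmap_ne _ _ _ hi]

theorem del_grp (E : Ops g K L Q) (p q c : Deg N) (hc : p + q = c) (a : (tens K).X p)
    (b : (tens L).X q) :
    del _ c (c - 1) (grp E p q c hc a b) =
      grp E (p - 1) q (c - 1) (by rw [← hc]; ring) (del _ p (p - 1) a) b +
      sg R (par p) • grp E p (q - 1) (c - 1) (by rw [← hc]; ring) a (del _ q (q - 1) b) := by
  suffices H : ∀ b, del _ c (c - 1) ∘ₗ (grp E p q c hc).flip b =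
      (grp E (p - 1) q (c - 1) (by rw [← hc]; ring)).flip b ∘ₗ del _ p (p - 1) +
      sg R (par p) • (grp E p (q - 1) (c - 1) (by rw [← hc]; ring)).flip (del _ q (q - 1) b) from
    LinearMap.congr_fun (H b) a
  intro b
  refine tp_ext fun m hm x => ?_
  suffices H : del _ c (c - 1) ∘ₗ grp E p q c hc (tp K m p hm x) =
      grp E (p - 1) q (c - 1) (by rw [← hc]; ring) (del _ p (p - 1) (tp K m p hm x)) +
      sg R (par p) • (grp E p (q - 1) (c - 1) (by rw [← hc]; ring) (tp K m p hm x)) ∘ₗ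
        del _ q (q - 1) from
    LinearMap.congr_fun H b
  refine tp_ext fun l hl y => ?_
  simp only [LinearMap.comp_apply, LinearMap.add_apply, LinearMap.smul_apply]
  have hd := fibDeg_eq g m l
  generalize hdd : fibDeg g m l = d at hd
  have hd' := fib_sum g hc hm hl hd
  rw [grp_tp E p q c hc m hm x l hl y d hd hd', map_smul,
    del_tp Q (sub_add_cancel c 1), del_tp K (sub_add_cancel p 1), del_tp L (sub_add_cancel q 1)]
  simp only [map_sum, map_smul, LinearMap.sum_apply, LinearMap.smul_apply]
  have h1 : ∀ j, grp E (p - 1) q (c - 1) (by rw [← hc]; ring)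
      (tp K (low m j) (p - 1) (low_sum (sub_add_cancel p 1) hm j)
        fun i => dmap K m (low m j) j i (x i)) (tp L l q hl y) = _ := fun j =>
    grp_tp E (p - 1) q (c - 1) (by rw [← hc]; ring) (low m j)
      (low_sum (sub_add_cancel p 1) hm j) _ l hl y (low d (g j)) (fib_low_left hd)
      (low_sum (sub_add_cancel c 1) hd' (g j))
  have h2 : ∀ k, grp E p (q - 1) (c - 1) (by rw [← hc]; ring) (tp K m p hm x)
      (tp L (low l k) (q - 1) (low_sum (sub_add_cancel q 1) hl k)
        fun i => dmap L l (low l k) k i (y i)) = _ := fun k =>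
    grp_tp E p (q - 1) (c - 1) (by rw [← hc]; ring) m hm x (low l k)
      (low_sum (sub_add_cancel q 1) hl k) _ (low d k) (fib_low_right hd)
      (low_sum (sub_add_cancel c 1) hd' k)
  simp only [h1, h2]
  rw [← Fintype.sum_fiberwise g, Finset.smul_sum, Finset.smul_sum, ← Finset.sum_add_distrib]
  refine Finset.sum_congr rfl fun k _ => ?_
  rw [dmap_update, op_del E k _ _ _ _ _ (by rw [low_self]; ring), MultilinearMap.map_update_add,
    MultilinearMap.map_update_sum, smul_add, smul_add, Finset.smul_sum, Finset.smul_sum]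
  congr 1
  · refine Finset.sum_congr rfl fun ⟨j, hj⟩ _ => ?_
    subst hj
    rw [MultilinearMap.map_update_smul, fam_left E j hd x y]
    simp only [smul_smul, ← sg_add]
    refine congrArg (fun s => sg R s • _) ?_
    rw [← add_assoc, ← hdd, gsg_low_left]
  · rw [MultilinearMap.map_update_smul, fam_right E k hd x y]
    simp only [smul_smul, ← sg_add]
    refine congrArg (fun s => sg R s • _) ?_
    rw [← add_assoc, ← hdd, gsg_low_right, ← hm, map_sum, add_assoc]

theorem sg_sum {ι : Type} [Fintype ι] (f : ι → ZMod 2) : sg R (∑ i, f i) = ∏ i, sg R (f i) := by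
  classical
  induction (Finset.univ : Finset ι) using Finset.induction_on with
  | empty => simp [sg_zero]
  | insert a s ha ih => rw [Finset.sum_insert ha, Finset.prod_insert ha, sg_add, ih]

/-- The bijection of `(h ∘ g) ⁻¹ d` with the ordered sum over `k` in `h ⁻¹ d` of the `g ⁻¹ k`. -/
def fibEquiv {A B D : Type} (g : A → B) (h : B → D) (d : D) :
    {j // h (g j) = d} ≃ Σₗ k : {k // h k = d}, {j // g j = k.1} where
  toFun j := toLex ⟨⟨g j.1, j.2⟩, ⟨j.1, rfl⟩⟩
  invFun q := ⟨(ofLex q).2.1, by rw [(ofLex q).2.2]; exact (ofLex q).1.2⟩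
  left_inv _ := rfl
  right_inv := by
    have key : ∀ (k : B) (hk : h k = d) (j : A) (hj : g j = k),
        (toLex ⟨⟨g j, by rw [hj, hk]⟩, ⟨j, rfl⟩⟩ : Σₗ k : {k // h k = d}, {j // g j = k.1}) =
          toLex ⟨⟨k, hk⟩, ⟨j, hj⟩⟩ := by
      rintro _ hk j rfl
      rfl
    exact fun q => key (ofLex q).1.1 (ofLex q).1.2 (ofLex q).2.1 (ofLex q).2.2

theorem sum_fibEquiv {D : Type} [Fintype D] [LinearOrder D] (g : B → C) (h : C → D) (d : D)
    (m : B → Deg N) :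
    ∑ j : {j // h (g j) = d}, m j.1 = ∑ k : {k // h k = d}, ∑ j : {j // g j = k.1}, m j.1 := by
  rw [← Fintype.sum_sigma (fun q : Σ k : {k // h k = d}, {j // g j = k.1} => m q.2.1)]
  exact Fintype.sum_equiv ((fibEquiv g h d).trans ofLex) _ _ fun _ => rfl

/-- The sign exponent in the associativity of operations over a point `d`. -/
def asg {D : Type} [DecidableEq D] (g : B → C) (h : C → D) (m : B → Deg N) (l : C → Deg N) (d : D) :
    ZMod 2 :=
  ∑ k : {k // h k = d}, ∑ k' : {k // h k = d},
      (if k < k' then par (l k.1) * ∑ j : {j // g j = k'.1}, par (m j.1) else 0) +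
    ∑ j : {j // h (g j) = d}, ∑ j' : {j // h (g j) = d},
      if j < j' ∧ g j'.1 < g j.1 then par (m j.1) * par (m j'.1) else 0

theorem grp_assoc {D : Type} [Fintype D] [LinearOrder D] {h : C → D} {T V W : D → Ch R N}
    (E₁ : Ops g K L Q) (E₂ : Ops h Q T W) (E₃ : Ops h L T V)
    (E₄ : Ops (fun j => h (g j)) K V W)
    (H : ∀ (d : D) (m : B → Deg N) (x : ∀ j, (K j).X (m j)) (l : C → Deg N)
      (y : ∀ k, (L k).X (l k)) (t : Deg N) (z : (T d).X t) (e : C → Deg N)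
      (he : ∀ k, ∑ j : {j // g j = k}, m j.1 + l k = e k) (c v : Deg N)
      (hc : ∑ k : {k // h k = d}, e k.1 + t = c) (hv : ∑ k : {k // h k = d}, l k.1 + t = v)
      (hc' : ∑ j : {j // h (g j) = d}, m j.1 + v = c),
      E₂.op d (fun k => e k.1) t c hc
          (fun k => E₁.op k.1 (fun j => m j.1) (l k.1) (e k.1) (he k.1) (fun j => x j.1) (y k.1)) z =
        sg R (asg g h m l d) • E₄.op d (fun j => m j.1) v c hc' (fun j => x j.1)
          (E₃.op d (fun k => l k.1) t v hv (fun k => y k.1) z))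
    (p q r pq qr c : Deg N) (h₁ : p + q = pq) (h₂ : pq + r = c) (h₃ : q + r = qr) (h₄ : p + qr = c)
    (a : (tens K).X p) (b : (tens L).X q) (w : (tens T).X r) :
    grp E₂ pq r c h₂ (grp E₁ p q pq h₁ a b) w = grp E₄ p qr c h₄ a (grp E₃ q r qr h₃ b w) := by
  suffices H' : (grp E₂ pq r c h₂).flip w ∘ₗ (grp E₁ p q pq h₁).flip b =
      (grp E₄ p qr c h₄).flip (grp E₃ q r qr h₃ b w) from LinearMap.congr_fun H' a
  refine tp_ext fun m hm x => ?_
  simp only [LinearMap.comp_apply, LinearMap.flip_apply]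
  suffices H' : (grp E₂ pq r c h₂).flip w ∘ₗ (grp E₁ p q pq h₁ (tp K m p hm x)) =
      (grp E₄ p qr c h₄ (tp K m p hm x)) ∘ₗ (grp E₃ q r qr h₃).flip w from
    LinearMap.congr_fun H' b
  refine tp_ext fun l hl y => ?_
  simp only [LinearMap.comp_apply, LinearMap.flip_apply]
  suffices H' : grp E₂ pq r c h₂ (grp E₁ p q pq h₁ (tp K m p hm x) (tp L l q hl y)) =
      (grp E₄ p qr c h₄ (tp K m p hm x)) ∘ₗ (grp E₃ q r qr h₃ (tp L l q hl y)) from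
    LinearMap.congr_fun H' w
  refine tp_ext fun t ht z => ?_
  simp only [LinearMap.comp_apply]
  have he' := fib_sum g h₁ hm hl (fibDeg_eq g m l)
  have hf' := fib_sum h h₂ he' ht (fibDeg_eq h (fibDeg g m l) t)
  have hv' := fib_sum h h₃ hl ht (fibDeg_eq h l t)
  have hw : ∀ d, ∑ j : {j // h (g j) = d}, m j.1 + fibDeg h l t d =
      fibDeg h (fibDeg g m l) t d := fun d => by
    unfold fibDeg
    rw [Finset.sum_add_distrib, ← add_assoc]
    exact congrArg (fun s => s + _ + _) (sum_fibEquiv g h d m)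
  rw [grp_tp E₁ p q pq h₁ m hm x l hl y _ (fibDeg_eq g m l) he',
    grp_tp E₃ q r qr h₃ l hl y t ht z _ (fibDeg_eq h l t) hv', map_smul, map_smul,
    LinearMap.smul_apply,
    grp_tp E₂ pq r c h₂ _ he' _ t ht z _ (fibDeg_eq h (fibDeg g m l) t) hf',
    grp_tp E₄ p qr c h₄ m hm x _ hv' _ _ hw hf']
  have := fun d => H d m x l y (t d) (z d) _ (fibDeg_eq g m l) _ _
    (fibDeg_eq h (fibDeg g m l) t d) (fibDeg_eq h l t d) (hw d)
  simp only [this]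
  rw [MultilinearMap.map_smul_univ, ← sg_sum]
  simp only [smul_smul, ← sg_add]
  refine congrArg (fun s => sg R s • _) ?_
  rw [← add_assoc]
  exact gsg_assoc g h m l t

end GroupingLaws

section PermLemmas

variable {R : Type u} [CommRing R] {N : ℕ} (M : DGMulticat R N)

theorem perm_perm {I I' I'' : Type} [Fintype I] [LinearOrder I] [Fintype I'] [LinearOrder I']
    [Fintype I''] [LinearOrder I''] {x : I → M.Ob} {x' : I' → M.Ob} {x'' : I'' → M.Ob}
    (e : I ≃ I') (e' : I' ≃ I'') (e'' : I ≃ I'') (h : ∀ i, x i = x' (e i))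
    (h' : ∀ i, x' i = x'' (e' i)) (h'' : ∀ i, x i = x'' (e'' i)) (he : ∀ i, e' (e i) = e'' i)
    (y : M.Ob) (a : Deg N) (m : (M.Hom x'' y).X a) :
    app (M.perm e h y) a (app (M.perm e' h' y) a m) = app (M.perm e'' h'' y) a m := by
  obtain rfl : e'' = e.trans e' := by ext i; rw [← he]; rfl
  obtain rfl : x' = fun i => x'' (e' i) := funext h'
  obtain rfl : x = fun i => x'' (e' (e i)) := funext h
  exact congrArg (fun f => app f a m) (M.perm_trans x'' e e' y)

theorem perm_penta {I I₁ I₂ I₃ I₄ : Type} [Fintype I] [LinearOrder I] [Fintype I₁] [LinearOrder I₁]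
    [Fintype I₂] [LinearOrder I₂] [Fintype I₃] [LinearOrder I₃] [Fintype I₄] [LinearOrder I₄]
    {x : I → M.Ob} {x₁ : I₁ → M.Ob} {x₂ : I₂ → M.Ob} {x₃ : I₃ → M.Ob} {x₄ : I₄ → M.Ob}
    (e₁ : I ≃ I₁) (e₂ : I₁ ≃ I₂) (e₃ : I₂ ≃ I₃) (e₄ : I ≃ I₄) (e₅ : I₄ ≃ I₃)
    (h₁ : ∀ i, x i = x₁ (e₁ i)) (h₂ : ∀ i, x₁ i = x₂ (e₂ i)) (h₃ : ∀ i, x₂ i = x₃ (e₃ i))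
    (h₄ : ∀ i, x i = x₄ (e₄ i)) (h₅ : ∀ i, x₄ i = x₃ (e₅ i))
    (he : ∀ i, e₃ (e₂ (e₁ i)) = e₅ (e₄ i)) (y : M.Ob) (a : Deg N) (m : (M.Hom x₃ y).X a) :
    app (M.perm e₁ h₁ y) a (app (M.perm e₂ h₂ y) a (app (M.perm e₃ h₃ y) a m)) =
      app (M.perm e₄ h₄ y) a (app (M.perm e₅ h₅ y) a m) := by
  have h₀ : ∀ i, x i = x₃ ((e₄.trans e₅) i) := fun i => (h₄ i).trans (h₅ _)
  rw [perm_perm M e₄ e₅ (e₄.trans e₅) h₄ h₅ h₀ (fun _ => rfl),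
    perm_perm M e₁ e₂ (e₁.trans e₂) h₁ h₂ (fun i => (h₁ i).trans (h₂ _)) (fun _ => rfl),
    perm_perm M _ _ (e₄.trans e₅) _ _ h₀ he]

theorem perm_one {I : Type} [Fintype I] [LinearOrder I] {x : I → M.Ob} (e : I ≃ I)
    (he : ∀ i, e i = i) (h : ∀ i, x i = x (e i)) (y : M.Ob) (a : Deg N) (m : (M.Hom x y).X a) :
    app (M.perm e h y) a m = m := by
  obtain rfl : e = Equiv.refl I := by ext i; exact he i
  exact congrArg (fun f => app f a m) (M.perm_refl x y)

end PermLemmas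

section FibreComplexes

variable {R : Type u} [CommRing R] {N : ℕ} (M : DGMulticat R N)
  {A B C D : Type} [Fintype A] [LinearOrder A] [Fintype B] [LinearOrder B]
  [Fintype C] [LinearOrder C] [Fintype D] [LinearOrder D]

/-- The complexes `M (a|_{f ⁻¹ j}; b j)`. -/
abbrev fibHom (f : A → B) (a : A → M.Ob) (b : B → M.Ob) (j : B) : Ch R N :=
  M.Hom (fun i : {i // f i = j} => a i.1) (b j)

variable {M}

theorem map_sum_aux {V W ι : Type*} [AddCommGroup V] [AddCommGroup W] [Module R V] [Module R W]
    [Fintype ι] (P : V →ₗ[R] W) (s : ι → R) (v : ι → V) (t : R) (w : V) :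
    P (∑ i, s i • v i + t • w) = ∑ i, s i • P (v i) + t • P w := by
  simp only [map_add, map_sum, map_smul]

/-- The composition in a multicategory, over a point `k`, of the multimorphisms of a map `g`
with those of a map `f`. -/
def compOps (f : A → B) (g : B → C) (a : A → M.Ob) (b : B → M.Ob) (c : C → M.Ob) :
    Ops g (fibHom M f a b) (fibHom M g b c) (fibHom M (fun i => g (f i)) a c) where
  op k u h e he := (app (M.perm (fibEquiv f g k) (fun _ => rfl) (c k)) e).compRight R
    |>.compMultilinearMap (M.comp (x := fun (j : {j // g j = k}) (i : {i // f i = j.1}) => a i.1)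
      (y := fun j : {j // g j = k} => b j.1) (z := c k) u h e he)
  del_op k u h e he m l := by
    refine (app_del (M.perm (x := fun i : {i // g (f i) = k} => a i.1)
      (x' := fun p : Σₗ j : {j // g j = k}, {i // f i = j.1} => a (ofLex p).2.1)
      (fibEquiv f g k) (fun _ => rfl) (c k)) e (e - 1) _).symm.trans ?_
    refine (congrArg (app (M.perm (fibEquiv f g k) (fun _ => rfl) (c k)) (e - 1))
      (M.del_comp (x := fun (j : {j // g j = k}) (i : {i // f i = j.1}) => a i.1)
        (y := fun j : {j // g j = k} => b j.1) (z := c k) u h e he m l)).trans ?_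
    exact map_sum_aux _ _ _ _ _

theorem compOps_op (f : A → B) (g : B → C) (a : A → M.Ob) (b : B → M.Ob) (c : C → M.Ob) (k : C)
    (u : {j // g j = k} → Deg N) (h e : Deg N) (he : ∑ j, u j + h = e)
    (m : ∀ j : {j // g j = k}, (fibHom M f a b j.1).X (u j)) (l : (fibHom M g b c k).X h) :
    (compOps f g a b c).op k u h e he m l = app (M.perm (fibEquiv f g k) (fun _ => rfl) (c k)) e
      (M.comp (x := fun (j : {j // g j = k}) (i : {i // f i = j.1}) => a i.1)
      (y := fun j : {j // g j = k} => b j.1) (z := c k) u h e he m l) := rfl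

theorem fibEquiv_eq (g : B → C) (h : C → D) (d : D) (j : {j // h (g j) = d}) (k : C)
    (hk : g j.1 = k) : fibEquiv g h d j = toLex ⟨⟨k, by rw [← hk, j.2]⟩, ⟨j.1, hk⟩⟩ := by
  subst hk; rfl

theorem smul_aux {V₁ V₂ V₃ W₁ : Type u} [AddCommGroup V₁] [AddCommGroup V₂] [AddCommGroup V₃]
    [AddCommGroup W₁] [Module R V₁] [Module R V₂] [Module R V₃] [Module R W₁]
    (P : V₁ →ₗ[R] V₂) (Q : V₂ →ₗ[R] V₃) (P' : W₁ →ₗ[R] V₃) (s t : ZMod 2) (v : V₁) (w : W₁)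
    (h : Q (P v) = P' w) : Q (P (sg R s • v)) = sg R (s + t) • P' (sg R t • w) := by
  rw [map_smul, map_smul, map_smul, smul_smul, sg_add, mul_assoc, sg_mul_self, mul_one, h]

theorem kz_fibEquiv (g : B → C) (h : C → D) (d : D) (m : B → Deg N) :
    kz (fibEquiv g h d) (fun q => m (ofLex q).2.1) =
      ∑ j : {j // h (g j) = d}, ∑ j' : {j // h (g j) = d},
        if j < j' ∧ g j'.1 < g j.1 then par (m j.1) * par (m j'.1) else 0 := by
  unfold kz
  refine Finset.sum_congr rfl fun i _ => Finset.sum_congr rfl fun j _ => ?_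
  refine if_congr (and_congr_right fun hij => ?_) rfl rfl
  constructor
  · intro h'
    rcases Sigma.Lex.lt_def.1 h' with h1 | ⟨h1, h2⟩
    · exact h1
    · exfalso
      have h3 : g j.1 = g i.1 := congrArg Subtype.val h1
      refine lt_asymm h' ?_
      rw [fibEquiv_eq g h d i _ rfl, fibEquiv_eq g h d j _ h3]
      exact Sigma.Lex.right _ _ hij
  · intro h'
    exact Sigma.Lex.lt_def.2 (Or.inl h')

theorem compOps_assoc (f : A → B) (g : B → C) (h : C → D) (x : A → M.Ob) (y : B → M.Ob)
    (z : C → M.Ob) (w : D → M.Ob) (p q r pq qr c : Deg N) (h₁ : p + q = pq) (h₂ : pq + r = c)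
    (h₃ : q + r = qr) (h₄ : p + qr = c) (a : (tens (fibHom M f x y)).X p)
    (b : (tens (fibHom M g y z)).X q) (s : (tens (fibHom M h z w)).X r) :
    grp (compOps (fun i => g (f i)) h x z w) pq r c h₂ (grp (compOps f g x y z) p q pq h₁ a b) s =
      grp (compOps f (fun i => h (g i)) x y w) p qr c h₄ a
        (grp (compOps g h y z w) q r qr h₃ b s) := by
  refine grp_assoc _ _ _ _ (fun d m a l b t s e he c v hc hv hc' => ?_) p q r pq qr c h₁ h₂ h₃ h₄ a b s
  simp only [compOps_op]
  have s₁ := M.comp_perm_inner (x := fun (k : {k // h k = d}) (i : Σₗ j : {j // g j = k.1}, {i // f i = j.1}) =>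
    x (ofLex i).2.1) (y := fun k : {k // h k = d} => z k.1) (z := w d)
    (fun k => fibEquiv f g k.1) (fun k => e k.1) t c hc
    (fun k => M.comp (x := fun (j : {j // g j = k.1}) (i : {i // f i = j.1}) => x i.1)
      (y := fun j : {j // g j = k.1} => y j.1) (z := z k.1) (fun j => m j.1) (l k.1) (e k.1) (he k.1)
      (fun j => a j.1) (b k.1)) s
  have h₅ : ∑ q : Σₗ k : {k // h k = d}, {j // g j = k.1}, m (ofLex q).2.1 + v = c := by
    rw [← hc', sum_fibEquiv]
    congr 1
    exact Fintype.sum_sigma (fun q : Σ k : {k // h k = d}, {j // g j = k.1} => m q.2.1)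
  have s₂ := M.comp_comp (x := fun (k : {k // h k = d}) (j : {j // g j = k.1})
      (i : {i // f i = j.1}) => x i.1) (y := fun (k : {k // h k = d}) (j : {j // g j = k.1}) => y j.1)
    (z := fun k : {k // h k = d} => z k.1) (w := w d) (fun k j => m j.1) (fun k => l k.1) t
    (fun k => e k.1) v c (fun k => he k.1) hc hv h₅ (fun k j => a j.1) (fun k => b k.1) s
  have s₃ := M.comp_perm_outer (I := fun q : Σₗ k : {k // h k = d}, {j // g j = k.1} => {i // f i = (ofLex q).2.1})
    (x := fun q i => x i.1) (y := fun q => y (ofLex q).2.1) (z := w d)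
    (fibEquiv g h d) (fun q => m (ofLex q).2.1) v c h₅ hc' (fun q => a (ofLex q).2.1)
    (M.comp (x := fun (k : {k // h k = d}) (j : {j // g j = k.1}) => y j.1)
      (y := fun k : {k // h k = d} => z k.1) (z := w d) (fun k => l k.1) t v hv (fun k => b k.1) s)
  rw [kz_fibEquiv] at s₃
  refine (congrArg (app (M.perm (fibEquiv (fun i => g (f i)) h d) (fun _ => rfl) (w d)) c)
    (s₁.trans (congrArg _ s₂))).trans ?_
  refine Eq.trans ?_ (congrArg (fun v => sg R (asg g h m l d) •
    app (M.perm (fibEquiv f (fun i => h (g i)) d) (fun _ => rfl) (w d)) c v) s₃.symm)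
  refine smul_aux _ _ _ _ _ _ _ ?_
  exact perm_penta M _ _ _ _ _ _ _ _ _ _ (fun _ => rfl) (w d) c _

end FibreComplexes

section UnitLaws

variable {R : Type u} [CommRing R] {N : ℕ} {M : DGMulticat R N}
  {A B C : Type} [Fintype A] [LinearOrder A] [Fintype B] [LinearOrder B]
  [Fintype C] [LinearOrder C]

/-- The action of multimorphisms on an algebra, over a point. -/
def actOps (X : DGAlg M) (f : A → B) (a : A → M.Ob) (b : B → M.Ob) :
    Ops f (fun i => X.obj (a i)) (fibHom M f a b) (fun j => X.obj (b j)) where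
  op k u h e he := X.act (x := fun i : {i // f i = k} => a i.1) (y := b k) u h e he
  del_op k u h e he m l := X.del_act u h e he m l

theorem actOps_op (X : DGAlg M) (f : A → B) (a : A → M.Ob) (b : B → M.Ob) (k : B)
    (u : {j // f j = k} → Deg N) (h e : Deg N) (he : ∑ j, u j + h = e)
    (m : ∀ j : {j // f j = k}, (X.obj (a j.1)).X (u j)) (l : (fibHom M f a b k).X h) :
    (actOps X f a b).op k u h e he m l =
      X.act (x := fun i : {i // f i = k} => a i.1) (y := b k) u h e he m l := rfl

theorem smul_aux₂ {V W : Type u} [AddCommGroup V] [AddCommGroup W] [Module R V] [Module R W]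
    (s t : ZMod 2) (v w : V) (h : w = sg R t • v) : sg R s • v = sg R (s + t) • w := by
  rw [h, smul_smul, sg_add, mul_assoc, sg_mul_self, mul_one]

theorem actOps_assoc (X : DGAlg M) (f : A → B) (g : B → C) (x : A → M.Ob) (y : B → M.Ob)
    (z : C → M.Ob) (p q r pq qr c : Deg N) (h₁ : p + q = pq) (h₂ : pq + r = c)
    (h₃ : q + r = qr) (h₄ : p + qr = c) (a : (tens fun i => X.obj (x i)).X p)
    (b : (tens (fibHom M f x y)).X q) (s : (tens (fibHom M g y z)).X r) :
    grp (actOps X g y z) pq r c h₂ (grp (actOps X f x y) p q pq h₁ a b) s =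
      grp (actOps X (fun i => g (f i)) x z) p qr c h₄ a (grp (compOps f g x y z) q r qr h₃ b s) := by
  refine grp_assoc _ _ _ _ (fun d m a l b t s e he c v hc hv hc' => ?_) p q r pq qr c h₁ h₂ h₃ h₄ a b s
  simp only [compOps_op, actOps_op]
  have h₅ : ∑ q : Σₗ k : {k // g k = d}, {j // f j = k.1}, m (ofLex q).2.1 + v = c := by
    rw [← hc', sum_fibEquiv]
    congr 1
    exact Fintype.sum_sigma (fun q : Σ k : {k // g k = d}, {j // f j = k.1} => m q.2.1)
  have s₂ := X.act_act (x := fun (k : {k // g k = d}) (j : {j // f j = k.1}) => x j.1)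
    (y := fun k : {k // g k = d} => y k.1) (z := z d) (fun k j => m j.1) (fun k => l k.1) t
    (fun k => e k.1) v c (fun k => he k.1) hc hv h₅ (fun k j => a j.1) (fun k => b k.1) s
  have s₃ := X.act_perm (x := fun q : Σₗ k : {k // g k = d}, {j // f j = k.1} => x (ofLex q).2.1)
    (y := z d) (fibEquiv f g d) (fun q => m (ofLex q).2.1) v c h₅ hc' (fun q => a (ofLex q).2.1)
    (M.comp (x := fun (k : {k // g k = d}) (j : {j // f j = k.1}) => x j.1)
      (y := fun k : {k // g k = d} => y k.1) (z := z d) (fun k => l k.1) t v hv (fun k => b k.1) s)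
  rw [kz_fibEquiv] at s₃
  exact s₂.trans (smul_aux₂ (W := (X.obj (z d)).X c) _ _ _ _ s₃)

/-- The bijection of a fibre of the identity with a point. -/
def fibPoint (j : B) : {i : B // id i = j} ≃ Unit where
  toFun _ := ()
  invFun _ := ⟨j, rfl⟩
  left_inv i := Subtype.ext i.2.symm
  right_inv _ := rfl

/-- The identity multimorphism, with inputs indexed by a fibre of the identity. -/
def fibOne (a : B → M.Ob) (j : B) : (fibHom M id a a j).X 0 :=
  app (M.perm (x' := fun _ : Unit => a j) (fibPoint j) (fun i => congrArg a i.2) (a j)) 0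
    (M.one (a j))

theorem comp_perm_inner' {J : Type} {I I' : J → Type} [Fintype J] [LinearOrder J]
    [∀ j, Fintype (I j)] [∀ j, LinearOrder (I j)] [∀ j, Fintype (I' j)] [∀ j, LinearOrder (I' j)]
    {x₁ : ∀ j, I j → M.Ob} {x : ∀ j, I' j → M.Ob} {y : J → M.Ob} {z : M.Ob} (e : ∀ j, I j ≃ I' j)
    (hx : ∀ j i, x₁ j i = x j (e j i))
    (g : J → Deg N) (h c : Deg N) (hc : ∑ j, g j + h = c)
    (f : ∀ j, (M.Hom (x j) (y j)).X (g j)) (p : (M.Hom y z).X h) :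
    M.comp g h c hc (fun j => app (M.perm (e j) (hx j) (y j)) (g j) (f j)) p =
      app (M.perm (x := fun p : Σₗ j, I j => x₁ (ofLex p).1 (ofLex p).2) (lexInner e)
        (fun p => hx _ _) z) c (M.comp g h c hc f p) := by
  obtain rfl : x₁ = fun j i => x j (e j i) := by funext j i; exact hx j i
  exact M.comp_perm_inner e g h c hc f p

theorem comp_fibOne (g : B → C) (a : B → M.Ob) (c : C → M.Ob) (k : C) (h : Deg N)
    (hc : ∑ _ : {j // g j = k}, (0 : Deg N) + h = h) (p : (fibHom M g a c k).X h) :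
    (compOps id g a a c).op k (fun _ => 0) h h hc (fun j => fibOne a j.1) p = p := by
  rw [compOps_op]
  have s₁ := comp_perm_inner' (M := M) (x₁ := fun (j : {j // g j = k}) (i : {i : B // id i = j.1}) => a i.1)
    (x := fun (j : {j // g j = k}) (_ : Unit) => a j.1) (y := fun j : {j // g j = k} => a j.1)
    (z := c k) (fun j => fibPoint j.1) (fun j i => congrArg a i.2) (fun _ => 0) h h hc
    (fun j => M.one (a j.1)) p
  have s₂ := M.one_comp (fun j : {j // g j = k} => a j.1) (c k) h hc p
  refine (congrArg (app (M.perm (fibEquiv id g k) (fun _ => rfl) (c k)) h)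
    (s₁.trans (congrArg _ s₂))).trans ?_
  refine (perm_penta M _ _ _ (Equiv.refl _) (Equiv.refl _) _ _ _ (fun _ => rfl) (fun _ => rfl)
    (fun _ => rfl) _ _ _).trans ?_
  exact (perm_one M (x := fun i : {i // g i = k} => a i.1) _ (fun _ => rfl) (fun _ => rfl) (c k) h
    _).trans (perm_one M (x := fun i : {i // g i = k} => a i.1) _ (fun _ => rfl) (fun _ => rfl)
      (c k) h p)

theorem sum_fibId (m : B → Deg N) (k : B) : ∑ j : {j : B // id j = k}, m j.1 = m k := by
  rw [Fintype.sum_eq_single (⟨k, rfl⟩ : {j : B // id j = k})]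
  intro j hj
  exact absurd (Subtype.ext j.2) hj

theorem perm_fibOne (b : B → M.Ob) (k : B) :
    app (M.perm (x := fun _ : Unit => b k) (fibPoint k).symm (fun _ => rfl) (b k)) 0 (fibOne b k) =
      M.one (b k) :=
  (perm_perm M (fibPoint k).symm (fibPoint k) (Equiv.refl _) _ _ (fun _ => rfl) (fun _ => rfl)
    _ _ _).trans (perm_one M _ (fun _ => rfl) _ _ _ _)

theorem kz_unit {J : Type} [LinearOrder J] (e : Unit ≃ J) (m : J → Deg N) : kz e m = 0 := by
  simp [kz]

theorem comp_fibOne' (f : A → B) (a : A → M.Ob) (b : B → M.Ob) (k : B) (m : B → Deg N)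
    (hc : ∑ j : {j : B // id j = k}, m j.1 + 0 = m k)
    (x : ∀ j, (fibHom M f a b j).X (m j)) :
    (compOps f id a b b).op k (fun j => m j.1) 0 (m k) hc (fun j => x j.1) (fibOne b k) = x k := by
  rw [compOps_op]
  have hu : ∑ _ : Unit, m k + 0 = m k := by simp
  have s₁ := M.comp_perm_outer (I := fun j : {j : B // id j = k} => {i // f i = j.1})
    (x := fun j i => a i.1) (y := fun j => b j.1) (z := b k) (fibPoint k).symm (fun j => m j.1) 0
    (m k) hc hu (fun j => x j.1) (fibOne b k)
  rw [kz_unit, sg_zero, one_smul] at s₁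
  have s₂ := M.comp_one (fun i : {i // f i = k} => a i.1) (b k) (m k) hu (x k)
  have s₃ := s₂.symm.trans ((congrArg (M.comp (I := fun _ : Unit => {i // f i = k})
    (x := fun _ i => a i.1) (fun _ => m k) 0 (m k) hu
    (fun _ => x k)) (perm_fibOne b k)).symm.trans s₁)
  have s₄ := congrArg (app (M.perm (x := fun i : {i // f i = k} => a i.1)
    (x' := fun p : Σₗ _ : Unit, {i // f i = k} => a (ofLex p).2.1) (lexUnitLeft _).symm
    (fun _ => rfl) (b k)) (m k)) s₃
  have s₅ := (perm_perm M (lexUnitLeft {i // f i = k}).symm (lexUnitLeft {i // f i = k})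
    (Equiv.refl _) (fun _ => rfl) (fun _ => rfl) (fun _ => rfl) (fun _ => rfl) (b k) (m k) (x k)).trans
      (perm_one M _ (fun _ => rfl) _ _ _ _)
  refine Eq.trans ?_ (s₄.symm.trans s₅)
  refine (perm_perm M _ _ (fibEquiv f id k) _ _ (fun _ => rfl) (fun i => ?_) _ _ _).symm
  exact (fibEquiv_eq f id k i k i.2).symm

theorem act_fibOne (X : DGAlg M) (b : B → M.Ob) (k : B) (m : B → Deg N)
    (hc : ∑ j : {j : B // id j = k}, m j.1 + 0 = m k)
    (x : ∀ j, (X.obj (b j)).X (m j)) :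
    (actOps X id b b).op k (fun j => m j.1) 0 (m k) hc (fun j => x j.1) (fibOne b k) = x k := by
  rw [actOps_op]
  have hu : ∑ _ : Unit, m k + 0 = m k := by simp
  have s₁ := X.act_perm (x := fun j : {j : B // id j = k} => b j.1) (y := b k) (fibPoint k).symm
    (fun j => m j.1) 0 (m k) hc hu (fun j => x j.1) (fibOne b k)
  rw [kz_unit, sg_zero, one_smul] at s₁
  have s₂ := X.act_one (b k) (m k) hu (x k)
  exact s₁.symm.trans ((congrArg (X.act (x := fun _ : Unit => b k) (fun _ => m k) 0 (m k) hu
    (fun _ => x k)) (perm_fibOne b k)).trans s₂)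

theorem gsg_zero_left (g : B → C) (l : C → Deg N) : gsg g (fun _ => 0) l = 0 := by
  simp [gsg]

theorem gsg_zero_right (m : B → Deg N) : gsg id m (fun _ => 0) = 0 := by
  simp only [gsg, id_eq, map_zero, zero_mul, ite_self, Finset.sum_const_zero, add_zero]
  refine Finset.sum_eq_zero fun i _ => Finset.sum_eq_zero fun j _ => if_neg ?_
  exact fun h => lt_asymm h.1 h.2

/-- The tensor product of identities. -/
def tensOne (a : B → M.Ob) : (tens (fibHom M id a a)).X 0 :=
  tp _ (fun _ => 0) 0 (by simp) (fibOne a)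

theorem del_tensOne (a : B → M.Ob) (c : Deg N) : del _ 0 c (tensOne a) = 0 := by
  by_cases hc : c + 1 = 0
  · unfold tensOne
    rw [del_tp _ hc]
    refine Finset.sum_eq_zero fun j _ => ?_
    rw [tp_zero _ j, smul_zero]
    rw [dmap_self]
    refine (app_del _ _ _ _).symm.trans ?_
    rw [M.del_one, map_zero]
  · rw [del_shape _ _ _ hc]
    rfl

theorem tens_one_comp (g : B → C) (a : B → M.Ob) (c : C → M.Ob) (h : Deg N) (hc : 0 + h = h)
    (p : (tens (fibHom M g a c)).X h) :
    grp (compOps id g a a c) 0 h h hc (tensOne a) p = p := by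
  suffices H : grp (compOps id g a a c) 0 h h hc (tensOne a) = LinearMap.id from
    LinearMap.congr_fun H p
  refine tp_ext fun l hl y => ?_
  refine (grp_tp (compOps id g a a c) 0 h h hc (fun _ => 0) (by simp) (fibOne a) l hl y l
    (by simp) hl).trans ?_
  rw [gsg_zero_left, sg_zero, one_smul]
  exact congrArg (tp (fibHom M g a c) l h hl)
    (funext fun k => comp_fibOne g a c k (l k) (by simp) (y k))

theorem tens_comp_one (f : A → B) (a : A → M.Ob) (b : B → M.Ob) (h : Deg N) (hc : h + 0 = h)
    (p : (tens (fibHom M f a b)).X h) :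
    grp (compOps f id a b b) h 0 h hc p (tensOne b) = p := by
  suffices H : (grp (compOps f id a b b) h 0 h hc).flip (tensOne b) = LinearMap.id from
    LinearMap.congr_fun H p
  refine tp_ext fun m hm x => ?_
  refine (grp_tp (compOps f id a b b) h 0 h hc m hm x (fun _ => 0) (by simp) (fibOne b) m
    (fun k => by rw [sum_fibId, add_zero]) hm).trans ?_
  rw [gsg_zero_right, sg_zero, one_smul]
  exact congrArg (tp (fibHom M f a b) m h hm) (funext fun k => comp_fibOne' f a b k m _ x)

theorem tens_act_one (X : DGAlg M) (b : B → M.Ob) (h : Deg N) (hc : h + 0 = h)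
    (p : (tens fun j => X.obj (b j)).X h) :
    grp (actOps X id b b) h 0 h hc p (tensOne b) = p := by
  suffices H : (grp (actOps X id b b) h 0 h hc).flip (tensOne b) = LinearMap.id from
    LinearMap.congr_fun H p
  refine tp_ext fun m hm x => ?_
  refine (grp_tp (actOps X id b b) h 0 h hc m hm x (fun _ => 0) (by simp) (fibOne b) m
    (fun k => by rw [sum_fibId, add_zero]) hm).trans ?_
  rw [gsg_zero_right, sg_zero, one_smul]
  exact congrArg (tp (fun j => X.obj (b j)) m h hm) (funext fun k => act_fibOne X b k m _ x)

end UnitLaws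

section PropHom

variable {R : Type u} [CommRing R] {N : ℕ} (M : DGMulticat R N)
  {A B C D : Type} [Fintype A] [LinearOrder A] [Fintype B] [LinearOrder B]
  [Fintype C] [LinearOrder C] [Fintype D] [LinearOrder D]

/-- The morphism complexes of the PROP of a multicategory: the (finite) direct sum over all
maps `f` of `⨂ j, M (a|_{f ⁻¹ j}; b j)`. -/
def propHom (a : A → M.Ob) (b : B → M.Ob) : Ch R N :=
  mkCh (fun γ => ∀ f : A → B, (tens (fibHom M f a b)).X γ)
    (fun γ γ' => LinearMap.pi fun f => del (tens (fibHom M f a b)) γ γ' ∘ₗ LinearMap.proj f)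
    (fun γ γ' h => by
      refine LinearMap.ext fun φ => funext fun f => ?_
      simp [del_shape _ _ _ h])
    (fun γ γ' γ'' φ => by
      funext f
      simp [del_del])

variable {M}

/-- The component at `f` of a morphism. -/
def propCo {a : A → M.Ob} {b : B → M.Ob} (f : A → B) (γ : Deg N) :
    (propHom M a b).X γ →ₗ[R] (tens (fibHom M f a b)).X γ :=
  LinearMap.proj (R := R) (φ := fun f : A → B => (tens (fibHom M f a b)).X γ) f

/-- The morphism with one nonzero component, at `f`. -/
def propIn {a : A → M.Ob} {b : B → M.Ob} (f : A → B) (γ : Deg N) :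
    (tens (fibHom M f a b)).X γ →ₗ[R] (propHom M a b).X γ :=
  LinearMap.single R (fun f : A → B => (tens (fibHom M f a b)).X γ) f

theorem propIn_ext {a : A → M.Ob} {b : B → M.Ob} {γ : Deg N} {W : Type u} [AddCommGroup W]
    [Module R W] {φ ψ : (propHom M a b).X γ →ₗ[R] W}
    (h : ∀ f x, φ (propIn f γ x) = ψ (propIn f γ x)) : φ = ψ :=
  LinearMap.pi_ext (φ := fun f : A → B => (tens (fibHom M f a b)).X γ) h

theorem propCo_self {a : A → M.Ob} {b : B → M.Ob} (f : A → B) (γ : Deg N)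
    (x : (tens (fibHom M f a b)).X γ) : propCo f γ (propIn f γ x) = x :=
  Pi.single_eq_same (M := fun f : A → B => (tens (fibHom M f a b)).X γ) f x

theorem propCo_ne {a : A → M.Ob} {b : B → M.Ob} {f f' : A → B} (h : f' ≠ f) (γ : Deg N)
    (x : (tens (fibHom M f a b)).X γ) : propCo f' γ (propIn f γ x) = 0 :=
  Pi.single_eq_of_ne (M := fun f : A → B => (tens (fibHom M f a b)).X γ) h x

theorem del_propIn {a : A → M.Ob} {b : B → M.Ob} (f : A → B) (γ γ' : Deg N)
    (x : (tens (fibHom M f a b)).X γ) :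
    del _ γ γ' (propIn f γ x) = propIn f γ' (del _ γ γ' x) := by
  funext f'
  change del _ γ γ' (propCo f' γ (propIn f γ x)) = propCo f' γ' (propIn f γ' (del _ γ γ' x))
  by_cases h : f' = f
  · subst h
    rw [propCo_self, propCo_self]
  · rw [propCo_ne h, propCo_ne h, map_zero]

/-- The composition in the PROP of a multicategory. -/
def propComp (a : A → M.Ob) (b : B → M.Ob) (c : C → M.Ob) (g h e : Deg N) (he : g + h = e) :
    (propHom M a b).X g →ₗ[R] (propHom M b c).X h →ₗ[R] (propHom M a c).X e :=
  ∑ f : A → B, ∑ f' : B → C,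
    ((grp (compOps f f' a b c) g h e he).compl₁₂ (propCo f g) (propCo f' h)).compr₂
      (propIn (fun i => f' (f i)) e)

theorem propComp_in (a : A → M.Ob) (b : B → M.Ob) (c : C → M.Ob) (g h e : Deg N) (he : g + h = e)
    (f : A → B) (f' : B → C) (x : (tens (fibHom M f a b)).X g) (y : (tens (fibHom M f' b c)).X h) :
    propComp a b c g h e he (propIn f g x) (propIn f' h y) =
      propIn (fun i => f' (f i)) e (grp (compOps f f' a b c) g h e he x y) := by
  unfold propComp
  simp only [LinearMap.sum_apply, LinearMap.compr₂_apply, LinearMap.compl₁₂_apply]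
  rw [Finset.sum_eq_single f, Finset.sum_eq_single f', propCo_self, propCo_self]
  · intro f'' _ h
    rw [propCo_ne h]
    simp
  · simp
  · intro f'' _ h
    refine Finset.sum_eq_zero fun _ _ => ?_
    rw [propCo_ne h]
    simp
  · simp

theorem prop_ext₂ {a : A → M.Ob} {b : B → M.Ob} {c : C → M.Ob} {g h : Deg N}
    {W : Type u} [AddCommGroup W] [Module R W]
    {φ ψ : (propHom M a b).X g →ₗ[R] (propHom M b c).X h →ₗ[R] W}
    (H : ∀ f x f' y, φ (propIn f g x) (propIn f' h y) = ψ (propIn f g x) (propIn f' h y)) : φ = ψ :=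
  propIn_ext fun f x => propIn_ext fun f' y => H f x f' y

theorem del_propComp (a : A → M.Ob) (b : B → M.Ob) (c : C → M.Ob) (g h e : Deg N) (he : g + h = e)
    (x : (propHom M a b).X g) (y : (propHom M b c).X h) :
    del _ e (e - 1) (propComp a b c g h e he x y) =
      propComp a b c (g - 1) h (e - 1) (by rw [← he]; ring) (del _ g (g - 1) x) y +
      sg R (par g) • propComp a b c g (h - 1) (e - 1) (by rw [← he]; ring) x
        (del _ h (h - 1) y) := by
  suffices H : (propComp a b c g h e he).compr₂ (del _ e (e - 1)) =
      (propComp a b c (g - 1) h (e - 1) (by rw [← he]; ring)).comp (del _ g (g - 1)) +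
      sg R (par g) • (propComp a b c g (h - 1) (e - 1) (by rw [← he]; ring)).compl₂
        (del _ h (h - 1)) from
    LinearMap.congr_fun (LinearMap.congr_fun H x) y
  refine prop_ext₂ fun f x f' y => ?_
  simp only [LinearMap.compr₂_apply, LinearMap.comp_apply, LinearMap.add_apply,
    LinearMap.smul_apply, LinearMap.compl₂_apply]
  simp only [propComp_in, del_propIn, del_grp, map_add, map_smul]

theorem propComp_assoc (x : A → M.Ob) (y : B → M.Ob) (z : C → M.Ob) (w : D → M.Ob)
    (f g h fg gh c : Deg N) (h₁ : f + g = fg) (h₂ : fg + h = c) (h₃ : g + h = gh) (h₄ : f + gh = c)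
    (a : (propHom M x y).X f) (b : (propHom M y z).X g) (p : (propHom M z w).X h) :
    propComp x z w fg h c h₂ (propComp x y z f g fg h₁ a b) p =
      propComp x y w f gh c h₄ a (propComp y z w g h gh h₃ b p) := by
  suffices H : (propComp x y z f g fg h₁).compr₂ ((propComp x z w fg h c h₂).flip p) =
      (propComp x y w f gh c h₄).compl₂ ((propComp y z w g h gh h₃).flip p) from
    LinearMap.congr_fun (LinearMap.congr_fun H a) b
  refine prop_ext₂ fun s a t b => ?_
  simp only [LinearMap.compr₂_apply, LinearMap.compl₂_apply, LinearMap.flip_apply]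
  suffices H : propComp x z w fg h c h₂ (propComp x y z f g fg h₁ (propIn s f a) (propIn t g b)) =
      propComp x y w f gh c h₄ (propIn s f a) ∘ₗ (propComp y z w g h gh h₃ (propIn t g b)) from
    LinearMap.congr_fun H p
  refine propIn_ext fun r p => ?_
  simp only [LinearMap.comp_apply, propComp_in]
  exact congrArg (propIn _ c) (compOps_assoc s t r x y z w f g h fg gh c h₁ h₂ h₃ h₄ a b p)

/-- The identities of the PROP of a multicategory. -/
def propOne (a : A → M.Ob) : (propHom M a a).X 0 := propIn id 0 (tensOne a)

theorem propOne_comp (a : A → M.Ob) (b : B → M.Ob) (h : Deg N) (hc : 0 + h = h)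
    (p : (propHom M a b).X h) : propComp a a b 0 h h hc (propOne a) p = p := by
  suffices H : propComp a a b 0 h h hc (propOne a) = LinearMap.id from LinearMap.congr_fun H p
  refine propIn_ext fun f x => ?_
  unfold propOne
  rw [propComp_in]
  exact congrArg (propIn f h) (tens_one_comp f a b h hc x)

theorem propComp_one (a : A → M.Ob) (b : B → M.Ob) (h : Deg N) (hc : h + 0 = h)
    (p : (propHom M a b).X h) : propComp a b b h 0 h hc p (propOne b) = p := by
  suffices H : (propComp a b b h 0 h hc).flip (propOne b) = LinearMap.id from
    LinearMap.congr_fun H p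
  refine propIn_ext fun f x => ?_
  unfold propOne
  rw [LinearMap.flip_apply, propComp_in]
  exact congrArg (propIn f h) (tens_comp_one f a b h hc x)

/-- The action of the PROP of a multicategory on the tensor products of the values of
an algebra. -/
def propAct (X : DGAlg M) (a : A → M.Ob) (b : B → M.Ob) (g h e : Deg N) (he : g + h = e) :
    (tens fun i => X.obj (a i)).X g →ₗ[R] (propHom M a b).X h →ₗ[R]
      (tens fun j => X.obj (b j)).X e :=
  ∑ f : A → B, (grp (actOps X f a b) g h e he).compl₂ (propCo f h)

theorem propAct_in (X : DGAlg M) (a : A → M.Ob) (b : B → M.Ob) (g h e : Deg N) (he : g + h = e)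
    (x : (tens fun i => X.obj (a i)).X g) (f : A → B) (y : (tens (fibHom M f a b)).X h) :
    propAct X a b g h e he x (propIn f h y) = grp (actOps X f a b) g h e he x y := by
  unfold propAct
  simp only [LinearMap.sum_apply, LinearMap.compl₂_apply]
  rw [Finset.sum_eq_single f, propCo_self]
  · intro f'' _ h
    rw [propCo_ne h]
    simp
  · simp

theorem del_propAct (X : DGAlg M) (a : A → M.Ob) (b : B → M.Ob) (g h e : Deg N) (he : g + h = e)
    (x : (tens fun i => X.obj (a i)).X g) (y : (propHom M a b).X h) :
    del _ e (e - 1) (propAct X a b g h e he x y) =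
      propAct X a b (g - 1) h (e - 1) (by rw [← he]; ring) (del _ g (g - 1) x) y +
      sg R (par g) • propAct X a b g (h - 1) (e - 1) (by rw [← he]; ring) x
        (del _ h (h - 1) y) := by
  suffices H : del _ e (e - 1) ∘ₗ propAct X a b g h e he x =
      propAct X a b (g - 1) h (e - 1) (by rw [← he]; ring) (del _ g (g - 1) x) +
      sg R (par g) • propAct X a b g (h - 1) (e - 1) (by rw [← he]; ring) x ∘ₗ del _ h (h - 1) from
    LinearMap.congr_fun H y
  refine propIn_ext fun f y => ?_
  simp only [LinearMap.comp_apply, LinearMap.add_apply, LinearMap.smul_apply, propAct_in,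
    del_propIn, del_grp]

theorem propAct_assoc (X : DGAlg M) (x : A → M.Ob) (y : B → M.Ob) (z : C → M.Ob)
    (f g h fg gh c : Deg N) (h₁ : f + g = fg) (h₂ : fg + h = c) (h₃ : g + h = gh) (h₄ : f + gh = c)
    (a : (tens fun i => X.obj (x i)).X f) (b : (propHom M x y).X g) (p : (propHom M y z).X h) :
    propAct X y z fg h c h₂ (propAct X x y f g fg h₁ a b) p =
      propAct X x z f gh c h₄ a (propComp x y z g h gh h₃ b p) := by
  suffices H : (propAct X y z fg h c h₂).comp (propAct X x y f g fg h₁ a) =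
      (propComp x y z g h gh h₃).compr₂ (propAct X x z f gh c h₄ a) from
    LinearMap.congr_fun (LinearMap.congr_fun H b) p
  refine prop_ext₂ fun s b t p => ?_
  simp only [LinearMap.compr₂_apply, LinearMap.comp_apply]
  simp only [propComp_in, propAct_in]
  exact actOps_assoc X s t x y z f g h fg gh c h₁ h₂ h₃ h₄ a b p

theorem propAct_one (X : DGAlg M) (b : B → M.Ob) (h : Deg N) (hc : h + 0 = h)
    (p : (tens fun i => X.obj (b i)).X h) : propAct X b b h 0 h hc p (propOne b) = p := by
  unfold propOne
  rw [propAct_in]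
  exact tens_act_one X b h hc p

variable {O : DGMulticat R N} (π : DGMultifunctor M O)

/-- The maps on tensor products induced by a multifunctor. -/
def fibMap (f : A → B) (a : A → M.Ob) (b : B → M.Ob) :
    tens (fibHom M f a b) ⟶ tens (fibHom O f (fun i => π.obj (a i)) (fun j => π.obj (b j))) :=
  tMap fun j => π.map (fun i : {i // f i = j} => a i.1) (b j)

theorem fibMap_grp (f : A → B) (f' : B → C) (a : A → M.Ob) (b : B → M.Ob) (c : C → M.Ob)
    (g h e : Deg N) (he : g + h = e) (x : (tens (fibHom M f a b)).X g)
    (y : (tens (fibHom M f' b c)).X h) :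
    app (fibMap π (fun i => f' (f i)) a c) e (grp (compOps f f' a b c) g h e he x y) =
      grp (compOps f f' (fun i => π.obj (a i)) (fun i => π.obj (b i)) (fun i => π.obj (c i))) g h e he
        (app (fibMap π f a b) g x) (app (fibMap π f' b c) h y) := by
  suffices H : app (fibMap π (fun i => f' (f i)) a c) e ∘ₗ (grp (compOps f f' a b c) g h e he).flip y =
      (grp (compOps f f' (fun i => π.obj (a i)) (fun i => π.obj (b i)) (fun i => π.obj (c i))) g h e he).flip
        (app (fibMap π f' b c) h y) ∘ₗ app (fibMap π f a b) g from LinearMap.congr_fun H x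
  refine tp_ext fun m hm x => ?_
  suffices H : app (fibMap π (fun i => f' (f i)) a c) e ∘ₗ
        grp (compOps f f' a b c) g h e he (tp _ m g hm x) =
      grp (compOps f f' (fun i => π.obj (a i)) (fun i => π.obj (b i)) (fun i => π.obj (c i))) g h e he
        (app (fibMap π f a b) g (tp _ m g hm x)) ∘ₗ (app (fibMap π f' b c) h) from
    LinearMap.congr_fun H y
  refine tp_ext fun l hl y => ?_
  simp only [LinearMap.comp_apply]
  have hd := fib_sum f' he hm hl (fibDeg_eq f' m l)
  unfold fibMap
  rw [grp_tp _ g h e he m hm x l hl y _ (fibDeg_eq f' m l) hd, map_smul, tMap_tp, tMap_tp, tMap_tp,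
    grp_tp _ g h e he m hm _ l hl _ _ (fibDeg_eq f' m l) hd]
  congr 2
  funext k
  rw [compOps_op, compOps_op]
  have s₁ := congrArg (fun F => app F (fibDeg f' m l k)
      (M.comp (x := fun (j : {j // f' j = k}) (i : {i // f i = j.1}) => a i.1)
      (y := fun j : {j // f' j = k} => b j.1) (z := c k) (fun j => m j.1) (l k) _
      (fibDeg_eq f' m l k) (fun j => x j.1) (y k)))
    (π.map_perm (fun p : Σₗ j : {j // f' j = k}, {i // f i = j.1} => a (ofLex p).2.1)
      (fibEquiv f f' k) (c k))
  have s₂ := π.map_comp (x := fun (j : {j // f' j = k}) (i : {i // f i = j.1}) => a i.1)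
      (y := fun j : {j // f' j = k} => b j.1) (z := c k) (fun j => m j.1) (l k) _
      (fibDeg_eq f' m l k) (fun j => x j.1) (y k)
  exact s₁.trans (congrArg (app (O.perm (fibEquiv f f' k) (fun _ => rfl) (π.obj (c k)))
    (fibDeg f' m l k)) s₂)

/-- The map on morphism complexes of PROPs induced by a multifunctor. -/
def propMap (a : A → M.Ob) (b : B → M.Ob) :
    propHom M a b ⟶ propHom O (fun i => π.obj (a i)) (fun j => π.obj (b j)) :=
  mkHom (fun γ => LinearMap.pi fun f => app (fibMap π f a b) γ ∘ₗ propCo f γ) (fun γ γ' φ => by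
    funext f
    exact app_del (fibMap π f a b) γ γ' (propCo f γ φ))

theorem propMap_in (a : A → M.Ob) (b : B → M.Ob) (f : A → B) (γ : Deg N)
    (x : (tens (fibHom M f a b)).X γ) :
    app (propMap π a b) γ (propIn f γ x) = propIn f γ (app (fibMap π f a b) γ x) := by
  funext f'
  change app (fibMap π f' a b) γ (propCo f' γ (propIn f γ x)) = propCo f' γ (propIn f γ _)
  by_cases h : f' = f
  · subst h
    rw [propCo_self, propCo_self]
  · rw [propCo_ne h, propCo_ne h, map_zero]

theorem propMap_comp (a : A → M.Ob) (b : B → M.Ob) (c : C → M.Ob) (g h e : Deg N) (he : g + h = e)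
    (x : (propHom M a b).X g) (y : (propHom M b c).X h) :
    app (propMap π a c) e (propComp a b c g h e he x y) =
      propComp _ _ _ g h e he (app (propMap π a b) g x) (app (propMap π b c) h y) := by
  suffices H : (propComp a b c g h e he).compr₂ (app (propMap π a c) e) =
      (propComp _ _ _ g h e he).compl₁₂ (app (propMap π a b) g) (app (propMap π b c) h) from
    LinearMap.congr_fun (LinearMap.congr_fun H x) y
  refine prop_ext₂ fun f x f' y => ?_
  simp only [LinearMap.compr₂_apply, LinearMap.compl₁₂_apply]
  rw [propMap_in, propMap_in, propComp_in, propComp_in, propMap_in, fibMap_grp]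

theorem map_perm' {I I' : Type} [Fintype I] [LinearOrder I] [Fintype I'] [LinearOrder I']
    {x₁ : I → M.Ob} {x : I' → M.Ob} (e : I ≃ I') (hx : ∀ i, x₁ i = x (e i)) (y : M.Ob) (γ : Deg N)
    (m : (M.Hom x y).X γ) :
    app (π.map x₁ y) γ (app (M.perm e hx y) γ m) =
      app (O.perm e (fun i => congrArg π.obj (hx i)) (π.obj y)) γ (app (π.map x y) γ m) := by
  obtain rfl : x₁ = fun i => x (e i) := funext hx
  exact congrArg (fun F => app F γ m) (π.map_perm x e y)

theorem propMap_one (a : A → M.Ob) :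
    app (propMap π a a) 0 (propOne a) = propOne (fun i => π.obj (a i)) := by
  unfold propOne
  rw [propMap_in]
  refine congrArg (propIn id 0) ?_
  unfold tensOne fibMap
  rw [tMap_tp]
  congr 1
  funext j
  unfold fibOne
  refine (map_perm' π (x := fun _ : Unit => a j) (fibPoint j) (fun i => congrArg a i.2) (a j) 0
    (M.one (a j))).trans ?_
  rw [π.map_one]

end PropHom

section PropCategories

variable {R : Type u} [CommRing R] {N : ℕ}

/-- The PROP category of a multicategory with an ordering of its objects. The objects are the
finite non-decreasing sequences of objects. -/
def propCat (M : DGMulticat R N) [LinearOrder M.Ob] : DGCat R N where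
  Ob := Σ n : ℕ, {x : Fin n → M.Ob // Monotone x}
  Hom x y := propHom M x.2.1 y.2.1
  one x := propOne x.2.1
  comp g h c hc := propComp _ _ _ g h c hc
  del_one x c := by
    unfold propOne
    rw [del_propIn, del_tensOne, map_zero]
  del_comp g h c hc f p := del_propComp _ _ _ g h c hc f p
  one_comp h hc p := propOne_comp _ _ h hc p
  comp_one h hc p := propComp_one _ _ h hc p
  comp_comp f g h fg gh c h₁ h₂ h₃ h₄ a b p := propComp_assoc _ _ _ _ f g h fg gh c h₁ h₂ h₃ h₄ a b p

/-- The module over the PROP category that is associated to an algebra: its value at a sequence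
`x₁, …, xₙ` is `A x₁ ⊗ ⋯ ⊗ A xₙ`. -/
def propMod {M : DGMulticat R N} [LinearOrder M.Ob] (A : DGAlg M) : DGMod (propCat M) where
  obj x := tens fun i => A.obj (x.2.1 i)
  act g h c hc := propAct A _ _ g h c hc
  del_act g h c hc a m := del_propAct A _ _ g h c hc a m
  act_one h hc a := propAct_one A _ h hc a
  act_act f g h fg gh c h₁ h₂ h₃ h₄ a b p := propAct_assoc A _ _ _ f g h fg gh c h₁ h₂ h₃ h₄ a b p

/-- The functor on PROP categories induced by a multifunctor that preserves the orderings of the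
objects. -/
def propFunctor {M O : DGMulticat R N} [LinearOrder M.Ob] [LinearOrder O.Ob]
    (π : DGMultifunctor M O) (hπ : Monotone π.obj) : DGFunctor (propCat M) (propCat O) where
  obj x := ⟨x.1, fun i => π.obj (x.2.1 i), fun _ _ h => hπ (x.2.2 h)⟩
  map x y := propMap π x.2.1 y.2.1
  map_one x := propMap_one π x.2.1
  map_comp g h c hc f p := propMap_comp π _ _ _ g h c hc f p

end PropCategories

section Freeness

variable {R : Type u} [CommRing R] {N : ℕ}

/-- The bijection of a fibre of a permutation with a point. -/
def fibPerm {B : Type} (σ : Equiv.Perm B) (j : B) : {i // σ i = j} ≃ Unit where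
  toFun _ := ()
  invFun _ := ⟨σ.symm j, σ.apply_symm_apply j⟩
  left_inv i := Subtype.ext ((Equiv.symm_apply_eq σ).2 i.2.symm)
  right_inv _ := rfl

/-- The morphism from a sequence `a` to itself in the PROP that is associated to a permutation
which preserves `a`. -/
def permMor {M : DGMulticat R N} {B : Type} [Fintype B] [LinearOrder B] (a : B → M.Ob)
    (σ : Equiv.Perm B) (hσ : ∀ i, a (σ i) = a i) : (propHom M a a).X 0 :=
  propIn (σ : B → B) 0 (tp (fibHom M σ a a) (fun _ => 0) 0 (by simp) (fun j =>
    app (M.perm (x := fun i : {i // σ i = j} => a i.1) (x' := fun _ : Unit => a j) (fibPerm σ j)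
      (fun i => by rw [← hσ, i.2]) (a j)) 0 (M.one (a j))))

/-- The group `Aut x` of the permutations that preserve a sequence. -/
def autSeq {X B : Type*} (x : B → X) : Subgroup (Equiv.Perm B) where
  carrier := {σ | ∀ i, x (σ i) = x i}
  mul_mem' := fun {σ τ} hσ hτ i => by rw [Equiv.Perm.mul_apply, hσ, hτ]
  one_mem' _ := rfl
  inv_mem' := fun {σ} hσ i => by
    have := hσ (σ⁻¹ i)
    simpa using this.symm

/-- The action of `Aut x` on the morphisms from `x`, by precomposition with permutations. -/
def autAct {M : DGMulticat R N} [LinearOrder M.Ob] (x y : (propCat M).Ob) (σ : autSeq x.2.1)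
    (γ : Deg N) : ((propCat M).Hom x y).X γ →ₗ[R] ((propCat M).Hom x y).X γ :=
  (propCat M).comp (x := x) (y := x) (z := y) 0 γ γ (zero_add γ) (permMor x.2.1 σ.1 σ.2)

/-- A complex `K` with an action of a group `G` is bounded below and free over `R[G]` if it is
obtained, by collapsing the grading, from a `ℤ`-graded complex of free `R[G]`-modules that vanishes
in small degrees: there are `R[G]`-bases `e n`, for `n : ℤ`, of the graded pieces `W n` (which are
empty for small `n`), such that `K.X γ` is the direct sum of the `W n` for `n ≡ γ`, and such that
the differential sends `W n` to `W (n - 1)`. -/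
def BddBelowFree (K : Ch R N) {G : Type} (ρ : G → ∀ γ, K.X γ →ₗ[R] K.X γ) : Prop :=
  ∃ (ι : ℤ → Type u) (e : ∀ n : ℤ, ι n → K.X (n : Deg N)),
    (∃ b : ℤ, ∀ n < b, IsEmpty (ι n)) ∧
    (∀ n i, del K (n : Deg N) ((n - 1 : ℤ) : Deg N) (e n i) ∈
      Submodule.span R (Set.range fun p : ι (n - 1) × G => ρ p.2 _ (e (n - 1) p.1))) ∧
    ∀ γ : Deg N,
      LinearIndependent R (fun p : Σ n : {n : ℤ // (n : Deg N) = γ}, ι n.1 × G =>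
        tr K (p.1.1 : Deg N) γ (ρ p.2.2 _ (e p.1.1 p.2.1))) ∧
      Submodule.span R (Set.range fun p : Σ n : {n : ℤ // (n : Deg N) = γ}, ι n.1 × G =>
        tr K (p.1.1 : Deg N) γ (ρ p.2.2 _ (e p.1.1 p.2.1))) = ⊤

/-- The freeness hypothesis, for a multicategory `M` and an operad `O`. -/
structure FreenessHypothesis (M O : DGMulticat R N) [LinearOrder M.Ob] [Unique O.Ob] : Prop where
  /-- The endomorphism algebras in the PROP category of `M` are the group rings `R[Aut x]`. -/
  identity : ∀ x : (propCat M).Ob,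
    LinearIndependent R (fun σ : autSeq x.2.1 => permMor (M := M) x.2.1 σ.1 σ.2) ∧
    Submodule.span R (Set.range fun σ : autSeq x.2.1 => permMor (M := M) x.2.1 σ.1 σ.2) = ⊤ ∧
    ∀ γ : Deg N, γ ≠ 0 → ∀ m : ((propCat M).Hom x x).X γ, m = 0
  free₁ : ∀ x y : (propCat M).Ob, BddBelowFree ((propCat M).Hom x y) (autAct x y)
  free₂ : ∀ n : ℕ, 1 ≤ n → BddBelowFree (O.Hom (fun _ : Fin n => default) default)
    (fun (σ : Equiv.Perm (Fin n)) γ => app (O.perm σ (fun _ => rfl) default) γ)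

/-- The unit object of a PROP category of an operad: the sequence of length one. -/
def propUnit (O : DGMulticat R N) [LinearOrder O.Ob] [Unique O.Ob] : (propCat O).Ob :=
  ⟨1, fun _ => default, monotone_const⟩

end Freeness

section CompareBar

universe v₁ v₂ v₃ v₄ v₅ v₆ v₇ u₁ u₂ u₃ u₄ u₅ u₆ u₇

variable {𝒞₁ : Type u₁} [Category.{v₁} 𝒞₁] {𝒜₁ : Type u₂} [Category.{v₂} 𝒜₁]
  {ℬ₁ : Type u₃} [Category.{v₃} ℬ₁] {𝒞₂ : Type u₄} [Category.{v₄} 𝒞₂] {𝒜₂ : Type u₅}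
  [Category.{v₅} 𝒜₂] {ℬ₂ : Type u₆} [Category.{v₆} ℬ₂] {𝒱 : Type u₇} [Category.{v₇} 𝒱]
  [Preadditive 𝒱]
  {F₁ : 𝒞₁ ⥤ 𝒜₁} {U₁ : 𝒜₁ ⥤ 𝒞₁} {G₁ : 𝒞₁ ⥤ ℬ₁} {H₁ : ℬ₁ ⥤ 𝒜₁}
  {F₂ : 𝒞₂ ⥤ 𝒜₂} {U₂ : 𝒜₂ ⥤ 𝒞₂} {G₂ : 𝒞₂ ⥤ ℬ₂} {H₂ : ℬ₂ ⥤ 𝒜₂}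
  {T : 𝒞₁ ⥤ 𝒞₂} {P : 𝒜₁ ⥤ 𝒜₂} {P' : ℬ₁ ⥤ ℬ₂}

/-- The comparison `F₂ T ⟶ P F₁` of free objects. -/
def freeCmp (adj₁ : F₁ ⊣ U₁) (adj₂ : F₂ ⊣ U₂) (e : P ⋙ U₂ ≅ U₁ ⋙ T) (D : 𝒞₁) :
    F₂.obj (T.obj D) ⟶ P.obj (F₁.obj D) :=
  (adj₂.homEquiv _ _).symm (T.map (adj₁.unit.app D) ≫ e.inv.app (F₁.obj D))

theorem freeCmp_map (adj₁ : F₁ ⊣ U₁) (adj₂ : F₂ ⊣ U₂) (e : P ⋙ U₂ ≅ U₁ ⋙ T) {D : 𝒞₁} {A : 𝒜₁}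
    (g : F₁.obj D ⟶ A) : freeCmp adj₁ adj₂ e D ≫ P.map g =
      (adj₂.homEquiv _ _).symm (T.map (adj₁.homEquiv _ _ g) ≫ e.inv.app A) := by
  have h := e.inv.naturality g
  simp only [Functor.comp_map] at h
  unfold freeCmp
  rw [← Adjunction.homEquiv_naturality_right_symm, Category.assoc]
  congr 1
  rw [adj₁.homEquiv_unit, T.map_comp, Category.assoc]
  congr 1
  exact h.symm

theorem freeCmp_naturality (adj₁ : F₁ ⊣ U₁) (adj₂ : F₂ ⊣ U₂) (e : P ⋙ U₂ ≅ U₁ ⋙ T) {D D' : 𝒞₁}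
    (f : D ⟶ D') : F₂.map (T.map f) ≫ freeCmp adj₁ adj₂ e D' =
      freeCmp adj₁ adj₂ e D ≫ P.map (F₁.map f) := by
  rw [freeCmp_map]
  unfold freeCmp
  rw [← Adjunction.homEquiv_naturality_left_symm, ← Category.assoc, ← T.map_comp]
  congr 3
  rw [adj₁.homEquiv_unit]
  exact adj₁.unit.naturality f

/-- The comparison `G₂ T ⟶ P' G₁` of relatively free objects. -/
def relCmp (adjG₁ : G₁ ⊣ H₁ ⋙ U₁) (adjG₂ : G₂ ⊣ H₂ ⋙ U₂) (e : P ⋙ U₂ ≅ U₁ ⋙ T)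
    (r : H₁ ⋙ P ⟶ P' ⋙ H₂) (D : 𝒞₁) : G₂.obj (T.obj D) ⟶ P'.obj (G₁.obj D) :=
  (adjG₂.homEquiv _ _).symm (T.map (adjG₁.unit.app D) ≫ e.inv.app (H₁.obj (G₁.obj D)) ≫
    U₂.map (r.app (G₁.obj D)))

theorem relCmp_map (adjG₁ : G₁ ⊣ H₁ ⋙ U₁) (adjG₂ : G₂ ⊣ H₂ ⋙ U₂) (e : P ⋙ U₂ ≅ U₁ ⋙ T)
    (r : H₁ ⋙ P ⟶ P' ⋙ H₂) {D : 𝒞₁} {B : ℬ₁} (g : G₁.obj D ⟶ B) :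
    relCmp adjG₁ adjG₂ e r D ≫ P'.map g = (adjG₂.homEquiv _ _).symm
      (T.map (adjG₁.homEquiv _ _ g) ≫ e.inv.app (H₁.obj B) ≫ U₂.map (r.app B)) := by
  have h := e.inv.naturality (H₁.map g)
  have h' := r.naturality g
  simp only [Functor.comp_map] at h h'
  unfold relCmp
  rw [← Adjunction.homEquiv_naturality_right_symm, Category.assoc, Category.assoc]
  congr 1
  rw [adjG₁.homEquiv_unit, T.map_comp, Category.assoc]
  congr 1
  have h'' := congrArg U₂.map h'
  rw [U₂.map_comp, U₂.map_comp] at h''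
  refine Eq.trans ?_ ((congrArg (· ≫ U₂.map (r.app B)) h.symm).trans (Category.assoc _ _ _))
  rw [Category.assoc]
  congr 1
  exact h''.symm

theorem relCmp_naturality (adjG₁ : G₁ ⊣ H₁ ⋙ U₁) (adjG₂ : G₂ ⊣ H₂ ⋙ U₂) (e : P ⋙ U₂ ≅ U₁ ⋙ T)
    (r : H₁ ⋙ P ⟶ P' ⋙ H₂) {D D' : 𝒞₁} (f : D ⟶ D') :
    G₂.map (T.map f) ≫ relCmp adjG₁ adjG₂ e r D' =
      relCmp adjG₁ adjG₂ e r D ≫ P'.map (G₁.map f) := by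
  rw [relCmp_map]
  unfold relCmp
  rw [← Adjunction.homEquiv_naturality_left_symm, ← Category.assoc, ← T.map_comp]
  congr 3
  rw [adjG₁.homEquiv_unit]
  exact adjG₁.unit.naturality f

theorem barAct_relCmp (adj₁ : F₁ ⊣ U₁) (adj₂ : F₂ ⊣ U₂) (adjG₁ : G₁ ⊣ H₁ ⋙ U₁)
    (adjG₂ : G₂ ⊣ H₂ ⋙ U₂) (e : P ⋙ U₂ ≅ U₁ ⋙ T) (r : H₁ ⋙ P ⟶ P' ⋙ H₂) (D : 𝒞₁) :
    barAct adj₂ adjG₂ (T.obj D) ≫ relCmp adjG₁ adjG₂ e r D =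
      G₂.map (U₂.map (freeCmp adj₁ adj₂ e D) ≫ e.hom.app (F₁.obj D)) ≫
        relCmp adjG₁ adjG₂ e r (U₁.obj (F₁.obj D)) ≫ P'.map (barAct adj₁ adjG₁ D) := by
  rw [relCmp_map]
  unfold barAct
  rw [← Adjunction.homEquiv_naturality_right_symm, Equiv.apply_symm_apply]
  refine Eq.trans (congrArg _ ?_) (adjG₂.homEquiv_naturality_left_symm _ _)
  have h := e.inv.naturality ((adj₁.homEquiv _ _).symm (adjG₁.unit.app D))
  simp only [Functor.comp_map] at h
  have h2 := freeCmp_map adj₁ adj₂ e ((adj₁.homEquiv _ _).symm (adjG₁.unit.app D))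
  rw [Equiv.apply_symm_apply] at h2
  have e1 : U₂.map ((adj₂.homEquiv _ _).symm (adjG₂.unit.app (T.obj D))) ≫
      (H₂ ⋙ U₂).map (relCmp adjG₁ adjG₂ e r D) =
      U₂.map ((adj₂.homEquiv _ _).symm (T.map (adjG₁.unit.app D) ≫
        e.inv.app (H₁.obj (G₁.obj D)))) ≫ U₂.map (r.app (G₁.obj D)) := by
    rw [Functor.comp_map, ← U₂.map_comp, ← U₂.map_comp,
      ← Adjunction.homEquiv_naturality_right_symm, ← Adjunction.homEquiv_naturality_right_symm]
    congr 2
    refine (adjG₂.homEquiv_unit (f := relCmp adjG₁ adjG₂ e r D)).symm.trans ?_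
    unfold relCmp
    rw [Equiv.apply_symm_apply]
    exact (Category.assoc _ _ _).symm
  refine e1.trans ?_
  rw [← h2, U₂.map_comp, Category.assoc, Category.assoc]
  congr 1
  have h3 := congrArg (fun t => e.hom.app (F₁.obj D) ≫ t ≫ U₂.map (r.app (G₁.obj D))) h
  simp only [Category.assoc] at h3
  refine Eq.trans ?_ h3.symm
  exact (Iso.hom_inv_id_app_assoc e (F₁.obj D) _).symm

/-- The comparison `(F₂ U₂) ^ n P A ⟶ P (F₁ U₁) ^ n A`. -/
def resCmp (adj₁ : F₁ ⊣ U₁) (adj₂ : F₂ ⊣ U₂) (e : P ⋙ U₂ ≅ U₁ ⋙ T) (A : 𝒜₁) :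
    ∀ n, resObj F₂ U₂ (P.obj A) n ⟶ P.obj (resObj F₁ U₁ A n)
  | 0 => 𝟙 (P.obj A)
  | n + 1 => F₂.map (U₂.map (resCmp adj₁ adj₂ e A n) ≫ e.hom.app (resObj F₁ U₁ A n)) ≫
      freeCmp adj₁ adj₂ e (U₁.obj (resObj F₁ U₁ A n))

theorem counit_freeCmp (adj₁ : F₁ ⊣ U₁) (adj₂ : F₂ ⊣ U₂) (e : P ⋙ U₂ ≅ U₁ ⋙ T) {X : 𝒜₂} {Y : 𝒜₁}
    (t : X ⟶ P.obj Y) : adj₂.counit.app X ≫ t =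
      (F₂.map (U₂.map t ≫ e.hom.app Y) ≫ freeCmp adj₁ adj₂ e (U₁.obj Y)) ≫
        P.map (adj₁.counit.app Y) := by
  have h1 := freeCmp_map adj₁ adj₂ e (adj₁.counit.app Y)
  have h2 : T.map ((adj₁.homEquiv (U₁.obj Y) Y) (adj₁.counit.app Y)) ≫ e.inv.app Y = e.inv.app Y := by
    rw [adj₁.homEquiv_unit]
    have h3 := congrArg (fun f => T.map f ≫ e.inv.app Y) (adj₁.right_triangle_components Y)
    refine h3.trans ?_
    simp
  refine Eq.trans ?_ (Category.assoc _ _ _).symm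
  refine Eq.trans ?_ (congrArg (F₂.map (U₂.map t ≫ e.hom.app Y) ≫ ·) h1).symm
  refine Eq.trans ?_ (congrArg (fun g => F₂.map (U₂.map t ≫ e.hom.app Y) ≫
    (adj₂.homEquiv (T.obj (U₁.obj Y)) (P.obj Y)).symm g) h2).symm
  refine Eq.trans ?_ (adj₂.homEquiv_naturality_left_symm _ _)
  have h4 : (U₂.map t ≫ e.hom.app Y) ≫ e.inv.app Y = U₂.map t := by simp
  refine Eq.trans ?_ (congrArg _ h4).symm
  rw [Adjunction.homEquiv_counit]
  exact (adj₂.counit.naturality t).symm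

theorem barAct_simCmp (adj₁ : F₁ ⊣ U₁) (adj₂ : F₂ ⊣ U₂) (adjG₁ : G₁ ⊣ H₁ ⋙ U₁)
    (adjG₂ : G₂ ⊣ H₂ ⋙ U₂) (e : P ⋙ U₂ ≅ U₁ ⋙ T) (r : H₁ ⋙ P ⟶ P' ⋙ H₂) {X : 𝒜₂} {Y : 𝒜₁}
    (t : X ⟶ P.obj Y) :
    barAct adj₂ adjG₂ (U₂.obj X) ≫ G₂.map (U₂.map t ≫ e.hom.app Y) ≫
        relCmp adjG₁ adjG₂ e r (U₁.obj Y) =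
      (G₂.map (U₂.map (F₂.map (U₂.map t ≫ e.hom.app Y) ≫ freeCmp adj₁ adj₂ e (U₁.obj Y)) ≫
        e.hom.app (F₁.obj (U₁.obj Y))) ≫ relCmp adjG₁ adjG₂ e r (U₁.obj (F₁.obj (U₁.obj Y)))) ≫
        P'.map (barAct adj₁ adjG₁ (U₁.obj Y)) := by
  have h1 := barAct_naturality adj₂ adjG₂ (U₂.map t ≫ e.hom.app Y)
  have h2 := barAct_relCmp adj₁ adj₂ adjG₁ adjG₂ e r (U₁.obj Y)
  refine (Category.assoc _ _ _).symm.trans ?_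
  refine (congrArg (· ≫ relCmp adjG₁ adjG₂ e r (U₁.obj Y)) h1.symm).trans ?_
  refine (Category.assoc _ _ _).trans ?_
  refine (congrArg (G₂.map (U₂.map (F₂.map (U₂.map t ≫ e.hom.app Y))) ≫ ·) h2).trans ?_
  refine (Category.assoc _ _ _).symm.trans (Eq.trans ?_ (Category.assoc _ _ _).symm)
  refine congrArg (· ≫ relCmp adjG₁ adjG₂ e r (U₁.obj (F₁.obj (U₁.obj Y))) ≫
        P'.map (barAct adj₁ adjG₁ (U₁.obj Y))) ?_
  refine (G₂.map_comp _ _).symm.trans (congrArg G₂.map ?_)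
  rw [U₂.map_comp]
  exact (Category.assoc _ _ _).symm

theorem resCmp_face (adj₁ : F₁ ⊣ U₁) (adj₂ : F₂ ⊣ U₂) (e : P ⋙ U₂ ≅ U₁ ⋙ T) (A : 𝒜₁) (n : ℕ)
    (i : Fin (n + 1)) : resFace adj₂ (P.obj A) n i ≫ resCmp adj₁ adj₂ e A n =
      resCmp adj₁ adj₂ e A (n + 1) ≫ P.map (resFace adj₁ A n i) := by
  have h0 : ∀ n, resFace adj₂ (P.obj A) n 0 ≫ resCmp adj₁ adj₂ e A n =
      resCmp adj₁ adj₂ e A (n + 1) ≫ P.map (resFace adj₁ A n 0) := by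
    intro n
    rw [resFace_zero, resFace_zero]
    exact counit_freeCmp adj₁ adj₂ e (resCmp adj₁ adj₂ e A n)
  induction n with
  | zero =>
    obtain rfl : i = 0 := Subsingleton.elim (α := Fin 1) _ _
    exact h0 0
  | succ n ih =>
    refine Fin.cases (h0 _) (fun i => ?_) i
    change F₂.map (U₂.map (resFace adj₂ (P.obj A) n i)) ≫ F₂.map _ ≫ freeCmp adj₁ adj₂ e _ =
      (F₂.map _ ≫ freeCmp adj₁ adj₂ e _) ≫ P.map (F₁.map (U₁.map (resFace adj₁ A n i)))
    rw [Category.assoc, ← freeCmp_naturality, ← Category.assoc, ← Category.assoc, ← F₂.map_comp,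
      ← F₂.map_comp]
    congr 2
    rw [← Category.assoc, ← U₂.map_comp, ih, U₂.map_comp, Category.assoc, Category.assoc]
    congr 1
    exact e.hom.naturality (resFace adj₁ A n i)

/-- The comparison `G₂ U₂ (F₂ U₂) ^ n P A ⟶ P' G₁ U₁ (F₁ U₁) ^ n A`. -/
def simCmp (adj₁ : F₁ ⊣ U₁) (adj₂ : F₂ ⊣ U₂) (adjG₁ : G₁ ⊣ H₁ ⋙ U₁)
    (adjG₂ : G₂ ⊣ H₂ ⋙ U₂) (e : P ⋙ U₂ ≅ U₁ ⋙ T) (r : H₁ ⋙ P ⟶ P' ⋙ H₂) (A : 𝒜₁) (n : ℕ) :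
    G₂.obj (U₂.obj (resObj F₂ U₂ (P.obj A) n)) ⟶ P'.obj (G₁.obj (U₁.obj (resObj F₁ U₁ A n))) :=
  G₂.map (U₂.map (resCmp adj₁ adj₂ e A n) ≫ e.hom.app (resObj F₁ U₁ A n)) ≫
    relCmp adjG₁ adjG₂ e r (U₁.obj (resObj F₁ U₁ A n))

theorem simCmp_face (adj₁ : F₁ ⊣ U₁) (adj₂ : F₂ ⊣ U₂) (adjG₁ : G₁ ⊣ H₁ ⋙ U₁)
    (adjG₂ : G₂ ⊣ H₂ ⋙ U₂) (e : P ⋙ U₂ ≅ U₁ ⋙ T) (r : H₁ ⋙ P ⟶ P' ⋙ H₂) (A : 𝒜₁) (n : ℕ)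
    (i : Fin (n + 2)) :
    barFace adj₂ adjG₂ (P.obj A) n i ≫ simCmp adj₁ adj₂ adjG₁ adjG₂ e r A n =
      simCmp adj₁ adj₂ adjG₁ adjG₂ e r A (n + 1) ≫ P'.map (barFace adj₁ adjG₁ A n i) := by
  refine Fin.cases ?_ (fun i => ?_) i
  · exact barAct_simCmp adj₁ adj₂ adjG₁ adjG₂ e r (resCmp adj₁ adj₂ e A n)
  · change G₂.map (U₂.map (resFace adj₂ (P.obj A) n i)) ≫ G₂.map _ ≫ relCmp adjG₁ adjG₂ e r _ =
      (G₂.map _ ≫ relCmp adjG₁ adjG₂ e r _) ≫ P'.map (G₁.map (U₁.map (resFace adj₁ A n i)))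
    rw [Category.assoc, ← relCmp_naturality, ← Category.assoc, ← Category.assoc, ← G₂.map_comp,
      ← G₂.map_comp]
    congr 2
    rw [← Category.assoc, ← U₂.map_comp, resCmp_face, U₂.map_comp, Category.assoc, Category.assoc]
    congr 1
    exact e.hom.naturality (resFace adj₁ A n i)

theorem altFace_d {X : ℕ → 𝒱} (δ : ∀ n, Fin (n + 2) → (X (n + 1) ⟶ X n)) (hδ) (n : ℕ) :
    (altFace X δ hδ).d (n + 1) n = ∑ i : Fin (n + 2), (-1 : ℤ) ^ (i : ℕ) • δ n i :=
  ChainComplex.of_d X (fun n => ∑ i : Fin (n + 2), (-1 : ℤ) ^ (i : ℕ) • δ n i) n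

/-- A map of complexes of alternating sums of face maps. -/
def altMap {X Y : ℕ → 𝒱} (δ : ∀ n, Fin (n + 2) → (X (n + 1) ⟶ X n)) (hδ)
    (δ' : ∀ n, Fin (n + 2) → (Y (n + 1) ⟶ Y n)) (hδ') (f : ∀ n, X n ⟶ Y n)
    (hf : ∀ n i, δ n i ≫ f n = f (n + 1) ≫ δ' n i) : altFace X δ hδ ⟶ altFace Y δ' hδ' :=
  ChainComplex.ofHom f (fun n => by
    refine (congrArg (f (n + 1) ≫ ·) (altFace_d δ' hδ' n)).trans
      (Eq.trans ?_ (congrArg (· ≫ f n) (altFace_d δ hδ n)).symm)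
    refine (Preadditive.comp_sum _ _ _).trans (Eq.trans ?_ (Preadditive.sum_comp _ _ _).symm)
    refine Finset.sum_congr rfl fun i _ => ?_
    refine (Preadditive.comp_zsmul _ _ _).trans (Eq.trans ?_ (Preadditive.zsmul_comp _ _ _).symm)
    exact congrArg _ (hf n i).symm)

/-- The comparison of bar constructions. -/
def barCmp (adj₁ : F₁ ⊣ U₁) (adj₂ : F₂ ⊣ U₂) (adjG₁ : G₁ ⊣ H₁ ⋙ U₁)
    (adjG₂ : G₂ ⊣ H₂ ⋙ U₂) (e : P ⋙ U₂ ≅ U₁ ⋙ T) (r : H₁ ⋙ P ⟶ P' ⋙ H₂)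
    {E₁ : ℬ₁ ⥤ 𝒱} {E₂ : ℬ₂ ⥤ 𝒱} (s : P' ⋙ E₂ ⟶ E₁) (A : 𝒜₁) :
    barCx adj₂ adjG₂ E₂ (P.obj A) ⟶ barCx adj₁ adjG₁ E₁ A :=
  altMap _ _ _ _ (fun n => E₂.map (simCmp adj₁ adj₂ adjG₁ adjG₂ e r A n) ≫
      s.app (G₁.obj (U₁.obj (resObj F₁ U₁ A n)))) (fun n i => by
    rw [← Category.assoc, ← E₂.map_comp, simCmp_face, E₂.map_comp, Category.assoc, Category.assoc]
    congr 1
    exact s.naturality (barFace adj₁ adjG₁ A n i))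

end CompareBar

section TensorFunctors

variable {R : Type u} [CommRing R] {N : ℕ}

theorem tMap_id {J : Type} [Fintype J] [LinearOrder J] (K : J → Ch R N) :
    tMap (fun j => 𝟙 (K j)) = 𝟙 (tens K) := by
  refine hom_ext_app fun γ q => ?_
  suffices H : app (tMap fun j => 𝟙 (K j)) γ = LinearMap.id from LinearMap.congr_fun H q
  refine tp_ext fun g h x => ?_
  rw [tMap_tp]
  rfl

theorem app_tMap_id {J : Type} [Fintype J] [LinearOrder J] (K : J → Ch R N) (γ : Deg N)
    (q : (tens K).X γ) : app (tMap fun j => 𝟙 (K j)) γ q = q := by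
  rw [tMap_id]
  rfl

theorem tMap_comp {J : Type} [Fintype J] [LinearOrder J] {K L Q : J → Ch R N}
    (f : ∀ j, K j ⟶ L j) (f' : ∀ j, L j ⟶ Q j) :
    tMap (fun j => f j ≫ f' j) = tMap f ≫ tMap f' := by
  refine hom_ext_app fun γ q => ?_
  suffices H : app (tMap fun j => f j ≫ f' j) γ = app (tMap f') γ ∘ₗ app (tMap f) γ from
    LinearMap.congr_fun H q
  refine tp_ext fun g h x => ?_
  rw [LinearMap.comp_apply, tMap_tp, tMap_tp, tMap_tp]
  rfl

/-- The tensor products of a collection of complexes, over the objects of the PROP category. -/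
def colTens (M : DGMulticat R N) [LinearOrder M.Ob] :
    (M.Ob → Ch R N) ⥤ ((propCat M).Ob → Ch R N) where
  obj D := fun x => tens fun i => D (x.2.1 i)
  map f := fun x => tMap fun i => f (x.2.1 i)
  map_id D := funext fun x => tMap_id _
  map_comp f g := funext fun x => tMap_comp _ _

theorem grp_tMap {B C : Type} [Fintype B] [LinearOrder B] [Fintype C] [LinearOrder C] {g : B → C}
    {K K' : B → Ch R N} {L L' Q Q' : C → Ch R N} (E : Ops g K L Q) (E' : Ops g K' L' Q')
    (k : ∀ j, K j ⟶ K' j) (l : ∀ j, L j ⟶ L' j) (q : ∀ j, Q j ⟶ Q' j)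
    (hE : ∀ (j : C) (u : {i // g i = j} → Deg N) (h c : Deg N) (hc : ∑ i, u i + h = c)
      (m : ∀ i : {i // g i = j}, (K i.1).X (u i)) (v : (L j).X h),
      app (q j) c (E.op j u h c hc m v) =
        E'.op j u h c hc (fun i => app (k i.1) (u i) (m i)) (app (l j) h v))
    (a b c : Deg N) (hc : a + b = c) (x : (tens K).X a) (y : (tens L).X b) :
    app (tMap q) c (grp E a b c hc x y) = grp E' a b c hc (app (tMap k) a x) (app (tMap l) b y) := by
  suffices H : app (tMap q) c ∘ₗ (grp E a b c hc).flip y =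
      (grp E' a b c hc).flip (app (tMap l) b y) ∘ₗ app (tMap k) a from LinearMap.congr_fun H x
  refine tp_ext fun m hm x => ?_
  suffices H : app (tMap q) c ∘ₗ grp E a b c hc (tp _ m a hm x) =
      grp E' a b c hc (app (tMap k) a (tp _ m a hm x)) ∘ₗ (app (tMap l) b) from
    LinearMap.congr_fun H y
  refine tp_ext fun n hn y => ?_
  simp only [LinearMap.comp_apply]
  have hd := fib_sum g hc hm hn (fibDeg_eq g m n)
  rw [grp_tp _ a b c hc m hm x n hn y _ (fibDeg_eq g m n) hd, map_smul, tMap_tp, tMap_tp, tMap_tp,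
    grp_tp _ a b c hc m hm _ n hn _ _ (fibDeg_eq g m n) hd]
  congr 2
  funext j
  exact hE _ _ _ _ _ _ _

theorem propAct_map {M : DGMulticat R N} {A B : Type} [Fintype A] [LinearOrder A] [Fintype B]
    [LinearOrder B] {X Y : DGAlg M} (F : X ⟶ Y) (a : A → M.Ob) (b : B → M.Ob) (g h e : Deg N)
    (he : g + h = e) (x : (tens fun i => X.obj (a i)).X g) (y : (propHom M a b).X h) :
    app (tMap fun j => F.hom (b j)) e (propAct X a b g h e he x y) =
      propAct Y a b g h e he (app (tMap fun i => F.hom (a i)) g x) y := by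
  suffices H : app (tMap fun j => F.hom (b j)) e ∘ₗ propAct X a b g h e he x =
      propAct Y a b g h e he (app (tMap fun i => F.hom (a i)) g x) from LinearMap.congr_fun H y
  refine propIn_ext fun f y => ?_
  rw [LinearMap.comp_apply, propAct_in, propAct_in]
  have h1 := grp_tMap (actOps X f a b) (actOps Y f a b) (fun i => F.hom (a i)) (fun j => 𝟙 _)
    (fun j => F.hom (b j)) (fun j u h c hc m v => F.map_act u h c hc m v) g h e he x y
  rw [tMap_id] at h1
  exact h1

/-- The functor from algebras over a multicategory to modules over its PROP category. -/
def algProp (M : DGMulticat R N) [LinearOrder M.Ob] : DGAlg M ⥤ DGMod (propCat M) where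
  obj A := propMod A
  map F :=
    { hom := fun x => tMap fun i => F.hom (x.2.1 i)
      map_act := fun g h c hc a m => propAct_map F _ _ g h c hc a m }
  map_id A := DGModHom.ext (funext fun x => tMap_id _)
  map_comp F G := DGModHom.ext (funext fun x => tMap_comp _ _)

theorem propAct_res {M O : DGMulticat R N} (π : DGMultifunctor M O) {A B : Type} [Fintype A]
    [LinearOrder A] [Fintype B] [LinearOrder B] (X : DGAlg O) (a : A → M.Ob) (b : B → M.Ob)
    (g h e : Deg N) (he : g + h = e) (x : (tens fun i => X.obj (π.obj (a i))).X g)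
    (y : (propHom M a b).X h) :
    propAct ((algRes π).obj X) a b g h e he x y =
      propAct X (fun i => π.obj (a i)) (fun j => π.obj (b j)) g h e he x
        (app (propMap π a b) h y) := by
  suffices H : propAct ((algRes π).obj X) a b g h e he x =
      propAct X (fun i => π.obj (a i)) (fun j => π.obj (b j)) g h e he x ∘ₗ
        app (propMap π a b) h from LinearMap.congr_fun H y
  refine propIn_ext fun f y => ?_
  refine (propAct_in ((algRes π).obj X) a b g h e he x f y).trans ?_
  have h1 := grp_tMap (actOps ((algRes π).obj X) f a b)
    (actOps X f (fun i => π.obj (a i)) (fun j => π.obj (b j))) (fun i => 𝟙 _)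
    (fun j => π.map (fun i : {i // f i = j} => a i.1) (b j))
    (fun j => 𝟙 _) (fun j u h c hc m v => rfl) g h e he x y
  have h0 := congrArg (fun t => grp (actOps X f (fun i => π.obj (a i)) (fun j => π.obj (b j)))
    g h e he t (app (fibMap π f a b) h y)) (app_tMap_id (fun i => X.obj (π.obj (a i))) g x)
  have h2 := propAct_in X (fun i => π.obj (a i)) (fun j => π.obj (b j)) g h e he x f
    (app (fibMap π f a b) h y)
  exact ((app_tMap_id (fun j => X.obj (π.obj (b j))) e _).symm.trans (h1.trans h0)).trans (h2.symm.trans (congrArg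
    (propAct X (fun i => π.obj (a i)) (fun j => π.obj (b j)) g h e he x)
    (propMap_in π a b f h y)).symm)

/-- The restriction of algebras is compatible with the passage to PROPs. -/
def propRes {M O : DGMulticat R N} [LinearOrder M.Ob] [LinearOrder O.Ob]
    (π : DGMultifunctor M O) (hπ : Monotone π.obj) :
    algRes π ⋙ algProp M ⟶ algProp O ⋙ modRes (propFunctor π hπ) where
  app X :=
    { hom := fun x => 𝟙 (tens fun i => X.obj (π.obj (x.2.1 i)))
      map_act := fun {x y} g h c hc a m => propAct_res π X x.2.1 y.2.1 g h c hc a m }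
  naturality X Y F := DGModHom.ext (funext fun x => hom_ext_app fun _ _ => rfl)

/-- The canonical map from a tensor product with one factor to this factor, in each degree. -/
def tensPtX (K : Ch R N) (γ : Deg N) : (tens fun _ : Fin 1 => K).X γ →ₗ[R] K.X γ :=
  tLift fun g _ =>
    { toFun := fun x => tr K (g 0) γ (x 0)
      map_update_add' := fun x j v w => by
        obtain rfl : j = 0 := Subsingleton.elim _ _
        simp
      map_update_smul' := fun x j r v => by
        obtain rfl : j = 0 := Subsingleton.elim _ _
        simp }

theorem tensPtX_tp (K : Ch R N) (γ : Deg N) (g : Fin 1 → Deg N) (h : ∑ j, g j = γ)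
    (x : ∀ j, K.X (g j)) :
    tensPtX K γ (tp (fun _ : Fin 1 => K) g γ h x) = tr K (g 0) γ (x 0) :=
  tLift_tp _ _ _ _

/-- The canonical map from a tensor product with one factor to this factor. -/
def tensPt (K : Ch R N) : (tens fun _ : Fin 1 => K) ⟶ K :=
  mkHom (tensPtX K)
    (fun c c' q => by
      by_cases hc : c' + 1 = c
      · suffices H : tensPtX K c' ∘ₗ del (tens fun _ : Fin 1 => K) c c' = del K c c' ∘ₗ tensPtX K c from
          LinearMap.congr_fun H q
        refine tp_ext fun g h x => ?_
        rw [LinearMap.comp_apply, LinearMap.comp_apply, del_tp _ hc, map_sum]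
        simp only [map_smul, tensPtX_tp, Fin.sum_univ_one]
        have hg : g 0 = c := by rw [← h, Fin.sum_univ_one]
        have h1 : before g (0 : Fin 1) = 0 := by simp [before]
        rw [h1, sg_zero, one_smul, dmap_self, del_tr _ hg, tr_del]
        rw [low_self, hg, ← hc]; ring
      · rw [del_shape _ c c' hc, del_shape _ c c' hc]
        simp)

theorem tensPt_naturality {K L : Ch R N} (f : K ⟶ L) :
    tMap (fun _ : Fin 1 => f) ≫ tensPt L = tensPt K ≫ f := by
  refine hom_ext_app fun γ q => ?_
  suffices H : tensPtX L γ ∘ₗ app (tMap fun _ : Fin 1 => f) γ = app f γ ∘ₗ tensPtX K γ from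
    LinearMap.congr_fun H q
  refine tp_ext fun g h x => ?_
  rw [LinearMap.comp_apply, LinearMap.comp_apply, tMap_tp, tensPtX_tp, tensPtX_tp, app_tr]

/-- The value at the unit of the module associated to an algebra over an operad. -/
def propEval (O : DGMulticat R N) [LinearOrder O.Ob] [Unique O.Ob] :
    algProp O ⋙ modForget (propCat O) ⋙ Pi.eval _ (propUnit O) ⟶
      algForget O ⋙ Pi.eval _ default where
  app X := tensPt (X.obj default)
  naturality X Y F := tensPt_naturality (F.hom default)

/-- The comparison map `Φ` from the categorical to the operadic left Kan extension. -/
def cmpLan {M O : DGMulticat R N} [LinearOrder M.Ob] [LinearOrder O.Ob] [Unique O.Ob]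
    (π : DGMultifunctor M O) (hπ : Monotone π.obj) (A : DGAlg M) :
    catLan (propFunctor π hπ) (propMod A) (propUnit O) ⟶ opLan π A default :=
  HomologicalComplex₂.total.map
    (barCmp (algAdj M) (modAdj (propCat M)) (opAdj π) (catAdj (propFunctor π hπ))
      (P := algProp M) (P' := algProp O) (T := colTens M) (Iso.refl _) (propRes π hπ)
      (propEval O) A) (ComplexShape.down (Deg N))

end TensorFunctors

section Subcomplexes

variable {R : Type u} [CommRing R] {N : ℕ}

/-- The subcomplex of a complex given by submodules preserved by the differential. -/
def subCx (K : Ch R N) (S : ∀ a, Submodule R (K.X a))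
    (hS : ∀ a b x, x ∈ S a → del K a b x ∈ S b) : Ch R N :=
  mkCh (fun a => S a) (fun a b => (del K a b).restrict (hS a b))
    (fun a b h => LinearMap.ext fun x => Subtype.ext (by
      rw [LinearMap.coe_restrict_apply, del_shape K a b h]
      rfl))
    (fun a b c x => Subtype.ext (by
      rw [LinearMap.coe_restrict_apply, LinearMap.coe_restrict_apply, del_del]
      rfl))

theorem del_map_mem {K L : Ch R N} (f : K ⟶ L) {S : ∀ a, Submodule R (K.X a)}
    (hS : ∀ a b x, x ∈ S a → del K a b x ∈ S b) (a b : Deg N) (y : L.X a)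
    (hy : y ∈ (S a).map (app f a)) : del L a b y ∈ (S b).map (app f b) := by
  obtain ⟨x, hx, rfl⟩ := hy
  exact ⟨del K a b x, hS a b x hx, app_del f a b x⟩

/-- The restriction of a chain map to a subcomplex, as a map onto the image of this subcomplex. -/
def subMap {K L : Ch R N} (f : K ⟶ L) (S : ∀ a, Submodule R (K.X a))
    (hS : ∀ a b x, x ∈ S a → del K a b x ∈ S b) :
    subCx K S hS ⟶ subCx L (fun a => (S a).map (app f a)) (del_map_mem f hS) :=
  mkHom (K := subCx K S hS) (L := subCx L (fun a => (S a).map (app f a)) (del_map_mem f hS))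
    (fun a => (app f a).restrict fun x hx => ⟨x, hx, rfl⟩)
    (fun a b x => Subtype.ext (app_del f a b x.1))

end Subcomplexes

section Filtration

variable {R : Type u} [CommRing R] {N : ℕ} {𝒞 𝒟 : DGCat R N}

open Classical in
/-- The number of essential levels (zero or one) between two objects. -/
def step (x y : 𝒞.Ob) : ℕ := if x = y then 0 else 1

/-- The submodule of `((F U) ^ n A) (y) = ⨁ A (x₀) ⊗ 𝒞 (x₀, x₁) ⊗ ⋯ ⊗ 𝒞 (xₙ₋₁, y)` spanned by
the summands with at most `m` indices `i` such that `xᵢ ≠ xᵢ₊₁`, where `xₙ = y`. -/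
def resFil (A : DGMod 𝒞) : ∀ (n m : ℕ) (y : 𝒞.Ob) (c : Deg N),
    Submodule R (((resObj (modFree 𝒞) (modForget 𝒞) A n).obj y).X c)
  | 0, _, _, _ => ⊤
  | n + 1, m, y, c => Submodule.span R {q | ∃ (x : 𝒞.Ob) (m' : ℕ) (a b : Deg N) (hc : a + b = c)
      (d : ((resObj (modFree 𝒞) (modForget 𝒞) A n).obj x).X a) (p : (𝒞.Hom x y).X b),
      d ∈ resFil A n m' x a ∧ m' + step x y ≤ m ∧
        q = fm (resObj (modFree 𝒞) (modForget 𝒞) A n).obj y x a b c hc d p}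

/-- The elements `c ⊗ o`, with `c` in `C x` and `o` a morphism from `p x` to `y`, of the value at
`y` of the free `𝒟`-module on the direct image of `C`. -/
def lanGen (p : DGFunctor 𝒞 𝒟) (C : 𝒞.Ob → Ch R N) (y : 𝒟.Ob) (x : 𝒞.Ob) (a b c : Deg N)
    (hc : a + b = c) : (C x).X a →ₗ[R] (𝒟.Hom (p.obj x) y).X b →ₗ[R]
      (((colPush p.obj ⋙ modFree 𝒟).obj C).obj y).X c :=
  fm ((colPush p.obj).obj C) y (p.obj x) a b c hc ∘ₗ app ((colAdj p.obj).unit.app C x) a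

/-- The submodule of the `n`-simplices `⨁ A (x₀) ⊗ 𝒞 (x₀, x₁) ⊗ ⋯ ⊗ 𝒞 (xₙ₋₁, xₙ) ⊗ 𝒟 (p xₙ, y)`
of the bar construction spanned by the summands with at most `m` indices `i` such that
`xᵢ ≠ xᵢ₊₁`. -/
def simFil (p : DGFunctor 𝒞 𝒟) (A : DGMod 𝒞) (y : 𝒟.Ob) (m n : ℕ) (c : Deg N) :
    Submodule R (((barCx (modAdj 𝒞) (catAdj p) (modForget 𝒟 ⋙ Pi.eval _ y) A).X n).X c) :=
  Submodule.span R {q | ∃ (x : 𝒞.Ob) (a b : Deg N) (hc : a + b = c)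
    (d : ((resObj (modFree 𝒞) (modForget 𝒞) A n).obj x).X a) (o : (𝒟.Hom (p.obj x) y).X b),
    d ∈ resFil A n m x a ∧
      q = lanGen p (resObj (modFree 𝒞) (modForget 𝒞) A n).obj y x a b c hc d o}

/-- The inclusion of the `n`-simplices in the realization. -/
def realizeIn (K : ChainComplex (Ch R N) ℕ) (n : ℕ) (a c : Deg N) (h : (n : Deg N) + a = c) :
    (K.X n).X a →ₗ[R] (realize K).X c :=
  (HomologicalComplex₂.ιTotal K (ComplexShape.down (Deg N)) n a c h).hom

/-- The `m`-th stage of the filtration of the left Kan extension by the number of essential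
levels. -/
def lanFil (p : DGFunctor 𝒞 𝒟) (A : DGMod 𝒞) (y : 𝒟.Ob) (m : ℕ) (c : Deg N) :
    Submodule R ((catLan p A y).X c) :=
  ⨆ (n : ℕ) (a : Deg N) (h : (n : Deg N) + a = c), (simFil p A y m n a).map (realizeIn _ n a c h)

theorem span_map_mem {V W : Type u} [AddCommGroup V] [Module R V] [AddCommGroup W] [Module R W]
    (f : V →ₗ[R] W) {s : Set V} {T : Submodule R W} (h : ∀ q ∈ s, f q ∈ T) {q : V}
    (hq : q ∈ Submodule.span R s) : f q ∈ T :=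
  (Submodule.span_le (p := T.comap f)).2 h hq

theorem step_triangle (x y z : 𝒞.Ob) : step x z ≤ step x y + step y z := by
  unfold step
  split_ifs <;> simp_all

theorem resFil_mono (A : DGMod 𝒞) (n : ℕ) {m m' : ℕ} (h : m ≤ m') (y : 𝒞.Ob) (c : Deg N) :
    resFil A n m y c ≤ resFil A n m' y c := by
  cases n with
  | zero => exact le_refl _
  | succ n =>
    refine Submodule.span_mono ?_
    rintro q ⟨x, k, a, b, hc, d, p, hd, hk, rfl⟩
    exact ⟨x, k, a, b, hc, d, p, hd, hk.trans h, rfl⟩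

theorem resFil_del (A : DGMod 𝒞) (n m : ℕ) (y : 𝒞.Ob) (c : Deg N)
    (q : ((resObj (modFree 𝒞) (modForget 𝒞) A n).obj y).X c) (hq : q ∈ resFil A n m y c) :
    del _ c (c - 1) q ∈ resFil A n m y (c - 1) := by
  induction n generalizing m y c with
  | zero => trivial
  | succ n ih =>
    refine Submodule.span_induction ?_ ?_ ?_ ?_ hq
    · rintro q ⟨x, k, a, b, hc, d, p, hd, hk, rfl⟩
      have h1 := del_fm (resObj (modFree 𝒞) (modForget 𝒞) A n).obj y x a b c hc d p
      refine Eq.subst (motive := fun t => t ∈ resFil A (n + 1) m y (c - 1)) h1.symm ?_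
      refine Submodule.add_mem _ (Submodule.subset_span ?_)
        (Submodule.smul_mem _ _ (Submodule.subset_span ?_))
      · exact ⟨x, k, a - 1, b, _, _, _, ih k x a d hd, hk, rfl⟩
      · exact ⟨x, k, a, b - 1, _, _, _, hd, hk, rfl⟩
    · rw [map_zero]; exact Submodule.zero_mem _
    · intro q q' _ _ h h'
      rw [map_add]; exact Submodule.add_mem _ h h'
    · intro r q _ h
      rw [map_smul]; exact Submodule.smul_mem _ _ h

theorem resFil_act (A : DGMod 𝒞) (n m m' : ℕ) (x y : 𝒞.Ob) (g h c : Deg N) (hc : g + h = c)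
    (q : ((resObj (modFree 𝒞) (modForget 𝒞) A n).obj x).X g) (hq : q ∈ resFil A n m x g)
    (p : (𝒞.Hom x y).X h) (hm : m + step x y ≤ m') :
    (resObj (modFree 𝒞) (modForget 𝒞) A n).act g h c hc q p ∈ resFil A n m' y c := by
  cases n with
  | zero => trivial
  | succ n =>
    refine Submodule.span_induction ?_ ?_ ?_ ?_ hq
    · rintro q ⟨w, k, a, b, hc', d, p', hd, hk, rfl⟩
      have h1 := fmAct_fm (resObj (modFree 𝒞) (modForget 𝒞) A n).obj g h c hc w a b hc' d p' p
        (b + h) rfl (by rw [← hc, ← hc']; ring)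
      refine Eq.subst (motive := fun t => t ∈ resFil A (n + 1) m' y c) h1.symm ?_
      refine Submodule.subset_span ⟨w, k, a, b + h, _, _, _, hd, ?_, rfl⟩
      have := step_triangle w x y
      omega
    · rw [map_zero]; exact Submodule.zero_mem _
    · intro q q' _ _ h h'
      rw [map_add]; exact Submodule.add_mem _ h h'
    · intro r q _ h
      rw [map_smul]; exact Submodule.smul_mem _ _ h

theorem modFree_map_fm {D D' : 𝒞.Ob → Ch R N} (φ : D ⟶ D') (y x : 𝒞.Ob) (a b c : Deg N)
    (hc : a + b = c) (d : (D x).X a) (m : (𝒞.Hom x y).X b) :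
    app (((modFree 𝒞).map φ).hom y) c (fm D y x a b c hc d m) =
      fm D' y x a b c hc (app (φ x) a d) m := by
  have h1 := fmEval_fm (A := freeMod D') (fun x => φ x ≫ freeModUnit D' x) y x a b c hc d m
  refine h1.trans ?_
  rw [app_comp, freeModUnit_app]
  refine (fmAct_fm D' a b c hc x a 0 (add_zero a) _ _ m b (zero_add b) hc).trans ?_
  rw [𝒞.one_comp]

theorem counit_fm (A : DGMod 𝒞) (y x : 𝒞.Ob) (a b c : Deg N)
    (hc : a + b = c) (d : (A.obj x).X a) (m : (𝒞.Hom x y).X b) :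
    app (((modAdj 𝒞).counit.app A).hom y) c (fm A.obj y x a b c hc d m) = A.act a b c hc d m := by
  have h1 := fmEval_fm (A := A) (fun x => 𝟙 (A.obj x)) y x a b c hc d m
  exact h1

theorem modAdj_symm_fm {D : 𝒞.Ob → Ch R N} {A : DGMod 𝒞} (φ : D ⟶ (modForget 𝒞).obj A)
    (y x : 𝒞.Ob) (a b c : Deg N) (hc : a + b = c) (d : (D x).X a) (m : (𝒞.Hom x y).X b) :
    app ((((modAdj 𝒞).homEquiv D A).symm φ).hom y) c (fm D y x a b c hc d m) =
      A.act a b c hc (app (φ x) a d) m := by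
  rw [Adjunction.homEquiv_counit]
  have h1 := modFree_map_fm φ y x a b c hc d m
  exact (congrArg (app (((modAdj 𝒞).counit.app A).hom y) c) h1).trans
    (counit_fm A y x a b c hc (app (φ x) a d) m)

theorem resFil_face (A : DGMod 𝒞) (n m : ℕ) (i : Fin (n + 1)) (y : 𝒞.Ob) (c : Deg N)
    (q : ((resObj (modFree 𝒞) (modForget 𝒞) A (n + 1)).obj y).X c)
    (hq : q ∈ resFil A (n + 1) m y c) :
    app ((resFace (modAdj 𝒞) A n i).hom y) c q ∈ resFil A n m y c := by
  induction n generalizing m y c with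
  | zero => trivial
  | succ n ih =>
    refine Submodule.span_induction ?_ ?_ ?_ ?_ hq
    · rintro q ⟨x, k, a, b, hc, d, p, hd, hk, rfl⟩
      clear hq
      revert i
      refine Fin.cases ?_ (fun i => ?_)
      · have h1 := counit_fm (resObj (modFree 𝒞) (modForget 𝒞) A (n + 1)) y x a b c hc d p
        refine Eq.subst (motive := fun t => t ∈ resFil A (n + 1) m y c) h1.symm ?_
        exact resFil_act A (n + 1) k m x y a b c hc d hd p hk
      · have h1 := modFree_map_fm ((modForget 𝒞).map (resFace (modAdj 𝒞) A n i)) y x a b c hc d p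
        refine Eq.subst (motive := fun t => t ∈ resFil A (n + 1) m y c) h1.symm ?_
        exact Submodule.subset_span ⟨x, k, a, b, hc, _, p, ih k i x a d hd, hk, rfl⟩
    · rw [map_zero]; exact Submodule.zero_mem _
    · intro q q' _ _ h h'
      rw [map_add]; exact Submodule.add_mem _ h h'
    · intro r q _ h
      rw [map_smul]; exact Submodule.smul_mem _ _ h

theorem del_lanGen (p : DGFunctor 𝒞 𝒟) (C : 𝒞.Ob → Ch R N) (y : 𝒟.Ob) (x : 𝒞.Ob) (a b c : Deg N)
    (hc : a + b = c) (d : (C x).X a) (o : (𝒟.Hom (p.obj x) y).X b) :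
    del _ c (c - 1) (lanGen p C y x a b c hc d o) =
      lanGen p C y x (a - 1) b (c - 1) (by rw [← hc]; ring) (del _ a (a - 1) d) o +
      sg R (par a) • lanGen p C y x a (b - 1) (c - 1) (by rw [← hc]; ring) d (del _ b (b - 1) o) := by
  have h1 := del_fm ((colPush p.obj).obj C) y (p.obj x) a b c hc
    (app ((colAdj p.obj).unit.app C x) a d) o
  have h2 := app_del ((colAdj p.obj).unit.app C x) a (a - 1) d
  refine h1.trans ?_
  exact congrArg (fun t => fm ((colPush p.obj).obj C) y (p.obj x) (a - 1) b (c - 1)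
    (by rw [← hc]; ring) t o + sg R (par a) • fm ((colPush p.obj).obj C) y (p.obj x) a (b - 1) (c - 1)
    (by rw [← hc]; ring) (app ((colAdj p.obj).unit.app C x) a d) (del _ b (b - 1) o)) h2.symm

theorem lanGen_map (p : DGFunctor 𝒞 𝒟) {C C' : 𝒞.Ob → Ch R N} (φ : C ⟶ C') (y : 𝒟.Ob) (x : 𝒞.Ob)
    (a b c : Deg N) (hc : a + b = c) (d : (C x).X a) (o : (𝒟.Hom (p.obj x) y).X b) :
    app (((colPush p.obj ⋙ modFree 𝒟).map φ).hom y) c (lanGen p C y x a b c hc d o) =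
      lanGen p C' y x a b c hc (app (φ x) a d) o := by
  have h1 := modFree_map_fm ((colPush p.obj).map φ) y (p.obj x) a b c hc
    (app ((colAdj p.obj).unit.app C x) a d) o
  have h2 := congrFun ((colAdj (R := R) (N := N) p.obj).unit.naturality φ) x
  have h3 := congrArg (fun f => app f a d) h2
  refine h1.trans ?_
  exact congrArg (fun t => fm ((colPush p.obj).obj C') y (p.obj x) a b c hc t o) h3.symm

theorem lanGen_act (p : DGFunctor 𝒞 𝒟) (C : 𝒞.Ob → Ch R N) (y z : 𝒟.Ob) (x : 𝒞.Ob)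
    (a b g h c e : Deg N) (hg : a + b = g) (hc : g + h = c) (he : b + h = e) (hc' : a + e = c)
    (d : (C x).X a) (o : (𝒟.Hom (p.obj x) y).X b) (o' : (𝒟.Hom y z).X h) :
    ((colPush p.obj ⋙ modFree 𝒟).obj C).act g h c hc (lanGen p C y x a b g hg d o) o' =
      lanGen p C z x a e c hc' d (𝒟.comp b h e he o o') :=
  fmAct_fm ((colPush p.obj).obj C) g h c hc (p.obj x) a b hg
    (app ((colAdj p.obj).unit.app C x) a d) o o' e he hc'

theorem catAdj_unit (p : DGFunctor 𝒞 𝒟) (C : 𝒞.Ob → Ch R N) (x : 𝒞.Ob) (a : Deg N)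
    (d : (C x).X a) : app ((catAdj p).unit.app C x) a d =
      lanGen p C (p.obj x) x a 0 a (add_zero a) d (𝒟.one (p.obj x)) := rfl

theorem catAdj_symm_lanGen (p : DGFunctor 𝒞 𝒟) {C : 𝒞.Ob → Ch R N} {B : DGMod 𝒟}
    (ψ : C ⟶ (modRes p ⋙ modForget 𝒞).obj B) (y : 𝒟.Ob) (x : 𝒞.Ob)
    (a b c : Deg N) (hc : a + b = c) (d : (C x).X a) (o : (𝒟.Hom (p.obj x) y).X b) :
    app ((((catAdj p).homEquiv C B).symm ψ).hom y) c (lanGen p C y x a b c hc d o) =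
      B.act a b c hc (app (ψ x) a d) o := by
  obtain ⟨φ, rfl⟩ := ((catAdj p).homEquiv C B).surjective ψ
  rw [Equiv.symm_apply_apply]
  have h2 := congrArg (fun f => app f a d) (congrFun ((catAdj p).homEquiv_unit (f := φ)) x)
  have h3 : app ((((catAdj p).homEquiv C B) φ) x) a d =
    app (φ.hom (p.obj x)) a (lanGen p C (p.obj x) x a 0 a (add_zero a) d (𝒟.one (p.obj x))) := h2
  have h4 := φ.map_act a b c hc
    (lanGen p C (p.obj x) x a 0 a (add_zero a) d (𝒟.one (p.obj x))) o
  have h5 := lanGen_act p C (p.obj x) y x a 0 a b c b (add_zero a) hc (zero_add b) hc d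
    (𝒟.one (p.obj x)) o
  rw [𝒟.one_comp] at h5
  exact (congrArg (app (φ.hom y) c) h5.symm).trans
    (h4.trans (congrArg (fun t => B.act a b c hc t o) h3.symm))

theorem barAct_lanGen (p : DGFunctor 𝒞 𝒟) (D : 𝒞.Ob → Ch R N) (y : 𝒟.Ob) (x w : 𝒞.Ob)
    (a b c a' b' : Deg N) (hc : a + b = c) (ha : a' + b' = a) (d : (D w).X a')
    (m : (𝒞.Hom w x).X b') (o : (𝒟.Hom (p.obj x) y).X b) :
    app ((barAct (modAdj 𝒞) (catAdj p) D).hom y) c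
        (lanGen p (freeMod D).obj y x a b c hc (fm D x w a' b' a ha d m) o) =
      lanGen p D y w a' (b' + b) c (by rw [← hc, ← ha]; ring) d
        (𝒟.comp b' b (b' + b) rfl (app (p.map w x) b' m) o) := by
  have h1 := catAdj_symm_lanGen p ((modForget 𝒞).map
    (((modAdj 𝒞).homEquiv D ((modRes p).obj ((colPush p.obj ⋙ modFree 𝒟).obj D))).symm
      ((catAdj p).unit.app D))) y x a b c hc
    (fm D x w a' b' a ha d m) o
  refine h1.trans ?_
  have h2 := modAdj_symm_fm (A := (modRes p).obj ((colPush p.obj ⋙ modFree 𝒟).obj D))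
    ((catAdj p).unit.app D) x w a' b' a ha d m
  have h3 := lanGen_act p D (p.obj w) (p.obj x) w a' 0 a' b' a b' (add_zero a') ha (zero_add b') ha d
    (𝒟.one (p.obj w)) (app (p.map w x) b' m)
  rw [𝒟.one_comp] at h3
  have h4 := h2.trans h3
  refine (congrArg (fun t => ((colPush p.obj ⋙ modFree 𝒟).obj D).act a b c hc t o) h4).trans ?_
  exact lanGen_act p D (p.obj x) y w a' b' a b c (b' + b) ha hc rfl _ d _ o

theorem simFil_del (p : DGFunctor 𝒞 𝒟) (A : DGMod 𝒞) (y : 𝒟.Ob) (m n : ℕ) (c : Deg N)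
    (q : ((barCx (modAdj 𝒞) (catAdj p) (modForget 𝒟 ⋙ Pi.eval _ y) A).X n).X c)
    (hq : q ∈ simFil p A y m n c) : del _ c (c - 1) q ∈ simFil p A y m n (c - 1) := by
  refine Submodule.span_induction ?_ ?_ ?_ ?_ hq
  · rintro q ⟨x, a, b, hc, d, o, hd, rfl⟩
    have h1 := del_lanGen p (resObj (modFree 𝒞) (modForget 𝒞) A n).obj y x a b c hc d o
    refine Eq.subst (motive := fun t => t ∈ simFil p A y m n (c - 1)) h1.symm ?_
    refine Submodule.add_mem _ (Submodule.subset_span ?_)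
      (Submodule.smul_mem _ _ (Submodule.subset_span ?_))
    · exact ⟨x, a - 1, b, _, _, _, resFil_del A n m x a d hd, rfl⟩
    · exact ⟨x, a, b - 1, _, _, _, hd, rfl⟩
  · rw [map_zero]; exact Submodule.zero_mem _
  · intro q q' _ _ h h'
    rw [map_add]; exact Submodule.add_mem _ h h'
  · intro r q _ h
    rw [map_smul]; exact Submodule.smul_mem _ _ h

theorem simFil_barAct (p : DGFunctor 𝒞 𝒟) (A : DGMod 𝒞) (y : 𝒟.Ob) (m n : ℕ) (x : 𝒞.Ob)
    (a b c : Deg N) (hc : a + b = c)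
    (q : ((resObj (modFree 𝒞) (modForget 𝒞) A (n + 1)).obj x).X a)
    (hq : q ∈ resFil A (n + 1) m x a) (o : (𝒟.Hom (p.obj x) y).X b) :
    app ((barAct (modAdj 𝒞) (catAdj p) (resObj (modFree 𝒞) (modForget 𝒞) A n).obj).hom y) c
      (lanGen p (resObj (modFree 𝒞) (modForget 𝒞) A (n + 1)).obj y x a b c hc q o) ∈
        simFil p A y m n c := by
  refine span_map_mem
    (app ((barAct (modAdj 𝒞) (catAdj p) (resObj (modFree 𝒞) (modForget 𝒞) A n).obj).hom y) c ∘ₗ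
      (lanGen p (resObj (modFree 𝒞) (modForget 𝒞) A (n + 1)).obj y x a b c hc).flip o)
    (T := simFil p A y m n c) ?_ hq
  rintro q ⟨w, k, a', b', ha, d, f, hd, hk, rfl⟩
  have h1 := barAct_lanGen p (resObj (modFree 𝒞) (modForget 𝒞) A n).obj y x w a b c a' b' hc ha d f o
  refine Eq.subst (motive := fun t => t ∈ simFil p A y m n c) h1.symm ?_
  exact Submodule.subset_span ⟨w, a', b' + b, _, _, _, resFil_mono A n (by omega) w a' hd, rfl⟩

theorem simFil_face (p : DGFunctor 𝒞 𝒟) (A : DGMod 𝒞) (y : 𝒟.Ob) (m n : ℕ) (i : Fin (n + 2))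
    (c : Deg N)
    (q : ((barCx (modAdj 𝒞) (catAdj p) (modForget 𝒟 ⋙ Pi.eval _ y) A).X (n + 1)).X c)
    (hq : q ∈ simFil p A y m (n + 1) c) :
    app ((barFace (modAdj 𝒞) (catAdj p) A n i).hom y) c q ∈ simFil p A y m n c := by
  refine span_map_mem (app ((barFace (modAdj 𝒞) (catAdj p) A n i).hom y) c)
    (T := simFil p A y m n c) ?_ hq
  rintro q ⟨x, a, b, hc, d, o, hd, rfl⟩
  refine Fin.cases ?_ (fun i => ?_) i
  · exact simFil_barAct p A y m n x a b c hc d hd o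
  · have h1 := lanGen_map p ((modForget 𝒞).map (resFace (modAdj 𝒞) A n i)) y x a b c hc d o
    refine Eq.subst (motive := fun t => t ∈ simFil p A y m n c) h1.symm ?_
    exact Submodule.subset_span ⟨x, a, b, hc, _, o, resFil_face A n m i x a d hd, rfl⟩

end Filtration

section FiltrationDifferential

variable {R : Type u} [CommRing R] {N : ℕ}

theorem units_smul_mem {K L : ModuleCat.{u} R} (ε : ℤˣ) (f : K ⟶ L) (T : Submodule R L) (q : K)
    (h : f.hom q ∈ T) : (ε • f).hom q ∈ T := by
  rcases Int.units_eq_one_or ε with rfl | rfl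
  · rw [one_smul]; exact h
  · rw [Units.neg_smul, one_smul]; exact T.neg_mem h

theorem realize_del (K : ChainComplex (Ch R N) ℕ) (S : ∀ (n : ℕ) (a : Deg N), Submodule R ((K.X n).X a))
    (hS : ∀ n a q, q ∈ S n a → del (K.X n) a (a - 1) q ∈ S n (a - 1))
    (hS' : ∀ n a q, q ∈ S (n + 1) a → app (K.d (n + 1) n) a q ∈ S n a) (c c' : Deg N)
    (x : (realize K).X c)
    (hx : x ∈ ⨆ (n : ℕ) (a : Deg N) (h : (n : Deg N) + a = c), (S n a).map (realizeIn K n a c h)) :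
    del (realize K) c c' x ∈
      ⨆ (n : ℕ) (a : Deg N) (h : (n : Deg N) + a = c'), (S n a).map (realizeIn K n a c' h) := by
  set T := ⨆ (n : ℕ) (a : Deg N) (h : (n : Deg N) + a = c'), (S n a).map (realizeIn K n a c' h)
    with hT
  have hmem : ∀ (n : ℕ) (a : Deg N) (h : (n : Deg N) + a = c') (q : (K.X n).X a), q ∈ S n a →
      realizeIn K n a c' h q ∈ T := fun n a h q hq =>
    Submodule.mem_iSup_of_mem n (Submodule.mem_iSup_of_mem a (Submodule.mem_iSup_of_mem h ⟨q, hq, rfl⟩))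
  by_cases hc : c' + 1 = c
  swap
  · rw [del_shape _ _ _ hc]
    exact T.zero_mem
  suffices H : (⨆ (n : ℕ) (a : Deg N) (h : (n : Deg N) + a = c), (S n a).map (realizeIn K n a c h)) ≤
      T.comap (del (realize K) c c') from H hx
  refine iSup_le fun n => iSup_le fun a => iSup_le fun h => ?_
  rintro _ ⟨q, hq, rfl⟩
  have h1 : (HomologicalComplex₂.D₁ K (ComplexShape.down (Deg N)) c c').hom (realizeIn K n a c h q) ∈ T := by
    have e1 := congrArg (fun f => f.hom q)
      (HomologicalComplex₂.ι_D₁ K (ComplexShape.down (Deg N)) c c' n a h)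
    refine Eq.subst (motive := fun t => t ∈ T) e1.symm ?_
    cases n with
    | zero =>
      rw [HomologicalComplex₂.d₁_eq_zero]
      · exact T.zero_mem
      · simp
    | succ n =>
      have hr : (n : Deg N) + a = c' := by
        rw [← add_left_inj 1, hc, ← h]; push_cast; ring
      rw [HomologicalComplex₂.d₁_eq K (ComplexShape.down (Deg N)) (i₁ := n + 1) (i₁' := n) rfl a c' hr]
      have := hmem n a hr _ (hS' n a q hq)
      exact units_smul_mem _ _ T q this
  have h2 : (HomologicalComplex₂.D₂ K (ComplexShape.down (Deg N)) c c').hom (realizeIn K n a c h q) ∈ T := by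
    have e1 := congrArg (fun f => f.hom q)
      (HomologicalComplex₂.ι_D₂ K (ComplexShape.down (Deg N)) c c' n a h)
    refine Eq.subst (motive := fun t => t ∈ T) e1.symm ?_
    have hr : (n : Deg N) + (a - 1) = c' := by
      rw [← add_left_inj 1, hc, ← h]; ring
    rw [HomologicalComplex₂.d₂_eq K (ComplexShape.down (Deg N)) n (i₂ := a) (i₂' := a - 1)
      (sub_add_cancel a 1) c' hr]
    have := hmem n (a - 1) hr _ (hS n a q hq)
    exact units_smul_mem _ _ T q this
  exact T.add_mem h1 h2

theorem altFace_mem {K : ℕ → Ch R N} (δ : ∀ n, Fin (n + 2) → (K (n + 1) ⟶ K n)) (hδ)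
    (S : ∀ (n : ℕ) (a : Deg N), Submodule R ((K n).X a))
    (hS : ∀ n i a q, q ∈ S (n + 1) a → app (δ n i) a q ∈ S n a) (n : ℕ) (a : Deg N)
    (q : (K (n + 1)).X a) (hq : q ∈ S (n + 1) a) :
    app ((altFace K δ hδ).d (n + 1) n) a q ∈ S n a := by
  have h1 := congrArg (fun f => app f a q) (altFace_d δ hδ n)
  refine Eq.subst (motive := fun t => t ∈ S n a) h1.symm ?_
  have h2 : ∀ s : Finset (Fin (n + 2)), app (∑ i ∈ s, (-1 : ℤ) ^ (i : ℕ) • δ n i) a q ∈ S n a := by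
    intro s
    induction s using Finset.induction_on with
    | empty =>
      rw [Finset.sum_empty]
      exact (S n a).zero_mem
    | insert i s hi ih =>
      rw [Finset.sum_insert hi]
      exact (S n a).add_mem ((S n a).smul_of_tower_mem ((-1 : ℤ) ^ (i : ℕ)) (hS n i a q hq)) ih
  exact h2 Finset.univ

variable {𝒞 𝒟 : DGCat R N}

theorem lanFil_del (p : DGFunctor 𝒞 𝒟) (A : DGMod 𝒞) (y : 𝒟.Ob) (m : ℕ) (c c' : Deg N)
    (x : (catLan p A y).X c) (hx : x ∈ lanFil p A y m c) :
    del (catLan p A y) c c' x ∈ lanFil p A y m c' :=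
  realize_del _ (simFil p A y m) (fun n a q hq => simFil_del p A y m n a q hq)
    (altFace_mem _ _ (simFil p A y m) (fun n i a q hq => simFil_face p A y m n i a q hq)) c c' x hx

variable {M O : DGMulticat R N} [LinearOrder M.Ob] [LinearOrder O.Ob] [Unique O.Ob]

/-- The restriction `F_m Φ : F_m L ⟶ F_m L'` of the comparison map `Φ` to the `m`-th stages of the
filtrations by the number of essential levels, where `F_m L'` is the image of `F_m L`. -/
def cmpFil (π : DGMultifunctor M O) (hπ : Monotone π.obj) (A : DGAlg M) (m : ℕ) :
    subCx (catLan (propFunctor π hπ) (propMod A) (propUnit O))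
        (lanFil (propFunctor π hπ) (propMod A) (propUnit O) m)
        (lanFil_del (propFunctor π hπ) (propMod A) (propUnit O) m) ⟶
      subCx (opLan π A default)
        (fun a => (lanFil (propFunctor π hπ) (propMod A) (propUnit O) m a).map
          (app (cmpLan π hπ A) a))
        (del_map_mem (cmpLan π hπ A) (lanFil_del (propFunctor π hπ) (propMod A) (propUnit O) m)) :=
  subMap (cmpLan π hπ A) (lanFil (propFunctor π hπ) (propMod A) (propUnit O) m)
    (lanFil_del (propFunctor π hπ) (propMod A) (propUnit O) m)

end FiltrationDifferential

end

/-!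
# Categorical and operadic left Kan extensions

The comparison `Φ` is surjective on the simplices of every degree, and its kernel turns out to be
contractible by a homotopy that respects the filtration by the number of nonidentity steps. So `Φ`,
and its restriction to every stage of the filtration, is even a homotopy equivalence
(`HomotopyEquiv.exists_of_kernel`, `HomotopyEquiv.exists_subMap`).

*The kernel.* On `n`-simplices, `Φ` is the canonical map from tensors `r ⊗ v`, where `r` lies in
the `n`-fold free `PM`-module at a sequence `x` and `v` is a morphism of `PO` from the image of `x`
to the unit, to a free `O`-algebra on a direct sum. A free algebra is a quotient of sums of tensors
over all sequences of generators, by the equivariance under permutations. Restricted to the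
non-decreasing sequences, what remains of these relations is `r s ⊗ v = r ⊗ s v` for `s` in
`R[Aut x] = PM(x, x)`. The precise form is that a map on the tensors over non-decreasing sequences
which is balanced under `Aut x` (`BalancedMap`) extends uniquely to the free algebra; this rests on
a model of the free algebra by generators and relations (`FreeQ`, `algQ`) and on the compatibility
of the Koszul signs with sorting (`BalancedMap.exists_extension`, `IsFreeOn.tens_induction`). If
the morphisms `v` have a basis `e i` over `R[Aut x]`, the relations are therefore resolved by the
normal form `r ⊗ s e i ↦ r s ⊗ e i`, where `r s` has again been brought to normal form, and the
kernel of `Φ` is the kernel of this projection (`comparison_normalForm`, `lanCmp_normalForm`).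

*The bases.* The freeness hypothesis supplies homogeneous bases of `PM(x, y)`, and of `O(n)` over
`R[Sₙ]`; representatives of the cosets of `Aut x` in `Sₙ` turn the latter into bases over
`R[Aut x]`. Since the complexes come from `ℤ`-graded ones that are bounded below, the basis elements
have a rank in `ℕ` which the differential lowers (`EssBasis`, `nonempty_essBasis`).

*The homotopy.* It is defined recursively by `η (r ⊗ s e) = (r ⊗ s) ⊗ e - η (r s) ⊗ e`: insert the
endomorphism `s` as a simplicial step of its own, which does not count as a nonidentity step. The
operator `1 - (∂ η + η ∂)` acts on `r ⊗ e` through `r`, up to terms with fewer nonidentity steps or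
a basis element of lower rank. On the module `PA` at which the recursion starts it is the identity,
but the kernel of `Φ` does not meet `PA`, and the coefficients of its elements with respect to the
bases lie in the analogous kernel of lower simplicial degree. By induction on the number of
nonidentity steps, the simplicial degree and the rank, the operator is locally nilpotent on the
kernel (`BarSystem.exists_defect_pow_eq_zero`), hence `∂ η + η ∂` is invertible there. Everything is
assembled in `exists_homotopyEquiv_of_nf`.
-/

noncomputable section

open scoped DirectSum

section

variable {R : Type u} [CommRing R] {N : ℕ}

/-! ### Homotopy equivalences from contractions of the kernel -/

section Perturbation

/-- The anticommutator `d h + h d` of the differential and a map of degree one. -/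
def anti (K : Ch R N) (h : ∀ a b, K.X a →ₗ[R] K.X b) (a : Deg N) : K.X a →ₗ[R] K.X a :=
  del K (a + 1) a ∘ₗ h a (a + 1) + h (a - 1) a ∘ₗ del K a (a - 1)

theorem anti_apply (K : Ch R N) (h : ∀ a b, K.X a →ₗ[R] K.X b) (a : Deg N) (x : K.X a) :
    anti K h a x = del K (a + 1) a (h a (a + 1) x) + h (a - 1) a (del K a (a - 1) x) := rfl

theorem del_anti (K : Ch R N) (h : ∀ a b, K.X a →ₗ[R] K.X b) (a b : Deg N) (x : K.X a) :
    del K a b (anti K h a x) = anti K h b (del K a b x) := by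
  by_cases hb : b + 1 = a
  · subst hb
    have e : ∀ c, c = b → del K (b + 1) b (h c (b + 1) (del K (b + 1) c x)) =
        del K (b + 1) b (h b (b + 1) (del K (b + 1) b x)) := by rintro c rfl; rfl
    simp only [anti_apply, map_add, del_del, map_zero, zero_add, add_zero]
    exact e _ (add_sub_cancel_right b 1)
  · rw [del_shape K a b hb]; simp

/-- A degreewise split surjection `f` is a homotopy equivalence if its kernel has an endomorphism `h`
of degree one such that `1 - (d h + h d)` is locally nilpotent on it: then `θ = d h + h d` is
invertible on the kernel, and `θ⁻¹ h` contracts it. The maps `q` are projections to the kernel. -/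
theorem HomotopyEquiv.exists_of_kernel {K L : Ch R N} (f : K ⟶ L)
    (hf : ∀ a, Function.Surjective (app f a))
    (h : ∀ a b, K.X a →ₗ[R] K.X b) (hh : ∀ a b x, app f a x = 0 → app f b (h a b x) = 0)
    (q : ∀ a, K.X a →ₗ[R] K.X a) (hq : ∀ a x, app f a (q a x) = 0)
    (hq' : ∀ a x, app f a x = 0 → q a x = x)
    (hN : ∀ a x, app f a x = 0 → ∃ n : ℕ, ((1 - anti K h a) ^ n) x = 0) :
    ∃ e : HomotopyEquiv K L, e.hom = f := by
  have hd : ∀ a b x, app f a x = 0 → app f b (del K a b x) = 0 := fun a b x hx => by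
    rw [app_del, hx, map_zero]
  have hθ : ∀ a x, app f a x = 0 → app f a (anti K h a x) = 0 := fun a x hx => by
    rw [anti_apply, map_add, hd _ _ _ (hh _ _ _ hx), hh _ _ _ (hd _ _ _ hx), add_zero]
  let θ : ∀ a, LinearMap.ker (app f a) →ₗ[R] LinearMap.ker (app f a) := fun a =>
    (anti K h a).restrict fun x hx => hθ a x hx
  have hP : ∀ a (n : ℕ) x, app f a x = 0 → app f a (((1 - anti K h a) ^ n) x) = 0 := by
    intro a n
    induction n with
    | zero => intro x hx; simpa using hx
    | succ n ih =>
      intro x hx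
      rw [pow_succ', Module.End.mul_apply, LinearMap.sub_apply, map_sub, hθ _ _ (ih x hx)]
      simpa using ih x hx
  have hbij : ∀ a, Function.Bijective (θ a) := by
    intro a
    constructor
    · refine (injective_iff_map_eq_zero _).2 fun x hx => ?_
      obtain ⟨n, hn⟩ := hN a x.1 x.2
      have h1 : anti K h a x.1 = 0 := congrArg Subtype.val hx
      have h2 : ∀ n : ℕ, ((1 - anti K h a) ^ n) x.1 = x.1 := by
        intro n
        induction n with
        | zero => rfl
        | succ n ih =>
          rw [pow_succ', Module.End.mul_apply, ih, LinearMap.sub_apply, h1]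
          simp
      exact Subtype.ext ((h2 n).symm.trans hn)
    · intro x
      obtain ⟨n, hn⟩ := hN a x.1 x.2
      refine ⟨⟨(∑ i ∈ Finset.range n, (1 - anti K h a) ^ i) x.1, ?_⟩, Subtype.ext ?_⟩
      · rw [LinearMap.sum_apply]
        exact sum_mem fun i _ => hP a i _ x.2
      · change (anti K h a * ∑ i ∈ Finset.range n, (1 - anti K h a) ^ i) x.1 = x.1
        have h3 := mul_neg_geom_sum (1 - anti K h a) n
        rw [sub_sub_cancel] at h3
        rw [h3, LinearMap.sub_apply, hn, sub_zero]
        rfl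
  let Θ : ∀ a, LinearMap.ker (app f a) ≃ₗ[R] LinearMap.ker (app f a) := fun a =>
    LinearEquiv.ofBijective (θ a) (hbij a)
  -- the contraction of the kernel, extended by the projection `q`
  let k : ∀ a b, K.X a →ₗ[R] K.X b := fun a b =>
    (LinearMap.ker (app f b)).subtype ∘ₗ (Θ b).symm.toLinearMap ∘ₗ
      ((h a b).restrict (p := LinearMap.ker (app f a)) (fun x hx => hh a b x hx)) ∘ₗ
        (q a).codRestrict (LinearMap.ker (app f a)) (hq a)
  have hk : ∀ a b x, app f b (k a b x) = 0 := fun a b x => Subtype.property (p := fun y => y ∈ LinearMap.ker (app f b)) _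
  have hΘ : ∀ a x (hx : app f a x = 0), anti K h a ((Θ a).symm ⟨x, hx⟩).1 = x := fun a x hx =>
    congrArg Subtype.val ((Θ a).apply_symm_apply ⟨x, hx⟩)
  have hΘ' : ∀ a x (hx : app f a x = 0), ∀ y, app f a y = 0 → anti K h a y = x →
      ((Θ a).symm ⟨x, hx⟩).1 = y := by
    intro a x hx y hy e
    have : (Θ a).symm ⟨x, hx⟩ = ⟨y, hy⟩ := by
      rw [LinearEquiv.symm_apply_eq]
      exact Subtype.ext e.symm
    rw [this]
  have hkx : ∀ a b x (hx : app f a x = 0), k a b x = ((Θ b).symm ⟨h a b x, hh a b x hx⟩).1 := by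
    intro a b x hx
    change ((Θ b).symm ⟨h a b (q a x), _⟩).1 = _
    congr 3
    rw [hq' a x hx]
  have hkk : ∀ a x, app f a x = 0 → anti K k a x = x := by
    intro a x hx
    rw [anti_apply, hkx a (a + 1) x hx, hkx (a - 1) a _ (hd _ _ _ hx)]
    have e1 : del K (a + 1) a ((Θ (a + 1)).symm ⟨h a (a + 1) x, hh _ _ _ hx⟩).1 =
        ((Θ a).symm ⟨del K (a + 1) a (h a (a + 1) x), hd _ _ _ (hh _ _ _ hx)⟩).1 := by
      refine (hΘ' a _ _ _ (hd _ _ _ (LinearMap.mem_ker.1 ((Θ (a + 1)).symm _).2)) ?_).symm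
      rw [← del_anti, hΘ]
    rw [e1]
    have e2 := congrArg Subtype.val (((Θ a).symm).map_add ⟨del K (a + 1) a (h a (a + 1) x), hd _ _ _ (hh _ _ _ hx)⟩
      ⟨h (a - 1) a (del K a (a - 1) x), hh _ _ _ (hd _ _ _ hx)⟩)
    refine e2.symm.trans ?_
    exact hΘ' a _ _ x hx rfl
  let s : ∀ a, L.X a → K.X a := fun a => Function.surjInv (hf a)
  have hs : ∀ a y, app f a (s a y) = y := fun a => Function.surjInv_eq (hf a)
  have hker : ∀ a x x', app f a x = app f a x' → x - anti K k a x = x' - anti K k a x' := by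
    intro a x x' e
    have h1 := hkk a (x - x') (by rw [map_sub, e, sub_self])
    rw [map_sub] at h1
    rw [sub_eq_sub_iff_sub_eq_sub, h1]
  let g : L ⟶ K := mkHom (K := L) (L := K) (fun a =>
      { toFun := fun y => s a y - anti K k a (s a y)
        map_add' := fun y y' => by
          rw [hker a (s a (y + y')) (s a y + s a y') (by simp only [map_add, hs])]
          rw [map_add]; abel
        map_smul' := fun r y => by
          rw [hker a (s a (r • y)) (r • s a y) (by simp only [map_smul, hs]), map_smul, smul_sub]
          rfl })
    (fun a b y => by
      change s b (del L a b y) - anti K k b (s b (del L a b y)) =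
        del K a b (s a y - anti K k a (s a y))
      rw [hker b (s b (del L a b y)) (del K a b (s a y)) (by rw [app_del, hs, hs]), map_sub, del_anti])
  have hg : ∀ a x, app g a (app f a x) = x - anti K k a x := by
    intro a x
    change s a (app f a x) - anti K k a (s a (app f a x)) = _
    exact hker a _ _ (hs a _)
  have hfg : g ≫ f = 𝟙 L := hom_ext_app fun a y => by
    rw [app_comp, app_id]
    change app f a (s a y - anti K k a (s a y)) = y
    rw [map_sub, hs, anti_apply, map_add, hd _ _ _ (hk _ _ _), hk, add_zero, sub_zero]
  classical
  let H : Homotopy (𝟙 K) (f ≫ g) :=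
    { hom := fun a b => if (ComplexShape.down (Deg N)).Rel b a then ModuleCat.ofHom (k a b) else 0
      zero := fun a b hab => if_neg hab
      comm := fun a => by
        have r1 : (ComplexShape.down (Deg N)).Rel a (a - 1) := sub_add_cancel a 1
        have r2 : (ComplexShape.down (Deg N)).Rel (a + 1) a := rfl
        rw [dNext_eq _ r1, prevD_eq _ r2, if_pos r1, if_pos r2]
        ext x
        have h1 := hg a x
        change x = k (a - 1) a (del K a (a - 1) x) + del K (a + 1) a (k a (a + 1) x) +
          app g a (app f a x)
        rw [h1, anti_apply]
        abel }
  exact ⟨⟨f, g, H.symm, Homotopy.ofEq hfg⟩, rfl⟩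

/-- If `h` and `q` preserve a subcomplex `S`, then `f` also restricts to a homotopy equivalence of
`S` with its image. -/
theorem HomotopyEquiv.exists_subMap {K L : Ch R N} (f : K ⟶ L) (S : ∀ a, Submodule R (K.X a))
    (hS : ∀ a b x, x ∈ S a → del K a b x ∈ S b)
    (h : ∀ a b, K.X a →ₗ[R] K.X b) (hh : ∀ a b x, app f a x = 0 → app f b (h a b x) = 0)
    (q : ∀ a, K.X a →ₗ[R] K.X a) (hq : ∀ a x, app f a (q a x) = 0)
    (hq' : ∀ a x, app f a x = 0 → q a x = x)
    (hN : ∀ a x, app f a x = 0 → ∃ n : ℕ, ((1 - anti K h a) ^ n) x = 0)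
    (hSh : ∀ a b x, x ∈ S a → h a b x ∈ S b) (hSq : ∀ a x, x ∈ S a → q a x ∈ S a) :
    ∃ e : HomotopyEquiv (subCx K S hS) (subCx L (fun a => (S a).map (app f a)) (del_map_mem f hS)),
      e.hom = subMap f S hS := by
  have h0 : ∀ a (x : S a), app (subMap f S hS) a x = 0 → app f a x.1 = 0 := fun a x hx =>
    congrArg Subtype.val hx
  have h1 : ∀ a (x : S a), app f a x.1 = 0 → app (subMap f S hS) a x = 0 := fun a x hx =>
    Subtype.ext hx
  refine HomotopyEquiv.exists_of_kernel (subMap f S hS) ?_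
    (fun a b => (h a b).restrict (hSh a b)) (fun a b x hx => h1 b _ (hh a b _ (h0 a x hx)))
    (fun a => (q a).restrict (hSq a)) (fun a x => h1 a _ (hq a _))
    (fun a x hx => Subtype.ext (hq' a _ (h0 a x hx))) ?_
  · rintro a ⟨_, x, hx, rfl⟩
    exact ⟨⟨x, hx⟩, rfl⟩
  · intro a x hx
    obtain ⟨n, hn⟩ := hN a x.1 (h0 a x hx)
    refine ⟨n, ?_⟩
    have key : ∀ n : ℕ, Subtype.val (p := fun y => y ∈ S a)
        (((1 - anti (subCx K S hS) (fun a b => (h a b).restrict (hSh a b)) a) ^ n) x) =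
          ((1 - anti K h a) ^ n) x.1 := by
      intro n
      induction n with
      | zero => rfl
      | succ n ih =>
        rw [pow_succ', pow_succ', Module.End.mul_apply, Module.End.mul_apply, ← ih]
        rfl
    exact Subtype.ext ((key n).trans hn)

end Perturbation

/-! ### Abstract bar constructions and the homotopy -/

open Classical in
/-- The formal properties of the bar construction of a module over a category `𝒞` with bases of its
morphisms, for the total modules in which the gradings have been forgotten.

An object `z` of `Option Ob` is an object of `𝒞`, or `none` for the place at which the Kan extension
is evaluated. `V x z` are the morphisms, with composition `comp` and differential `d`, and
`T z` is spanned by the module itself, called `base z`, and by the tensors `ten r v` for `r` in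
`T (some x)` and `v` in `V x z`. `act` is the module structure, on the last factor of a
tensor, `bd` is the total differential, and `ε`, `εV` are the signs of the degree. The elements `e i`
are a basis of `V x z` over the endomorphisms of `x`, and `rk` is a rank that `d` lowers;
`V x (some x)` has the single basis element `one x`. `coef` are the coefficients of a tensor with
respect to the basis, `bp` is the projection to `base`, `η` is the homotopy, and `nf` moves the
endomorphisms of the objects to the left in a tensor. -/
structure BarSystem (R : Type u) [CommRing R] where
  Ob : Type u
  T : Option Ob → Type u
  V : Ob → Option Ob → Type u
  [addT : ∀ z, AddCommGroup (T z)]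
  [modT : ∀ z, Module R (T z)]
  [addV : ∀ x z, AddCommGroup (V x z)]
  [modV : ∀ x z, Module R (V x z)]
  base : ∀ z, Submodule R (T z)
  ten : ∀ {x z}, T (some x) →ₗ[R] V x z →ₗ[R] T z
  act : ∀ {x z}, T (some x) →ₗ[R] V x z →ₗ[R] T z
  comp : ∀ {x y z}, V x (some y) →ₗ[R] V y z →ₗ[R] V x z
  one : ∀ x, V x (some x)
  comp_assoc : ∀ {w x y z} (a : V w (some x)) (b : V x (some y)) (c : V y z),
    comp (comp a b) c = comp a (comp b c)
  one_comp : ∀ {x z} (v : V x z), comp (one x) v = v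
  comp_one : ∀ {x y} (v : V x (some y)), comp v (one y) = v
  act_ten : ∀ {w x z} (r : T (some w)) (m : V w (some x)) (v : V x z),
    act (ten r m) v = ten r (comp m v)
  act_base : ∀ {x z} (b : T (some x)) (v : V x z), b ∈ base (some x) → act b v ∈ base z
  act_act : ∀ {w x z} (r : T (some w)) (m : V w (some x)) (v : V x z),
    act (act r m) v = act r (comp m v)
  act_one : ∀ {x} (r : T (some x)), act r (one x) = r
  d : ∀ {x z}, V x z →ₗ[R] V x z
  d_comp : ∀ {x z} (s : V x (some x)) (v : V x z), d (comp s v) = comp s (d v)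
  ε : ∀ z, T z →ₗ[R] T z
  εV : ∀ x z, V x z →ₗ[R] V x z
  εV_comp : ∀ {x z} (s : V x (some x)) (v : V x z), εV x z (comp s v) = comp s (εV x z v)
  ε_base : ∀ {z} (b : T z), b ∈ base z → ε z b ∈ base z
  ε_ten : ∀ {x z} (r : T (some x)) (v : V x z), ε z (ten r v) = ten (ε _ r) (εV x z v)
  ε_act : ∀ {x} (r : T (some x)) (s : V x (some x)), ε _ (act r s) = act (ε _ r) s
  bd : ∀ z, T z →ₗ[R] T z
  bd_base : ∀ {z} (b : T z), b ∈ base z → bd z b ∈ base z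
  bd_ten : ∀ {x z} (r : T (some x)) (v : V x z),
    bd z (ten r v) = act r v - ten (bd _ r) v + ten (ε _ r) (d v)
  bd_act : ∀ {x} (r : T (some x)) (s : V x (some x)), bd _ (act r s) = act (bd _ r) s
  ι : Ob → Option Ob → Type u
  e : ∀ {x z}, ι x z → V x z
  rk : ∀ {x z}, ι x z → ℕ
  V_span : ∀ {x z} (v : V x z), v ∈ Submodule.span R {v | ∃ (s : V x (some x)) (i : ι x z), v = comp s (e i)}
  d_e : ∀ {x z} (i : ι x z), d (e i) ∈ Submodule.span R
    {v | ∃ (s : V x (some x)) (j : ι x z), rk j < rk i ∧ v = comp s (e j)}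
  diag : ∀ x, ι x (some x)
  diag_eq : ∀ {x} (i : ι x (some x)), i = diag x
  e_diag : ∀ x, e (diag x) = one x
  d_one : ∀ x, d (one x) = 0
  coef : ∀ z, T z →ₗ[R] ⨁ q : (Σ x, ι x z), T (some q.1)
  coef_base : ∀ {z} (b : T z), b ∈ base z → coef z b = 0
  coef_ten : ∀ {x z} (r : T (some x)) (s : V x (some x)) (i : ι x z),
    coef z (ten r (comp s (e i))) =
      DirectSum.lof R (Σ x, ι x z) (fun q => T (some q.1)) ⟨x, i⟩ (act r s)
  bp : ∀ z, T z →ₗ[R] T z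
  bp_base : ∀ {z} (b : T z), b ∈ base z → bp z b = b
  bp_ten : ∀ {x z} (r : T (some x)) (v : V x z), bp z (ten r v) = 0
  η : ∀ z, T z →ₗ[R] T z
  η_base : ∀ {z} (b : T z), b ∈ base z → η z b = 0
  η_ten : ∀ {x z} (r : T (some x)) (s : V x (some x)) (i : ι x z),
    η z (ten r (comp s (e i))) = ten (ten r s) (e i) - ten (η _ (act r s)) (e i)
  nf : ∀ z, T z →ₗ[R] T z
  nf_base : ∀ {z} (b : T z), b ∈ base z → nf z b = b
  nf_ten : ∀ {x z} (r : T (some x)) (s : V x (some x)) (i : ι x z),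
    nf z (ten r (comp s (e i))) = ten (nf _ (act r s)) (e i)

attribute [instance] BarSystem.addT BarSystem.modT BarSystem.addV BarSystem.modV

namespace BarSystem

variable {R : Type u} [CommRing R] (S : BarSystem R)

/-- The elements of the `m`-th stage of the filtration in which the tensors with `V x z` count as
`st x z` steps. The base lies in the first stage. -/
inductive Fil (st : S.Ob → Option S.Ob → ℕ) : ℕ → ∀ z, S.T z → Prop
  | zero (m z) : Fil st m z 0
  | add {m z t t'} : Fil st m z t → Fil st m z t' → Fil st m z (t + t')
  | base {m z b} : 1 ≤ m → b ∈ S.base z → Fil st m z b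
  | ten {m m' x z r} (v : S.V x z) : Fil st m (some x) r → m + st x z ≤ m' → Fil st m' z (S.ten r v)

variable {S} {st : S.Ob → Option S.Ob → ℕ}

theorem Fil.smul {m z t} (c : R) (h : S.Fil st m z t) : S.Fil st m z (c • t) := by
  induction h with
  | zero m z => rw [smul_zero]; exact .zero _ _
  | add _ _ h h' => rw [smul_add]; exact .add h h'
  | base hm hb => exact .base hm (Submodule.smul_mem _ c hb)
  | ten v hr hm ih => rw [← LinearMap.map_smul]; exact .ten _ hr hm

variable (S st) in
/-- The filtration as a submodule. -/
def fil (m : ℕ) (z : Option S.Ob) : Submodule R (S.T z) where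
  carrier := {t | S.Fil st m z t}
  zero_mem' := .zero m z
  add_mem' := .add
  smul_mem' c _ h := h.smul c

theorem mem_fil {m z t} : t ∈ S.fil st m z ↔ S.Fil st m z t := Iff.rfl

theorem fil_mono {m m' : ℕ} (h : m ≤ m') {z t} (ht : t ∈ S.fil st m z) : t ∈ S.fil st m' z := by
  rw [mem_fil] at ht
  induction ht generalizing m' with
  | zero m z => exact zero_mem _
  | add _ _ h1 h2 => exact add_mem (h1 h) (h2 h)
  | base hm hb => exact .base (hm.trans h) hb
  | ten v hr hm ih => exact .ten v hr (hm.trans h)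

theorem ten_mem_fil {m m' : ℕ} {x z r} (v : S.V x z) (hr : r ∈ S.fil st m (some x))
    (h : m + st x z ≤ m') : S.ten r v ∈ S.fil st m' z := Fil.ten v hr h

theorem fil_zero {m : ℕ} (hm : m = 0) {z t} (ht : t ∈ S.fil st m z) : t = 0 := by
  rw [mem_fil] at ht
  induction ht with
  | zero m z => rfl
  | add _ _ h h' => rw [h hm, h' hm, add_zero]
  | base h hb => omega
  | ten v hr h ih => rw [ih (by omega), map_zero, LinearMap.zero_apply]

theorem act_mem_fil (htri : ∀ x y z, st x z ≤ st x (some y) + st y z) {m m' : ℕ} {x z r}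
    (hr : r ∈ S.fil st m (some x)) (v : S.V x z) (h : m + st x z ≤ m') : S.act r v ∈ S.fil st m' z := by
  suffices H : ∀ m y (t : S.T y), S.Fil st m y t → ∀ (hy : y = some x), m + st x z ≤ m' →
    S.act (hy ▸ t : S.T (some x)) v ∈ S.fil st m' z from H m _ r hr rfl h
  clear h hr m
  intro m y t ht
  induction ht with
  | zero m z => rintro rfl h; rw [map_zero]; exact zero_mem _
  | add _ _ h1 h2 =>
    rintro rfl h
    have := Submodule.add_mem _ (h1 rfl h) (h2 rfl h)
    rwa [← LinearMap.add_apply, ← map_add] at this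
  | base hm hb => rintro rfl h; exact .base (by omega) (S.act_base _ _ hb)
  | @ten m m'' w _ r μ hr hm ih =>
    rintro rfl h
    change S.act (S.ten r μ) v ∈ _
    rw [S.act_ten]
    have := htri w x z
    exact ten_mem_fil _ hr (by omega)

theorem act_mem_fil_diag {m : ℕ} {x r} (hr : r ∈ S.fil st m (some x)) (v : S.V x (some x)) :
    S.act r v ∈ S.fil st m (some x) := by
  suffices H : ∀ y (t : S.T y), S.Fil st m y t → ∀ (hy : y = some x),
    S.act (hy ▸ t : S.T (some x)) v ∈ S.fil st m (some x) from H _ r hr rfl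
  clear hr
  intro y t ht
  induction ht with
  | zero m z => rintro rfl; rw [map_zero]; exact zero_mem _
  | add _ _ h1 h2 =>
    rintro rfl
    have := Submodule.add_mem _ (h1 rfl) (h2 rfl)
    rwa [← LinearMap.add_apply, ← map_add] at this
  | base hm hb => rintro rfl; exact .base (by omega) (S.act_base _ _ hb)
  | @ten m m'' w _ r μ hr hm ih =>
    rintro rfl
    change S.act (S.ten r μ) v ∈ _
    rw [S.act_ten]
    exact ten_mem_fil _ hr hm

theorem coef_mem_fil {m : ℕ} {z t} (ht : t ∈ S.fil st m z) (q : Σ x, S.ι x z) :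
    S.coef z t q ∈ S.fil st (m - st q.1 z) (some q.1) := by
  classical
  rw [mem_fil] at ht
  induction ht with
  | zero m z => rw [map_zero]; exact zero_mem _
  | add _ _ h1 h2 => rw [map_add]; exact add_mem (h1 q) (h2 q)
  | base hm hb => rw [S.coef_base _ hb]; exact zero_mem _
  | @ten m m' w z r v hr hm ih =>
    refine Submodule.span_induction (p := fun v _ => S.coef z (S.ten r v) q ∈
      S.fil st (m' - st q.1 z) (some q.1)) ?_ ?_ ?_ ?_ (S.V_span v)
    · rintro _ ⟨s, i, rfl⟩
      rw [S.coef_ten]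
      by_cases hq : (⟨w, i⟩ : Σ x, S.ι x z) = q
      · subst hq
        convert fil_mono _ (act_mem_fil_diag hr s) using 1
        · exact DirectSum.lof_apply R _ _
        · exact Nat.le_sub_of_add_le hm
      · have : DirectSum.lof R (Σ x, S.ι x z) (fun q => S.T (some q.1)) ⟨w, i⟩ (S.act r s) q = 0 :=
          DFinsupp.single_eq_of_ne (Ne.symm hq)
        convert Submodule.zero_mem _
    · simp only [map_zero]; exact zero_mem _
    · intro v v' _ _ h h'
      simp only [map_add]; exact add_mem h h'
    · intro c v _ h
      simp only [map_smul]; exact Submodule.smul_mem _ c h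

theorem ε_mem_fil {m : ℕ} {z t} (ht : t ∈ S.fil st m z) : S.ε z t ∈ S.fil st m z := by
  rw [mem_fil] at ht
  induction ht with
  | zero m z => rw [map_zero]; exact zero_mem _
  | add _ _ h h' => rw [map_add]; exact add_mem h h'
  | base h hb => exact .base h (S.ε_base _ hb)
  | ten v hr h ih => rw [S.ε_ten]; exact ten_mem_fil _ ih h

theorem bd_mem_fil (htri : ∀ x y z, st x z ≤ st x (some y) + st y z)
    {m : ℕ} {z t} (ht : t ∈ S.fil st m z) : S.bd z t ∈ S.fil st m z := by
  rw [mem_fil] at ht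
  induction ht with
  | zero m z => rw [map_zero]; exact zero_mem _
  | add _ _ h h' => rw [map_add]; exact add_mem h h'
  | base h hb => exact .base h (S.bd_base _ hb)
  | ten v hr h ih =>
    rw [S.bd_ten]
    exact add_mem (Submodule.sub_mem _ (act_mem_fil htri hr v h) (ten_mem_fil _ ih h))
      (ten_mem_fil _ (ε_mem_fil hr) h)

/-- Induction on the expansion of a morphism in a basis. -/
theorem V_induction {x z} {p : S.V x z → Prop} (v : S.V x z)
    (h : ∀ (s : S.V x (some x)) (i : S.ι x z), p (S.comp s (S.e i))) (h0 : p 0) (hadd : ∀ v v', p v → p v' → p (v + v')) : p v := by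
  have key := Submodule.span_induction (p := fun v _ => ∀ c : R, p (c • v)) ?_ ?_ ?_ ?_ (S.V_span v)
  · simpa using key 1
  · rintro _ ⟨s, i, rfl⟩ c
    have := h (c • s) i
    rwa [map_smul, LinearMap.smul_apply] at this
  · intro c; rwa [smul_zero]
  · intro v v' _ _ h h' c
    rw [smul_add]; exact hadd _ _ (h c) (h' c)
  · intro c v _ h c'
    rw [smul_smul]; exact h _

theorem η_mem_fil (hst : ∀ x, st x (some x) = 0) {m : ℕ} {z t} (ht : t ∈ S.fil st m z) :
    S.η z t ∈ S.fil st m z := by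
  suffices H : ∀ m y (t : S.T y), S.Fil st m y t → S.η y t ∈ S.fil st m y ∧ ∀ x (hy : y = some x) s,
    S.η (some x) (S.act (hy ▸ t : S.T (some x)) s) ∈ S.fil st m (some x) from (H m _ t ht).1
  clear ht t z m
  intro m y t ht
  induction ht with
  | zero m z =>
    refine ⟨by rw [map_zero]; exact zero_mem _, ?_⟩
    rintro x rfl s
    rw [map_zero, LinearMap.zero_apply, map_zero]; exact zero_mem _
  | add _ _ h1 h2 =>
    refine ⟨by rw [map_add]; exact add_mem h1.1 h2.1, ?_⟩
    rintro x rfl s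
    have := Submodule.add_mem _ (h1.2 x rfl s) (h2.2 x rfl s)
    rwa [← map_add, ← LinearMap.add_apply, ← map_add] at this
  | base hm hb =>
    refine ⟨by rw [S.η_base _ hb]; exact zero_mem _, ?_⟩
    rintro x rfl s
    rw [S.η_base _ (S.act_base _ _ hb)]; exact zero_mem _
  | @ten m m'' w z r μ hr hm ih =>
    have key : ∀ v : S.V w z, S.η z (S.ten r v) ∈ S.fil st m'' z := by
      intro v
      refine V_induction (p := fun v => S.η z (S.ten r v) ∈ S.fil st m'' z) v ?_ ?_ ?_
      · intro s i
        rw [S.η_ten]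
        exact sub_mem (ten_mem_fil _ (ten_mem_fil _ hr (by rw [hst, add_zero])) hm)
          (ten_mem_fil _ (ih.2 w rfl s) hm)
      · rw [map_zero, map_zero]; exact zero_mem _
      · intro v v' h h'
        rw [map_add, map_add]; exact add_mem h h'
    refine ⟨key μ, ?_⟩
    rintro x rfl s
    change S.η _ (S.act (S.ten r μ) s) ∈ _
    rw [S.act_ten]
    exact key _

variable (S) in
/-- The endomorphism `1 - (∂ η + η ∂)`. -/
def defect (z : Option S.Ob) : Module.End R (S.T z) := 1 - (S.bd z ∘ₗ S.η z + S.η z ∘ₗ S.bd z)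

theorem defect_apply {z} (t : S.T z) : S.defect z t = t - (S.bd z (S.η z t) + S.η z (S.bd z t)) := rfl

theorem defect_base {z} {b : S.T z} (hb : b ∈ S.base z) : S.defect z b = b := by
  rw [defect_apply, S.η_base _ hb, S.η_base _ (S.bd_base _ hb), map_zero, add_zero, sub_zero]

theorem defect_mem_fil (htri : ∀ x y z, st x z ≤ st x (some y) + st y z)
    (hst : ∀ x, st x (some x) = 0) {m : ℕ} {z t} (ht : t ∈ S.fil st m z) :
    S.defect z t ∈ S.fil st m z :=
  Submodule.sub_mem _ ht (Submodule.add_mem _ (bd_mem_fil htri (η_mem_fil hst ht))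
    (η_mem_fil hst (bd_mem_fil htri ht)))

/-- If `x` is not `z`, the terms other than the first have fewer essential steps or a lower rank. -/
theorem defect_ten {x z} (r : S.T (some x)) (s : S.V x (some x)) (i : S.ι x z) :
    S.defect z (S.ten r (S.comp s (S.e i))) = S.ten (S.defect _ (S.act r s)) (S.e i) -
      (S.η z (S.act r (S.comp s (S.e i))) - S.act (S.η _ (S.act r s)) (S.e i)) -
      (S.ten (S.ε _ (S.ten r s)) (S.d (S.e i)) - S.ten (S.ε _ (S.η _ (S.act r s))) (S.d (S.e i)) +
        S.η z (S.ten (S.ε _ r) (S.comp s (S.d (S.e i))))) := by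
  have hs : S.d s = 0 := by
    have := S.d_comp s (S.one x)
    rwa [S.comp_one, S.d_one, map_zero] at this
  have h1 : S.bd z (S.ten r (S.comp s (S.e i))) = S.act r (S.comp s (S.e i)) -
      S.ten (S.bd _ r) (S.comp s (S.e i)) + S.ten (S.ε _ r) (S.comp s (S.d (S.e i))) := by
    rw [S.bd_ten, S.d_comp]
  have h2 : S.bd _ (S.ten r s) = S.act r s - S.ten (S.bd _ r) s := by
    rw [S.bd_ten, hs, map_zero, add_zero]
  rw [defect_apply, defect_apply, h1, S.η_ten, map_sub (S.bd z), S.bd_ten (S.ten r s),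
    S.bd_ten (S.η _ _), S.act_ten, h2, S.bd_act]
  simp only [map_sub, map_add, LinearMap.sub_apply, LinearMap.add_apply, S.η_ten]
  abel

theorem defect_ten_diag {x} (r : S.T (some x)) (s : S.V x (some x)) :
    S.defect _ (S.ten r s) = S.ten (S.defect _ (S.act r s)) (S.one x) := by
  have := defect_ten r s (S.diag x)
  rwa [S.e_diag, S.comp_one, S.d_one, S.act_one, map_zero, map_zero, map_zero, map_zero, map_zero, sub_self,
    sub_self, add_zero, sub_zero, sub_zero] at this

open Classical in
/-- The number of essential steps from `x` to `z`. -/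
def ess (x : S.Ob) (z : Option S.Ob) : ℕ := if z = some x then 0 else 1

theorem ess_self (x : S.Ob) : ess x (some x) = 0 := if_pos rfl

theorem ess_tri (x y : S.Ob) (z : Option S.Ob) : ess x z ≤ ess x (some y) + ess y z := by
  unfold ess
  split_ifs <;> simp_all

/-- The homotopy commutes with the action of `s e` up to elements that do not have more essential
steps than the argument: a nonidentity last step of the argument is merged with `s e`. -/
theorem commutator_mem_fil {m : ℕ} {x z} {r : S.T (some x)} (hr : r ∈ S.fil ess m (some x))
    (s : S.V x (some x)) (i : S.ι x z) :
    S.η z (S.act r (S.comp s (S.e i))) - S.act (S.η _ (S.act r s)) (S.e i) ∈ S.fil ess m z := by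
  suffices H : ∀ y (t : S.T y), S.Fil ess m y t → ∀ (hy : y = some x),
    S.η z (S.act (hy ▸ t : S.T (some x)) (S.comp s (S.e i))) -
      S.act (S.η _ (S.act (hy ▸ t : S.T (some x)) s)) (S.e i) ∈ S.fil ess m z from H _ r hr rfl
  clear hr
  intro y t ht
  induction ht with
  | zero m z => rintro rfl; simp
  | @add _ _ a b _ _ h1 h2 =>
    rintro rfl
    have := Submodule.add_mem _ (h1 rfl) (h2 rfl)
    change S.η z (S.act (a + b) _) - S.act (S.η _ (S.act (a + b) s)) (S.e i) ∈ _
    simp only [map_add, LinearMap.add_apply] at this ⊢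
    convert this using 1
    abel
  | @base _ _ b hm hb =>
    rintro rfl
    change S.η z (S.act b _) - S.act (S.η _ (S.act b s)) (S.e i) ∈ _
    rw [S.η_base _ (S.act_base _ _ hb), S.η_base _ (S.act_base _ _ hb)]
    simp
  | @ten m m' w _ r' μ hr hm ih =>
    rintro rfl
    change S.η z (S.act (S.ten r' μ) _) - S.act (S.η _ (S.act (S.ten r' μ) s)) (S.e i) ∈ _
    rw [S.act_ten, S.act_ten]
    by_cases hwx : w = x
    · subst hwx
      have h1 := S.η_ten r' (S.comp μ s) (S.diag w)
      rw [S.e_diag, S.comp_one] at h1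
      rw [← S.comp_assoc, S.η_ten, h1, map_sub, LinearMap.sub_apply, S.act_ten, S.act_ten, S.one_comp, sub_self]
      exact zero_mem _
    · have h1 : ess w (some x) = 1 := if_neg fun h => hwx (Option.some.inj h).symm
      have h2 : ess w z ≤ 1 := by unfold ess; split_ifs <;> simp
      refine Submodule.sub_mem _ (η_mem_fil ess_self (ten_mem_fil _ hr (by omega))) ?_
      refine V_induction (p := fun v => S.act (S.η _ (S.ten r' v)) (S.e i) ∈ S.fil ess m' z)
        (S.comp μ s) ?_ ?_ ?_
      · intro s' j
        rw [S.η_ten, map_sub, LinearMap.sub_apply, S.act_ten, S.act_ten]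
        exact Submodule.sub_mem _
          (ten_mem_fil _ (ten_mem_fil _ hr (by rw [ess_self, add_zero])) (by omega))
          (ten_mem_fil _ (η_mem_fil ess_self (act_mem_fil_diag hr s')) (by omega))
      · simp
      · intro v v' h h'
        simp only [map_add, LinearMap.add_apply]
        exact add_mem h h'

end BarSystem

/-! ### Local nilpotence of the defect on the kernel -/

namespace BarSystem

variable {R : Type u} [CommRing R] {S : BarSystem R}

/-- The linear map `r ↦ r ⊗ v`. -/
def tenR {x z} (v : S.V x z) : S.T (some x) →ₗ[R] S.T z := S.ten.flip v

theorem tenR_apply {x z} (v : S.V x z) (r : S.T (some x)) : tenR v r = S.ten r v := rfl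

open Classical in
/-- The sum of linear functions of the coefficients. -/
def comb {z} {W : Type u} [AddCommGroup W] [Module R W]
    (φ : ∀ q : Σ x, S.ι x z, S.T (some q.1) →ₗ[R] W) : S.T z →ₗ[R] W :=
  DirectSum.toModule R _ W φ ∘ₗ S.coef z

section Comb

variable {z : Option S.Ob} {W : Type u} [AddCommGroup W] [Module R W]
  (φ : ∀ q : Σ x, S.ι x z, S.T (some q.1) →ₗ[R] W)

theorem comb_base {b : S.T z} (hb : b ∈ S.base z) : comb φ b = 0 := by
  rw [comb, LinearMap.comp_apply, S.coef_base _ hb, map_zero]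

theorem comb_ten {x} (r : S.T (some x)) (s : S.V x (some x)) (i : S.ι x z) :
    comb φ (S.ten r (S.comp s (S.e i))) = φ ⟨x, i⟩ (S.act r s) := by
  classical
  rw [comb, LinearMap.comp_apply, S.coef_ten]
  exact DirectSum.toModule_lof R _ _

theorem comb_mem {t : S.T z} (P : Submodule R W) (h : ∀ q : Σ x, S.ι x z, φ q (S.coef z t q) ∈ P) :
    comb φ t ∈ P := by
  classical
  rw [comb, LinearMap.comp_apply]
  generalize S.coef z t = c at h
  have : DirectSum.toModule R (Σ x, S.ι x z) W φ c = DFinsupp.sum c fun q t => φ q t := by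
    rw [DirectSum.toModule, DFinsupp.lsum_apply_apply, DFinsupp.sumAddHom_apply]
    rfl
  rw [this]
  exact sum_mem fun q _ => h q

end Comb

/-- The filtration by simplicial level. -/
abbrev lev (n : ℕ) (z : Option S.Ob) : Submodule R (S.T z) := S.fil (fun _ _ => 1) n z

theorem coef_mem_lev {n : ℕ} {z t} (ht : t ∈ S.lev (n + 1) z) (q : Σ x, S.ι x z) :
    S.coef z t q ∈ S.lev n (some q.1) := coef_mem_fil ht q

theorem coef_mem_ess {m : ℕ} {z t} (ht : t ∈ S.fil ess (m + 1) z) (q : Σ x, S.ι x z)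
    (h : z ≠ some q.1) : S.coef z t q ∈ S.fil ess m (some q.1) := by
  have := coef_mem_fil ht q
  rwa [ess, if_neg h] at this

theorem lev_induction {z} {p : S.T z → Prop} {n : ℕ} {t : S.T z} (ht : t ∈ S.lev (n + 1) z)
    (h0 : p 0) (hadd : ∀ t t', p t → p t' → p (t + t')) (hb : ∀ b, b ∈ S.base z → p b)
    (hten : ∀ x (r : S.T (some x)) s (i : S.ι x z), r ∈ S.lev n (some x) →
      p (S.ten r (S.comp s (S.e i)))) : p t := by
  rw [mem_fil] at ht
  generalize hm : n + 1 = m at ht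
  induction ht with
  | zero => exact h0
  | add _ _ h1 h2 => exact hadd _ _ (h1 h0 hadd hb hten hm) (h2 h0 hadd hb hten hm)
  | base _ h => exact hb _ h
  | @ten _ _ x z r v hr hm' ih =>
    exact V_induction (p := fun v => p (S.ten r v)) v (fun s i => hten _ _ s i (fil_mono (by omega) hr)) (by rwa [map_zero])
      (fun v v' h h' => by rw [map_add]; exact hadd _ _ h h')

/-- The submodules generated by the differences `r s ⊗ v - r ⊗ s v`. -/
inductive Ker : ∀ z, S.T z → Prop
  | zero (z) : Ker z 0
  | add {z t t'} : Ker z t → Ker z t' → Ker z (t + t')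
  | rel {x z} (r : S.T (some x)) (s : S.V x (some x)) (v : S.V x z) :
      Ker z (S.ten (S.act r s) v - S.ten r (S.comp s v))
  | ten {x z k} (v : S.V x z) : Ker (some x) k → Ker z (S.ten k v)

theorem Ker.smul {z t} (c : R) (h : S.Ker z t) : S.Ker z (c • t) := by
  induction h with
  | zero z => rw [smul_zero]; exact .zero _
  | add _ _ h h' => rw [smul_add]; exact .add h h'
  | rel r s v =>
    rw [smul_sub, ← LinearMap.map_smul, ← LinearMap.map_smul, ← LinearMap.map_smul]
    exact .rel _ _ _
  | ten v h ih => rw [← LinearMap.map_smul]; exact .ten _ h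

variable (S) in
/-- The submodule generated by the differences `r s ⊗ v - r ⊗ s v`. -/
def K (z : Option S.Ob) : Submodule R (S.T z) where
  carrier := {t | S.Ker z t}
  zero_mem' := .zero z
  add_mem' := .add
  smul_mem' c _ h := h.smul c

theorem mem_K {z t} : t ∈ S.K z ↔ S.Ker z t := Iff.rfl

theorem K_ten {x z} (k : S.T (some x)) (v : S.V x z) (hk : k ∈ S.K (some x)) : S.ten k v ∈ S.K z :=
  Ker.ten v hk

theorem K_rel {x z} (r : S.T (some x)) (s : S.V x (some x)) (v : S.V x z) :
    S.ten (S.act r s) v - S.ten r (S.comp s v) ∈ S.K z := Ker.rel r s v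

theorem K_act {x z} {k : S.T (some x)} (v : S.V x z) (hk : k ∈ S.K (some x)) : S.act k v ∈ S.K z := by
  suffices H : ∀ y (t : S.T y), S.Ker y t → ∀ (hy : y = some x),
    S.act (hy ▸ t : S.T (some x)) v ∈ S.K z from H _ k hk rfl
  clear hk
  intro y t ht
  induction ht with
  | zero z => rintro rfl; rw [map_zero]; exact zero_mem _
  | add _ _ h1 h2 =>
    rintro rfl
    have := Submodule.add_mem _ (h1 rfl) (h2 rfl)
    rwa [← LinearMap.add_apply, ← map_add] at this
  | rel r s m =>
    rintro rfl
    change S.act (S.ten (S.act r s) m - S.ten r (S.comp s m)) v ∈ S.K z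
    rw [map_sub, LinearMap.sub_apply, S.act_ten, S.act_ten, S.comp_assoc]
    exact K_rel _ _ _
  | ten m h ih =>
    rintro rfl
    change S.act (S.ten _ m) v ∈ S.K z
    rw [S.act_ten]
    exact K_ten _ _ h

theorem K_bp {z} (k : S.T z) (hk : k ∈ S.K z) : S.bp z k = 0 := by
  rw [mem_K] at hk
  induction hk with
  | zero z => rw [map_zero]
  | add _ _ h h' => rw [map_add, h, h', add_zero]
  | rel r s v => rw [map_sub, S.bp_ten, S.bp_ten, sub_zero]
  | ten v h ih => rw [S.bp_ten]

theorem K_ε {z} {k : S.T z} (hk : k ∈ S.K z) : S.ε z k ∈ S.K z := by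
  rw [mem_K] at hk
  induction hk with
  | zero z => rw [map_zero]; exact zero_mem _
  | add _ _ h h' => rw [map_add]; exact add_mem h h'
  | @rel x z r s v =>
    have h1 : ∀ m : S.V x (some x), S.ten (S.ε _ r) (S.εV x z (S.comp m v)) =
        S.ten (S.ε _ r) (S.comp m (S.εV x z v)) := fun m => by rw [S.εV_comp]
    rw [map_sub, S.ε_ten, S.ε_ten, S.ε_act, h1]
    exact K_rel _ _ _
  | ten v h ih => rw [S.ε_ten]; exact K_ten _ _ ih

theorem K_bd {z} (k : S.T z) (hk : k ∈ S.K z) : S.bd z k ∈ S.K z := by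
  rw [mem_K] at hk
  induction hk with
  | zero z => rw [map_zero]; exact zero_mem _
  | add _ _ h h' => rw [map_add]; exact add_mem h h'
  | rel r s v =>
    rw [map_sub, S.bd_ten, S.bd_ten, S.bd_act, S.act_act, S.ε_act, S.d_comp]
    convert Submodule.sub_mem _ (K_rel (S.ε _ r) s (S.d v)) (K_rel (S.bd _ r) s v) using 1
    abel
  | ten v h ih =>
    rw [S.bd_ten]
    exact add_mem (Submodule.sub_mem _ (K_act _ h) (K_ten _ _ ih)) (K_ten _ _ (K_ε h))

theorem K_coef {z} (k : S.T z) (hk : k ∈ S.K z) (q : Σ x, S.ι x z) : S.coef z k q ∈ S.K (some q.1) := by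
  classical
  rw [mem_K] at hk
  induction hk with
  | zero z => rw [map_zero]; exact zero_mem _
  | add _ _ h h' => rw [map_add]; exact add_mem (h q) (h' q)
  | @rel x z r s v =>
    suffices H : S.coef z (S.ten (S.act r s) v - S.ten r (S.comp s v)) = 0 by
      rw [H]; exact zero_mem _
    refine V_induction (p := fun v => S.coef z (S.ten (S.act r s) v - S.ten r (S.comp s v)) = 0) v
      ?_ ?_ ?_
    · intro s' i
      rw [← S.comp_assoc, map_sub, S.coef_ten, S.coef_ten, S.act_act, sub_self]
    · simp
    · intro v v' h h'
      simp only [map_add, map_sub] at h h' ⊢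
      rw [add_sub_add_comm, h, h', add_zero]
  | @ten x z k v h ih =>
    refine V_induction (p := fun v => S.coef z (S.ten k v) q ∈ S.K (some q.1)) v ?_ ?_ ?_
    · intro s i
      rw [S.coef_ten]
      by_cases hq : (⟨x, i⟩ : Σ x, S.ι x z) = q
      · subst hq
        convert K_act s h using 1
        exact DirectSum.lof_apply R _ _
      · have : DirectSum.lof R (Σ x, S.ι x z) (fun q => S.T (some q.1)) ⟨x, i⟩ (S.act k s) q = 0 :=
          DFinsupp.single_eq_of_ne (Ne.symm hq)
        convert Submodule.zero_mem _
    · simp only [map_zero]; exact zero_mem _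
    · intro v v' h h'
      simp only [map_add]; exact add_mem h h'

variable (S) in
/-- Every element is a finite sum of elements of finite simplicial level. -/
def Exhaustive : Prop := ∀ z (t : S.T z), ∃ n, t ∈ S.lev n z

theorem η_sub_comb_mem_K {n : ℕ} {z} {t : S.T z} (ht : t ∈ S.lev (n + 1) z) :
    S.η z t - comb (fun q => tenR (S.e q.2) ∘ₗ (tenR (S.one q.1) - S.η (some q.1))) t ∈ S.K z := by
  refine lev_induction (p := fun t => S.η z t - comb (fun q => tenR (S.e q.2) ∘ₗ
    (tenR (S.one q.1) - S.η (some q.1))) t ∈ S.K z) ht ?_ ?_ ?_ ?_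
  · rw [map_zero, map_zero, sub_zero]; exact zero_mem _
  · intro t t' h h'
    rw [map_add, map_add, add_sub_add_comm]; exact add_mem h h'
  · intro b hb
    rw [S.η_base _ hb, comb_base _ hb, sub_zero]; exact zero_mem _
  · intro x r s i _
    rw [S.η_ten, comb_ten]
    have h1 := K_ten _ (S.e i) (K_rel r s (S.one x))
    rw [S.comp_one, map_sub, LinearMap.sub_apply] at h1
    convert Submodule.neg_mem _ h1 using 1
    simp only [LinearMap.comp_apply, LinearMap.sub_apply, tenR_apply, map_sub]
    abel

/-- The homotopy preserves the kernel, by induction on the simplicial level. -/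
theorem η_mem_K {n : ℕ} {z} {k : S.T z} (hn : k ∈ S.lev n z) (hk : k ∈ S.K z) : S.η z k ∈ S.K z := by
  induction n generalizing z with
  | zero => rw [fil_zero rfl hn, map_zero]; exact zero_mem _
  | succ n ih =>
    have h1 := η_sub_comb_mem_K hn
    refine (Submodule.sub_mem_iff_left _ (comb_mem _ _ fun q => ?_)).1 h1
    have hq := K_coef k hk q
    exact K_ten _ _ (Submodule.sub_mem _ (K_ten _ _ hq) (ih (coef_mem_lev hn q) hq))

theorem defect_mem_K (hS : S.Exhaustive) {z} {k : S.T z} (hk : k ∈ S.K z) : S.defect z k ∈ S.K z := by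
  obtain ⟨n, hn⟩ := hS z k
  obtain ⟨n', hn'⟩ := hS z (S.bd z k)
  exact sub_mem hk (Submodule.add_mem _ (K_bd _ (η_mem_K hn hk))
    (η_mem_K hn' (K_bd _ hk)))

theorem sub_nf_mem_K {n : ℕ} {z} {t : S.T z} (ht : t ∈ S.lev n z) : t - S.nf z t ∈ S.K z := by
  induction n generalizing z with
  | zero => rw [fil_zero rfl ht, map_zero, sub_zero]; exact zero_mem _
  | succ n ih =>
    refine lev_induction (p := fun t => t - S.nf z t ∈ S.K z) ht ?_ ?_ ?_ ?_
    · rw [map_zero, sub_zero]; exact zero_mem _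
    · intro t t' h h'
      rw [map_add, add_sub_add_comm]; exact add_mem h h'
    · intro b hb
      rw [S.nf_base _ hb, sub_self]; exact zero_mem _
    · intro x r s i hr
      have h1 := K_ten _ (S.e i) (ih (act_mem_fil_diag hr s))
      have h2 := K_rel r s (S.e i)
      rw [S.nf_ten]
      convert Submodule.sub_mem _ h1 h2 using 1
      simp only [LinearMap.sub_apply, map_sub]
      abel

theorem nf_eq {n : ℕ} {z} {t : S.T z} (ht : t ∈ S.lev (n + 1) z) :
    S.nf z t = S.bp z t + comb (fun q => tenR (S.e q.2) ∘ₗ S.nf _) t := by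
  refine lev_induction (p := fun t => S.nf z t = S.bp z t + comb (fun q => tenR (S.e q.2) ∘ₗ
    S.nf _) t) ht ?_ ?_ ?_ ?_
  · simp
  · intro t t' h h'
    rw [map_add, map_add, map_add, h, h']; abel
  · intro b hb
    rw [S.nf_base _ hb, S.bp_base _ hb, comb_base _ hb, add_zero]
  · intro x r s i _
    rw [S.nf_ten, S.bp_ten, comb_ten, zero_add]
    rfl

/-- The normal form vanishes on the relations; with `sub_nf_mem_K`, its kernel is exactly `K`. -/
theorem nf_eq_zero {n : ℕ} {z} {k : S.T z} (hn : k ∈ S.lev n z) (hk : k ∈ S.K z) : S.nf z k = 0 := by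
  induction n generalizing z with
  | zero => rw [fil_zero rfl hn, map_zero]
  | succ n ih =>
    rw [nf_eq hn, K_bp _ hk, zero_add]
    refine (Submodule.mem_bot R).1 (comb_mem _ _ fun q => ?_)
    rw [LinearMap.comp_apply, ih (coef_mem_lev hn q) (K_coef k hk q), map_zero]
    exact zero_mem _

variable (S) in
/-- The elements on which the defect is nilpotent. -/
def nil (z : Option S.Ob) : Submodule R (S.T z) := Module.End.maxGenEigenspace (S.defect z) 0

theorem mem_nil {z t} : t ∈ S.nil z ↔ ∃ n : ℕ, (S.defect z ^ n) t = 0 := by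
  rw [nil, Module.End.mem_maxGenEigenspace]
  simp

theorem mem_nil_of_defect {z t} (h : S.defect z t ∈ S.nil z) : t ∈ S.nil z := by
  obtain ⟨n, hn⟩ := mem_nil.1 h
  exact mem_nil.2 ⟨n + 1, by rw [pow_succ, Module.End.mul_apply, hn]⟩

theorem defect_mem_nil {z t} (h : t ∈ S.nil z) : S.defect z t ∈ S.nil z := by
  obtain ⟨n, hn⟩ := mem_nil.1 h
  exact mem_nil.2 ⟨n, by rw [← Module.End.mul_apply, ← pow_succ, pow_succ', Module.End.mul_apply, hn, map_zero]⟩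

theorem nil_induction {z} {p : S.T z → Prop} {t : S.T z} (ht : t ∈ S.nil z) (h0 : p 0)
    (P : Submodule R (S.T z)) (htP : t ∈ P) (hP : ∀ t ∈ P, S.defect z t ∈ P)
    (h : ∀ t ∈ P, p (S.defect z t) → p t) : p t := by
  obtain ⟨n, hn⟩ := mem_nil.1 ht
  clear ht
  induction n generalizing t with
  | zero => rw [show t = 0 from hn]; exact h0
  | succ n ih => exact h t htP (ih (hP t htP) (by rwa [pow_succ, Module.End.mul_apply] at hn))

theorem ten_one_mem_nil {x} {r : S.T (some x)} (hr : r ∈ S.nil (some x)) :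
    S.ten r (S.one x) ∈ S.nil (some x) := by
  refine nil_induction (p := fun r => S.ten r (S.one x) ∈ S.nil (some x)) hr ?_ ⊤ trivial
    (fun _ _ => trivial) ?_
  · rw [map_zero]; exact zero_mem _
  · intro t _ h
    refine mem_nil_of_defect ?_
    rwa [defect_ten_diag, S.act_one]

variable (S) in
/-- The span of the `m`-th stage of the essential filtration and of the tensors
`r ⊗ s e` with `r` in this stage and `e` a basis element of rank less than `p`. -/
def rankFil (m p : ℕ) (z : Option S.Ob) : Submodule R (S.T z) :=
  S.fil ess m z ⊔ Submodule.span R {t | ∃ (x : S.Ob) (r : S.T (some x)) (s : S.V x (some x))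
    (i : S.ι x z), z ≠ some x ∧ r ∈ S.fil ess m (some x) ∧ S.rk i < p ∧
      t = S.ten r (S.comp s (S.e i))}

theorem fil_le_rankFil {m p : ℕ} {z} : S.fil ess m z ≤ S.rankFil m p z := le_sup_left

theorem ten_mem_rankFil {m p : ℕ} {x z} (hz : z ≠ some x) {r : S.T (some x)}
    (hr : r ∈ S.fil ess m (some x)) (s : S.V x (some x)) {i : S.ι x z} (hi : S.rk i < p) :
    S.ten r (S.comp s (S.e i)) ∈ S.rankFil m p z :=
  Submodule.mem_sup_right (Submodule.subset_span ⟨x, r, s, i, hz, hr, hi, rfl⟩)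

theorem ten_e_mem_rankFil {m p : ℕ} {x z} (hz : z ≠ some x) {r : S.T (some x)}
    (hr : r ∈ S.fil ess m (some x)) {i : S.ι x z} (hi : S.rk i < p) :
    S.ten r (S.e i) ∈ S.rankFil m p z := by
  rw [← S.one_comp (S.e i)]
  exact ten_mem_rankFil hz hr _ hi

theorem rankFil_mono {m p p' : ℕ} (h : p ≤ p') {z} : S.rankFil m p z ≤ S.rankFil m p' z := by
  refine sup_le_sup_left (Submodule.span_mono ?_) _
  rintro _ ⟨x, r, s, i, hz, hr, hi, rfl⟩
  exact ⟨x, r, s, i, hz, hr, hi.trans_le h, rfl⟩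

theorem ess_of_ne {x : S.Ob} {z} (hz : z ≠ some x) : ess x z = 1 := if_neg hz

theorem rankFil_le {m p : ℕ} {z} : S.rankFil m p z ≤ S.fil ess (m + 1) z := by
  refine sup_le (fun t ht => fil_mono (Nat.le_succ m) ht) (Submodule.span_le.2 ?_)
  rintro _ ⟨x, r, s, i, hz, hr, hi, rfl⟩
  exact ten_mem_fil _ hr (by rw [ess_of_ne hz])

theorem ten_d_mem_rankFil {m : ℕ} {x z} (hz : z ≠ some x) {r : S.T (some x)}
    (hr : r ∈ S.fil ess m (some x)) (i : S.ι x z) :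
    S.ten r (S.d (S.e i)) ∈ S.rankFil m (S.rk i) z := by
  refine (Submodule.span_le (p := (S.rankFil m (S.rk i) z).comap (S.ten (z := z) r))).2 ?_ (S.d_e i)
  rintro _ ⟨s, j, hj, rfl⟩
  exact ten_mem_rankFil hz hr s hj

theorem η_ten_d_mem_rankFil {m : ℕ} {x z} (hz : z ≠ some x) {r : S.T (some x)}
    (hr : r ∈ S.fil ess m (some x)) (s : S.V x (some x)) (i : S.ι x z) :
    S.η z (S.ten r (S.comp s (S.d (S.e i)))) ∈ S.rankFil m (S.rk i) z := by
  refine (Submodule.span_le (p := (S.rankFil m (S.rk i) z).comap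
    (S.η z ∘ₗ S.ten r ∘ₗ S.comp s))).2 ?_ (S.d_e i)
  rintro _ ⟨s', j, hj, rfl⟩
  change S.η z (S.ten r (S.comp s (S.comp s' (S.e j)))) ∈ S.rankFil m (S.rk i) z
  rw [← S.comp_assoc, S.η_ten]
  exact Submodule.sub_mem _
    (ten_e_mem_rankFil hz (ten_mem_fil _ hr (by rw [ess_self, add_zero])) hj)
    (ten_e_mem_rankFil hz (η_mem_fil ess_self (act_mem_fil_diag hr _)) hj)

/-- Up to terms of lower essential length or lower rank, the defect acts on the coefficients
of the essential basis elements. -/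
theorem defect_ten_sub_mem_rankFil {m : ℕ} {x z} (hz : z ≠ some x) {r : S.T (some x)}
    (hr : r ∈ S.fil ess m (some x)) (s : S.V x (some x)) (i : S.ι x z) :
    S.defect z (S.ten r (S.comp s (S.e i))) - S.ten (S.defect _ (S.act r s)) (S.e i) ∈
      S.rankFil m (S.rk i) z := by
  rw [defect_ten, sub_sub (S.ten _ _), sub_sub_cancel_left]
  refine Submodule.neg_mem _ (Submodule.add_mem _ (fil_le_rankFil (commutator_mem_fil hr s i))
    (Submodule.add_mem _ (Submodule.sub_mem _ ?_ ?_) ?_))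
  · exact ten_d_mem_rankFil hz (ε_mem_fil (ten_mem_fil _ hr (by rw [ess_self, add_zero]))) i
  · exact ten_d_mem_rankFil hz (ε_mem_fil (η_mem_fil ess_self (act_mem_fil_diag hr s))) i
  · exact η_ten_d_mem_rankFil hz (ε_mem_fil hr) s i

open Classical in
/-- The leading part of the defect at the essential basis elements of rank `p`. -/
def lead (p : ℕ) (z : Option S.Ob) : S.T z →ₗ[R] S.T z :=
  comb fun q => if z ≠ some q.1 ∧ S.rk q.2 = p then tenR (S.e q.2) ∘ₗ S.defect _ else 0

open Classical in
/-- The part of the defect at the inessential basis elements. -/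
def leadDiag (z : Option S.Ob) : S.T z →ₗ[R] S.T z :=
  comb fun q => if z = some q.1 then tenR (S.e q.2) ∘ₗ S.defect _ else 0

theorem defect_sub_lead_mem {m p : ℕ} {z} {t : S.T z} (ht : t ∈ S.rankFil m (p + 1) z) :
    S.defect z t - lead p z t ∈ S.rankFil m p z := by
  classical
  have H : S.rankFil m (p + 1) z ≤ (S.rankFil m p z).comap (S.defect z - lead p z) :=
    sup_le ?_ (Submodule.span_le.2 ?_)
  · exact H ht
  clear ht t
  · intro t ht
    cases m with
    | zero => rw [fil_zero rfl ht]; exact zero_mem _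
    | succ m =>
      refine fil_le_rankFil (Submodule.sub_mem _ (defect_mem_fil ess_tri ess_self ht)
        (comb_mem (z := z) _ _ fun q => ?_))
      split_ifs with h
      · exact ten_mem_fil _ (defect_mem_fil ess_tri ess_self (coef_mem_ess ht q h.1))
          (by rw [ess_of_ne h.1])
      · exact zero_mem _
  · rintro _ ⟨x, r, s, i, hz, hr, hi, rfl⟩
    change S.defect z (S.ten r (S.comp s (S.e i))) - lead p z (S.ten r (S.comp s (S.e i))) ∈ S.rankFil m p z
    have h1 := defect_ten_sub_mem_rankFil hz hr s i
    rw [lead, comb_ten]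
    by_cases hp : S.rk i = p
    · rw [if_pos ⟨hz, hp⟩]
      rwa [hp] at h1
    · rw [if_neg fun h => hp h.2, LinearMap.zero_apply, sub_zero]
      refine (Submodule.sub_mem_iff_left _ ?_).1 (rankFil_mono (by omega) h1)
      exact ten_e_mem_rankFil hz (defect_mem_fil ess_tri ess_self (act_mem_fil_diag hr s)) (by omega)

theorem exists_defect_sub_leadDiag_mem {m : ℕ} {z} {t : S.T z} (ht : t ∈ S.fil ess (m + 1) z) :
    ∃ p, S.defect z t - S.bp z t - leadDiag z t ∈ S.rankFil m p z := by
  classical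
  rw [mem_fil] at ht
  generalize hM : m + 1 = M at ht
  induction ht with
  | zero => exact ⟨0, by simp⟩
  | add _ _ h1 h2 =>
    obtain ⟨p, hp⟩ := h1 hM
    obtain ⟨p', hp'⟩ := h2 hM
    refine ⟨max p p', ?_⟩
    convert Submodule.add_mem _ (rankFil_mono (le_max_left p p') hp)
      (rankFil_mono (le_max_right p p') hp') using 1
    simp only [map_add]
    abel
  | base h hb =>
    refine ⟨0, ?_⟩
    rw [defect_base hb, S.bp_base _ hb, leadDiag, comb_base _ hb, sub_self, sub_zero]
    exact zero_mem _
  | @ten m₁ m' x z r v hr hm ih =>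
    by_cases hz : z = some x
    · subst hz
      refine ⟨0, ?_⟩
      have h1 := defect_ten_diag r v
      have h2 : leadDiag _ (S.ten r v) = S.ten (S.defect _ (S.act r v)) (S.one x) := by
        have := comb_ten (fun q : Σ y, S.ι y (some x) => if some x = some q.1 then
          tenR (S.e q.2) ∘ₗ S.defect _ else 0) r v (S.diag x)
        rw [S.e_diag, S.comp_one] at this
        rw [leadDiag, this, if_pos rfl, ← S.e_diag]
        rfl
      rw [h1, h2, S.bp_ten, sub_zero, sub_self]
      exact zero_mem _
    · rw [ess_of_ne hz] at hm
      have hr' : r ∈ S.fil ess m (some x) := fil_mono (by omega) hr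
      refine V_induction (p := fun v => ∃ p, S.defect z (S.ten r v) - S.bp z (S.ten r v) -
        leadDiag z (S.ten r v) ∈ S.rankFil m p z) v ?_ ?_ ?_
      · intro s i
        refine ⟨S.rk i + 1, ?_⟩
        rw [S.bp_ten, leadDiag, comb_ten, if_neg hz, LinearMap.zero_apply, sub_zero, sub_zero]
        refine (Submodule.sub_mem_iff_left _ ?_).1
          (rankFil_mono (Nat.le_succ _) (defect_ten_sub_mem_rankFil hz hr' s i))
        exact ten_e_mem_rankFil hz (defect_mem_fil ess_tri ess_self (act_mem_fil_diag hr' s))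
          (Nat.lt_succ_self _)
      · exact ⟨0, by simp⟩
      · rintro v v' ⟨p, hp⟩ ⟨p', hp'⟩
        refine ⟨max p p', ?_⟩
        convert Submodule.add_mem _ (rankFil_mono (le_max_left p p') hp)
          (rankFil_mono (le_max_right p p') hp') using 1
        simp only [map_add]
        abel

/-- Induction on the rank: the leading part of the defect is its action on the coefficients, which
lie in the kernel and in a lower stage of the essential filtration. -/
theorem mem_nil_of_mem_rankFil (hS : S.Exhaustive) {m : ℕ}
    (ih : ∀ z (k : S.T z), k ∈ S.K z → k ∈ S.fil ess m z → k ∈ S.nil z) (p : ℕ) {z} {k : S.T z}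
    (hk : k ∈ S.K z) (hkp : k ∈ S.rankFil m p z) : k ∈ S.nil z := by
  classical
  induction p generalizing z with
  | zero =>
    have H : S.rankFil m 0 z ≤ S.fil ess m z := sup_le le_rfl (Submodule.span_le.2 ?_)
    · exact ih z k hk (H hkp)
    rintro _ ⟨x, r, s, i, hz, hr, hi, rfl⟩
    exact absurd hi (Nat.not_lt_zero _)
  | succ p ihp =>
    have hpart : ∀ (x : S.Ob) (i : S.ι x z), z ≠ some x → S.rk i = p → ∀ r : S.T (some x),
        r ∈ S.K _ → r ∈ S.fil ess m (some x) → S.ten r (S.e i) ∈ S.nil z := by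
      intro x i hz hi r hr hrm
      refine nil_induction (p := fun r => S.ten r (S.e i) ∈ S.nil z) (ih _ r hr hrm) ?_
        (S.K _ ⊓ S.fil ess m (some x)) ⟨hr, hrm⟩
        (fun t ht => ⟨defect_mem_K hS ht.1, defect_mem_fil ess_tri ess_self ht.2⟩) ?_
      · rw [map_zero]; exact zero_mem _
      · rintro t ⟨ht, htm⟩ h
        have h1 := defect_ten_sub_mem_rankFil hz htm (S.one x) i
        rw [S.one_comp, S.act_one, hi] at h1
        refine mem_nil_of_defect ((Submodule.sub_mem_iff_left _ h).1 (ihp ?_ h1))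
        exact sub_mem (defect_mem_K hS (K_ten _ _ ht))
          (K_ten _ _ (defect_mem_K hS ht))
    refine mem_nil_of_defect ((Submodule.sub_mem_iff_left _ ?_).1 (ihp ?_ (defect_sub_lead_mem hkp)))
    · refine comb_mem _ _ fun q => ?_
      split_ifs with h
      · exact hpart q.1 q.2 h.1 h.2 _ (defect_mem_K hS (K_coef k hk q))
          (defect_mem_fil ess_tri ess_self (coef_mem_ess (rankFil_le hkp) q h.1))
      · exact zero_mem _
    · refine Submodule.sub_mem _ (defect_mem_K hS hk) (comb_mem _ _ fun q => ?_)
      split_ifs with h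
      · exact K_ten _ _ (defect_mem_K hS (K_coef k hk q))
      · exact zero_mem _

/-- Induction on the number of essential steps, and on the simplicial level for the tensors that end
with an endomorphism. -/
theorem mem_nil_of_mem_fil (hS : S.Exhaustive) (m : ℕ) {z} {k : S.T z}
    (hk : k ∈ S.K z) (hkm : k ∈ S.fil ess m z) : k ∈ S.nil z := by
  classical
  induction m generalizing z with
  | zero => rw [fil_zero rfl hkm]; exact zero_mem _
  | succ m ih =>
    obtain ⟨n, hn⟩ := hS z k
    induction n generalizing z with
    | zero => rw [fil_zero rfl hn]; exact zero_mem _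
    | succ n ihn =>
      obtain ⟨p, hp⟩ := exists_defect_sub_leadDiag_mem hkm
      rw [K_bp _ hk, sub_zero] at hp
      refine mem_nil_of_defect ((Submodule.sub_mem_iff_left _ ?_).1
        (mem_nil_of_mem_rankFil hS (fun z k hk hkm => ih hk hkm) p ?_ hp))
      · refine comb_mem _ _ fun q => ?_
        split_ifs with h
        · obtain ⟨x, i⟩ := q
          obtain rfl : z = some x := h
          have h1 := K_coef k hk ⟨x, i⟩
          have h2 := coef_mem_fil hkm ⟨x, i⟩
          rw [ess_self, Nat.sub_zero] at h2
          have h3 := ihn h1 h2 (coef_mem_lev hn ⟨x, i⟩)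
          have h4 := ten_one_mem_nil (defect_mem_nil h3)
          obtain rfl : i = S.diag x := S.diag_eq i
          rw [← S.e_diag] at h4
          exact h4
        · exact zero_mem _
      · refine Submodule.sub_mem _ (defect_mem_K hS hk) (comb_mem _ _ fun q => ?_)
        split_ifs with h
        · exact K_ten _ _ (defect_mem_K hS (K_coef k hk q))
        · exact zero_mem _

theorem fil_le_of_le {st st' : S.Ob → Option S.Ob → ℕ} (h : ∀ x z, st x z ≤ st' x z) {m : ℕ} {z}
    {t : S.T z} (ht : t ∈ S.fil st' m z) : t ∈ S.fil st m z := by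
  rw [mem_fil] at ht
  induction ht with
  | zero m z => exact zero_mem _
  | add _ _ h h' => exact add_mem h h'
  | base h hb => exact .base h hb
  | @ten _ _ x z _ v hr hm ih =>
    have := h x z
    exact ten_mem_fil _ ih (by omega)

/-- The defect is locally nilpotent on the kernel. -/
theorem exists_defect_pow_eq_zero (hS : S.Exhaustive) {z} {k : S.T z} (hk : k ∈ S.K z) :
    ∃ n : ℕ, (S.defect z ^ n) k = 0 := by
  obtain ⟨n, hn⟩ := hS z k
  refine mem_nil.1 (mem_nil_of_mem_fil hS n hk (fil_le_of_le (fun x z => ?_) hn))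
  unfold ess
  split_ifs <;> simp

end BarSystem

/-! ### Bases, and maps defined recursively on the bar construction -/

/-- The free modules `(F U) ^ n A` over a dg category that the bar construction is built from. -/
notation "freeRes(" A ")" => resObj (modFree _) (modForget _) A

section BarLevels

variable {𝒞 𝒟 : DGCat R N}

/-- The left `𝒞`-modules `𝒞 (-, y)`, and `𝒟 (p -, y₀)` at `none`. -/
def vOb (p : DGFunctor 𝒞 𝒟) (y₀ : 𝒟.Ob) (x : 𝒞.Ob) : Option 𝒞.Ob → Ch R N
  | some y => 𝒞.Hom x y
  | none => 𝒟.Hom (p.obj x) y₀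

/-- The action of `𝒞` on the left `𝒞`-modules `vOb`. -/
def vComp (p : DGFunctor 𝒞 𝒟) (y₀ : 𝒟.Ob) {x y : 𝒞.Ob} : ∀ {z : Option 𝒞.Ob} (g h c : Deg N)
    (_ : g + h = c), (𝒞.Hom x y).X g →ₗ[R] (vOb p y₀ y z).X h →ₗ[R] (vOb p y₀ x z).X c
  | some _, g, h, c, hc => 𝒞.comp g h c hc
  | none, g, h, c, hc => 𝒟.comp g h c hc ∘ₗ app (p.map x y) g

variable (p : DGFunctor 𝒞 𝒟) (y₀ : 𝒟.Ob)

theorem vComp_assoc {x y z : 𝒞.Ob} {w : Option 𝒞.Ob} (f g h fg gh c : Deg N) (h₁ : f + g = fg)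
    (h₂ : fg + h = c) (h₃ : g + h = gh) (h₄ : f + gh = c) (a : (𝒞.Hom x y).X f)
    (b : (𝒞.Hom y z).X g) (v : (vOb p y₀ z w).X h) :
    vComp p y₀ fg h c h₂ (𝒞.comp f g fg h₁ a b) v =
      vComp p y₀ f gh c h₄ a (vComp p y₀ g h gh h₃ b v) := by
  cases w with
  | some w => exact 𝒞.comp_comp f g h fg gh c h₁ h₂ h₃ h₄ a b v
  | none =>
    have h1 := p.map_comp f g fg h₁ a b
    have h2 := 𝒟.comp_comp f g h fg gh c h₁ h₂ h₃ h₄ (app (p.map x y) f a) (app (p.map y z) g b) v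
    exact (congrArg (fun t => 𝒟.comp fg h c h₂ t v) h1).trans h2

theorem one_vComp {x : 𝒞.Ob} {z : Option 𝒞.Ob} (h : Deg N) (hc : 0 + h = h) (v : (vOb p y₀ x z).X h) :
    vComp p y₀ 0 h h hc (𝒞.one x) v = v := by
  cases z with
  | some z => exact 𝒞.one_comp h hc v
  | none =>
    exact (congrArg (fun t => 𝒟.comp 0 h h hc t v) (p.map_one x)).trans (𝒟.one_comp h hc v)

theorem del_vComp {x y : 𝒞.Ob} {z : Option 𝒞.Ob} (g h c : Deg N) (hc : g + h = c)
    (f : (𝒞.Hom x y).X g) (v : (vOb p y₀ y z).X h) :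
    del _ c (c - 1) (vComp p y₀ g h c hc f v) =
      vComp p y₀ (g - 1) h (c - 1) (by rw [← hc]; ring) (del _ g (g - 1) f) v +
      sg R (par g) • vComp p y₀ g (h - 1) (c - 1) (by rw [← hc]; ring) f (del _ h (h - 1) v) := by
  cases z with
  | some z => exact 𝒞.del_comp g h c hc f v
  | none =>
    have h1 := 𝒟.del_comp g h c hc (app (p.map x y) g f) v
    have h2 := app_del (p.map x y) g (g - 1) f
    refine h1.trans (congrArg₂ (· + ·) ?_ rfl)
    exact congrArg (fun t => 𝒟.comp (g - 1) h (c - 1) (by rw [← hc]; ring) t v) h2.symm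

/-- Homogeneous bases of the left modules `vOb` over the endomorphisms of the objects of `𝒞`,
with differentials that lower the rank. -/
structure EssBasis where
  ι : 𝒞.Ob → Option 𝒞.Ob → Deg N → Type u
  e : ∀ {x z b}, ι x z b → (vOb p y₀ x z).X b
  rk : ∀ {x z b}, ι x z b → ℕ
  dec : ∀ x z b, (vOb p y₀ x z).X b →ₗ[R] (ι x z b →₀ (𝒞.Hom x x).X 0)
  dec_comp : ∀ {x z b} (s : (𝒞.Hom x x).X 0) (i : ι x z b),
    dec x z b (vComp p y₀ 0 b b (zero_add b) s (e i)) = Finsupp.single i s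
  sum_dec : ∀ {x z b} (v : (vOb p y₀ x z).X b),
    (dec x z b v).sum (fun i s => vComp p y₀ 0 b b (zero_add b) s (e i)) = v
  hom_eq_zero : ∀ x b, b ≠ 0 → ∀ m : (𝒞.Hom x x).X b, m = 0
  del_e : ∀ {x z b} (i : ι x z b), del _ b (b - 1) (e i) ∈ Submodule.span R
    {v | ∃ (s : (𝒞.Hom x x).X 0) (j : ι x z (b - 1)), rk j < rk i ∧
      v = vComp p y₀ 0 (b - 1) (b - 1) (zero_add _) s (e j)}
  diag : ∀ x, ι x (some x) 0
  diag_eq : ∀ {x} (i : Σ b, ι x (some x) b), i = ⟨0, diag x⟩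
  e_diag : ∀ x, e (diag x) = 𝒞.one x

variable (A : DGMod 𝒞)

/-- The complexes `((F U) ^ n A) (y)`. -/
abbrev rOb (n : ℕ) (y : 𝒞.Ob) : Ch R N := (freeRes(A) n).obj y

/-- The complexes `⨁ x, ((F U) ^ n A) (x) ⊗ vOb x z`. -/
def qOb (n : ℕ) (z : Option 𝒞.Ob) : Ch R N := sumTen (rOb A n) (fun x => vOb p y₀ x z)

/-- The pure tensors of `qOb`. -/
def qTen (n : ℕ) {x : 𝒞.Ob} {z : Option 𝒞.Ob} (a b c : Deg N) (hc : a + b = c) :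
    (rOb A n x).X a →ₗ[R] (vOb p y₀ x z).X b →ₗ[R] (qOb p y₀ A n z).X c :=
  stX (rOb A n) (fun x => vOb p y₀ x z) x a b c hc

/-- The pure tensors of `(F U) ^ (n + 1) A`. -/
def rTen (n : ℕ) {x y : 𝒞.Ob} (a b c : Deg N) (hc : a + b = c) :
    (rOb A n x).X a →ₗ[R] (𝒞.Hom x y).X b →ₗ[R] (rOb A (n + 1) y).X c :=
  fm (rOb A n) y x a b c hc

/-- The action of `𝒞` on `(F U) ^ n A`. -/
def rAct (n : ℕ) {x y : 𝒞.Ob} (a b c : Deg N) (hc : a + b = c) :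
    (rOb A n x).X a →ₗ[R] (𝒞.Hom x y).X b →ₗ[R] (rOb A n y).X c :=
  (freeRes(A) n).act a b c hc

theorem rAct_rTen (n : ℕ) {w x y : 𝒞.Ob} (a b g h c e : Deg N) (hab : a + b = g) (hc : g + h = c)
    (he : b + h = e) (hc' : a + e = c) (r : (rOb A n w).X a) (m : (𝒞.Hom w x).X b)
    (q : (𝒞.Hom x y).X h) :
    rAct A (n + 1) g h c hc (rTen A n a b g hab r m) q =
      rTen A n a e c hc' r (𝒞.comp b h e he m q) :=
  fmAct_fm _ g h c hc w a b hab r m q e he hc'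

theorem rAct_one (n : ℕ) {x : 𝒞.Ob} (a : Deg N) (r : (rOb A n x).X a) :
    rAct A n a 0 a (add_zero a) r (𝒞.one x) = r :=
  (freeRes(A) n).act_one a (add_zero a) r

theorem rAct_rAct (n : ℕ) {x y z : 𝒞.Ob} (f g h fg gh c : Deg N) (h₁ : f + g = fg) (h₂ : fg + h = c)
    (h₃ : g + h = gh) (h₄ : f + gh = c) (r : (rOb A n x).X f) (b : (𝒞.Hom x y).X g)
    (q : (𝒞.Hom y z).X h) :
    rAct A n fg h c h₂ (rAct A n f g fg h₁ r b) q = rAct A n f gh c h₄ r (𝒞.comp g h gh h₃ b q) :=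
  (freeRes(A) n).act_act f g h fg gh c h₁ h₂ h₃ h₄ r b q

variable {p y₀}

/-- Linear maps out of `qOb` from values on the tensors `r ⊗ s e` with `e` in a basis. -/
def bLift (B : EssBasis p y₀) {n : ℕ} {z : Option 𝒞.Ob} {c : Deg N} {W : Type u} [AddCommGroup W] [Module R W]
    (φ : ∀ (x : 𝒞.Ob) (a b : Deg N), a + b = c → B.ι x z b →
      (rOb A n x).X a →ₗ[R] (𝒞.Hom x x).X 0 →ₗ[R] W) : (qOb p y₀ A n z).X c →ₗ[R] W :=
  stLift fun x a b h =>
    (((Finsupp.lsum R fun i => (φ x a b h i).flip) ∘ₗ B.dec x z b).flip :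
      (rOb A n x).X a →ₗ[R] (vOb p y₀ x z).X b →ₗ[R] W)

variable {A}

theorem bLift_qTen (B : EssBasis p y₀) {n : ℕ} {z : Option 𝒞.Ob} {c : Deg N} {W : Type u} [AddCommGroup W]
    [Module R W] (φ : ∀ (x : 𝒞.Ob) (a b : Deg N), a + b = c → B.ι x z b →
      (rOb A n x).X a →ₗ[R] (𝒞.Hom x x).X 0 →ₗ[R] W) (x : 𝒞.Ob) (a b : Deg N) (h : a + b = c)
    (r : (rOb A n x).X a) (s : (𝒞.Hom x x).X 0) (i : B.ι x z b) :
    bLift A B φ (qTen p y₀ A n a b c h r (vComp p y₀ 0 b b (zero_add b) s (B.e i))) =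
      φ x a b h i r s := by
  refine (stLift_stX _ x a b h r _).trans ?_
  change (Finsupp.lsum R fun i => (φ x a b h i).flip) (B.dec x z b _) r = _
  rw [B.dec_comp, Finsupp.lsum_single]
  rfl

theorem qTen_ext {n : ℕ} {z : Option 𝒞.Ob} {c : Deg N} {W : Type u} [AddCommGroup W] [Module R W]
    {φ ψ : (qOb p y₀ A n z).X c →ₗ[R] W}
    (h : ∀ x a b (hc : a + b = c) (r : (rOb A n x).X a) (v : (vOb p y₀ x z).X b),
      φ (qTen p y₀ A n a b c hc r v) = ψ (qTen p y₀ A n a b c hc r v)) : φ = ψ :=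
  stX_ext h

theorem EssBasis.induction (B : EssBasis p y₀) {x : 𝒞.Ob} {z : Option 𝒞.Ob} {b : Deg N}
    {P : (vOb p y₀ x z).X b → Prop} (v : (vOb p y₀ x z).X b) (h0 : P 0)
    (hadd : ∀ v v', P v → P v' → P (v + v'))
    (h : ∀ s (i : B.ι x z b), P (vComp p y₀ 0 b b (zero_add b) s (B.e i))) : P v := by
  rw [← B.sum_dec v]
  exact Finset.sum_induction _ P hadd h0 fun i _ => h _ _

variable (A)

/-- One step of the recursive definition of the homotopy `η`. -/
def ηStep (B : EssBasis p y₀) (n : ℕ) (ψ : ∀ x a, (rOb A n x).X a →ₗ[R] (rOb A (n + 1) x).X a)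
    (z : Option 𝒞.Ob) (c : Deg N) : (qOb p y₀ A n z).X c →ₗ[R] (qOb p y₀ A (n + 1) z).X c :=
  bLift A B fun x a b h i =>
    (rTen A n a 0 a (add_zero a) - (rAct A n a 0 a (add_zero a)).compr₂ (ψ x a)).compr₂
      ((qTen p y₀ A (n + 1) a b c h).flip (B.e i))

variable {A} in
theorem ηStep_qTen (B : EssBasis p y₀) (n : ℕ)
    (ψ : ∀ x a, (rOb A n x).X a →ₗ[R] (rOb A (n + 1) x).X a) {z : Option 𝒞.Ob} {x : 𝒞.Ob}
    (a b c : Deg N) (h : a + b = c) (r : (rOb A n x).X a) (s : (𝒞.Hom x x).X 0) (i : B.ι x z b) :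
    ηStep A B n ψ z c (qTen p y₀ A n a b c h r (vComp p y₀ 0 b b (zero_add b) s (B.e i))) =
      qTen p y₀ A (n + 1) a b c h (rTen A n a 0 a (add_zero a) r s -
        ψ x a (rAct A n a 0 a (add_zero a) r s)) (B.e i) := by
  unfold ηStep
  rw [bLift_qTen]
  rfl

/-- The degeneracy-like homotopy `η (r ⊗ s e) = r ⊗ s ⊗ e - η (r s) ⊗ e` on `(F U) ^ n A`. -/
def ηR (B : EssBasis p y₀) : ∀ (n : ℕ) (x : 𝒞.Ob) (a : Deg N),
    (rOb A n x).X a →ₗ[R] (rOb A (n + 1) x).X a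
  | 0 => fun _ _ => 0
  | n + 1 => fun x a => ηStep A B n (ηR B n) (some x) a

/-- The homotopy `η` on the complexes `qOb`. -/
def ηQ (B : EssBasis p y₀) (n : ℕ) (z : Option 𝒞.Ob) (c : Deg N) :
    (qOb p y₀ A n z).X c →ₗ[R] (qOb p y₀ A (n + 1) z).X c := ηStep A B n (ηR A B n) z c

variable {A} in
theorem ηQ_qTen (B : EssBasis p y₀) (n : ℕ) {z : Option 𝒞.Ob} {x : 𝒞.Ob} (a b c : Deg N) (h : a + b = c)
    (r : (rOb A n x).X a) (s : (𝒞.Hom x x).X 0) (i : B.ι x z b) :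
    ηQ A B n z c (qTen p y₀ A n a b c h r (vComp p y₀ 0 b b (zero_add b) s (B.e i))) =
      qTen p y₀ A (n + 1) a b c h (rTen A n a 0 a (add_zero a) r s) (B.e i) -
        qTen p y₀ A (n + 1) a b c h (ηR A B n x a (rAct A n a 0 a (add_zero a) r s)) (B.e i) := by
  rw [ηQ, ηStep_qTen, map_sub, LinearMap.sub_apply]

/-- One step of the recursive definition of the normal form. -/
def nfStep (B : EssBasis p y₀) (n : ℕ) (ψ : ∀ x a, (rOb A n x).X a →ₗ[R] (rOb A n x).X a)
    (z : Option 𝒞.Ob) (c : Deg N) : (qOb p y₀ A n z).X c →ₗ[R] (qOb p y₀ A n z).X c :=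
  bLift A B fun x a b h i => ((rAct A n a 0 a (add_zero a)).compr₂ (ψ x a)).compr₂
      ((qTen p y₀ A n a b c h).flip (B.e i))

variable {A} in
theorem nfStep_qTen (B : EssBasis p y₀) (n : ℕ)
    (ψ : ∀ x a, (rOb A n x).X a →ₗ[R] (rOb A n x).X a) {z : Option 𝒞.Ob} {x : 𝒞.Ob}
    (a b c : Deg N) (h : a + b = c) (r : (rOb A n x).X a) (s : (𝒞.Hom x x).X 0) (i : B.ι x z b) :
    nfStep A B n ψ z c (qTen p y₀ A n a b c h r (vComp p y₀ 0 b b (zero_add b) s (B.e i))) =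
      qTen p y₀ A n a b c h (ψ x a (rAct A n a 0 a (add_zero a) r s)) (B.e i) := by
  unfold nfStep
  rw [bLift_qTen]
  rfl

/-- The normal form of an element of `(F U) ^ n A` with respect to the relations
`r s ⊗ v = r ⊗ s v`. -/
def nfR (B : EssBasis p y₀) : ∀ (n : ℕ) (x : 𝒞.Ob) (a : Deg N),
    (rOb A n x).X a →ₗ[R] (rOb A n x).X a
  | 0 => fun _ _ => LinearMap.id
  | n + 1 => fun x a => nfStep A B n (nfR B n) (some x) a

/-- The normal form on the complexes `qOb`. -/
def nfQ (B : EssBasis p y₀) (n : ℕ) (z : Option 𝒞.Ob) (c : Deg N) :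
    (qOb p y₀ A n z).X c →ₗ[R] (qOb p y₀ A n z).X c := nfStep A B n (nfR A B n) z c

variable {A} in
theorem nfQ_qTen (B : EssBasis p y₀) (n : ℕ) {z : Option 𝒞.Ob} {x : 𝒞.Ob} (a b c : Deg N) (h : a + b = c)
    (r : (rOb A n x).X a) (s : (𝒞.Hom x x).X 0) (i : B.ι x z b) :
    nfQ A B n z c (qTen p y₀ A n a b c h r (vComp p y₀ 0 b b (zero_add b) s (B.e i))) =
      qTen p y₀ A n a b c h (nfR A B n x a (rAct A n a 0 a (add_zero a) r s)) (B.e i) := by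
  rw [nfQ, nfStep_qTen]

/-- The alternating sum of the faces of `(F U) ^ (n + 1) A`. -/
def rFace (n : ℕ) (x : 𝒞.Ob) (a : Deg N) : (rOb A (n + 1) x).X a →ₗ[R] (rOb A n x).X a :=
  ∑ i : Fin (n + 1), (-1 : R) ^ (i : ℕ) • app ((resFace (modAdj 𝒞) A n i).hom x) a

theorem rFace_rTen_zero {x y : 𝒞.Ob} (a b c : Deg N) (hc : a + b = c)
    (r : (rOb A 0 x).X a) (m : (𝒞.Hom x y).X b) :
    rFace A 0 y c (rTen A 0 a b c hc r m) = rAct A 0 a b c hc r m := by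
  rw [rFace, Fin.sum_univ_one, Fin.val_zero, pow_zero, one_smul]
  exact counit_fm A y x a b c hc r m

theorem rFace_rTen (n : ℕ) {x y : 𝒞.Ob} (a b c : Deg N) (hc : a + b = c)
    (r : (rOb A (n + 1) x).X a) (m : (𝒞.Hom x y).X b) :
    rFace A (n + 1) y c (rTen A (n + 1) a b c hc r m) =
      rAct A (n + 1) a b c hc r m - rTen A n a b c hc (rFace A n x a r) m := by
  have h0 : app ((resFace (modAdj 𝒞) A (n + 1) 0).hom y) c (rTen A (n + 1) a b c hc r m) =
    rAct A (n + 1) a b c hc r m := counit_fm _ y x a b c hc r m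
  have h1 : ∀ i : Fin (n + 1), app ((resFace (modAdj 𝒞) A (n + 1) i.succ).hom y) c
      (rTen A (n + 1) a b c hc r m) =
        rTen A n a b c hc (app ((resFace (modAdj 𝒞) A n i).hom x) a r) m := fun i =>
    modFree_map_fm ((modForget 𝒞).map (resFace (modAdj 𝒞) A n i)) y x a b c hc r m
  rw [rFace, Fin.sum_univ_succ, LinearMap.add_apply, Fin.val_zero, pow_zero, one_smul, h0,
    LinearMap.sum_apply, sub_eq_add_neg, rFace, LinearMap.sum_apply, map_sum, LinearMap.sum_apply,
    ← Finset.sum_neg_distrib]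
  refine congrArg _ (Finset.sum_congr rfl fun i _ => ?_)
  rw [LinearMap.smul_apply, LinearMap.smul_apply, h1, map_smul, LinearMap.smul_apply, Fin.val_succ,
    pow_succ, mul_neg_one, neg_smul]

theorem rFace_rAct (n : ℕ) {x y : 𝒞.Ob} (a b c : Deg N) (hc : a + b = c)
    (r : (rOb A (n + 1) x).X a) (m : (𝒞.Hom x y).X b) :
    rFace A n y c (rAct A (n + 1) a b c hc r m) = rAct A n a b c hc (rFace A n x a r) m := by
  rw [rFace, rFace, LinearMap.sum_apply, LinearMap.sum_apply, map_sum, LinearMap.sum_apply]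
  refine Finset.sum_congr rfl fun i _ => ?_
  rw [LinearMap.smul_apply, LinearMap.smul_apply, map_smul, LinearMap.smul_apply]
  exact congrArg _ ((resFace (modAdj 𝒞) A n i).map_act a b c hc r m)

end BarLevels

/-! ### The total module of the bar construction -/

section BarTotal

variable {𝒞 𝒟 : DGCat R N}
variable (p : DGFunctor 𝒞 𝒟) (y₀ : 𝒟.Ob) (A : DGMod 𝒞)

/-- The complexes of simplices ending in `z`. -/
def tOb : Option 𝒞.Ob → ℕ → Ch R N
  | some y, n => rOb A n y
  | none, n => qOb p y₀ A n none

/-- The sum of all homogeneous parts of the complexes of simplices ending in `z`. -/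
abbrev tSum (z : Option 𝒞.Ob) : Type u := ⨁ k : ℕ × Deg N, (tOb p y₀ A z k.1).X k.2

/-- The sum of all homogeneous parts of `vOb`. -/
abbrev vSum (x : 𝒞.Ob) (z : Option 𝒞.Ob) : Type u := ⨁ b : Deg N, (vOb p y₀ x z).X b

variable {p y₀} in
/-- The inclusion of a homogeneous part. -/
def vIn {x : 𝒞.Ob} {z : Option 𝒞.Ob} (b : Deg N) : (vOb p y₀ x z).X b →ₗ[R] vSum p y₀ x z :=
  DirectSum.lof R _ (fun b => (vOb p y₀ x z).X b) b

variable {p y₀} in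
/-- The inclusion of a homogeneous part. -/
def hIn {x y : 𝒞.Ob} (b : Deg N) : (𝒞.Hom x y).X b →ₗ[R] vSum p y₀ x (some y) :=
  vIn (z := some y) b

/-- The inclusion of a homogeneous part. -/
def rIn (n : ℕ) (y : 𝒞.Ob) (a : Deg N) : (rOb A n y).X a →ₗ[R] tSum p y₀ A (some y) :=
  DirectSum.lof R _ (fun k : ℕ × Deg N => (tOb p y₀ A (some y) k.1).X k.2) (n, a)

/-- The inclusion of a homogeneous part. -/
def qIn (n : ℕ) : ∀ (z : Option 𝒞.Ob) (c : Deg N), (qOb p y₀ A n z).X c →ₗ[R] tSum p y₀ A z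
  | some y, c => rIn p y₀ A (n + 1) y c
  | none, c => DirectSum.lof R _ (fun k : ℕ × Deg N => (tOb p y₀ A none k.1).X k.2) (n, c)

variable {p y₀ A}

theorem vSum_induction {x : 𝒞.Ob} {z : Option 𝒞.Ob} {P : vSum p y₀ x z → Prop} (v : vSum p y₀ x z)
    (h : ∀ b v, P (vIn b v)) (h0 : P 0 := by simp)
    (hadd : ∀ v v', P v → P v' → P (v + v') := by
      intro _ _ h h'; simp only [map_add, LinearMap.add_apply, add_zero, h, h'] <;> abel) : P v :=
  DirectSum.induction_on v h0 h hadd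

theorem rSum_induction {y : 𝒞.Ob} {P : tSum p y₀ A (some y) → Prop} (t : tSum p y₀ A (some y))
    (h : ∀ n a r, P (rIn p y₀ A n y a r)) (h0 : P 0 := by simp)
    (hadd : ∀ v v', P v → P v' → P (v + v') := by
      intro _ _ h h'; simp only [map_add, LinearMap.add_apply, add_zero, h, h'] <;> abel) : P t :=
  DirectSum.induction_on t h0 (fun k r => h k.1 k.2 r) hadd

theorem tSum_induction {z : Option 𝒞.Ob} {P : tSum p y₀ A z → Prop} (t : tSum p y₀ A z)
    (h0 : P 0) (hadd : ∀ t t', P t → P t' → P (t + t'))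
    (hb : ∀ y (h : z = some y) a r, P (h ▸ rIn p y₀ A 0 y a r))
    (hq : ∀ n c q, P (qIn p y₀ A n z c q)) : P t := by
  cases z with
  | none => exact DirectSum.induction_on t h0 (fun k r => hq k.1 k.2 r) hadd
  | some y =>
    refine rSum_induction t (fun n a r => ?_) h0 hadd
    cases n with
    | zero => exact hb y rfl a r
    | succ n => exact hq n a r

theorem qTen_induction {n : ℕ} {z : Option 𝒞.Ob} {c : Deg N} {P : (qOb p y₀ A n z).X c → Prop}
    (q : (qOb p y₀ A n z).X c) (h0 : P 0) (hadd : ∀ q q', P q → P q' → P (q + q'))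
    (h : ∀ x a b (hc : a + b = c) (r : (rOb A n x).X a) (v : (vOb p y₀ x z).X b),
      P (qTen p y₀ A n a b c hc r v)) : P q := by
  classical
  refine DirectSum.induction_on (β := fun s : 𝒞.Ob × {p : Deg N × Deg N // p.1 + p.2 = c} =>
    TensorProduct R ((rOb A n s.1).X s.2.1.1) ((vOb p y₀ s.1 z).X s.2.1.2)) q h0 ?_ hadd
  rintro ⟨x, ⟨a, b⟩, hc⟩ t
  induction t using TensorProduct.induction_on with
  | zero => rw [map_zero]; exact h0
  | add t t' ht ht' => rw [map_add]; exact hadd _ _ ht ht'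
  | tmul r v =>
    exact h x a b hc r v

/-- Linear maps out of `tSum`. -/
def barLift {W : Type u} [AddCommGroup W] [Module R W] : ∀ (z : Option 𝒞.Ob)
    (_ : ∀ y, z = some y → ∀ a, (A.obj y).X a →ₗ[R] W)
    (_ : ∀ n c, (qOb p y₀ A n z).X c →ₗ[R] W), tSum p y₀ A z →ₗ[R] W
  | some y, β, φ => DirectSum.toModule R _ W fun k => match k with
    | (0, a) => β y rfl a
    | (n + 1, a) => φ n a
  | none, _, φ => DirectSum.toModule R _ W fun k => φ k.1 k.2

section Lift

variable {W : Type u} [AddCommGroup W] [Module R W]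

theorem barLift_qIn (z : Option 𝒞.Ob) (β : ∀ y, z = some y → ∀ a, (A.obj y).X a →ₗ[R] W)
    (φ : ∀ n c, (qOb p y₀ A n z).X c →ₗ[R] W) (n : ℕ) (c : Deg N) (q : (qOb p y₀ A n z).X c) :
    barLift z β φ (qIn p y₀ A n z c q) = φ n c q := by
  cases z with
  | none =>
    exact DirectSum.toModule_lof R (M := fun k : ℕ × Deg N => (tOb p y₀ A none k.1).X k.2) (n, c) q
  | some y =>
    exact DirectSum.toModule_lof R (M := fun k : ℕ × Deg N => (tOb p y₀ A (some y) k.1).X k.2) (n + 1, c) q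

theorem barLift_rIn_zero (y : 𝒞.Ob) (β : ∀ y', some y = some y' → ∀ a, (A.obj y').X a →ₗ[R] W)
    (φ : ∀ n c, (qOb p y₀ A n (some y)).X c →ₗ[R] W) (a : Deg N) (r : (rOb A 0 y).X a) :
    barLift (some y) β φ (rIn p y₀ A 0 y a r) = β y rfl a r :=
  DirectSum.toModule_lof R (M := fun k : ℕ × Deg N => (tOb p y₀ A (some y) k.1).X k.2) (0, a) r

theorem barLift_rIn_succ (y : 𝒞.Ob) (β : ∀ y', some y = some y' → ∀ a, (A.obj y').X a →ₗ[R] W)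
    (φ : ∀ n c, (qOb p y₀ A n (some y)).X c →ₗ[R] W) (n : ℕ) (a : Deg N) (r : (rOb A (n + 1) y).X a) :
    barLift (some y) β φ (rIn p y₀ A (n + 1) y a r) = φ n a r := barLift_qIn (some y) β φ n a r

end Lift

/-- Tensors. -/
def tTen {x : 𝒞.Ob} {z : Option 𝒞.Ob} :
    tSum p y₀ A (some x) →ₗ[R] vSum p y₀ x z →ₗ[R] tSum p y₀ A z :=
  DirectSum.toModule R _ _ fun k => LinearMap.flip (DirectSum.toModule R _ _ fun b =>
    ((qTen p y₀ A k.1 k.2 b (k.2 + b) rfl).compr₂ (qIn p y₀ A k.1 z (k.2 + b))).flip)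

theorem tTen_in {x : 𝒞.Ob} {z : Option 𝒞.Ob} (n : ℕ) (a b c : Deg N) (hc : a + b = c)
    (r : (rOb A n x).X a) (v : (vOb p y₀ x z).X b) :
    tTen (rIn p y₀ A n x a r) (vIn b v) = qIn p y₀ A n z c (qTen p y₀ A n a b c hc r v) := by
  subst hc
  have h1 : tTen (z := z) (rIn p y₀ A n x a r) =
      (LinearMap.flip (DirectSum.toModule R _ _ fun b =>
        ((qTen p y₀ A n a b (a + b) rfl).compr₂ (qIn p y₀ A n z (a + b))).flip)) r :=
    DirectSum.toModule_lof R (M := fun k : ℕ × Deg N => (tOb p y₀ A (some x) k.1).X k.2) (n, a) r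
  rw [h1, LinearMap.flip_apply]
  exact LinearMap.congr_fun
    (DirectSum.toModule_lof R (M := fun b => (vOb p y₀ x z).X b) b v) r

/-- The composition of `𝒞` on sums of homogeneous parts. -/
def hComp {x y : 𝒞.Ob} {z : Option 𝒞.Ob} :
    vSum p y₀ x (some y) →ₗ[R] vSum p y₀ y z →ₗ[R] vSum p y₀ x z :=
  DirectSum.toModule R _ _ fun g => LinearMap.flip (DirectSum.toModule R _ _ fun h =>
    ((vComp p y₀ g h (g + h) rfl).compr₂ (vIn (g + h))).flip)

theorem hComp_in {x y : 𝒞.Ob} {z : Option 𝒞.Ob} (g h c : Deg N) (hc : g + h = c)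
    (f : (𝒞.Hom x y).X g) (v : (vOb p y₀ y z).X h) :
    hComp (hIn (p := p) (y₀ := y₀) g f) (vIn h v) = vIn c (vComp p y₀ g h c hc f v) := by
  subst hc
  have h1 : hComp (z := z) (hIn (p := p) (y₀ := y₀) g f) =
      (LinearMap.flip (DirectSum.toModule R _ _ fun h =>
        ((vComp p y₀ g h (g + h) rfl).compr₂ (vIn (g + h))).flip)) f :=
    DirectSum.toModule_lof R (M := fun b => (vOb p y₀ x (some y)).X b) g f
  rw [h1, LinearMap.flip_apply]
  exact LinearMap.congr_fun (DirectSum.toModule_lof R (M := fun b => (vOb p y₀ y z).X b) h v) f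

/-- The differential on sums of homogeneous parts. -/
def vDel {x : 𝒞.Ob} {z : Option 𝒞.Ob} : vSum p y₀ x z →ₗ[R] vSum p y₀ x z :=
  DirectSum.toModule R _ _ fun b => vIn (b - 1) ∘ₗ del _ b (b - 1)

theorem vDel_in {x : 𝒞.Ob} {z : Option 𝒞.Ob} (b : Deg N) (v : (vOb p y₀ x z).X b) :
    vDel (vIn b v) = vIn (b - 1) (del _ b (b - 1) v) :=
  DirectSum.toModule_lof R (M := fun b => (vOb p y₀ x z).X b) b v

/-- The sign operator on sums of homogeneous parts. -/
def vSign (x : 𝒞.Ob) (z : Option 𝒞.Ob) : vSum p y₀ x z →ₗ[R] vSum p y₀ x z :=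
  DirectSum.toModule R _ _ fun b => (-sg R (par b)) • vIn b

theorem vSign_in {x : 𝒞.Ob} {z : Option 𝒞.Ob} (b : Deg N) (v : (vOb p y₀ x z).X b) :
    vSign x z (vIn b v) = (-sg R (par b)) • vIn b v :=
  DirectSum.toModule_lof R (M := fun b => (vOb p y₀ x z).X b) b v

/-- The action of `𝒞` on the degree zero simplices. -/
def baseAct {x : 𝒞.Ob} : ∀ (z : Option 𝒞.Ob) (a : Deg N),
    (A.obj x).X a →ₗ[R] vSum p y₀ x z →ₗ[R] tSum p y₀ A z
  | some y, a => LinearMap.flip (DirectSum.toModule R _ _ fun b =>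
      ((A.act a b (a + b) rfl).compr₂ (rIn p y₀ A 0 y (a + b))).flip)
  | none, a => 0

theorem baseAct_some {x y : 𝒞.Ob} (a b c : Deg N) (hc : a + b = c) (r : (A.obj x).X a)
    (m : (𝒞.Hom x y).X b) : baseAct (p := p) (y₀ := y₀) (some y) a r (hIn b m) =
      rIn p y₀ A 0 y c (A.act a b c hc r m) := by
  subst hc
  exact LinearMap.congr_fun (f := DirectSum.toModule R _ ((A.obj x).X a →ₗ[R] tSum p y₀ A (some y))
    (fun b => ((A.act a b (a + b) rfl).compr₂ (rIn p y₀ A 0 y (a + b))).flip)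
      (DirectSum.lof R _ (fun b => (vOb p y₀ x (some y)).X b) b m))
    (DirectSum.toModule_lof R (M := fun b => (vOb p y₀ x (some y)).X b) b m) r

/-- Linear maps out of `qOb`. -/
def qLift {n : ℕ} {z : Option 𝒞.Ob} {c : Deg N} {W : Type u} [AddCommGroup W] [Module R W]
    (φ : ∀ (x : 𝒞.Ob) (a b : Deg N), a + b = c →
      (rOb A n x).X a →ₗ[R] (vOb p y₀ x z).X b →ₗ[R] W) : (qOb p y₀ A n z).X c →ₗ[R] W :=
  stLift φ

theorem qLift_qTen {n : ℕ} {z : Option 𝒞.Ob} {c : Deg N} {W : Type u} [AddCommGroup W] [Module R W]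
    (φ : ∀ (x : 𝒞.Ob) (a b : Deg N), a + b = c →
      (rOb A n x).X a →ₗ[R] (vOb p y₀ x z).X b →ₗ[R] W) (x : 𝒞.Ob) (a b : Deg N) (h : a + b = c)
    (r : (rOb A n x).X a) (v : (vOb p y₀ x z).X b) :
    qLift φ (qTen p y₀ A n a b c h r v) = φ x a b h r v := stLift_stX φ x a b h r v

/-- The map `r, m, v ↦ r ⊗ m v`. -/
def tActStep (n : ℕ) {w x : 𝒞.Ob} {z : Option 𝒞.Ob} (a b : Deg N) :
    (rOb A n w).X a →ₗ[R] (vOb p y₀ w (some x)).X b →ₗ[R] (vSum p y₀ x z →ₗ[R] tSum p y₀ A z) :=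
  LinearMap.mk₂ R
    (fun r m => tTen (rIn p y₀ A n w a r) ∘ₗ hComp (vIn b m))
    (fun _ _ _ => by simp only [map_add, LinearMap.add_comp])
    (fun _ _ _ => by simp only [map_smul, LinearMap.smul_comp])
    (fun _ _ _ => by simp only [map_add, LinearMap.comp_add])
    (fun _ _ _ => by simp only [map_smul, LinearMap.comp_smul])

/-- The action of `𝒞`, where the degree zero simplices act trivially on the module `vOb none`. -/
def tAct {x : 𝒞.Ob} {z : Option 𝒞.Ob} :
    tSum p y₀ A (some x) →ₗ[R] vSum p y₀ x z →ₗ[R] tSum p y₀ A z :=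
  barLift (some x) (fun y h a => Option.some.inj h ▸ baseAct z a) fun n c =>
    qLift fun w a b h => tActStep n a b

theorem tAct_rIn_zero {x : 𝒞.Ob} {z : Option 𝒞.Ob} (a : Deg N) (r : (rOb A 0 x).X a) :
    tAct (z := z) (rIn p y₀ A 0 x a r) = baseAct z a r := barLift_rIn_zero _ _ _ _ _

theorem tAct_tTen_in {w x : 𝒞.Ob} {z : Option 𝒞.Ob} (n : ℕ) (a b : Deg N)
    (r : (rOb A n w).X a) (m : (vOb p y₀ w (some x)).X b) :
    tAct (z := z) (tTen (rIn p y₀ A n w a r) (vIn b m)) =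
      tTen (rIn p y₀ A n w a r) ∘ₗ hComp (vIn b m) := by
  rw [tTen_in n a b (a + b) rfl r m, tAct, barLift_qIn, qLift_qTen]
  rfl

theorem tAct_tTen {w x : 𝒞.Ob} {z : Option 𝒞.Ob} (r : tSum p y₀ A (some w))
    (m : vSum p y₀ w (some x)) (v : vSum p y₀ x z) :
    tAct (tTen r m) v = tTen r (hComp m v) := by
  refine rSum_induction (P := fun r => tAct (tTen r m) v = tTen r (hComp m v)) r fun n a r => ?_
  refine vSum_induction (P := fun m => tAct (tTen (rIn p y₀ A n w a r) m) v =
    tTen (rIn p y₀ A n w a r) (hComp m v)) m fun b m => ?_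
  exact LinearMap.congr_fun (tAct_tTen_in n a b r m) v

theorem tAct_in {x y : 𝒞.Ob} (n : ℕ) (a b c : Deg N) (hc : a + b = c) (r : (rOb A n x).X a)
    (m : (𝒞.Hom x y).X b) :
    tAct (rIn p y₀ A n x a r) (hIn b m) = rIn p y₀ A n y c (rAct A n a b c hc r m) := by
  cases n with
  | zero => rw [tAct_rIn_zero]; exact baseAct_some a b c hc r m
  | succ n =>
    have key : (tAct.flip (hIn b m)) ∘ₗ qIn p y₀ A n (some x) a =
        qIn p y₀ A n (some y) c ∘ₗ (rAct A (n + 1) a b c hc).flip m := by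
      refine qTen_ext fun w a' b' h r v => ?_
      have h1 := tTen_in (z := some x) n a' b' a h r v
      have h2 := tAct_tTen (rIn p y₀ A n w a' r) (vIn (z := some x) b' v) (hIn b m)
      have h3 := hComp_in (p := p) (y₀ := y₀) (z := some y) b' b (b' + b) rfl v m
      have h4 := rAct_rTen A n a' b' a b c (b' + b) h hc rfl (by rw [← hc, ← h]; ring) r v m
      have h5 := tTen_in (p := p) (y₀ := y₀) (z := some y) n a' (b' + b) c
        (by rw [← hc, ← h]; ring) r (𝒞.comp b' b (b' + b) rfl v m)
      refine (congrArg (fun t => tAct t (hIn b m)) h1.symm).trans (h2.trans ?_)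
      refine (congrArg (tTen (rIn p y₀ A n w a' r)) h3).trans (h5.trans ?_)
      exact (congrArg (rIn p y₀ A (n + 1) y c) h4).symm
    exact LinearMap.congr_fun key r

end BarTotal

/-! ### Operators on the total module -/

section BarOperators

variable {𝒞 𝒟 : DGCat R N}
variable {p : DGFunctor 𝒞 𝒟} {y₀ : 𝒟.Ob} {A : DGMod 𝒞}

theorem hComp_assoc {w x y : 𝒞.Ob} {z : Option 𝒞.Ob} (a : vSum p y₀ w (some x))
    (b : vSum p y₀ x (some y)) (c : vSum p y₀ y z) :
    hComp (hComp a b) c = hComp a (hComp b c) := by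
  refine vSum_induction (P := fun a => hComp (hComp a b) c = hComp a (hComp b c)) a fun f a => ?_
  refine vSum_induction (P := fun b => hComp (hComp (vIn f a) b) c = hComp (vIn f a) (hComp b c)) b fun g b => ?_
  refine vSum_induction (P := fun c => hComp (hComp (vIn f a) (vIn g b)) c =
    hComp (vIn f a) (hComp (vIn g b) c)) c fun h c => ?_
  have h1 := hComp_in (p := p) (y₀ := y₀) (z := some y) f g (f + g) rfl a b
  have h2 := hComp_in (p := p) (y₀ := y₀) g h (g + h) rfl b c
  have h3 := hComp_in (p := p) (y₀ := y₀) f (g + h) (f + g + h) (by ring) a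
    (vComp p y₀ g h (g + h) rfl b c)
  have h4 := hComp_in (p := p) (y₀ := y₀) (f + g) h (f + g + h) rfl (𝒞.comp f g (f + g) rfl a b) c
  have h5 := vComp_assoc p y₀ f g h (f + g) (g + h) (f + g + h) rfl rfl rfl (by ring) a b c
  exact (congrArg (fun t => hComp t (vIn h c)) h1).trans (h4.trans ((congrArg (vIn _) h5).trans
    (h3.symm.trans (congrArg (hComp (vIn f a)) h2).symm)))

theorem one_hComp {x : 𝒞.Ob} {z : Option 𝒞.Ob} (v : vSum p y₀ x z) :
    hComp (hIn 0 (𝒞.one x)) v = v := by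
  refine vSum_induction (P := fun v => hComp (hIn 0 (𝒞.one x)) v = v) v fun b v => ?_
  rw [hComp_in 0 b b (zero_add b), one_vComp]

theorem hComp_one {x y : 𝒞.Ob} (v : vSum p y₀ x (some y)) :
    hComp v (hIn 0 (𝒞.one y)) = v := by
  refine vSum_induction (P := fun v => hComp v (hIn 0 (𝒞.one y)) = v) v fun b v => ?_
  refine (hComp_in (p := p) (y₀ := y₀) (z := some y) b 0 b (add_zero b) v (𝒞.one y)).trans ?_
  exact congrArg (vIn b) (𝒞.comp_one b (add_zero b) v)

variable (p y₀ A) in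
/-- The span of the simplices of degree zero. -/
def tBase : ∀ z : Option 𝒞.Ob, Submodule R (tSum p y₀ A z)
  | some y => ⨆ a, LinearMap.range (rIn p y₀ A 0 y a)
  | none => ⊥

theorem rIn_mem_tBase (y : 𝒞.Ob) (a : Deg N) (r : (rOb A 0 y).X a) :
    rIn p y₀ A 0 y a r ∈ tBase p y₀ A (some y) :=
  Submodule.mem_iSup_of_mem a ⟨r, rfl⟩

theorem tBase_induction {y : 𝒞.Ob} {P : tSum p y₀ A (some y) → Prop} {t : tSum p y₀ A (some y)}
    (ht : t ∈ tBase p y₀ A (some y)) (h0 : P 0) (hadd : ∀ t t', P t → P t' → P (t + t'))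
    (h : ∀ a r, P (rIn p y₀ A 0 y a r)) : P t := by
  refine Submodule.iSup_induction (fun a => LinearMap.range (rIn p y₀ A 0 y a)) (motive := P) ht ?_ h0 hadd
  rintro a _ ⟨r, rfl⟩
  exact h a r

theorem tAct_mem_tBase {x : 𝒞.Ob} {z : Option 𝒞.Ob} (b : tSum p y₀ A (some x)) (v : vSum p y₀ x z)
    (hb : b ∈ tBase p y₀ A (some x)) : tAct b v ∈ tBase p y₀ A z := by
  refine tBase_induction (P := fun b => tAct b v ∈ tBase p y₀ A z) hb ?_ ?_ fun a r => ?_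
  · rw [map_zero]; exact zero_mem _
  · intro t t' h h'
    rw [map_add]; exact add_mem h h'
  rw [tAct_rIn_zero]
  cases z with
  | none => exact zero_mem _
  | some y =>
    refine vSum_induction (P := fun v => baseAct (some y) a r v ∈ tBase p y₀ A (some y)) v
      (fun b v => ?_) ?_ ?_
    rotate_left
    · rw [map_zero]; exact zero_mem _
    · intro v v' h h'
      rw [map_add]; exact add_mem h h'
    · refine Eq.subst (motive := fun t => t ∈ tBase p y₀ A (some y))
        (baseAct_some a b (a + b) rfl r v).symm ?_
      exact rIn_mem_tBase _ _ _

theorem rTen_induction {n : ℕ} {y : 𝒞.Ob} {c : Deg N} {P : (rOb A (n + 1) y).X c → Prop}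
    (q : (rOb A (n + 1) y).X c) (h0 : P 0) (hadd : ∀ q q', P q → P q' → P (q + q'))
    (h : ∀ x a b (hc : a + b = c) (r : (rOb A n x).X a) (v : (𝒞.Hom x y).X b),
      P (rTen A n a b c hc r v)) : P q := by
  classical
  refine DirectSum.induction_on (β := fun s : 𝒞.Ob × {p : Deg N × Deg N // p.1 + p.2 = c} =>
    TensorProduct R ((rOb A n s.1).X s.2.1.1) ((𝒞.Hom s.1 y).X s.2.1.2)) q h0 ?_ hadd
  rintro ⟨x, ⟨a, b⟩, hc⟩ t
  induction t using TensorProduct.induction_on with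
  | zero => rw [map_zero]; exact h0
  | tmul r v => exact h x a b hc r v
  | add t t' h h' => rw [map_add]; exact hadd _ _ h h'

theorem tAct_rIn_rAct {w x : 𝒞.Ob} {z : Option 𝒞.Ob} (n : ℕ) (a b : Deg N) (r : (rOb A (n + 1) w).X a)
    (m : (𝒞.Hom w x).X b) (v : vSum p y₀ x z) :
    tAct (rIn p y₀ A (n + 1) x (a + b) (rAct A (n + 1) a b (a + b) rfl r m)) v =
      tAct (rIn p y₀ A (n + 1) w a r) (hComp (hIn b m) v) := by
  refine rTen_induction (P := fun r : (rOb A (n + 1) w).X a =>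
    tAct (rIn p y₀ A (n + 1) x (a + b) (rAct A (n + 1) a b (a + b) rfl r m)) v =
      tAct (rIn p y₀ A (n + 1) w a r) (hComp (hIn b m) v)) r
    (by rw [LinearMap.map_zero₂, map_zero, LinearMap.map_zero₂, map_zero, LinearMap.map_zero₂])
    (fun _ _ h h' => by rw [LinearMap.map_add₂, map_add, LinearMap.map_add₂, h, h', map_add,
      LinearMap.map_add₂]) fun u a' b' h r q => ?_
  have h2 := tTen_in (p := p) (y₀ := y₀) (z := some w) n a' b' a h r q
  have h3 := tAct_tTen (rIn p y₀ A n u a' r) (hIn b' q) (hComp (hIn b m) v)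
  have h4 := rAct_rTen A n a' b' a b (a + b) (b' + b) h rfl rfl (by rw [← h]; ring) r q m
  have h5 := tTen_in (p := p) (y₀ := y₀) (z := some x) n a' (b' + b) (a + b)
    (by rw [← h]; ring) r (𝒞.comp b' b (b' + b) rfl q m)
  have h6 := hComp_in (p := p) (y₀ := y₀) (z := some x) b' b (b' + b) rfl q m
  have h7 := tAct_tTen (rIn p y₀ A n u a' r) (hComp (hIn b' q) (hIn b m)) v
  have h8 : tTen (rIn p y₀ A n u a' r) (hComp (hIn b' q) (hIn b m)) =
    qIn p y₀ A n (some x) (a + b) (rAct A (n + 1) a b (a + b) rfl (rTen A n a' b' a h r q) m) :=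
    (congrArg _ h6).trans (h5.trans (congrArg (qIn p y₀ A n (some x) (a + b)) h4.symm))
  refine (congrArg (fun t => tAct t v) h8.symm).trans (h7.trans ?_)
  rw [hComp_assoc]
  exact h3.symm.trans (congrArg (fun t => tAct t (hComp (hIn b m) v)) h2)

theorem tAct_tAct {w x : 𝒞.Ob} {z : Option 𝒞.Ob} (r : tSum p y₀ A (some w))
    (m : vSum p y₀ w (some x)) (v : vSum p y₀ x z) :
    tAct (tAct r m) v = tAct r (hComp m v) := by
  refine rSum_induction (P := fun r => tAct (tAct r m) v = tAct r (hComp m v)) r fun n a r => ?_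
  refine vSum_induction (P := fun m => tAct (tAct (rIn p y₀ A n w a r) m) v =
    tAct (rIn p y₀ A n w a r) (hComp m v)) m fun b m => ?_
  have h1 := tAct_in (p := p) (y₀ := y₀) n a b (a + b) rfl r m
  refine (congrArg (fun t => tAct t v) h1).trans ?_
  cases n with
  | zero =>
    cases z with
    | none =>
      rw [tAct_rIn_zero, tAct_rIn_zero]
      rfl
    | some z =>
      refine vSum_induction (P := fun v => tAct (rIn p y₀ A 0 x (a + b) (rAct A 0 a b (a + b) rfl r m)) v =
        tAct (rIn p y₀ A 0 w a r) (hComp (vIn b m) v)) v fun c v => ?_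
      have h2 := tAct_in (p := p) (y₀ := y₀) 0 (a + b) c (a + b + c) rfl (rAct A 0 a b (a + b) rfl r m) v
      have h3 := hComp_in (p := p) (y₀ := y₀) (z := some z) b c (b + c) rfl m v
      have h4 := tAct_in (p := p) (y₀ := y₀) 0 a (b + c) (a + b + c) (by ring) r
        (𝒞.comp b c (b + c) rfl m v)
      have h5 := rAct_rAct A 0 a b c (a + b) (b + c) (a + b + c) rfl rfl rfl (by ring) r m v
      exact h2.trans ((congrArg _ h5).trans (h4.symm.trans (congrArg _ h3.symm)))
  | succ n =>
    exact tAct_rIn_rAct n a b r m v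

theorem tAct_one {x : 𝒞.Ob} (r : tSum p y₀ A (some x)) : tAct r (hIn 0 (𝒞.one x)) = r := by
  refine rSum_induction (P := fun r => tAct r (hIn 0 (𝒞.one x)) = r) r fun n a r => ?_
  rw [tAct_in n a 0 a (add_zero a), rAct_one]

variable (p y₀ A) in
/-- The sign operator on sums of homogeneous parts. -/
def tSign : ∀ z : Option 𝒞.Ob, tSum p y₀ A z →ₗ[R] tSum p y₀ A z
  | some y => DirectSum.toModule R _ _ fun k => ((-1) ^ k.1 * sg R (par k.2)) • rIn p y₀ A k.1 y k.2
  | none => DirectSum.toModule R _ _ fun k =>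
      ((-1) ^ (k.1 + 1) * sg R (par k.2)) • qIn p y₀ A k.1 none k.2

theorem tSign_rIn (n : ℕ) (y : 𝒞.Ob) (a : Deg N) (r : (rOb A n y).X a) :
    tSign p y₀ A (some y) (rIn p y₀ A n y a r) = ((-1) ^ n * sg R (par a)) • rIn p y₀ A n y a r :=
  DirectSum.toModule_lof R (M := fun k : ℕ × Deg N => (tOb p y₀ A (some y) k.1).X k.2) (n, a) r

theorem tSign_qIn (n : ℕ) (z : Option 𝒞.Ob) (c : Deg N) (q : (qOb p y₀ A n z).X c) :
    tSign p y₀ A z (qIn p y₀ A n z c q) = ((-1) ^ (n + 1) * sg R (par c)) • qIn p y₀ A n z c q := by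
  cases z with
  | none =>
    exact DirectSum.toModule_lof R (M := fun k : ℕ × Deg N => (tOb p y₀ A none k.1).X k.2) (n, c) q
  | some y => exact tSign_rIn (n + 1) y c q

theorem tSign_tTen {x : 𝒞.Ob} {z : Option 𝒞.Ob} (r : tSum p y₀ A (some x)) (v : vSum p y₀ x z) :
    tSign p y₀ A z (tTen r v) = tTen (tSign p y₀ A _ r) (vSign x z v) := by
  refine rSum_induction (P := fun r => tSign p y₀ A z (tTen r v) =
    tTen (tSign p y₀ A _ r) (vSign x z v)) r fun n a r => ?_
  refine vSum_induction (P := fun v => tSign p y₀ A z (tTen (rIn p y₀ A n x a r) v) =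
    tTen (tSign p y₀ A _ (rIn p y₀ A n x a r)) (vSign x z v)) v fun b v => ?_
  rw [tTen_in n a b (a + b) rfl, tSign_qIn, tSign_rIn, vSign_in, LinearMap.map_smul, LinearMap.map_smul₂,
    smul_smul, tTen_in n a b (a + b) rfl, map_add, sg_add]
  congr 1
  ring

theorem del_end {B : EssBasis p y₀} {x : 𝒞.Ob} (s : vSum p y₀ x (some x)) : vDel s = 0 := by
  refine vSum_induction (P := fun s => vDel s = 0) s fun b s => ?_
  rw [vDel_in]
  by_cases hb : b = 0
  · subst hb
    have h1 : (0 : Deg N) - 1 ≠ 0 := fun h => by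
      have := congrArg par h
      rw [par_sub_one, map_zero] at this
      exact absurd this (by decide)
    exact (congrArg (vIn _) (B.hom_eq_zero x _ h1 (del _ _ _ s))).trans (map_zero _)
  · refine (congrArg (fun t => vIn (b - 1) (del _ b (b - 1) t)) (B.hom_eq_zero x b hb s)).trans ?_
    exact (congrArg (vIn (b - 1)) (map_zero (del (vOb p y₀ x (some x)) b (b - 1)))).trans (map_zero _)

theorem EssBasis.end_induction (B : EssBasis p y₀) {x : 𝒞.Ob} {P : vSum p y₀ x (some x) → Prop}
    (s : vSum p y₀ x (some x)) (h : ∀ s, P (hIn 0 s)) (h0 : P 0 := by simp)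
    (hadd : ∀ v v', P v → P v' → P (v + v') := by
      intro _ _ h h'; simp only [map_add, LinearMap.add_apply, add_zero, h, h'] <;> abel) : P s := by
  refine vSum_induction s (fun b s => ?_) h0 hadd
  by_cases hb : b = 0
  · subst hb; exact h s
  · have := B.hom_eq_zero x b hb s
    have h2 : vIn b s = (0 : vSum p y₀ x (some x)) := (congrArg (vIn b) this).trans (map_zero _)
    rw [h2]; exact h0

theorem vDel_hComp (B : EssBasis p y₀) {x : 𝒞.Ob} {z : Option 𝒞.Ob} (s : vSum p y₀ x (some x))
    (v : vSum p y₀ x z) : vDel (hComp s v) = hComp s (vDel v) := by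
  refine B.end_induction (P := fun s => vDel (hComp s v) = hComp s (vDel v)) s fun s => ?_
  refine vSum_induction (P := fun v => vDel (hComp (hIn 0 s) v) = hComp (hIn 0 s) (vDel v)) v fun b v => ?_
  have h1 : (0 : Deg N) - 1 ≠ 0 := fun h => by
    have := congrArg par h
    rw [par_sub_one, map_zero] at this
    exact absurd this (by decide)
  rw [hComp_in 0 b b (zero_add b), vDel_in, vDel_in, hComp_in 0 (b - 1) (b - 1) (zero_add _), del_vComp,
    B.hom_eq_zero x _ h1 (del _ 0 (0 - 1) s), map_zero, map_zero, LinearMap.zero_apply, zero_add, sg_zero,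
    one_smul]

theorem vSign_hComp (B : EssBasis p y₀) {x : 𝒞.Ob} {z : Option 𝒞.Ob} (s : vSum p y₀ x (some x))
    (v : vSum p y₀ x z) : vSign x z (hComp s v) = hComp s (vSign x z v) := by
  refine B.end_induction (P := fun s => vSign x z (hComp s v) = hComp s (vSign x z v)) s fun s => ?_
  refine vSum_induction (P := fun v => vSign x z (hComp (hIn 0 s) v) = hComp (hIn 0 s) (vSign x z v)) v fun b v => ?_
  rw [hComp_in 0 b b (zero_add b), vSign_in, vSign_in, LinearMap.map_smul, hComp_in 0 b b (zero_add b)]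

theorem tSign_tAct (B : EssBasis p y₀) {x : 𝒞.Ob} (r : tSum p y₀ A (some x)) (s : vSum p y₀ x (some x)) :
    tSign p y₀ A _ (tAct r s) = tAct (tSign p y₀ A _ r) s := by
  refine rSum_induction (P := fun r => tSign p y₀ A _ (tAct r s) = tAct (tSign p y₀ A _ r) s) r fun n a r => ?_
  refine B.end_induction (P := fun s => tSign p y₀ A _ (tAct (rIn p y₀ A n x a r) s) =
    tAct (tSign p y₀ A _ (rIn p y₀ A n x a r)) s) s fun s => ?_
  rw [tAct_in n a 0 a (add_zero a), tSign_rIn, tSign_rIn, LinearMap.map_smul, LinearMap.smul_apply,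
    tAct_in n a 0 a (add_zero a)]

/-- The differential of the sum of the homogeneous parts of `(F U) ^ n A`: the alternating sum of the
faces, minus the internal differential with sign. -/
def rBd (y : 𝒞.Ob) : tSum p y₀ A (some y) →ₗ[R] tSum p y₀ A (some y) :=
  barLift (some y) (fun y' h a => -(h ▸ rIn p y₀ A 0 y' (a - 1) ∘ₗ del _ a (a - 1)))
    fun n c => rIn p y₀ A n y c ∘ₗ rFace A n y c -
      ((-1 : R) ^ (n + 1)) • (rIn p y₀ A (n + 1) y (c - 1) ∘ₗ del (rOb A (n + 1) y) c (c - 1))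

theorem rBd_zero (y : 𝒞.Ob) (a : Deg N) (r : (rOb A 0 y).X a) :
    rBd y (rIn p y₀ A 0 y a r) = -rIn p y₀ A 0 y (a - 1) (del _ a (a - 1) r) :=
  barLift_rIn_zero _ _ _ _ _

theorem rBd_succ (n : ℕ) (y : 𝒞.Ob) (a : Deg N) (r : (rOb A (n + 1) y).X a) :
    rBd y (rIn p y₀ A (n + 1) y a r) = rIn p y₀ A n y a (rFace A n y a r) -
      ((-1 : R) ^ (n + 1)) • rIn p y₀ A (n + 1) y (a - 1) (del _ a (a - 1) r) :=
  barLift_rIn_succ _ _ _ _ _ _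

/-- The map `r, v ↦ r v - ∂ r ⊗ v + ε r ⊗ d v`. -/
def bdStep (n : ℕ) {x : 𝒞.Ob} {z : Option 𝒞.Ob} (a b : Deg N) :
    (rOb A n x).X a →ₗ[R] (vOb p y₀ x z).X b →ₗ[R] tSum p y₀ A z :=
  (tAct.compl₁₂ (rIn p y₀ A n x a) (vIn b) - tTen.compl₁₂ (rBd x ∘ₗ rIn p y₀ A n x a) (vIn b)) +
    tTen.compl₁₂ (tSign p y₀ A _ ∘ₗ rIn p y₀ A n x a) (vDel ∘ₗ vIn b)

theorem bdStep_apply (n : ℕ) {x : 𝒞.Ob} {z : Option 𝒞.Ob} (a b : Deg N) (r : (rOb A n x).X a)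
    (v : (vOb p y₀ x z).X b) : bdStep n a b r v = tAct (rIn p y₀ A n x a r) (vIn b v) -
      tTen (rBd x (rIn p y₀ A n x a r)) (vIn b v) +
        tTen (tSign p y₀ A _ (rIn p y₀ A n x a r)) (vDel (vIn b v)) := rfl

/-- The differential on the summand for `none`. -/
def qBd : tSum p y₀ A none →ₗ[R] tSum p y₀ A none :=
  barLift none (fun _ h => nomatch h) fun n c => qLift fun x a b h => bdStep n a b

theorem qBd_qTen (n : ℕ) (x : 𝒞.Ob) (a b c : Deg N) (h : a + b = c) (r : (rOb A n x).X a)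
    (v : (vOb p y₀ x none).X b) : qBd (qIn p y₀ A n none c (qTen p y₀ A n a b c h r v)) =
      bdStep n a b r v := by
  rw [qBd, barLift_qIn, qLift_qTen]

/-- The differential on the sums of homogeneous parts. -/
def tBd : ∀ z : Option 𝒞.Ob, tSum p y₀ A z →ₗ[R] tSum p y₀ A z
  | some y => rBd y
  | none => qBd

theorem tBd_tTen_rIn_hIn {x z : 𝒞.Ob} (n : ℕ) (a b : Deg N) (r : (rOb A n x).X a) (v : (𝒞.Hom x z).X b) :
    tBd (some z) (tTen (rIn p y₀ A n x a r) (hIn b v)) = tAct (rIn p y₀ A n x a r) (hIn b v) -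
      tTen (tBd _ (rIn p y₀ A n x a r)) (hIn b v) +
        tTen (tSign p y₀ A _ (rIn p y₀ A n x a r)) (vDel (hIn b v)) := by
  have h0 := tTen_in (p := p) (y₀ := y₀) (z := some z) n a b (a + b) rfl r v
  have h1 : tBd (some z) (tTen (rIn p y₀ A n x a r) (hIn b v)) =
    rIn p y₀ A n z (a + b) (rFace A n z (a + b) (rTen A n a b (a + b) rfl r v)) -
      ((-1 : R) ^ (n + 1)) • rIn p y₀ A (n + 1) z (a + b - 1)
        (del _ (a + b) (a + b - 1) (rTen A n a b (a + b) rfl r v)) :=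
    (congrArg (tBd (some z)) h0).trans (rBd_succ n z (a + b) (rTen A n a b (a + b) rfl r v))
  have h2 : del (rOb A (n + 1) z) (a + b) (a + b - 1) (rTen A n a b (a + b) rfl r v) =
    rTen A n (a - 1) b (a + b - 1) (by ring) (del _ a (a - 1) r) v +
      sg R (par a) • rTen A n a (b - 1) (a + b - 1) (by ring) r (del _ b (b - 1) v) :=
    del_fm _ z x a b (a + b) rfl r v
  have h3 : tAct (rIn p y₀ A n x a r) (hIn b v) = rIn p y₀ A n z (a + b) (rAct A n a b (a + b) rfl r v) :=
    tAct_in n a b (a + b) rfl r v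
  have h4 : ∀ k a' b' c' (hc : a' + b' = c') (r : (rOb A k x).X a') (v : (𝒞.Hom x z).X b'),
      tTen (rIn p y₀ A k x a' r) (hIn b' v) = rIn p y₀ A (k + 1) z c' (rTen A k a' b' c' hc r v) :=
    fun k a' b' c' hc r v => tTen_in (p := p) (y₀ := y₀) (z := some z) k a' b' c' hc r v
  have h5 : vDel (hIn (p := p) (y₀ := y₀) b v) = hIn (b - 1) (del (𝒞.Hom x z) b (b - 1) v) := vDel_in (z := some z) b v
  rw [h1, h2, h3, tSign_rIn, h5, LinearMap.map_smul₂, map_add, map_smul,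
    h4 n a (b - 1) (a + b - 1) (by ring)]
  cases n with
  | zero =>
    have hp : (-1 : R) ^ (0 + 1) = -1 := pow_one _
    rw [congrArg (rIn p y₀ A 0 z (a + b)) (rFace_rTen_zero A a b (a + b) rfl r v)]
    change _ = _ - tTen (rBd x (rIn p y₀ A 0 x a r)) _ + _
    rw [rBd_zero, map_neg, LinearMap.neg_apply, h4 0 (a - 1) b (a + b - 1) (by ring), pow_zero, one_mul, hp,
       smul_add, smul_smul, neg_smul, one_smul, neg_mul, one_mul, neg_smul]
    abel
  | succ n =>
    rw [rFace_rTen]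
    change _ = _ - tTen (rBd x (rIn p y₀ A (n + 1) x a r)) _ + _
    rw [rBd_succ, map_sub, map_sub, LinearMap.sub_apply, LinearMap.map_smul, LinearMap.smul_apply,
      h4 (n + 1) (a - 1) b (a + b - 1) (by ring), h4 n a b (a + b) rfl, smul_add, smul_smul,
      pow_succ (-1 : R) (n + 1), mul_neg_one, neg_smul, neg_mul, neg_smul]
    abel

theorem tBd_tTen {x : 𝒞.Ob} {z : Option 𝒞.Ob} (r : tSum p y₀ A (some x)) (v : vSum p y₀ x z) :
    tBd z (tTen r v) = tAct r v - tTen (tBd _ r) v + tTen (tSign p y₀ A _ r) (vDel v) := by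
  refine rSum_induction (P := fun r => tBd z (tTen r v) = tAct r v - tTen (tBd _ r) v +
    tTen (tSign p y₀ A _ r) (vDel v)) r fun n a r => ?_
  refine vSum_induction (P := fun v => tBd z (tTen (rIn p y₀ A n x a r) v) =
    tAct (rIn p y₀ A n x a r) v - tTen (tBd _ (rIn p y₀ A n x a r)) v +
      tTen (tSign p y₀ A _ (rIn p y₀ A n x a r)) (vDel v)) v fun b v => ?_
  cases z with
  | none =>
    rw [tTen_in n a b (a + b) rfl]
    exact (qBd_qTen n x a b _ rfl r v).trans (bdStep_apply n a b r v)
  | some z =>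
    exact tBd_tTen_rIn_hIn n a b r v

theorem tBd_mem_tBase {z : Option 𝒞.Ob} (b : tSum p y₀ A z) (hb : b ∈ tBase p y₀ A z) :
    tBd z b ∈ tBase p y₀ A z := by
  cases z with
  | none => rw [(Submodule.mem_bot R).1 hb, map_zero]; exact zero_mem _
  | some y =>
    refine tBase_induction (P := fun b => tBd (some y) b ∈ tBase p y₀ A (some y)) hb ?_ ?_ fun a r => ?_
    · rw [map_zero]; exact zero_mem _
    · intro t t' h h'
      rw [map_add]; exact add_mem h h'
    · change rBd y _ ∈ tBase p y₀ A (some y)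
      rw [rBd_zero]
      exact neg_mem (rIn_mem_tBase _ _ _)

theorem tSign_mem_tBase {z : Option 𝒞.Ob} (b : tSum p y₀ A z) (hb : b ∈ tBase p y₀ A z) :
    tSign p y₀ A z b ∈ tBase p y₀ A z := by
  cases z with
  | none => rw [(Submodule.mem_bot R).1 hb, map_zero]; exact zero_mem _
  | some y =>
    refine tBase_induction (P := fun b => tSign p y₀ A (some y) b ∈ tBase p y₀ A (some y)) hb ?_ ?_
      fun a r => ?_
    · rw [map_zero]; exact zero_mem _
    · intro t t' h h'
      rw [map_add]; exact add_mem h h'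
    · rw [tSign_rIn]
      exact Submodule.smul_mem _ _ (rIn_mem_tBase _ _ _)

theorem tBd_tAct (B : EssBasis p y₀) {x : 𝒞.Ob} (r : tSum p y₀ A (some x)) (s : vSum p y₀ x (some x)) :
    tBd _ (tAct r s) = tAct (tBd _ r) s := by
  refine rSum_induction (P := fun r => tBd _ (tAct r s) = tAct (tBd _ r) s) r fun n a r => ?_
  refine B.end_induction (P := fun s => tBd _ (tAct (rIn p y₀ A n x a r) s) =
    tAct (tBd _ (rIn p y₀ A n x a r)) s) s fun s => ?_
  have h0 : (0 : Deg N) - 1 ≠ 0 := fun h => by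
    have := congrArg par h
    rw [par_sub_one, map_zero] at this
    exact absurd this (by decide)
  have h1 : del (rOb A n x) a (a - 1) (rAct A n a 0 a (add_zero a) r s) =
      rAct A n (a - 1) 0 (a - 1) (add_zero _) (del _ a (a - 1) r) s := by
    refine ((freeRes(A) n).del_act a 0 a (add_zero a) r s).trans ?_
    rw [B.hom_eq_zero x _ h0 (del _ 0 (0 - 1) s), map_zero, smul_zero, add_zero]
    rfl
  rw [tAct_in n a 0 a (add_zero a)]
  cases n with
  | zero =>
    change rBd x _ = tAct (rBd x _) _
    rw [rBd_zero, rBd_zero, map_neg, LinearMap.neg_apply, h1, tAct_in 0 (a - 1) 0 (a - 1) (add_zero _)]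
  | succ n =>
    change rBd x _ = tAct (rBd x _) _
    rw [rBd_succ, rBd_succ, map_sub, LinearMap.sub_apply, LinearMap.map_smul, LinearMap.smul_apply, h1,
      tAct_in (n + 1) (a - 1) 0 (a - 1) (add_zero _), tAct_in n a 0 a (add_zero _), rFace_rAct]

end BarOperators

/-! ### The bar construction as an abstract bar system -/

section BarSystemOf

variable {𝒞 𝒟 : DGCat R N}
variable {p : DGFunctor 𝒞 𝒟} {y₀ : 𝒟.Ob} {A : DGMod 𝒞}

theorem tTen_end {x : 𝒞.Ob} {z : Option 𝒞.Ob} (n : ℕ) (a b : Deg N)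
    (r : (rOb A n x).X a) (s : (𝒞.Hom x x).X 0) (e : (vOb p y₀ x z).X b) :
    tTen (rIn p y₀ A n x a r) (hComp (hIn 0 s) (vIn b e)) =
      qIn p y₀ A n z (a + b) (qTen p y₀ A n a b (a + b) rfl r (vComp p y₀ 0 b b (zero_add b) s e)) := by
  rw [hComp_in 0 b b (zero_add b), tTen_in n a b (a + b) rfl]

theorem EssBasis.ten_induction (B : EssBasis p y₀) {x : 𝒞.Ob}
    {P : tSum p y₀ A (some x) → vSum p y₀ x (some x) → Prop}
    (r : tSum p y₀ A (some x)) (s : vSum p y₀ x (some x))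
    (h0 : ∀ s, P 0 s) (hadd : ∀ r r' s, P r s → P r' s → P (r + r') s)
    (h0' : ∀ r, P r 0) (hadd' : ∀ r s s', P r s → P r s' → P r (s + s'))
    (h : ∀ n a r s, P (rIn p y₀ A n x a r) (hIn 0 s)) : P r s := by
  refine rSum_induction (P := fun r => P r s) r (fun n a r => ?_) (h0 s)
    fun _ _ => hadd _ _ _
  exact B.end_induction (P := fun s => P (rIn p y₀ A n x a r) s) s (fun s => h n a r s) (h0' _)
    fun _ _ => hadd' _ _ _

/-- The homotopy `η`. -/
def tη (B : EssBasis p y₀) (z : Option 𝒞.Ob) : tSum p y₀ A z →ₗ[R] tSum p y₀ A z :=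
  barLift z (fun _ _ _ => 0) fun n c => qIn p y₀ A (n + 1) z c ∘ₗ ηQ A B n z c

theorem tη_qIn (B : EssBasis p y₀) (z : Option 𝒞.Ob) (n : ℕ) (c : Deg N) (q : (qOb p y₀ A n z).X c) :
    tη B z (qIn p y₀ A n z c q) = qIn p y₀ A (n + 1) z c (ηQ A B n z c q) := barLift_qIn _ _ _ _ _ _

theorem tη_rIn (B : EssBasis p y₀) (n : ℕ) (x : 𝒞.Ob) (a : Deg N) (r : (rOb A n x).X a) :
    tη B (some x) (rIn p y₀ A n x a r) = rIn p y₀ A (n + 1) x a (ηR A B n x a r) := by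
  cases n with
  | zero => exact (barLift_rIn_zero _ _ _ _ _).trans (map_zero _).symm
  | succ n => exact barLift_rIn_succ _ _ _ _ _ _

theorem tη_base (B : EssBasis p y₀) {z : Option 𝒞.Ob} (b : tSum p y₀ A z) (hb : b ∈ tBase p y₀ A z) :
    tη B z b = 0 := by
  cases z with
  | none => rw [(Submodule.mem_bot R).1 hb, map_zero]
  | some y =>
    refine tBase_induction (P := fun b => tη B (some y) b = 0) hb (map_zero _)
      (fun _ _ h h' => by rw [map_add, h, h', add_zero]) fun a r => ?_
    exact barLift_rIn_zero _ _ _ _ _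

theorem tη_ten (B : EssBasis p y₀) {x : 𝒞.Ob} {z : Option 𝒞.Ob} (r : tSum p y₀ A (some x))
    (s : vSum p y₀ x (some x)) (b : Deg N) (i : B.ι x z b) :
    tη B z (tTen r (hComp s (vIn b (B.e i)))) = tTen (tTen r s) (vIn b (B.e i)) -
      tTen (tη B _ (tAct r s)) (vIn b (B.e i)) := by
  refine B.ten_induction (P := fun r s => tη B z (tTen r (hComp s (vIn b (B.e i)))) =
      tTen (tTen r s) (vIn b (B.e i)) - tTen (tη B _ (tAct r s)) (vIn b (B.e i))) r s
    (fun _ => by simp) (fun _ _ _ h h' => by simp only [map_add, LinearMap.add_apply, h, h']; abel)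
    (fun _ => by simp) (fun _ _ _ h h' => by simp only [map_add, LinearMap.add_apply, h, h']; abel)
    fun n a r s => ?_
  have h1 : tTen (rIn p y₀ A n x a r) (hIn 0 s) =
      rIn p y₀ A (n + 1) x a (rTen A n a 0 a (add_zero a) r s) :=
    tTen_in (p := p) (y₀ := y₀) (z := some x) n a 0 a (add_zero a) r s
  rw [tTen_end, tη_qIn, ηQ_qTen, map_sub, tAct_in n a 0 a (add_zero a), tη_rIn, h1,
    tTen_in (n + 1) a b (a + b) rfl, tTen_in (n + 1) a b (a + b) rfl]

/-- The normal form. -/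
def tNf (B : EssBasis p y₀) (z : Option 𝒞.Ob) : tSum p y₀ A z →ₗ[R] tSum p y₀ A z :=
  barLift z (fun y h a => h ▸ rIn p y₀ A 0 y a) fun n c => qIn p y₀ A n z c ∘ₗ nfQ A B n z c

theorem tNf_qIn (B : EssBasis p y₀) (z : Option 𝒞.Ob) (n : ℕ) (c : Deg N) (q : (qOb p y₀ A n z).X c) :
    tNf B z (qIn p y₀ A n z c q) = qIn p y₀ A n z c (nfQ A B n z c q) := barLift_qIn _ _ _ _ _ _

theorem tNf_rIn (B : EssBasis p y₀) (n : ℕ) (x : 𝒞.Ob) (a : Deg N) (r : (rOb A n x).X a) :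
    tNf B (some x) (rIn p y₀ A n x a r) = rIn p y₀ A n x a (nfR A B n x a r) := by
  cases n with
  | zero => exact barLift_rIn_zero _ _ _ _ _
  | succ n => exact barLift_rIn_succ _ _ _ _ _ _

theorem tNf_base (B : EssBasis p y₀) {z : Option 𝒞.Ob} (b : tSum p y₀ A z) (hb : b ∈ tBase p y₀ A z) :
    tNf B z b = b := by
  cases z with
  | none => rw [(Submodule.mem_bot R).1 hb, map_zero]
  | some y =>
    refine tBase_induction (P := fun b => tNf B (some y) b = b) hb (map_zero _)
      (fun _ _ h h' => by rw [map_add, h, h']) fun a r => ?_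
    exact barLift_rIn_zero _ _ _ _ _

theorem tNf_ten (B : EssBasis p y₀) {x : 𝒞.Ob} {z : Option 𝒞.Ob} (r : tSum p y₀ A (some x))
    (s : vSum p y₀ x (some x)) (b : Deg N) (i : B.ι x z b) :
    tNf B z (tTen r (hComp s (vIn b (B.e i)))) = tTen (tNf B _ (tAct r s)) (vIn b (B.e i)) := by
  refine B.ten_induction (P := fun r s => tNf B z (tTen r (hComp s (vIn b (B.e i)))) =
      tTen (tNf B _ (tAct r s)) (vIn b (B.e i))) r s
    (fun _ => by simp) (fun _ _ _ h h' => by simp only [map_add, LinearMap.add_apply, h, h'])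
    (fun _ => by simp) (fun _ _ _ h h' => by simp only [map_add, LinearMap.add_apply, h, h'])
    fun n a r s => ?_
  rw [tTen_end, tNf_qIn, nfQ_qTen, tAct_in n a 0 a (add_zero a), tNf_rIn,
    tTen_in n a b (a + b) rfl]

/-- The projection to the simplices of degree zero. -/
def tBp (z : Option 𝒞.Ob) : tSum p y₀ A z →ₗ[R] tSum p y₀ A z :=
  barLift z (fun y h a => h ▸ rIn p y₀ A 0 y a) fun n c => 0

theorem tBp_base {z : Option 𝒞.Ob} (b : tSum p y₀ A z) (hb : b ∈ tBase p y₀ A z) :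
    tBp z b = b := by
  cases z with
  | none => rw [(Submodule.mem_bot R).1 hb, map_zero]
  | some y =>
    refine tBase_induction (P := fun b => tBp (some y) b = b) hb (map_zero _)
      (fun _ _ h h' => by rw [map_add, h, h']) fun a r => ?_
    exact barLift_rIn_zero _ _ _ _ _

theorem tBp_ten {x : 𝒞.Ob} {z : Option 𝒞.Ob} (r : tSum p y₀ A (some x)) (v : vSum p y₀ x z) :
    tBp z (tTen r v) = 0 := by
  refine rSum_induction (P := fun r => tBp z (tTen r v) = 0) r fun n a r => ?_
  refine vSum_induction (P := fun v => tBp z (tTen (rIn p y₀ A n x a r) v) = 0) v fun b v => ?_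
  rw [tTen_in n a b (a + b) rfl]
  exact barLift_qIn _ _ _ _ _ _

open Classical in
/-- The coefficients of an element with respect to the bases of the modules `vOb`. -/
def tCoef (B : EssBasis p y₀) (z : Option 𝒞.Ob) :
    tSum p y₀ A z →ₗ[R] ⨁ q : (Σ x, Σ b, B.ι x z b), tSum p y₀ A (some q.1) :=
  barLift z (fun _ _ _ => 0) fun n c => bLift A B fun x a b h i =>
    ((rAct A n a 0 a (add_zero a)).compr₂ (rIn p y₀ A n x a)).compr₂
      (DirectSum.lof R (Σ x, Σ b, B.ι x z b) (fun q => tSum p y₀ A (some q.1)) ⟨x, b, i⟩)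

theorem tCoef_base (B : EssBasis p y₀) {z : Option 𝒞.Ob} (b : tSum p y₀ A z)
    (hb : b ∈ tBase p y₀ A z) : tCoef B z b = 0 := by
  cases z with
  | none => rw [(Submodule.mem_bot R).1 hb, map_zero]
  | some y =>
    refine tBase_induction (P := fun b => tCoef B (some y) b = 0) hb (map_zero _)
      (fun _ _ h h' => by rw [map_add, h, h', add_zero]) fun a r => ?_
    exact barLift_rIn_zero _ _ _ _ _

open Classical in
theorem tCoef_ten (B : EssBasis p y₀) {x : 𝒞.Ob} {z : Option 𝒞.Ob} (r : tSum p y₀ A (some x))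
    (s : vSum p y₀ x (some x)) (b : Deg N) (i : B.ι x z b) :
    tCoef B z (tTen r (hComp s (vIn b (B.e i)))) =
      DirectSum.lof R (Σ x, Σ b, B.ι x z b) (fun q => tSum p y₀ A (some q.1)) ⟨x, b, i⟩ (tAct r s) := by
  refine B.ten_induction (P := fun r s => tCoef B z (tTen r (hComp s (vIn b (B.e i)))) =
      DirectSum.lof R (Σ x, Σ b, B.ι x z b) (fun q => tSum p y₀ A (some q.1)) ⟨x, b, i⟩ (tAct r s)) r s
    (fun _ => by simp only [map_zero, LinearMap.zero_apply])
    (fun _ _ _ h h' => by simp only [map_add, LinearMap.add_apply, h, h'])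
    (fun _ => by simp only [map_zero, LinearMap.zero_apply])
    (fun _ _ _ h h' => by simp only [map_add, LinearMap.add_apply, h, h'])
    fun n a r s => ?_
  rw [tTen_end, tCoef, barLift_qIn, bLift_qTen, tAct_in n a 0 a (add_zero a)]
  rfl

theorem EssBasis.vIn_mem_span (B : EssBasis p y₀) {x : 𝒞.Ob} {z : Option 𝒞.Ob} (v : vSum p y₀ x z) :
    v ∈ Submodule.span R {v | ∃ (s : vSum p y₀ x (some x)) (i : Σ b, B.ι x z b),
      v = hComp s (vIn i.1 (B.e i.2))} := by
  refine vSum_induction (P := fun v => v ∈ Submodule.span R {v | ∃ (s : vSum p y₀ x (some x))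
    (i : Σ b, B.ι x z b), v = hComp s (vIn i.1 (B.e i.2))}) v
    (fun b v => ?_) (Submodule.zero_mem _) fun _ _ => Submodule.add_mem _
  refine B.induction (P := fun v => vIn b v ∈ Submodule.span R {v | ∃ (s : vSum p y₀ x (some x))
    (i : Σ b, B.ι x z b), v = hComp s (vIn i.1 (B.e i.2))}) v ?_ ?_ fun s i => ?_
  · rw [map_zero]; exact zero_mem _
  · intro v v' h h'
    rw [map_add]; exact add_mem h h'
  · exact Submodule.subset_span ⟨hIn 0 s, ⟨b, i⟩, (hComp_in 0 b b (zero_add b) s (B.e i)).symm⟩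

theorem EssBasis.vDel_mem_span (B : EssBasis p y₀) {x : 𝒞.Ob} {z : Option 𝒞.Ob} (i : Σ b, B.ι x z b) :
    vDel (vIn i.1 (B.e i.2)) ∈ Submodule.span R {v | ∃ (s : vSum p y₀ x (some x)) (j : Σ b, B.ι x z b),
      B.rk j.2 < B.rk i.2 ∧ v = hComp s (vIn j.1 (B.e j.2))} := by
  rw [vDel_in]
  refine Submodule.span_induction (p := fun v _ => vIn (i.1 - 1) v ∈ Submodule.span R
    {v | ∃ (s : vSum p y₀ x (some x)) (j : Σ b, B.ι x z b),
      B.rk j.2 < B.rk i.2 ∧ v = hComp s (vIn j.1 (B.e j.2))}) ?_ ?_ ?_ ?_ (B.del_e i.2)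
  · rintro _ ⟨s, j, hj, rfl⟩
    exact Submodule.subset_span ⟨hIn 0 s, ⟨_, j⟩, hj, (hComp_in 0 _ _ (zero_add _) s (B.e j)).symm⟩
  · rw [map_zero]; exact zero_mem _
  · intro v v' _ _ h h'
    rw [map_add]; exact add_mem h h'
  · intro c v _ h
    rw [map_smul]; exact Submodule.smul_mem _ c h

variable (A) in
open Classical in
/-- The bar construction as a bar system. -/
def barSystem (B : EssBasis p y₀) : BarSystem R where
  Ob := 𝒞.Ob
  T := tSum p y₀ A
  V := vSum p y₀
  base := tBase p y₀ A
  ten := tTen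
  act := tAct
  comp := hComp
  one x := hIn 0 (𝒞.one x)
  comp_assoc := hComp_assoc
  one_comp := one_hComp
  comp_one := hComp_one
  act_ten := tAct_tTen
  act_base := tAct_mem_tBase
  act_act := tAct_tAct
  act_one := tAct_one
  d := vDel
  d_comp := vDel_hComp B
  ε := tSign p y₀ A
  εV := vSign
  εV_comp := vSign_hComp B
  ε_base := tSign_mem_tBase
  ε_ten := tSign_tTen
  ε_act := tSign_tAct B
  bd := tBd
  bd_base := tBd_mem_tBase
  bd_ten := tBd_tTen
  bd_act := tBd_tAct B
  ι x z := Σ b, B.ι x z b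
  e i := vIn i.1 (B.e i.2)
  rk i := B.rk i.2
  V_span := B.vIn_mem_span
  d_e := B.vDel_mem_span
  diag x := ⟨0, B.diag x⟩
  diag_eq i := B.diag_eq i
  e_diag x := congrArg (vIn 0) (B.e_diag x)
  d_one x := del_end (B := B) _
  coef := tCoef B
  coef_base := tCoef_base B
  coef_ten r s i := (tCoef_ten B r s i.1 i.2).trans (by congr!)
  bp := tBp
  bp_base := tBp_base
  bp_ten := tBp_ten
  η := tη B
  η_base := tη_base B
  η_ten r s i := tη_ten B r s i.1 i.2
  nf := tNf B
  nf_base := tNf_base B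
  nf_ten r s i := tNf_ten B r s i.1 i.2

theorem barSystem_exhaustive (B : EssBasis p y₀) : (barSystem A B).Exhaustive := by
  have key : ∀ n, (∀ x a (r : (rOb A n x).X a),
      (rIn p y₀ A n x a r : (barSystem A B).T (some x)) ∈ (barSystem A B).lev (n + 1) (some x)) ∧
    (∀ z c (q : (qOb p y₀ A n z).X c),
      (qIn p y₀ A n z c q : (barSystem A B).T z) ∈ (barSystem A B).lev (n + 2) z) := by
    have hq : ∀ n, (∀ x a (r : (rOb A n x).X a),
      (rIn p y₀ A n x a r : (barSystem A B).T (some x)) ∈ (barSystem A B).lev (n + 1) (some x)) →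
      ∀ z c (q : (qOb p y₀ A n z).X c),
        (qIn p y₀ A n z c q : (barSystem A B).T z) ∈ (barSystem A B).lev (n + 2) z := by
      intro n hr z c q
      refine qTen_induction (P := fun q => (qIn p y₀ A n z c q : (barSystem A B).T z) ∈
        (barSystem A B).lev (n + 2) z) q ?_ ?_ fun x a b hc r v => ?_
      · rw [map_zero]; exact zero_mem _
      · intro q q' h h'
        rw [map_add]; exact add_mem h h'
      · rw [← tTen_in n a b c hc]
        exact BarSystem.ten_mem_fil (S := barSystem A B) (vIn b v) (hr x a r) le_rfl
    intro n
    induction n with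
    | zero =>
      have h0 : ∀ x a (r : (rOb A 0 x).X a), (rIn p y₀ A 0 x a r : (barSystem A B).T (some x)) ∈
          (barSystem A B).lev (0 + 1) (some x) := fun x a r =>
        BarSystem.Fil.base le_rfl (rIn_mem_tBase x a r)
      exact ⟨h0, hq 0 h0⟩
    | succ n ih =>
      have h1 : ∀ x a (r : (rOb A (n + 1) x).X a), (rIn p y₀ A (n + 1) x a r :
          (barSystem A B).T (some x)) ∈ (barSystem A B).lev (n + 1 + 1) (some x) := fun x a r =>
        ih.2 (some x) a r
      exact ⟨h1, hq _ h1⟩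
  intro z t
  refine tSum_induction (P := fun t => ∃ n, (t : (barSystem A B).T z) ∈ (barSystem A B).lev n z) t
    ⟨0, Submodule.zero_mem _⟩ ?_ ?_ ?_
  · rintro t t' ⟨n, h⟩ ⟨n', h'⟩
    exact ⟨max n n', Submodule.add_mem _ (BarSystem.fil_mono (le_max_left _ _) h)
      (BarSystem.fil_mono (le_max_right _ _) h')⟩
  · rintro y rfl a r
    exact ⟨1, (key 0).1 y a r⟩
  · intro n c q
    exact ⟨n + 2, (key n).2 z c q⟩

end BarSystemOf

/-! ### Generators of direct images, free modules and realizations -/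

section DirectImage

theorem mem_iSup_range_sigma {ι : Type u} (D : ι → Ch R N) (a : Deg N) (t : (∐ D).X a) :
    t ∈ ⨆ i, LinearMap.range (app (Limits.Sigma.ι D i) a) := by
  let S : ∀ a, Submodule R ((∐ D).X a) := fun a => ⨆ i, LinearMap.range (app (Limits.Sigma.ι D i) a)
  have hS : ∀ a b x, x ∈ S a → del (∐ D) a b x ∈ S b := by
    intro a b x hx
    have : S a ≤ (S b).comap (del (∐ D) a b) := iSup_le fun i => by
      rintro _ ⟨d, rfl⟩
      exact Submodule.mem_iSup_of_mem i ⟨del _ a b d, app_del _ a b d⟩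
    exact this hx
  let g : ∐ D ⟶ subCx (∐ D) S hS := Limits.Sigma.desc fun i =>
    mkHom (K := D i) (L := subCx (∐ D) S hS)
      (fun a => (app (Limits.Sigma.ι D i) a).codRestrict (S a) fun d =>
        Submodule.mem_iSup_of_mem i ⟨d, rfl⟩)
      (fun a b x => Subtype.ext (app_del _ a b x))
  let j : subCx (∐ D) S hS ⟶ ∐ D := mkHom (K := subCx (∐ D) S hS) (L := ∐ D)
    (fun a => (S a).subtype) (fun a b x => rfl)
  have h : g ≫ j = 𝟙 _ := by
    refine Limits.Sigma.hom_ext _ _ fun i => ?_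
    rw [Limits.Sigma.ι_desc_assoc, Category.comp_id]
    exact hom_ext_app fun a x => rfl
  have h1 := congrArg (fun f => app f a t) h
  exact Eq.subst (motive := fun t => t ∈ S a) h1 (app g a t).2

variable {X Y : Type u} (f : X → Y)

theorem colAdj_unit_app (C : X → Ch R N) (x : X) : (colAdj f).unit.app C x =
    Limits.Sigma.ι (fun x' : {x' // f x' = f x} => C x'.1) ⟨x, rfl⟩ := by
  refine (congrFun ((colAdj f).homEquiv_id C) x).symm.trans ?_
  exact Category.comp_id (Limits.Sigma.ι (fun x' : {x' // f x' = f x} => C x'.1) ⟨x, rfl⟩)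

theorem colPush_induction {C : X → Ch R N} {y : Y} {a : Deg N}
    {P : ∀ y, (((colPush f).obj C) y).X a → Prop} (t : (((colPush f).obj C) y).X a)
    (h0 : P y 0) (hadd : ∀ t t', P y t → P y t' → P y (t + t'))
    (h : ∀ x (d : (C x).X a), P (f x) (app ((colAdj f).unit.app C x) a d)) : P y t := by
  refine Submodule.iSup_induction
    (fun x : {x // f x = y} => LinearMap.range (app (Limits.Sigma.ι (fun x' : {x // f x = y} => C x'.1) x) a))
    (motive := fun t => P y t) (mem_iSup_range_sigma (fun x : {x // f x = y} => C x.1) a t) ?_ h0 hadd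
  rintro ⟨x, rfl⟩ _ ⟨d, rfl⟩
  have := h x d
  rwa [colAdj_unit_app] at this

open Classical in
/-- The projection of the direct image of a collection to one summand. -/
def colProj (C : X → Ch R N) (x₀ : X) (y : Y) : (colPush f).obj C y ⟶ C x₀ :=
  Limits.Sigma.desc fun x : {x // f x = y} => if h : x.1 = x₀ then eqToHom (congrArg C h) else 0

theorem colProj_unit (C : X → Ch R N) (x₀ : X) (a : Deg N) (d : (C x₀).X a) :
    app (colProj f C x₀ (f x₀)) a (app ((colAdj f).unit.app C x₀) a d) = d := by
  rw [colAdj_unit_app]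
  have h : Limits.Sigma.ι (fun x' : {x' // f x' = f x₀} => C x'.1) ⟨x₀, rfl⟩ ≫ colProj f C x₀ (f x₀) = 𝟙 _ := by
    refine (Limits.Sigma.ι_desc _ _).trans ?_
    rw [dif_pos rfl]
    rfl
  exact congrArg (fun f => app f a d) h

theorem colProj_unit_of_ne (C : X → Ch R N) {x x₀ : X} (hx : x ≠ x₀) (a : Deg N) (d : (C x).X a) :
    app (colProj f C x₀ (f x)) a (app ((colAdj f).unit.app C x) a d) = 0 := by
  rw [colAdj_unit_app]
  have h : Limits.Sigma.ι (fun x' : {x' // f x' = f x} => C x'.1) ⟨x, rfl⟩ ≫ colProj f C x₀ (f x) = 0 :=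
    (Limits.Sigma.ι_desc _ _).trans (dif_neg hx)
  exact congrArg (fun f => app f a d) h

end DirectImage

section RelativelyFree

variable {𝒞 𝒟 : DGCat R N}
variable (p : DGFunctor 𝒞 𝒟) (C : 𝒞.Ob → Ch R N) (y : 𝒟.Ob)

variable {W : Type u} [AddCommGroup W] [Module R W]

open Classical in
/-- Linear maps out of the free module on a direct image, from one summand. -/
def lanProj (c : Deg N) (x₀ : 𝒞.Ob) (φ : ∀ (a b : Deg N), a + b = c →
      (C x₀).X a →ₗ[R] (𝒟.Hom (p.obj x₀) y).X b →ₗ[R] W) :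
    (((colPush p.obj ⋙ modFree 𝒟).obj C).obj y).X c →ₗ[R] W :=
  fmLift (D := (colPush p.obj).obj C) fun z a b h => if hz : z = p.obj x₀ then
    (φ a b h).compl₁₂ (app (colProj p.obj C x₀ z) a)
      (app (eqToHom (congrArg (fun z => 𝒟.Hom z y) hz)) b) else 0

theorem lanProj_lanGen (c : Deg N) (x₀ : 𝒞.Ob) (φ : ∀ (a b : Deg N), a + b = c →
      (C x₀).X a →ₗ[R] (𝒟.Hom (p.obj x₀) y).X b →ₗ[R] W) (a b : Deg N) (h : a + b = c)
    (d : (C x₀).X a) (o : (𝒟.Hom (p.obj x₀) y).X b) :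
    lanProj p C y c x₀ φ (lanGen p C y x₀ a b c h d o) = φ a b h d o := by
  refine (fmLift_fm _ (p.obj x₀) a b h _ o).trans ?_
  rw [dif_pos rfl]
  exact congrArg (fun t => φ a b h t o) (colProj_unit p.obj C x₀ a d)

theorem lanProj_lanGen_of_ne (c : Deg N) {x x₀ : 𝒞.Ob} (hx : x ≠ x₀) (φ : ∀ (a b : Deg N), a + b = c →
      (C x₀).X a →ₗ[R] (𝒟.Hom (p.obj x₀) y).X b →ₗ[R] W) (a b : Deg N) (h : a + b = c)
    (d : (C x).X a) (o : (𝒟.Hom (p.obj x) y).X b) :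
    lanProj p C y c x₀ φ (lanGen p C y x a b c h d o) = 0 := by
  refine (fmLift_fm _ (p.obj x) a b h _ o).trans ?_
  split_ifs with hz
  · refine (congrArg (fun t => φ a b h t _) (colProj_unit_of_ne p.obj C hx a d)).trans ?_
    rw [map_zero]; rfl
  · rfl

/-- The identification of `⨁ x, C x ⊗ 𝒟 (p x, y)` with the value at `y` of the free module on the
direct image of `C`. -/
def lanTen (c : Deg N) : (sumTen C fun x => 𝒟.Hom (p.obj x) y).X c →ₗ[R]
    (((colPush p.obj ⋙ modFree 𝒟).obj C).obj y).X c :=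
  stLift fun x a b h => lanGen p C y x a b c h

theorem lanTen_stX (x : 𝒞.Ob) (a b c : Deg N) (h : a + b = c) (d : (C x).X a)
    (o : (𝒟.Hom (p.obj x) y).X b) :
    lanTen p C y c (stX C (fun x => 𝒟.Hom (p.obj x) y) x a b c h d o) =
      lanGen p C y x a b c h d o :=
  stLift_stX (K := C) (L := fun x => 𝒟.Hom (p.obj x) y) (fun x a b h => lanGen p C y x a b c h) x a b h d o

theorem st_induction {X : Type u} {C D : X → Ch R N} {c : Deg N} {P : (sumTen C D).X c → Prop}
    (q : (sumTen C D).X c) (h0 : P 0) (hadd : ∀ q q', P q → P q' → P (q + q'))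
    (h : ∀ x a b (hc : a + b = c) (r : (C x).X a) (v : (D x).X b), P (stX C D x a b c hc r v)) : P q := by
  classical
  refine DirectSum.induction_on (β := fun s : X × {p : Deg N × Deg N // p.1 + p.2 = c} =>
    TensorProduct R ((C s.1).X s.2.1.1) ((D s.1).X s.2.1.2)) q h0 ?_ hadd
  rintro ⟨x, ⟨a, b⟩, hc⟩ t
  induction t using TensorProduct.induction_on with
  | zero => rw [map_zero]; exact h0
  | tmul r v => exact h x a b hc r v
  | add t t' h h' => rw [map_add]; exact hadd _ _ h h'

theorem lanTen_surjective (c : Deg N) : Function.Surjective (lanTen p C y c) := by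
  intro t
  refine st_induction (C := (colPush p.obj).obj C) (D := fun x => 𝒟.Hom x y)
    (P := fun t => ∃ q, lanTen p C y c q = t) t ⟨0, map_zero _⟩ ?_ fun z a b hc r v => ?_
  · rintro _ _ ⟨q, rfl⟩ ⟨q', rfl⟩
    exact ⟨q + q', map_add _ _ _⟩
  · refine colPush_induction p.obj (C := C) (P := fun z r => ∀ v : (𝒟.Hom z y).X b, ∃ q, lanTen p C y c q =
      stX ((colPush p.obj).obj C) (fun x => 𝒟.Hom x y) z a b c hc r v) r ?_ ?_ ?_ v
    · intro v
      exact ⟨0, by rw [map_zero, map_zero, LinearMap.zero_apply]; rfl⟩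
    · intro r r' h h' v
      obtain ⟨q, hq⟩ := h v
      obtain ⟨q', hq'⟩ := h' v
      exact ⟨q + q', by rw [map_add, hq, hq', map_add, LinearMap.add_apply]; rfl⟩
    · intro x d v
      exact ⟨_, lanTen_stX p C y x a b c hc d v⟩

theorem lanTen_injective (c : Deg N) : Function.Injective (lanTen p C y c) := by
  classical
  refine (injective_iff_map_eq_zero _).2 fun q hq => ?_
  let π : ∀ x₀, (((colPush p.obj ⋙ modFree 𝒟).obj C).obj y).X c →ₗ[R]
      (sumTen C fun x => 𝒟.Hom (p.obj x) y).X c := fun x₀ =>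
    lanProj p C y c x₀ fun a b h => stX C (fun x => 𝒟.Hom (p.obj x) y) x₀ a b c h
  have key : ∃ F : Finset 𝒞.Ob, ∀ F', F ⊆ F' → ∑ x ∈ F', π x (lanTen p C y c q) = q := by
    refine st_induction (P := fun q => ∃ F : Finset 𝒞.Ob, ∀ F', F ⊆ F' →
      ∑ x ∈ F', π x (lanTen p C y c q) = q) q ?_ ?_ ?_
    · exact ⟨∅, fun F' _ => by simp only [map_zero, Finset.sum_const_zero]⟩
    · rintro q q' ⟨F, hF⟩ ⟨F', hF'⟩
      refine ⟨F ∪ F', fun G hG => ?_⟩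
      simp only [map_add, Finset.sum_add_distrib]
      rw [hF G (Finset.union_subset_left hG), hF' G (Finset.union_subset_right hG)]
    · intro x a b hc d o
      refine ⟨{x}, fun G hG => ?_⟩
      rw [lanTen_stX, Finset.sum_eq_single_of_mem x (hG (Finset.mem_singleton_self x))]
      · exact lanProj_lanGen p C y c x _ a b hc d o
      · intro x' _ hx'
        exact lanProj_lanGen_of_ne p C y c hx'.symm _ a b hc d o
  obtain ⟨F, hF⟩ := key
  rw [← hF F subset_rfl, hq]
  simp only [map_zero, Finset.sum_const_zero]

/-- The identification of `⨁ x, C x ⊗ 𝒟 (p x, y)` with the value at `y` of the free module on the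
direct image of `C`. -/
def lanEquiv (c : Deg N) : (sumTen C fun x => 𝒟.Hom (p.obj x) y).X c ≃ₗ[R]
    (((colPush p.obj ⋙ modFree 𝒟).obj C).obj y).X c :=
  LinearEquiv.ofBijective (lanTen p C y c) ⟨lanTen_injective p C y c, lanTen_surjective p C y c⟩

end RelativelyFree

section RealizationParts

/-- Linear maps out of the homogeneous parts of a realization. -/
def realizeLift {K : ChainComplex (Ch R N) ℕ} {c : Deg N} {W : Type u} [AddCommGroup W] [Module R W]
    (φ : ∀ (n : ℕ) (a : Deg N), (n : Deg N) + a = c → (K.X n).X a →ₗ[R] W) :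
    (realize K).X c →ₗ[R] W :=
  (HomologicalComplex₂.totalDesc K (c₁₂ := ComplexShape.down (Deg N)) (A := ModuleCat.of R W)
    fun n a h => ModuleCat.ofHom (φ n a h)).hom

theorem realizeLift_realizeIn {K : ChainComplex (Ch R N) ℕ} {c : Deg N} {W : Type u} [AddCommGroup W]
    [Module R W] (φ : ∀ (n : ℕ) (a : Deg N), (n : Deg N) + a = c → (K.X n).X a →ₗ[R] W)
    (n : ℕ) (a : Deg N) (h : (n : Deg N) + a = c) (x : (K.X n).X a) :
    realizeLift φ (realizeIn K n a c h x) = φ n a h x := by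
  have h1 := HomologicalComplex₂.ι_totalDesc K (c₁₂ := ComplexShape.down (Deg N)) (A := ModuleCat.of R W)
    (fun n a h => ModuleCat.ofHom (φ n a h)) n a h
  exact congrArg (fun f => f.hom x) h1

theorem realize_ext {K : ChainComplex (Ch R N) ℕ} {c : Deg N} {W : Type u} [AddCommGroup W] [Module R W]
    {φ ψ : (realize K).X c →ₗ[R] W}
    (h : ∀ n a h x, φ (realizeIn K n a c h x) = ψ (realizeIn K n a c h x)) : φ = ψ := by
  have h1 : (ModuleCat.ofHom φ : (realize K).X c ⟶ ModuleCat.of R W) = ModuleCat.ofHom ψ :=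
    HomologicalComplex₂.total.hom_ext (c₁₂ := ComplexShape.down (Deg N)) fun n a hn =>
      ModuleCat.hom_ext (LinearMap.ext fun x => h n a hn x)
  exact congrArg ModuleCat.Hom.hom h1

theorem realize_induction {K : ChainComplex (Ch R N) ℕ} {c : Deg N} {P : (realize K).X c → Prop}
    (t : (realize K).X c) (h0 : P 0) (hadd : ∀ t t', P t → P t' → P (t + t'))
    (h : ∀ n a h x, P (realizeIn K n a c h x)) : P t := by
  let S : Submodule R ((realize K).X c) :=
    ⨆ k : {k : ℕ × Deg N // (k.1 : Deg N) + k.2 = c}, LinearMap.range (realizeIn K k.1.1 k.1.2 c k.2)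
  have hS : t ∈ S := by
    have h1 : S.mkQ = 0 := realize_ext fun n a hn x =>
      (Submodule.Quotient.mk_eq_zero S).2 (Submodule.mem_iSup_of_mem ⟨(n, a), hn⟩ ⟨x, rfl⟩)
    exact (Submodule.Quotient.mk_eq_zero S).1 (LinearMap.congr_fun h1 t)
  refine Submodule.iSup_induction _ (motive := P) hS ?_ h0 hadd
  rintro ⟨⟨n, a⟩, hn⟩ _ ⟨x, rfl⟩
  exact h n a hn x

/-- The homogeneous parts of an element of a realization. -/
def realizeOut (K : ChainComplex (Ch R N) ℕ) (c : Deg N) :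
    (realize K).X c →ₗ[R] ⨁ k : ℕ × Deg N, (K.X k.1).X k.2 :=
  realizeLift fun n a _ => DirectSum.lof R (ℕ × Deg N) (fun k => (K.X k.1).X k.2) (n, a)

theorem realizeOut_realizeIn (K : ChainComplex (Ch R N) ℕ) (n : ℕ) (a c : Deg N)
    (h : (n : Deg N) + a = c) (x : (K.X n).X a) : realizeOut K c (realizeIn K n a c h x) =
      DirectSum.lof R (ℕ × Deg N) (fun k => (K.X k.1).X k.2) (n, a) x :=
  realizeLift_realizeIn _ n a h x

theorem realizeOut_injective (K : ChainComplex (Ch R N) ℕ) (c : Deg N) :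
    Function.Injective (realizeOut K c) := by
  classical
  let g : (⨁ k : ℕ × Deg N, (K.X k.1).X k.2) →ₗ[R] (realize K).X c :=
    DirectSum.toModule R _ _ fun k =>
      if h : (k.1 : Deg N) + k.2 = c then realizeIn K k.1 k.2 c h else 0
  have h : g ∘ₗ realizeOut K c = LinearMap.id := realize_ext fun n a h x => by
    rw [LinearMap.comp_apply, realizeOut_realizeIn]
    refine (DirectSum.toModule_lof R (M := fun k : ℕ × Deg N => (K.X k.1).X k.2) (n, a) x).trans ?_
    rw [dif_pos h]
    rfl
  exact Function.LeftInverse.injective (g := g) (LinearMap.congr_fun h)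

theorem realize_map_realizeIn {K L : ChainComplex (Ch R N) ℕ} (φ : K ⟶ L) (n : ℕ) (a c : Deg N)
    (h : (n : Deg N) + a = c) (x : (K.X n).X a) :
    app (HomologicalComplex₂.total.map φ (ComplexShape.down (Deg N)) : realize K ⟶ realize L) c
      (realizeIn K n a c h x) = realizeIn L n a c h (app (φ.f n) a x) :=
  congrArg (fun f : (K.X n).X a ⟶ (realize L).X c => f.hom x) (HomologicalComplex₂.ιTotal_map (φ := φ) (c₁₂ := ComplexShape.down (Deg N)) (i₁ := n) (i₂ := a) (i₁₂ := c)
    (h := h))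

theorem del_realizeIn_zero (K : ChainComplex (Ch R N) ℕ) (a c : Deg N) (h : ((0 : ℕ) : Deg N) + a = c)
    (x : (K.X 0).X a) : del (realize K) c (c - 1) (realizeIn K 0 a c h x) =
      realizeIn K 0 (a - 1) (c - 1) (by rw [← h]; ring) (del (K.X 0) a (a - 1) x) := by
  have h1 := congrArg (fun f => f.hom x)
      (HomologicalComplex₂.ι_D₁ K (ComplexShape.down (Deg N)) c (c - 1) 0 a h)
  have h2 := congrArg (fun f => f.hom x)
      (HomologicalComplex₂.ι_D₂ K (ComplexShape.down (Deg N)) c (c - 1) 0 a h)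
  have hr2 : ((0 : ℕ) : Deg N) + (a - 1) = c - 1 := by rw [← h]; ring
  rw [HomologicalComplex₂.d₁_eq_zero _ _ _ _ _ (by simp)] at h1
  rw [HomologicalComplex₂.d₂_eq K (ComplexShape.down (Deg N)) 0 (i₂ := a) (i₂' := a - 1)
      (sub_add_cancel a 1) (c - 1) hr2] at h2
  refine (congrArg₂ (· + ·) h1 h2).trans ((zero_add _).trans ?_)
  have h3 : ComplexShape.ε₂ (ComplexShape.down ℕ) (ComplexShape.down (Deg N))
    (ComplexShape.down (Deg N)) (0, a) = 1 := pow_zero _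
  rw [h3, one_smul]
  rfl

theorem del_realizeIn_succ (K : ChainComplex (Ch R N) ℕ) (n : ℕ) (a c : Deg N)
    (h : ((n + 1 : ℕ) : Deg N) + a = c) (x : (K.X (n + 1)).X a) :
    del (realize K) c (c - 1) (realizeIn K (n + 1) a c h x) =
      realizeIn K n a (c - 1) (by rw [← h]; push_cast; ring) (app (K.d (n + 1) n) a x) +
      (-1 : R) ^ (n + 1) • realizeIn K (n + 1) (a - 1) (c - 1) (by rw [← h]; ring)
        (del (K.X (n + 1)) a (a - 1) x) := by
  have h1 := congrArg (fun f => f.hom x)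
      (HomologicalComplex₂.ι_D₁ K (ComplexShape.down (Deg N)) c (c - 1) (n + 1) a h)
  have h2 := congrArg (fun f => f.hom x)
      (HomologicalComplex₂.ι_D₂ K (ComplexShape.down (Deg N)) c (c - 1) (n + 1) a h)
  have hr1 : (n : Deg N) + a = c - 1 := by rw [← h]; push_cast; ring
  have hr2 : ((n + 1 : ℕ) : Deg N) + (a - 1) = c - 1 := by rw [← h]; ring
  rw [HomologicalComplex₂.d₁_eq K (ComplexShape.down (Deg N)) (i₁ := n + 1) (i₁' := n) rfl a (c - 1)
    hr1] at h1
  rw [HomologicalComplex₂.d₂_eq K (ComplexShape.down (Deg N)) (n + 1) (i₂ := a) (i₂' := a - 1)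
      (sub_add_cancel a 1) (c - 1) hr2] at h2
  refine (congrArg₂ (· + ·) h1 h2).trans (congrArg₂ (· + ·) ?_ ?_)
  · have h3 : ComplexShape.ε₁ (ComplexShape.down ℕ) (ComplexShape.down (Deg N))
      (ComplexShape.down (Deg N)) (n + 1, a) = 1 := rfl
    rw [h3, one_smul]
    rfl
  · have h3 : ComplexShape.ε₂ (ComplexShape.down ℕ) (ComplexShape.down (Deg N))
      (ComplexShape.down (Deg N)) (n + 1, a) = (-1) ^ (n + 1) := rfl
    rw [h3]
    rcases neg_one_pow_eq_or ℤˣ (n + 1) with h4 | h4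
    · rcases Nat.even_or_odd (n + 1) with h5 | h5
      · rw [h4, h5.neg_one_pow, one_smul, one_smul]; rfl
      · rw [h5.neg_one_pow] at h4; exact absurd h4 (by decide)
    · rcases Nat.even_or_odd (n + 1) with h5 | h5
      · rw [h5.neg_one_pow] at h4; exact absurd h4 (by decide)
      · rw [h4, h5.neg_one_pow, Units.neg_smul, one_smul, neg_smul, one_smul]; rfl

end RealizationParts

/-! ### The homotopy on the categorical left Kan extension -/

section BarComparison

variable {𝒞 𝒟 : DGCat R N}
variable (p : DGFunctor 𝒞 𝒟) (y₀ : 𝒟.Ob) (A : DGMod 𝒞)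

/-- The bar construction computing the left Kan extension along `p` at `y₀`. -/
abbrev lanBar : ChainComplex (Ch R N) ℕ :=
  barCx (modAdj 𝒞) (catAdj p) (modForget 𝒟 ⋙ Pi.eval _ y₀) A

/-- The `n`-simplices of the bar construction. -/
def simEquiv (n : ℕ) (c : Deg N) : (qOb p y₀ A n none).X c ≃ₗ[R] ((lanBar p y₀ A).X n).X c :=
  lanEquiv p (rOb A n) y₀ c

theorem simEquiv_qTen (n : ℕ) {x : 𝒞.Ob} (a b c : Deg N) (h : a + b = c) (r : (rOb A n x).X a)
    (v : (vOb p y₀ x none).X b) : simEquiv p y₀ A n c (qTen p y₀ A n a b c h r v) =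
      lanGen p (freeRes(A) n).obj y₀ x a b c h r v :=
  lanTen_stX p (rOb A n) y₀ x a b c h r v

/-- The parts of an element of the left Kan extension. -/
def partsEquiv : (⨁ k : ℕ × Deg N, ((lanBar p y₀ A).X k.1).X k.2) ≃ₗ[R] tSum p y₀ A none :=
  DFinsupp.mapRange.linearEquiv fun k : ℕ × Deg N => (simEquiv p y₀ A k.1 k.2).symm

/-- The parts of an element of the left Kan extension. -/
def barOut (c : Deg N) : (realize (lanBar p y₀ A)).X c →ₗ[R] tSum p y₀ A none :=
  (partsEquiv p y₀ A).toLinearMap ∘ₗ realizeOut (lanBar p y₀ A) c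

theorem barOut_injective (c : Deg N) : Function.Injective (barOut p y₀ A c) :=
  (partsEquiv p y₀ A).injective.comp (realizeOut_injective _ c)

variable {p y₀ A}

theorem barOut_apply (c : Deg N) (x : (realize (lanBar p y₀ A)).X c) (k : ℕ × Deg N) :
    (barOut p y₀ A c x) k = (simEquiv p y₀ A k.1 k.2).symm (realizeOut (lanBar p y₀ A) c x k) := rfl

theorem barOut_realizeIn (n : ℕ) (a c : Deg N) (h : (n : Deg N) + a = c)
    (q : ((lanBar p y₀ A).X n).X a) : barOut p y₀ A c (realizeIn (lanBar p y₀ A) n a c h q) =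
      qIn p y₀ A n none a ((simEquiv p y₀ A n a).symm q) := by
  have h1 : barOut p y₀ A c (realizeIn (lanBar p y₀ A) n a c h q) =
      partsEquiv p y₀ A (DirectSum.lof R (ℕ × Deg N)
        (fun k => ((lanBar p y₀ A).X k.1).X k.2) (n, a) q) :=
    congrArg (partsEquiv p y₀ A) (realizeOut_realizeIn (lanBar p y₀ A) n a c h q)
  refine h1.trans ?_
  exact DFinsupp.mapRange_single (f := fun (k : ℕ × Deg N) x => (simEquiv p y₀ A k.1 k.2).symm x)
    (hf := fun _ => map_zero _)

theorem barOut_simEquiv (n : ℕ) (a c : Deg N) (h : (n : Deg N) + a = c)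
    (q : (qOb p y₀ A n none).X a) :
    barOut p y₀ A c (realizeIn (lanBar p y₀ A) n a c h (simEquiv p y₀ A n a q)) =
      qIn p y₀ A n none a q := by
  rw [barOut_realizeIn, LinearEquiv.symm_apply_apply]

theorem bar_ext {c : Deg N} {W : Type u} [AddCommGroup W] [Module R W]
    {φ ψ : (realize (lanBar p y₀ A)).X c →ₗ[R] W}
    (h : ∀ (n : ℕ) a (h : (n : Deg N) + a = c) q,
      φ (realizeIn (lanBar p y₀ A) n a c h (simEquiv p y₀ A n a q)) =
        ψ (realizeIn (lanBar p y₀ A) n a c h (simEquiv p y₀ A n a q))) : φ = ψ := by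
  refine realize_ext fun n a hn x => ?_
  obtain ⟨q, rfl⟩ := (simEquiv p y₀ A n a).surjective x
  exact h n a hn q

theorem tBd_qTen_zero {x : 𝒞.Ob} (a b c : Deg N) (h : a + b = c) (r : (rOb A 0 x).X a)
    (v : (vOb p y₀ x none).X b) : tBd none (qIn p y₀ A 0 none c (qTen p y₀ A 0 a b c h r v)) =
      qIn p y₀ A 0 none (c - 1) (qTen p y₀ A 0 (a - 1) b (c - 1) (by rw [← h]; ring) (del _ a (a - 1) r) v +
        sg R (par a) • qTen p y₀ A 0 a (b - 1) (c - 1) (by rw [← h]; ring) r (del _ b (b - 1) v)) := by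
  have h1 : tAct (z := none) (rIn p y₀ A 0 x a r) (vIn b v) = 0 := by rw [tAct_rIn_zero]; rfl
  have h2 : tBd (some x) (rIn p y₀ A 0 x a r) = -rIn p y₀ A 0 x (a - 1) (del _ a (a - 1) r) :=
    rBd_zero x a r
  rw [← tTen_in 0 a b c h, tBd_tTen, h1, h2, tSign_rIn, vDel_in, zero_sub, map_neg, LinearMap.neg_apply,
    neg_neg, LinearMap.map_smul₂, tTen_in 0 (a - 1) b (c - 1) (by rw [← h]; ring),
    tTen_in 0 a (b - 1) (c - 1) (by rw [← h]; ring), pow_zero, one_mul, map_add, map_smul]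

theorem tBd_qTen_succ (n : ℕ) {x : 𝒞.Ob} (a b c : Deg N) (h : a + b = c) (r : (rOb A (n + 1) x).X a)
    (v : (vOb p y₀ x none).X b) :
    tBd none (qIn p y₀ A (n + 1) none c (qTen p y₀ A (n + 1) a b c h r v)) =
      tAct (rIn p y₀ A (n + 1) x a r) (vIn b v) -
      qIn p y₀ A n none c (qTen p y₀ A n a b c h (rFace A n x a r) v) +
      (-1 : R) ^ (n + 1) • qIn p y₀ A (n + 1) none (c - 1)
        (qTen p y₀ A (n + 1) (a - 1) b (c - 1) (by rw [← h]; ring) (del _ a (a - 1) r) v +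
        sg R (par a) •
          qTen p y₀ A (n + 1) a (b - 1) (c - 1) (by rw [← h]; ring) r (del _ b (b - 1) v)) := by
  have h2 : tBd (some x) (rIn p y₀ A (n + 1) x a r) = rIn p y₀ A n x a (rFace A n x a r) -
        ((-1 : R) ^ (n + 1)) • rIn p y₀ A (n + 1) x (a - 1) (del _ a (a - 1) r) :=
    rBd_succ n x a r
  rw [← tTen_in (n + 1) a b c h, tBd_tTen, h2, tSign_rIn, vDel_in, map_sub, LinearMap.sub_apply,
    LinearMap.map_smul₂, LinearMap.map_smul₂, tTen_in (n + 1) (a - 1) b (c - 1) (by rw [← h]; ring),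
    tTen_in (n + 1) a (b - 1) (c - 1) (by rw [← h]; ring), tTen_in n a b c h, map_add, map_smul,
    smul_add, smul_smul]
  abel

theorem barOut_barAct (n : ℕ) {x : 𝒞.Ob} (a b c d : Deg N) (h : a + b = c)
    (hd : (n : Deg N) + c = d) (r : (rOb A (n + 1) x).X a) (v : (𝒟.Hom (p.obj x) y₀).X b) :
    barOut p y₀ A d (realizeIn (lanBar p y₀ A) n c d hd
      (app ((barAct (modAdj 𝒞) (catAdj p) (freeRes(A) n).obj).hom y₀) c
        (lanGen p (freeRes(A) (n + 1)).obj y₀ x a b c h r v))) =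
      tAct (z := none) (rIn p y₀ A (n + 1) x a r) (vIn b v) := by
  let L : (rOb A (n + 1) x).X a →ₗ[R] tSum p y₀ A none :=
    barOut p y₀ A d ∘ₗ realizeIn (lanBar p y₀ A) n c d hd ∘ₗ
      app ((barAct (modAdj 𝒞) (catAdj p) (freeRes(A) n).obj).hom y₀) c ∘ₗ
        (lanGen p (freeRes(A) (n + 1)).obj y₀ x a b c h).flip v
  let L' : (rOb A (n + 1) x).X a →ₗ[R] tSum p y₀ A none :=
    (tAct (z := none)).flip (vIn (p := p) (y₀ := y₀) (x := x) (z := none) b v) ∘ₗ rIn p y₀ A (n + 1) x a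
  change L r = L' r
  refine rTen_induction (P := fun r => L r = L' r) r (by rw [map_zero, map_zero])
    (fun _ _ h h' => by rw [map_add, map_add, h, h']) fun w a' b' ha r m => ?_
  have h1 : L (rTen A n a' b' a ha r m) = barOut p y₀ A d (realizeIn (lanBar p y₀ A) n c d hd
      (lanGen p (freeRes(A) n).obj y₀ w a' (b' + b) c
        (by rw [← h, ← ha]; ring) r (𝒟.comp b' b (b' + b) rfl (app (p.map w x) b' m) v))) :=
    congrArg (fun t => barOut p y₀ A d (realizeIn (lanBar p y₀ A) n c d hd t))
      (barAct_lanGen p (freeRes(A) n).obj y₀ x w a b c a' b' h ha r m v)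
  have h2 : L' (rTen A n a' b' a ha r m) = tAct (tTen (rIn p y₀ A n w a' r) (hIn b' m))
      (vIn (p := p) (y₀ := y₀) (x := x) (z := none) b v) :=
    congrArg (fun t => tAct (z := none) t (vIn (p := p) (y₀ := y₀) (x := x) (z := none) b v))
      (tTen_in (p := p) (y₀ := y₀) (z := some x) n a' b' a ha r m).symm
  have h3 := hComp_in (p := p) (y₀ := y₀) (z := none) b' b (b' + b) rfl m v
  have h4 := tTen_in (z := none) n a' (b' + b) c (by rw [← h, ← ha]; ring) r
    (vComp p y₀ (z := none) b' b (b' + b) rfl m v)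
  refine h1.trans (Eq.trans ?_
    (h2.trans ((tAct_tTen _ _ _).trans ((congrArg (tTen _) h3).trans h4))).symm)
  refine (congrArg (fun t => barOut p y₀ A d (realizeIn (lanBar p y₀ A) n c d hd t))
    (simEquiv_qTen p y₀ A n a' (b' + b) c (by rw [← h, ← ha]; ring) r _).symm).trans ?_
  exact barOut_simEquiv n c d hd _

theorem app_altSum {k : ℕ} {K L : Ch R N} (c : Deg N) (s : Finset (Fin k)) (f : Fin k → (K ⟶ L))
    (t : K.X c) : app (∑ i ∈ s, (-1 : ℤ) ^ (i : ℕ) • f i) c t =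
      ∑ i ∈ s, (-1 : R) ^ (i : ℕ) • app (f i) c t := by
  induction s using Finset.induction_on with
  | empty => rfl
  | insert i s hi ih =>
    rw [Finset.sum_insert hi, Finset.sum_insert hi, ← ih]
    have h1 : app ((-1 : ℤ) ^ (i : ℕ) • f i) c t = (-1 : R) ^ (i : ℕ) • app (f i) c t := by
      change ((-1 : ℤ) ^ (i : ℕ)) • app (f i) c t = _
      rcases Nat.even_or_odd (i : ℕ) with h5 | h5
      · rw [h5.neg_one_pow, h5.neg_one_pow, one_smul, one_smul]
      · rw [h5.neg_one_pow, h5.neg_one_pow, neg_smul, neg_smul, one_smul, one_smul]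
    rw [← h1]
    rfl

theorem app_altSum_succ {k : ℕ} {K L : Ch R N} (c : Deg N) (f : Fin (k + 1) → (K ⟶ L)) (t : K.X c)
    (g : Fin k → L.X c) (hg : ∀ i, app (f i.succ) c t = g i) :
    app (∑ i : Fin (k + 1), (-1 : ℤ) ^ (i : ℕ) • f i) c t =
      app (f 0) c t - ∑ i : Fin k, (-1 : R) ^ (i : ℕ) • g i := by
  rw [app_altSum, Fin.sum_univ_succ, Fin.val_zero, pow_zero, one_smul, sub_eq_add_neg,
    ← Finset.sum_neg_distrib]
  congr 1
  refine Finset.sum_congr rfl fun i _ => ?_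
  rw [hg, Fin.val_succ, pow_succ, mul_neg_one, neg_smul]

theorem lanGen_rFace (n : ℕ) {x : 𝒞.Ob} (a b c : Deg N) (h : a + b = c)
    (r : (rOb A (n + 1) x).X a) (v : (𝒟.Hom (p.obj x) y₀).X b) :
    lanGen p (freeRes(A) n).obj y₀ x a b c h (rFace A n x a r) v =
      ∑ i : Fin (n + 1), (-1 : R) ^ (i : ℕ) •
        lanGen p (freeRes(A) n).obj y₀ x a b c h
          (app ((resFace (modAdj 𝒞) A n i).hom x) a r) v := by
  rw [rFace, LinearMap.sum_apply, map_sum, LinearMap.sum_apply]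
  refine Finset.sum_congr rfl fun i _ => ?_
  rw [LinearMap.smul_apply, LinearMap.map_smul₂]

theorem lanBar_d_lanGen (n : ℕ) {x : 𝒞.Ob} (a b c : Deg N) (h : a + b = c)
    (r : (rOb A (n + 1) x).X a) (v : (𝒟.Hom (p.obj x) y₀).X b) :
    app ((lanBar p y₀ A).d (n + 1) n) c
        (lanGen p (freeRes(A) (n + 1)).obj y₀ x a b c h r v) =
      app ((barAct (modAdj 𝒞) (catAdj p) (freeRes(A) n).obj).hom y₀) c
        (lanGen p (freeRes(A) (n + 1)).obj y₀ x a b c h r v) -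
      lanGen p (freeRes(A) n).obj y₀ x a b c h (rFace A n x a r) v := by
  have h0 : (lanBar p y₀ A).d (n + 1) n = ∑ i : Fin (n + 2), (-1 : ℤ) ^ (i : ℕ) •
      (modForget 𝒟 ⋙ Pi.eval _ y₀).map (barFace (modAdj 𝒞) (catAdj p) A n i) := altFace_d _ _ n
  have h1 := congrArg (fun f => app f c
    (lanGen p (freeRes(A) (n + 1)).obj y₀ x a b c h r v)) h0
  have h2 := app_altSum_succ c
    (fun i => (modForget 𝒟 ⋙ Pi.eval _ y₀).map (barFace (modAdj 𝒞) (catAdj p) A n i))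
    (lanGen p (freeRes(A) (n + 1)).obj y₀ x a b c h r v)
    (fun i => lanGen p (freeRes(A) n).obj y₀ x a b c h
        (app ((resFace (modAdj 𝒞) A n i).hom x) a r) v)
    (fun i => lanGen_map p ((modForget 𝒞).map (resFace (modAdj 𝒞) A n i)) y₀ x a b c h r v)
  have h3 := lanGen_rFace n a b c h r v
  refine (h1.trans h2).trans ?_
  rw [h3]
  rfl

theorem barOut_del (c c' : Deg N) (hc : c' + 1 = c) (x : (realize (lanBar p y₀ A)).X c) :
    barOut p y₀ A c' (del (realize (lanBar p y₀ A)) c c' x) = tBd none (barOut p y₀ A c x) := by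
  obtain rfl : c' = c - 1 := eq_sub_of_add_eq hc
  have key : barOut p y₀ A (c - 1) ∘ₗ del (realize (lanBar p y₀ A)) c (c - 1) = tBd none ∘ₗ barOut p y₀ A c := by
    refine bar_ext fun n d hd q => ?_
    refine qTen_induction (P := fun q => (barOut p y₀ A (c - 1) ∘ₗ del (realize (lanBar p y₀ A)) c (c - 1))
        (realizeIn (lanBar p y₀ A) n d c hd (simEquiv p y₀ A n d q)) =
      (tBd none ∘ₗ barOut p y₀ A c)
        (realizeIn (lanBar p y₀ A) n d c hd (simEquiv p y₀ A n d q))) q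
      (by simp only [map_zero]) (fun _ _ h h' => by simp only [map_add, h, h']) fun x a b h r v => ?_
    rw [LinearMap.comp_apply, LinearMap.comp_apply, barOut_simEquiv]
    have hdel : del ((lanBar p y₀ A).X n) d (d - 1) (simEquiv p y₀ A n d (qTen p y₀ A n a b d h r v)) =
        simEquiv p y₀ A n (d - 1) (qTen p y₀ A n (a - 1) b (d - 1) (by rw [← h]; ring) (del _ a (a - 1) r) v +
        sg R (par a) • qTen p y₀ A n a (b - 1) (d - 1) (by rw [← h]; ring) r (del _ b (b - 1) v)) := by
      rw [map_add, map_smul, simEquiv_qTen, simEquiv_qTen, simEquiv_qTen]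
      exact del_lanGen p (freeRes(A) n).obj y₀ x a b d h r v
    cases n with
    | zero =>
      rw [tBd_qTen_zero]
      refine (congrArg (barOut p y₀ A (c - 1)) (del_realizeIn_zero (lanBar p y₀ A) d c hd _)).trans ?_
      rw [hdel, barOut_simEquiv]
    | succ n =>
      rw [tBd_qTen_succ]
      refine (congrArg (barOut p y₀ A (c - 1)) (del_realizeIn_succ (lanBar p y₀ A) n d c hd _)).trans ?_
      rw [hdel, map_add, map_smul, barOut_simEquiv]
      refine congrArg (· + _) ?_
      have hc' : (n : Deg N) + d = c - 1 := by rw [← hd]; push_cast; ring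
      have e1 := simEquiv_qTen p y₀ A (n + 1) a b d h r v
      have e2 := lanBar_d_lanGen n a b d h r v
      have e3 := barOut_barAct n a b d (c - 1) h hc' r v
      have e4 := simEquiv_qTen p y₀ A n a b d h (rFace A n x a r) v
      have e5 := (congrArg (app ((lanBar p y₀ A).d (n + 1) n) d) e1).trans (e2.trans (congrArg (_ - ·) e4.symm))
      refine (congrArg (fun t => barOut p y₀ A (c - 1) (realizeIn (lanBar p y₀ A) n d (c - 1) hc' t)) e5).trans ?_
      let g : (((colPush p.obj ⋙ modFree 𝒟).obj (freeRes(A) n).obj).obj y₀).X d →ₗ[R]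
          tSum p y₀ A none := barOut p y₀ A (c - 1) ∘ₗ realizeIn (lanBar p y₀ A) n d (c - 1) hc'
      exact (map_sub g _ _).trans (congrArg₂ (· - ·) e3 (barOut_simEquiv n d (c - 1) hc' _))
  exact LinearMap.congr_fun key x

variable (A) in
/-- The homotopy `η` on the left Kan extension. -/
def barH (B : EssBasis p y₀) (c d : Deg N) : (realize (lanBar p y₀ A)).X c →ₗ[R] (realize (lanBar p y₀ A)).X d :=
  if hd : c + 1 = d then realizeLift fun n a h =>
    realizeIn (lanBar p y₀ A) (n + 1) a d (by rw [← hd, ← h]; push_cast; ring) ∘ₗ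
      (simEquiv p y₀ A (n + 1) a).toLinearMap ∘ₗ ηQ A B n none a ∘ₗ (simEquiv p y₀ A n a).symm.toLinearMap
  else 0

theorem barH_realizeIn (B : EssBasis p y₀) (c d : Deg N) (hd : c + 1 = d) (n : ℕ) (a : Deg N)
    (h : (n : Deg N) + a = c) (q : (qOb p y₀ A n none).X a) :
    barH A B c d (realizeIn (lanBar p y₀ A) n a c h (simEquiv p y₀ A n a q)) =
      realizeIn (lanBar p y₀ A) (n + 1) a d (by rw [← hd, ← h]; push_cast; ring)
        (simEquiv p y₀ A (n + 1) a (ηQ A B n none a q)) := by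
  rw [barH, dif_pos hd]
  refine (realizeLift_realizeIn _ n a h _).trans ?_
  simp only [LinearMap.comp_apply, LinearEquiv.coe_coe, LinearEquiv.symm_apply_apply]

theorem barOut_barH (B : EssBasis p y₀) (c d : Deg N) (hd : c + 1 = d) (x : (realize (lanBar p y₀ A)).X c) :
    barOut p y₀ A d (barH A B c d x) = tη B none (barOut p y₀ A c x) := by
  have key : barOut p y₀ A d ∘ₗ barH A B c d = tη B none ∘ₗ barOut p y₀ A c := by
    refine bar_ext fun n a h q => ?_
    rw [LinearMap.comp_apply, LinearMap.comp_apply, barH_realizeIn B c d hd, barOut_simEquiv,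
      barOut_simEquiv, tη_qIn]
  exact LinearMap.congr_fun key x

variable (A) in
/-- The projection to the relations on the left Kan extension. -/
def barQ (B : EssBasis p y₀) (c : Deg N) : (realize (lanBar p y₀ A)).X c →ₗ[R] (realize (lanBar p y₀ A)).X c :=
  LinearMap.id - realizeLift fun n a h => realizeIn (lanBar p y₀ A) n a c h ∘ₗ
    (simEquiv p y₀ A n a).toLinearMap ∘ₗ nfQ A B n none a ∘ₗ (simEquiv p y₀ A n a).symm.toLinearMap

theorem barQ_realizeIn (B : EssBasis p y₀) (c : Deg N) (n : ℕ) (a : Deg N)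
    (h : (n : Deg N) + a = c) (q : (qOb p y₀ A n none).X a) :
    barQ A B c (realizeIn (lanBar p y₀ A) n a c h (simEquiv p y₀ A n a q)) =
      realizeIn (lanBar p y₀ A) n a c h (simEquiv p y₀ A n a q) -
      realizeIn (lanBar p y₀ A) n a c h (simEquiv p y₀ A n a (nfQ A B n none a q)) := by
  rw [barQ, LinearMap.sub_apply, LinearMap.id_apply, realizeLift_realizeIn]
  simp only [LinearMap.comp_apply, LinearEquiv.coe_coe, LinearEquiv.symm_apply_apply]

theorem barOut_barQ (B : EssBasis p y₀) (c : Deg N) (x : (realize (lanBar p y₀ A)).X c) :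
    barOut p y₀ A c (barQ A B c x) = barOut p y₀ A c x - tNf B none (barOut p y₀ A c x) := by
  have key : barOut p y₀ A c ∘ₗ barQ A B c = barOut p y₀ A c - tNf B none ∘ₗ barOut p y₀ A c := by
    refine bar_ext fun n a h q => ?_
    rw [LinearMap.comp_apply, LinearMap.sub_apply, LinearMap.comp_apply, barQ_realizeIn, map_sub,
      barOut_simEquiv, barOut_simEquiv, tNf_qIn]
  exact LinearMap.congr_fun key x

theorem barOut_pow (B : EssBasis p y₀) (c : Deg N) (n : ℕ) (x : (realize (lanBar p y₀ A)).X c) :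
    barOut p y₀ A c (((1 - anti (realize (lanBar p y₀ A)) (barH A B) c) ^ n) x) =
      ((barSystem A B).defect none ^ n) (barOut p y₀ A c x) := by
  induction n generalizing x with
  | zero => rfl
  | succ n ih =>
    rw [pow_succ, pow_succ, Module.End.mul_apply, ih]
    change _ = ((barSystem A B).defect none ^ n) ((barSystem A B).defect none (barOut p y₀ A c x))
    refine congrArg (fun t => ((barSystem A B).defect none ^ n) t) ?_
    refine Eq.trans ?_ (BarSystem.defect_apply (S := barSystem A B) (z := none) (barOut p y₀ A c x)).symm
    rw [LinearMap.sub_apply, map_sub, anti_apply, map_add,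
      barOut_del _ _ rfl, barOut_barH B c (c + 1) rfl, barOut_barH B (c - 1) c (sub_add_cancel c 1),
      barOut_del c (c - 1) (sub_add_cancel c 1)]
    rfl

theorem nfR_mem_resFil (B : EssBasis p y₀) (n m : ℕ) (x : 𝒞.Ob) (a : Deg N) (r : (rOb A n x).X a)
    (hr : r ∈ resFil A n m x a) : nfR A B n x a r ∈ resFil A n m x a := by
  induction n generalizing m x a with
  | zero => trivial
  | succ n ih =>
    refine span_map_mem (nfR A B (n + 1) x a) ?_ hr
    rintro _ ⟨w, m', a', b, hc, d, v, hd, hm, rfl⟩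
    let S : Submodule R ((qOb p y₀ A n (some x)).X a) := resFil A (n + 1) m x a
    refine B.induction (z := some x) (P := fun v => nfQ A B n (some x) a
      (qTen p y₀ A n a' b a hc d v) ∈ S) v ?_ ?_ ?_
    · rw [map_zero, map_zero]; exact zero_mem _
    · intro v v' h h'
      rw [map_add, map_add]; exact add_mem h h'
    · intro s i
      refine Eq.subst (motive := fun t => t ∈ resFil A (n + 1) m x a)
        (nfQ_qTen (z := some x) B n a' b a hc d s i).symm ?_
      refine Submodule.subset_span ⟨w, m', a', b, hc, _, B.e i, ih m' w a' _ ?_, hm, rfl⟩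
      exact resFil_act A n m' m' w w a' 0 a' (add_zero a') d hd s (by rw [step, if_pos rfl, add_zero])

theorem ηR_mem_resFil (B : EssBasis p y₀) (n m : ℕ) (x : 𝒞.Ob) (a : Deg N) (r : (rOb A n x).X a)
    (hr : r ∈ resFil A n m x a) : ηR A B n x a r ∈ resFil A (n + 1) m x a := by
  induction n generalizing m x a with
  | zero => exact zero_mem _
  | succ n ih =>
    refine span_map_mem (ηR A B (n + 1) x a) ?_ hr
    rintro _ ⟨w, m', a', b, hc, d, v, hd, hm, rfl⟩
    let S : Submodule R ((qOb p y₀ A (n + 1) (some x)).X a) := resFil A (n + 1 + 1) m x a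
    refine B.induction (z := some x) (P := fun v => ηQ A B n (some x) a
      (qTen p y₀ A n a' b a hc d v) ∈ S) v ?_ ?_ ?_
    · rw [map_zero, map_zero]; exact zero_mem _
    · intro v v' h h'
      rw [map_add, map_add]; exact add_mem h h'
    · intro s i
      refine Eq.subst (motive := fun t => t ∈ resFil A (n + 1 + 1) m x a)
        (ηQ_qTen (z := some x) B n a' b a hc d s i).symm ?_
      refine Submodule.sub_mem _
        (Submodule.subset_span ⟨w, m', a', b, hc, _, B.e i, Submodule.subset_span ?_, hm, rfl⟩)
        (Submodule.subset_span ⟨w, m', a', b, hc, _, B.e i, ih m' w a' _ ?_, hm, rfl⟩)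
      · exact ⟨w, m', a', 0, add_zero a', d, s, hd, by rw [step, if_pos rfl, add_zero], rfl⟩
      · exact resFil_act A n m' m' w w a' 0 a' (add_zero a') d hd s (by rw [step, if_pos rfl, add_zero])

theorem simEquiv_nfQ_mem (B : EssBasis p y₀) (m n : ℕ) (c : Deg N) (q : (qOb p y₀ A n none).X c)
    (hq : simEquiv p y₀ A n c q ∈ simFil p A y₀ m n c) :
    simEquiv p y₀ A n c (nfQ A B n none c q) ∈ simFil p A y₀ m n c := by
  have gen : ∀ (x : 𝒞.Ob) (a b : Deg N) (hc : a + b = c) (d : (rOb A n x).X a)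
      (o : (vOb p y₀ x none).X b), d ∈ resFil A n m x a →
      simEquiv p y₀ A n c (nfQ A B n none c (qTen p y₀ A n a b c hc d o)) ∈ simFil p A y₀ m n c := by
    intro x a b hc d o hd
    refine B.induction (z := none) (P := fun o => simEquiv p y₀ A n c (nfQ A B n none c
      (qTen p y₀ A n a b c hc d o)) ∈ simFil p A y₀ m n c) o ?_ ?_ ?_
    · rw [map_zero, map_zero, map_zero]; exact zero_mem _
    · intro v v' h h'
      rw [map_add, map_add, map_add]; exact add_mem h h'
    · intro s i
      have h3 := nfQ_qTen B n a b c hc d s i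
      have h4 := simEquiv_qTen p y₀ A n a b c hc (nfR A B n x a (rAct A n a 0 a (add_zero a) d s)) (B.e i)
      refine Eq.subst (motive := fun t => t ∈ simFil p A y₀ m n c)
        ((congrArg (simEquiv p y₀ A n c) h3).trans h4).symm ?_
      refine Submodule.subset_span ⟨x, a, b, hc, _, B.e i, nfR_mem_resFil B n m x a _ ?_, rfl⟩
      exact resFil_act A n m m x x a 0 a (add_zero a) d hd s (by rw [step, if_pos rfl, add_zero])
  have key : ∀ t ∈ simFil p A y₀ m n c,
      ((simEquiv p y₀ A n c).toLinearMap ∘ₗ nfQ A B n none c ∘ₗ (simEquiv p y₀ A n c).symm.toLinearMap) t ∈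
        simFil p A y₀ m n c := by
    intro t ht
    refine span_map_mem _ ?_ ht
    rintro _ ⟨x, a, b, hc, d, o, hd, rfl⟩
    have h2 := (LinearEquiv.symm_apply_eq (simEquiv p y₀ A n c)).2 (simEquiv_qTen p y₀ A n a b c hc d o).symm
    exact Eq.subst (motive := fun t => t ∈ simFil p A y₀ m n c)
        (congrArg (fun t => simEquiv p y₀ A n c (nfQ A B n none c t)) h2).symm (gen x a b hc d o hd)
  have := key _ hq
  simpa only [LinearMap.comp_apply, LinearEquiv.coe_coe, LinearEquiv.symm_apply_apply] using this

theorem simEquiv_ηQ_mem (B : EssBasis p y₀) (m n : ℕ) (c : Deg N) (q : (qOb p y₀ A n none).X c)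
    (hq : simEquiv p y₀ A n c q ∈ simFil p A y₀ m n c) :
    simEquiv p y₀ A (n + 1) c (ηQ A B n none c q) ∈ simFil p A y₀ m (n + 1) c := by
  have gen : ∀ (x : 𝒞.Ob) (a b : Deg N) (hc : a + b = c) (d : (rOb A n x).X a)
      (o : (vOb p y₀ x none).X b), d ∈ resFil A n m x a →
      simEquiv p y₀ A (n + 1) c (ηQ A B n none c (qTen p y₀ A n a b c hc d o)) ∈
        simFil p A y₀ m (n + 1) c := by
    intro x a b hc d o hd
    refine B.induction (z := none) (P := fun o => simEquiv p y₀ A (n + 1) c (ηQ A B n none c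
      (qTen p y₀ A n a b c hc d o)) ∈ simFil p A y₀ m (n + 1) c) o ?_ ?_ ?_
    · rw [map_zero, map_zero, map_zero]; exact zero_mem _
    · intro v v' h h'
      rw [map_add, map_add, map_add]; exact add_mem h h'
    · intro s i
      have h3 := ηQ_qTen B n a b c hc d s i
      have h4 := fun r => simEquiv_qTen p y₀ A (n + 1) a b c hc r (B.e i)
      refine Eq.subst (motive := fun t => t ∈ simFil p A y₀ m (n + 1) c)
        (congrArg (simEquiv p y₀ A (n + 1) c) h3).symm ?_
      rw [map_sub, h4, h4]
      refine Submodule.sub_mem _ (Submodule.subset_span ⟨x, a, b, hc, _, B.e i, Submodule.subset_span ?_, rfl⟩)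
        (Submodule.subset_span ⟨x, a, b, hc, _, B.e i, ηR_mem_resFil B n m x a _ ?_, rfl⟩)
      · exact ⟨x, m, a, 0, add_zero a, d, s, hd, by rw [step, if_pos rfl, add_zero], rfl⟩
      · exact resFil_act A n m m x x a 0 a (add_zero a) d hd s (by rw [step, if_pos rfl, add_zero])
  have key : ∀ t ∈ simFil p A y₀ m n c,
      ((simEquiv p y₀ A (n + 1) c).toLinearMap ∘ₗ ηQ A B n none c ∘ₗ
        (simEquiv p y₀ A n c).symm.toLinearMap) t ∈ simFil p A y₀ m (n + 1) c := by
    intro t ht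
    refine span_map_mem _ ?_ ht
    rintro _ ⟨x, a, b, hc, d, o, hd, rfl⟩
    have h2 := (LinearEquiv.symm_apply_eq (simEquiv p y₀ A n c)).2 (simEquiv_qTen p y₀ A n a b c hc d o).symm
    exact Eq.subst (motive := fun t => t ∈ simFil p A y₀ m (n + 1) c)
        (congrArg (fun t => simEquiv p y₀ A (n + 1) c (ηQ A B n none c t)) h2).symm (gen x a b hc d o hd)
  have := key _ hq
  simpa only [LinearMap.comp_apply, LinearEquiv.coe_coe, LinearEquiv.symm_apply_apply] using this

theorem lanFil_map_mem {m : ℕ} {c d : Deg N} (f : (realize (lanBar p y₀ A)).X c →ₗ[R] (realize (lanBar p y₀ A)).X d)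
    (h : ∀ (n : ℕ) a (h : (n : Deg N) + a = c) q, simEquiv p y₀ A n a q ∈ simFil p A y₀ m n a →
      f (realizeIn (lanBar p y₀ A) n a c h (simEquiv p y₀ A n a q)) ∈ lanFil p A y₀ m d)
    (x : (realize (lanBar p y₀ A)).X c) (hx : x ∈ lanFil p A y₀ m c) : f x ∈ lanFil p A y₀ m d := by
  let S : Submodule R ((realize (lanBar p y₀ A)).X c) := lanFil p A y₀ m c
  let S' : Submodule R ((realize (lanBar p y₀ A)).X d) := lanFil p A y₀ m d
  have : S ≤ S'.comap f := by
    refine iSup_le fun n => iSup_le fun a => iSup_le fun hn => ?_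
    rintro _ ⟨t, ht, rfl⟩
    obtain ⟨q, rfl⟩ := (simEquiv p y₀ A n a).surjective t
    exact h n a hn q ht
  exact this hx

theorem realizeIn_mem_lanFil {m n : ℕ} {a c : Deg N} (h : (n : Deg N) + a = c)
    {q : ((lanBar p y₀ A).X n).X a} (hq : q ∈ simFil p A y₀ m n a) :
    realizeIn (lanBar p y₀ A) n a c h q ∈ lanFil p A y₀ m c := by
  have h1 : (simFil p A y₀ m n a).map (realizeIn (lanBar p y₀ A) n a c h) ≤ lanFil p A y₀ m c :=
    le_iSup_of_le n (le_iSup_of_le a (le_iSup_of_le h le_rfl))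
  exact h1 ⟨q, hq, rfl⟩

theorem barH_mem_lanFil (B : EssBasis p y₀) (m : ℕ) (c d : Deg N) (x : (realize (lanBar p y₀ A)).X c)
    (hx : x ∈ lanFil p A y₀ m c) : barH A B c d x ∈ lanFil p A y₀ m d := by
  by_cases hd : c + 1 = d
  · refine lanFil_map_mem (barH A B c d) (fun n a h q hq => ?_) x hx
    rw [barH_realizeIn B c d hd]
    exact realizeIn_mem_lanFil _ (simEquiv_ηQ_mem B m n a q hq)
  · rw [barH, dif_neg hd]; exact zero_mem _

theorem barQ_mem_lanFil (B : EssBasis p y₀) (m : ℕ) (c : Deg N) (x : (realize (lanBar p y₀ A)).X c)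
    (hx : x ∈ lanFil p A y₀ m c) : barQ A B c x ∈ lanFil p A y₀ m c := by
  refine lanFil_map_mem (barQ A B c) (fun n a h q hq => ?_) x hx
  rw [barQ_realizeIn]
  exact sub_mem (realizeIn_mem_lanFil _ hq)
    (realizeIn_mem_lanFil _ (simEquiv_nfQ_mem B m n a q hq))

section Map

variable {K : ChainComplex (Ch R N) ℕ} (φ : lanBar p y₀ A ⟶ K)

/-- The map of realizations induced by a map of complexes of simplices. -/
def realizeMap {K L : ChainComplex (Ch R N) ℕ} (φ : K ⟶ L) : realize K ⟶ realize L :=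
  HomologicalComplex₂.total.map φ (ComplexShape.down (Deg N))

theorem realizeOut_map (c : Deg N) (x : (realize (lanBar p y₀ A)).X c) (k : ℕ × Deg N) :
    realizeOut K c (app (realizeMap φ) c x) k =
        app (φ.f k.1) k.2 (realizeOut (lanBar p y₀ A) c x k) := by
  have key : realizeOut K c ∘ₗ app (realizeMap φ) c = (DFinsupp.mapRange.linearMap fun k : ℕ × Deg N => app (φ.f k.1) k.2) ∘ₗ
        realizeOut (lanBar p y₀ A) c := by
    refine realize_ext fun n a h t => ?_
    rw [LinearMap.comp_apply, LinearMap.comp_apply, realizeOut_realizeIn]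
    refine (congrArg (realizeOut K c) (realize_map_realizeIn φ n a c h t)).trans ?_
    rw [realizeOut_realizeIn]
    exact (DFinsupp.mapRange_single (f := fun (k : ℕ × Deg N) x => app (φ.f k.1) k.2 x)
      (hf := fun _ => map_zero _)).symm
  exact congrArg (fun t => t k) (LinearMap.congr_fun key x)

theorem tNf_none_apply (B : EssBasis p y₀) (t : tSum p y₀ A none) (k : ℕ × Deg N) :
    tNf B none t k = nfQ A B k.1 none k.2 (t k) := by
  have key : tNf B none = DFinsupp.mapRange.linearMap fun k : ℕ × Deg N => nfQ A B k.1 none k.2 := by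
    refine DirectSum.linearMap_ext R fun k => LinearMap.ext fun q => ?_
    refine (tNf_qIn B none k.1 k.2 q).trans ?_
    exact (DFinsupp.mapRange_single (f := fun (k : ℕ × Deg N) x => nfQ A B k.1 none k.2 x)
      (hf := fun _ => map_zero _)).symm
  exact congrArg (fun f => f t k) key

theorem map_eq_zero_iff_nf (B : EssBasis p y₀)
    (hker : ∀ n c q, app (φ.f n) c (simEquiv p y₀ A n c q) = 0 ↔ nfQ A B n none c q = 0) (c : Deg N)
    (x : (realize (lanBar p y₀ A)).X c) :
    app (realizeMap φ) c x = 0 ↔ tNf B none (barOut p y₀ A c x) = 0 := by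
  have h1 : ∀ k : ℕ × Deg N, app (φ.f k.1) k.2 (realizeOut (lanBar p y₀ A) c x k) = 0 ↔
      tNf B none (barOut p y₀ A c x) k = 0 := fun k => by
    rw [tNf_none_apply, barOut_apply]
    refine Iff.trans ?_ (hker k.1 k.2 _)
    rw [LinearEquiv.apply_symm_apply]
  rw [← (injective_iff_map_eq_zero' _).1 (realizeOut_injective K c), DFinsupp.ext_iff, DFinsupp.ext_iff]
  refine forall_congr' fun k => Iff.trans ?_ (h1 k)
  rw [realizeOut_map]
  rfl

theorem map_surjective (hsurj : ∀ n c, Function.Surjective (app (φ.f n) c)) (c : Deg N) :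
    Function.Surjective (app (realizeMap φ) c) := by
  intro t
  refine realize_induction (P := fun t => ∃ x, app (realizeMap φ) c x = t) t ⟨0, map_zero _⟩ ?_ fun n a h x => ?_
  · rintro _ _ ⟨x, rfl⟩ ⟨x', rfl⟩
    exact ⟨x + x', map_add _ _ _⟩
  · obtain ⟨x, rfl⟩ := hsurj n a x
    exact ⟨_, realize_map_realizeIn φ n a c h x⟩

/-- A map from the bar construction that is levelwise surjective, with kernels spanned by the
relations `r s ⊗ v = r ⊗ s v` for endomorphisms `s`, is a homotopy equivalence, compatibly with
the filtration by the number of essential levels. -/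
theorem exists_homotopyEquiv_of_nf (B : EssBasis p y₀)
    (hsurj : ∀ n c, Function.Surjective (app (φ.f n) c))
    (hker : ∀ n c q, app (φ.f n) c (simEquiv p y₀ A n c q) = 0 ↔ nfQ A B n none c q = 0) :
    (∃ e : HomotopyEquiv (realize (lanBar p y₀ A)) (realize K),
      e.hom = realizeMap φ) ∧
    ∀ m, ∃ e : HomotopyEquiv _ _, e.hom = subMap
      (realizeMap φ)
      (lanFil p A y₀ m) (lanFil_del p A y₀ m) := by
  have hE := barSystem_exhaustive (A := A) B
  have hnf : ∀ (t : tSum p y₀ A none), tNf B none t = 0 ↔ (t : (barSystem A B).T none) ∈ (barSystem A B).K none := by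
    intro t
    obtain ⟨n, hn⟩ := hE none t
    constructor
    · intro h
      have h1 := BarSystem.sub_nf_mem_K (S := barSystem A B) hn
      have h2 : (barSystem A B).nf none t = 0 := h
      exact Eq.subst (motive := fun s => s ∈ (barSystem A B).K none)
        ((congrArg (HSub.hSub (α := (barSystem A B).T none) t) h2).trans
          (sub_zero (G := (barSystem A B).T none) t)) h1
    · exact fun h => BarSystem.nf_eq_zero (S := barSystem A B) hn h
  have hh : ∀ a b x, app (realizeMap φ) a x = 0 → app (realizeMap φ) b (barH A B a b x) = 0 := by
    intro a b x hx
    by_cases hb : a + 1 = b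
    · rw [map_eq_zero_iff_nf φ B hker, hnf] at hx ⊢
      rw [barOut_barH B a b hb]
      obtain ⟨n, hn⟩ := hE none (barOut p y₀ A a x)
      exact BarSystem.η_mem_K (S := barSystem A B) hn hx
    · rw [barH, dif_neg hb, LinearMap.zero_apply, map_zero]
  have hq : ∀ a x, app (realizeMap φ) a (barQ A B a x) = 0 := by
    intro a x
    rw [map_eq_zero_iff_nf φ B hker, hnf, barOut_barQ]
    obtain ⟨n, hn⟩ := hE none (barOut p y₀ A a x)
    exact BarSystem.sub_nf_mem_K (S := barSystem A B) hn
  have hq' : ∀ a x, app (realizeMap φ) a x = 0 → barQ A B a x = x := by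
    intro a x hx
    rw [map_eq_zero_iff_nf φ B hker] at hx
    exact barOut_injective p y₀ A a (by rw [barOut_barQ, hx, sub_zero])
  have hN : ∀ a x, app (realizeMap φ) a x = 0 →
        ∃ n : ℕ, ((1 - anti (realize (lanBar p y₀ A)) (barH A B) a) ^ n) x = 0 := by
    intro a x hx
    rw [map_eq_zero_iff_nf φ B hker, hnf] at hx
    obtain ⟨n, hn⟩ := BarSystem.exists_defect_pow_eq_zero (S := barSystem A B) hE hx
    exact ⟨n, barOut_injective p y₀ A a (by rw [barOut_pow, map_zero]; exact hn)⟩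
  refine ⟨HomotopyEquiv.exists_of_kernel _ (map_surjective φ hsurj) (barH A B) hh (barQ A B) hq hq' hN,
    fun m => HomotopyEquiv.exists_subMap _ _ _ (barH A B) hh (barQ A B) hq hq' hN
      (barH_mem_lanFil B m) (barQ_mem_lanFil B m)⟩

end Map

end BarComparison

/-! ### Koszul signs and multilinear induction -/

section KoszulSigns

variable {N : ℕ} {J J' J'' : Type} [Fintype J] [LinearOrder J] [Fintype J'] [LinearOrder J']
  [Fintype J''] [LinearOrder J'']

theorem sum_lex {A : Type*} [AddCommMonoid A] {I : J → Type} [∀ j, Fintype (I j)]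
    (F : (Σₗ j, I j) → A) : ∑ q, F q = ∑ j, ∑ i, F (toLex ⟨j, i⟩) :=
  (Fintype.sum_equiv ofLex F (fun q : Σ j, I j => F (toLex q)) fun _ => rfl).trans
    (Fintype.sum_sigma _)

theorem lex_lt_iff {I : J → Type} [∀ j, LinearOrder (I j)] {j : J} {i i' : I j} :
    (toLex ⟨j, i⟩ : Σₗ j, I j) < toLex ⟨j, i'⟩ ↔ i < i' := by
  refine Sigma.Lex.lt_def.trans ⟨?_, fun h => Or.inr ⟨rfl, h⟩⟩
  rintro (h | ⟨h, h'⟩)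
  · exact absurd h (lt_irrefl _)
  · exact h'

theorem lex_lt_iff_of_ne {I : J → Type} [∀ j, LinearOrder (I j)] {j j' : J} {i : I j} {i' : I j'}
    (h : j ≠ j') : (toLex ⟨j, i⟩ : Σₗ j, I j) < toLex ⟨j', i'⟩ ↔ j < j' := by
  refine Sigma.Lex.lt_def.trans ⟨?_, Or.inl⟩
  rintro (h' | ⟨h', _⟩)
  · exact h'
  · exact absurd h' h

theorem kz_eq_zero (e : J ≃ J') (he : StrictMono e) (g : J' → Deg N) : kz e g = 0 :=
  Finset.sum_eq_zero fun i _ => Finset.sum_eq_zero fun j _ =>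
    if_neg fun h => lt_asymm (he h.1) h.2

theorem kz_trans (e : J ≃ J') (e' : J' ≃ J'') (g : J'' → Deg N) :
    kz (e.trans e') g = kz e (fun j => g (e' j)) + kz e' g := by
  have h1 : kz e' g = ∑ i, ∑ j, if e i < e j ∧ e' (e j) < e' (e i) then
      par (g (e' (e i))) * par (g (e' (e j))) else 0 := by
    refine (Fintype.sum_equiv e _ _ fun i => ?_).symm
    exact Fintype.sum_equiv e _ (fun j => if e i < j ∧ e' j < e' (e i) then
      par (g (e' (e i))) * par (g (e' j)) else 0) fun j => rfl
  rw [h1, sum_sym (fun i j => e i < e j ∧ e' (e j) < e' (e i)) (fun a h => lt_irrefl _ h.1)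
    (fun i => par (g (e' (e i))))]
  unfold kz
  rw [← add_assoc, ← Finset.sum_add_distrib, ← Finset.sum_add_distrib]
  refine Finset.sum_congr rfl fun i _ => ?_
  rw [← Finset.sum_add_distrib, ← Finset.sum_add_distrib]
  refine Finset.sum_congr rfl fun j _ => ?_
  simp only [Equiv.trans_apply]
  by_cases hij : i < j
  · have h2 : e i ≠ e j := fun h => hij.ne (e.injective h)
    have h3 : e' (e i) ≠ e' (e j) := fun h => h2 (e'.injective h)
    rcases lt_or_gt_of_ne h2 with h2 | h2 <;> rcases lt_or_gt_of_ne h3 with h3 | h3 <;>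
      simp [hij, h2, h3, h2.not_gt, h3.not_gt, CharTwo.add_self_eq_zero]
  · simp [hij]

theorem kz_refl (g : J → Deg N) : kz (Equiv.refl J) g = 0 := kz_eq_zero _ strictMono_id g

theorem kz_lexInner {I I' : J → Type} [∀ j, Fintype (I j)] [∀ j, LinearOrder (I j)]
    [∀ j, Fintype (I' j)] [∀ j, LinearOrder (I' j)] (e : ∀ j, I j ≃ I' j)
    (g : (Σₗ j, I' j) → Deg N) :
    kz (lexInner e) g = ∑ j, kz (e j) (fun i => g (toLex ⟨j, i⟩)) := by
  unfold kz
  rw [sum_lex]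
  refine Finset.sum_congr rfl fun j _ => Finset.sum_congr rfl fun i _ => ?_
  rw [sum_lex, Finset.sum_eq_single j]
  · refine Finset.sum_congr rfl fun i' _ => ?_
    refine if_congr (and_congr lex_lt_iff ?_) rfl rfl
    exact lex_lt_iff (I := I')
  · intro j' _ hj
    refine Finset.sum_eq_zero fun i' _ => if_neg ?_
    rintro ⟨h1, h2⟩
    exact lt_asymm ((lex_lt_iff_of_ne hj.symm).1 h1) ((lex_lt_iff_of_ne (I := I') hj).1 h2)
  · exact fun h => absurd (Finset.mem_univ _) h

theorem kz_lexOuter (e : J ≃ J') (I : J' → Type) [∀ j, Fintype (I j)] [∀ j, LinearOrder (I j)]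
    (g : (Σₗ j, I j) → Deg N) :
    kz (lexOuter e I) g = kz e (fun j => ∑ i, g (toLex ⟨j, i⟩)) := by
  unfold kz
  rw [sum_lex]
  refine Finset.sum_congr rfl fun j _ => ?_
  rw [Finset.sum_congr rfl fun i _ => sum_lex _, Finset.sum_comm]
  refine Finset.sum_congr rfl fun j' _ => ?_
  by_cases h : j < j' ∧ e j' < e j
  · rw [if_pos h, map_sum, map_sum, Finset.sum_mul_sum]
    refine Finset.sum_congr rfl fun i _ => Finset.sum_congr rfl fun i' _ => ?_
    refine if_pos ⟨(lex_lt_iff_of_ne h.1.ne).2 h.1, ?_⟩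
    exact (lex_lt_iff_of_ne (I := I) h.2.ne).2 h.2
  · rw [if_neg h]
    refine Finset.sum_eq_zero fun i _ => Finset.sum_eq_zero fun i' _ => if_neg ?_
    rintro ⟨h1, h2⟩
    by_cases hj : j = j'
    · subst hj
      exact lt_asymm (lex_lt_iff.1 h1) ((lex_lt_iff (I := I)).1 h2)
    · exact h ⟨(lex_lt_iff_of_ne hj).1 h1,
        (lex_lt_iff_of_ne (I := I) fun h => hj (e.injective h.symm)).1 h2⟩

theorem kz_low (e : J ≃ J') (g : J' → Deg N) (j : J) :
    kz e (low g (e j)) = kz e g + before (fun i => g (e i)) j + before g (e j) := by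
  have h1 : kz e (low g (e j)) = ∑ i, ∑ k, if i < k ∧ e k < e i then
      (par (g (e i)) + if i = j then 1 else 0) * (par (g (e k)) + if k = j then 1 else 0) else 0 := by
    unfold kz
    simp only [par_low, e.injective.eq_iff]
  have h2 : before g (e j) = ∑ i, if e i < e j then par (g (e i)) else 0 :=
    (Fintype.sum_equiv e _ _ fun i => rfl).symm
  rw [h1, sum_ite_shift, sum_ite_shift', sum_ite_point, sum_ite_point', h2]
  unfold kz before
  rw [add_assoc, add_assoc]
  congr 1
  rw [← Finset.sum_add_distrib, ← Finset.sum_add_distrib]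
  refine Finset.sum_congr rfl fun i _ => ?_
  by_cases hij : i = j
  · subst hij; simp
  · have h3 : e i ≠ e j := fun h => hij (e.injective h)
    rcases lt_or_gt_of_ne hij with h2 | h2 <;> rcases lt_or_gt_of_ne h3 with h3 | h3 <;>
      simp [hij, h2, h3, h2.not_gt, h3.not_gt, CharTwo.add_self_eq_zero]

end KoszulSigns

section Multilinear

variable {R : Type u} [CommRing R] {J : Type} [Fintype J]

/-- Induction on the coordinates in `K` of a family of vectors: a property that is preserved by
linear combinations in each of these coordinates only has to be checked on spanning sets. -/
theorem multi_induction [DecidableEq J] {V : J → Type*} [∀ j, AddCommGroup (V j)]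
    [∀ j, Module R (V j)] (K : Finset J) (T : ∀ j, Set (V j))
    (hT : ∀ j ∈ K, Submodule.span R (T j) = ⊤) (P : (∀ j, V j) → Prop)
    (h0 : ∀ v, ∀ j ∈ K, P (Function.update v j 0))
    (hadd : ∀ v, ∀ j ∈ K, ∀ a b, P (Function.update v j a) → P (Function.update v j b) →
      P (Function.update v j (a + b)))
    (hsmul : ∀ v, ∀ j ∈ K, ∀ (r : R) a, P (Function.update v j a) →
      P (Function.update v j (r • a)))
    (hgen : ∀ v, (∀ j ∈ K, v j ∈ T j) → P v) (v : ∀ j, V j) : P v := by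
  induction K using Finset.induction_on with
  | empty => exact hgen v fun j hj => absurd hj (Finset.notMem_empty j)
  | insert k K hk ih =>
    refine ih (fun j hj => hT j (Finset.mem_insert_of_mem hj))
      (fun v j hj => h0 v j (Finset.mem_insert_of_mem hj))
      (fun v j hj => hadd v j (Finset.mem_insert_of_mem hj))
      (fun v j hj => hsmul v j (Finset.mem_insert_of_mem hj)) fun w hw => ?_
    have hkK := Finset.mem_insert_self k K
    have hmem : w k ∈ Submodule.span R (T k) := by rw [hT k hkK]; trivial
    rw [← Function.update_eq_self k w]
    refine Submodule.span_induction (p := fun a _ => P (Function.update w k a)) ?_ (h0 w k hkK)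
      (fun a b _ _ => hadd w k hkK a b) (fun r a _ => hsmul w k hkK r a) hmem
    intro a ha
    refine hgen _ fun j hj => ?_
    by_cases hjk : j = k
    · subst hjk; rwa [Function.update_self]
    · rw [Function.update_of_ne hjk]
      exact hw j ((Finset.mem_insert.1 hj).resolve_left hjk)

variable {S : J → Type u} {W : Type u} [AddCommGroup W] [Module R W]

open Classical in
/-- The linear extension of a map on a set of generators. -/
def freeExt {S : Type u} (F : S → W) : (Π₀ _ : S, R) →ₗ[R] W :=
  DFinsupp.lsum ℕ fun s => LinearMap.toSpanSingleton R W (F s)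

open Classical in
theorem freeExt_single {S : Type u} (F : S → W) (s : S) :
    freeExt F (DFinsupp.single s (1 : R)) = F s := by
  rw [freeExt, DFinsupp.lsum_single, LinearMap.toSpanSingleton_apply, one_smul]

open Classical in
theorem span_single_eq_top (S : Type u) :
    Submodule.span R (Set.range fun s : S => (DFinsupp.single s 1 : Π₀ _ : S, R)) = ⊤ := by
  refine top_unique fun v _ => ?_
  induction v using DFinsupp.induction with
  | h0 => exact zero_mem _
  | ha i b v _ _ ih =>
    refine Submodule.add_mem _ ?_ (ih trivial)
    have : (DFinsupp.single i b : Π₀ _ : S, R) = b • DFinsupp.single i (1 : R) := by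
      rw [← DFinsupp.single_smul, smul_eq_mul, mul_one]
    rw [this]
    exact Submodule.smul_mem _ _ (Submodule.subset_span ⟨i, rfl⟩)

open Classical in
/-- The multilinear extension of a map on families of generators. -/
def multiFree (F : (∀ j, S j) → W) : MultilinearMap R (fun j => Π₀ _ : S j, R) W :=
  MultilinearMap.fromDFinsuppEquiv S R (M := fun _ _ => R) (N := W) fun s =>
    MultilinearMap.mkPiRing R J (F s)

open Classical in
theorem multiFree_single (F : (∀ j, S j) → W) (s : ∀ j, S j) :
    multiFree F (fun j => DFinsupp.single (s j) (1 : R)) = F s := by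
  rw [multiFree, MultilinearMap.fromDFinsuppEquiv_single, MultilinearMap.mkPiRing_apply]
  simp

open Classical in
theorem multiFree_eq_zero (F : (∀ j, S j) → W) (j : J) (n : Π₀ _ : S j, R)
    (h : ∀ s, freeExt (fun t => F (Function.update s j t)) n = 0) (v : ∀ j, Π₀ _ : S j, R)
    (hv : v j = n) : multiFree F v = 0 := by
  by_cases hS : Nonempty (S j)
  · refine multi_induction (R := R) (Finset.univ.erase j)
      (fun k => Set.range fun s : S k => (DFinsupp.single s 1 : Π₀ _ : S k, R))
      (fun k _ => span_single_eq_top (S k)) (fun v => v j = n → multiFree F v = 0) ?_ ?_ ?_ ?_ v hv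
    · intro v k hk _
      rw [MultilinearMap.map_update_zero]
    · intro v k hk a b ha hb hv
      have hjk := (Finset.ne_of_mem_erase hk).symm
      rw [Function.update_of_ne hjk] at ha hb hv
      rw [MultilinearMap.map_update_add, ha hv, hb hv, add_zero]
    · intro v k hk r a ha hv
      have hjk := (Finset.ne_of_mem_erase hk).symm
      rw [Function.update_of_ne hjk] at ha hv
      rw [MultilinearMap.map_update_smul, ha hv, smul_zero]
    · intro v hgen hv
      choose s hs using fun k (hk : k ≠ j) => hgen k (Finset.mem_erase.2 ⟨hk, Finset.mem_univ _⟩)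
      obtain ⟨t₀⟩ := hS
      have h1 : ∃ s' : ∀ k, S k, ∀ k, k ≠ j → (DFinsupp.single (s' k) 1 : Π₀ _ : S k, R) = v k := by
        refine ⟨fun k => if hk : k = j then hk ▸ t₀ else s k hk, fun k hk => ?_⟩
        beta_reduce
        rw [dif_neg hk]; exact hs k hk
      obtain ⟨s', hs'⟩ := h1
      have h2 : (multiFree F).toLinearMap v j = freeExt (fun t => F (Function.update s' j t)) := by
        refine LinearMap.ext_on_range (span_single_eq_top (S j)) fun t => ?_
        rw [freeExt_single, MultilinearMap.toLinearMap_apply, ← multiFree_single (R := R) F]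
        refine congrArg (multiFree F) (funext fun k => ?_)
        by_cases hk : k = j
        · subst hk; rw [Function.update_self, Function.update_self]
        · rw [Function.update_of_ne hk, Function.update_of_ne hk, hs' k hk]
      have h3 := LinearMap.congr_fun h2 n
      rw [h, MultilinearMap.toLinearMap_apply, ← hv, Function.update_eq_self] at h3
      exact h3
  · have : v j = 0 := DFinsupp.ext fun s => absurd ⟨s⟩ hS
    rw [← Function.update_eq_self j v, this, MultilinearMap.map_update_zero]

variable {Z : ∀ j, Submodule R (Π₀ _ : S j, R)}

theorem multiFree_congr (F : (∀ j, S j) → W)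
    (hF : ∀ (j : J) (s : ∀ j, S j) [DecidableEq J], ∀ n ∈ Z j,
      freeExt (fun t => F (Function.update s j t)) n = 0)
    (v w : ∀ j, Π₀ _ : S j, R) (h : ∀ j, v j - w j ∈ Z j) : multiFree F v = multiFree F w := by
  classical
  have key : ∀ K : Finset J, multiFree F (K.piecewise v w) = multiFree F w := by
    intro K
    induction K using Finset.induction_on with
    | empty => rw [Finset.piecewise_empty]
    | insert k K hk ih =>
      rw [← ih, Finset.piecewise_insert]
      have h1 : K.piecewise v w = Function.update (K.piecewise v w) k (w k) := by
        rw [← Finset.piecewise_eq_of_notMem K v w hk, Function.update_eq_self]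
      rw [← sub_eq_zero]
      nth_rw 2 [h1]
      rw [← MultilinearMap.map_update_sub]
      exact multiFree_eq_zero F k _ (fun s => hF k s _ (h k)) _ (Function.update_self ..)
  have := key Finset.univ
  rwa [Finset.piecewise_univ] at this

/-- The descent of a multilinear map to quotients. -/
def multiQuot (F : (∀ j, S j) → W)
    (hF : ∀ (j : J) (s : ∀ j, S j) [DecidableEq J], ∀ n ∈ Z j,
      freeExt (fun t => F (Function.update s j t)) n = 0) :
    MultilinearMap R (fun j => (Π₀ _ : S j, R) ⧸ Z j) W where
  toFun a := multiFree F fun j => (a j).out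
  map_update_add' a j x y := by
    rw [multiFree_congr F hF _ (Function.update (fun j => (a j).out) j (x.out + y.out)) ?_,
      multiFree_congr F hF (fun i => (Function.update a j x i).out)
        (Function.update (fun j => (a j).out) j x.out) ?_,
      multiFree_congr F hF (fun i => (Function.update a j y i).out)
        (Function.update (fun j => (a j).out) j y.out) ?_, MultilinearMap.map_update_add]
    all_goals
      intro i
      rw [← Submodule.Quotient.eq]
      by_cases hi : i = j
      · subst hi; simp
      · simp [hi]
  map_update_smul' a j r x := by
    rw [multiFree_congr F hF _ (Function.update (fun j => (a j).out) j (r • x.out)) ?_,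
      multiFree_congr F hF (fun i => (Function.update a j x i).out)
        (Function.update (fun j => (a j).out) j x.out) ?_, MultilinearMap.map_update_smul]
    all_goals
      intro i
      rw [← Submodule.Quotient.eq]
      by_cases hi : i = j
      · subst hi; simp
      · simp [hi]

theorem multiQuot_mk (F : (∀ j, S j) → W)
    (hF : ∀ (j : J) (s : ∀ j, S j) [DecidableEq J], ∀ n ∈ Z j,
      freeExt (fun t => F (Function.update s j t)) n = 0) (v : ∀ j, Π₀ _ : S j, R) :
    multiQuot F hF (fun j => Submodule.Quotient.mk (v j)) = multiFree F v :=
  multiFree_congr F hF _ _ fun j => by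
    rw [← Submodule.Quotient.eq]; simp

end Multilinear

section TensorPermutation

variable {J J' J'' : Type} [Fintype J] [LinearOrder J]
  [Fintype J'] [LinearOrder J'] [Fintype J''] [LinearOrder J'']

/-- Precomposition of a multilinear map with a reindexing of the variables. -/
def multiReindex {V : J' → Type*} [∀ j, AddCommGroup (V j)] [∀ j, Module R (V j)] {W : Type*}
    [AddCommGroup W] [Module R W] (e : J ≃ J') (f : MultilinearMap R (fun j => V (e j)) W) :
    MultilinearMap R V W where
  toFun x := f fun j => x (e j)
  map_update_add' x j v w := by
    obtain ⟨k, rfl⟩ := e.surjective j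
    have h := fun a => Function.update_comp_eq_of_injective' x e.injective k a
    classical
    rw [h, h, h, MultilinearMap.map_update_add]
  map_update_smul' x j r v := by
    obtain ⟨k, rfl⟩ := e.surjective j
    have h := fun a => Function.update_comp_eq_of_injective' x e.injective k a
    classical
    rw [h, h, MultilinearMap.map_update_smul]

theorem sum_reindex {γ : Deg N} (e : J ≃ J') {g : J' → Deg N} (h : ∑ j, g j = γ) :
    ∑ j, g (e j) = γ := by rw [← h]; exact Equiv.sum_comp e g

/-- The permutation of the factors of a tensor product, in each degree. -/
def tPermX (K : J' → Ch R N) (e : J ≃ J') (γ : Deg N) :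
    (tens K).X γ →ₗ[R] (tens fun j => K (e j)).X γ :=
  tLift fun g h => sg R (kz e g) • multiReindex e
    (tp (fun j => K (e j)) (fun j => g (e j)) γ (sum_reindex e h))

theorem tPermX_tp (K : J' → Ch R N) (e : J ≃ J') (γ : Deg N) (g : J' → Deg N) (h : ∑ j, g j = γ)
    (x : ∀ j, (K j).X (g j)) : tPermX K e γ (tp K g γ h x) = sg R (kz e g) •
      tp (fun j => K (e j)) (fun j => g (e j)) γ (sum_reindex e h) (fun j => x (e j)) :=
  tLift_tp _ g h x

theorem low_reindex (e : J ≃ J') (g : J' → Deg N) (j : J) :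
    low (fun i => g (e i)) j = fun i => low g (e j) (e i) := by
  funext i
  by_cases h : i = j
  · subst h; rw [low_self, low_self]
  · rw [low_ne _ h, low_ne _ fun h' => h (e.injective h')]

theorem dmap_reindex (K : J' → Ch R N) (e : J ≃ J') (g : J' → Deg N) (j i : J)
    (x : (K (e i)).X (g (e i))) :
    tr (K (e i)) _ _ (dmap (fun i => K (e i)) (fun i => g (e i)) (low (fun i => g (e i)) j) j i x) =
      dmap K g (low g (e j)) (e j) (e i) x := by
  have h1 := congrFun (low_reindex e g j) i
  by_cases h : i = j
  · subst h
    rw [dmap_self, dmap_self]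
    exact tr_del _ h1 x
  · rw [dmap_ne _ _ _ h, dmap_ne _ _ _ fun h' => h (e.injective h')]
    exact tr_tr (K (e i)) (low_ne (fun i => g (e i)) h).symm x

theorem tPermX_del (K : J' → Ch R N) (e : J ≃ J') (c c' : Deg N) (t : (tens K).X c) :
    tPermX K e c' (del _ c c' t) = del _ c c' (tPermX K e c t) := by
  by_cases hc : c' + 1 = c
  · suffices H : tPermX K e c' ∘ₗ del _ c c' = del _ c c' ∘ₗ tPermX K e c from
      LinearMap.congr_fun H t
    refine tp_ext fun g h x => ?_
    rw [LinearMap.comp_apply, LinearMap.comp_apply, del_tp _ hc, tPermX_tp, map_smul, del_tp _ hc,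
      map_sum, Finset.smul_sum]
    refine (Fintype.sum_equiv e _ _ fun j => ?_).symm
    rw [map_smul, tPermX_tp, smul_smul, smul_smul, ← sg_add, ← sg_add]
    refine congrArg₂ (· • ·) (congrArg (sg R) ?_) ?_
    · rw [kz_low]
      have h1 : before g (e j) + before g (e j) = 0 := CharTwo.add_self_eq_zero _
      linear_combination -h1
    · exact tp_congr _ _ (low_reindex e g j) fun i => dmap_reindex K e g j i (x (e i))
  · rw [del_shape _ _ _ hc, del_shape _ _ _ hc, LinearMap.zero_apply, map_zero, LinearMap.zero_apply]

end TensorPermutation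

/-! ### The free algebra by symbols and relations -/

section FreeByGenerators

variable {O : DGMulticat R N} {X : Type u} (f : X → O.Ob)
  (D : X → Ch R N)

/-- The symbols `d₁ ⊗ ⋯ ⊗ dₙ ⊗ m` that generate the free `O`-algebra on the direct image of the
collection `D` along `f`: a sequence of elements of `D`, and a multimorphism from the images under
`f` of their indices. -/
structure FreeSym (z : O.Ob) (c : Deg N) : Type u where
  n : ℕ
  x : Fin n → X
  g : Fin n → Deg N
  h : Deg N
  hc : ∑ i, g i + h = c
  d : ∀ i, (D (x i)).X (g i)
  m : (O.Hom (fun i => f (x i)) z).X h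

variable {f D}

/-- The symbol with other elements of the collection. -/
def FreeSym.withD {z : O.Ob} {c : Deg N} (t : FreeSym f D z c) (d : ∀ i, (D (t.x i)).X (t.g i)) :
    FreeSym f D z c := { t with d := d }

/-- The symbol with another multimorphism. -/
def FreeSym.withM {z : O.Ob} {c : Deg N} (t : FreeSym f D z c)
    (m : (O.Hom (fun i => f (t.x i)) z).X t.h) : FreeSym f D z c := { t with m := m }

/-- The reindexing of a symbol. -/
def FreeSym.perm {z : O.Ob} {c : Deg N} (t : FreeSym f D z c) {n : ℕ} (e : Fin n ≃ Fin t.n) :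
    FreeSym f D z c :=
  ⟨n, fun i => t.x (e i), fun i => t.g (e i), t.h, by rw [Equiv.sum_comp e t.g]; exact t.hc,
    fun i => t.d (e i), app (O.perm e (fun _ => rfl) z) t.h t.m⟩

/-- A function on symbols is admissible if it is multilinear, and equivariant up to Koszul signs. -/
structure IsFam {W : Type u} [AddCommGroup W] [Module R W] {z : O.Ob} {c : Deg N}
    (F : FreeSym f D z c → W) : Prop where
  lin_d : ∀ (t : FreeSym f D z c) (i : Fin t.n) (r : R) (a b : (D (t.x i)).X (t.g i)),
    F (t.withD (Function.update t.d i (r • a + b))) =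
      r • F (t.withD (Function.update t.d i a)) + F (t.withD (Function.update t.d i b))
  lin_m : ∀ (t : FreeSym f D z c) (r : R) (a b : (O.Hom (fun i => f (t.x i)) z).X t.h),
    F (t.withM (r • a + b)) = r • F (t.withM a) + F (t.withM b)
  perm : ∀ (t : FreeSym f D z c) {n : ℕ} (e : Fin n ≃ Fin t.n),
    F (t.perm e) = sg R (kz e t.g) • F t

variable (f D) in
/-- The relations between the symbols: the combinations on which all admissible functions
vanish. -/
def famRel (z : O.Ob) (c : Deg N) : Submodule R (Π₀ _ : FreeSym f D z c, R) where
  carrier := {v | ∀ (W : Type u) [AddCommGroup W] [Module R W] (F : FreeSym f D z c → W),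
    IsFam F → freeExt F v = 0}
  add_mem' hv hw W _ _ F hF := by rw [map_add, hv W F hF, hw W F hF, add_zero]
  zero_mem' W _ _ F hF := map_zero _
  smul_mem' r v hv W _ _ F hF := by rw [map_smul, hv W F hF, smul_zero]

variable (f D) in
/-- The module of elements of degree `c` over `z` of the free algebra. -/
abbrev FreeQ (z : O.Ob) (c : Deg N) : Type u := (Π₀ _ : FreeSym f D z c, R) ⧸ famRel f D z c

open Classical in
/-- The class of a symbol. -/
def mkQ {z : O.Ob} {c : Deg N} (t : FreeSym f D z c) : FreeQ f D z c :=
  Submodule.Quotient.mk (DFinsupp.single t 1)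

theorem isFam_mkQ {z : O.Ob} {c : Deg N} : IsFam (mkQ : FreeSym f D z c → FreeQ f D z c) := by
  classical
  refine ⟨fun t i r a b => ?_, fun t r a b => ?_, fun t n e => ?_⟩
  · rw [mkQ, mkQ, mkQ, ← Submodule.Quotient.mk_smul, ← Submodule.Quotient.mk_add,
      Submodule.Quotient.eq]
    intro W _ _ F hF
    simp only [map_sub, map_add, map_smul, freeExt_single]
    rw [hF.lin_d, sub_self]
  · rw [mkQ, mkQ, mkQ, ← Submodule.Quotient.mk_smul, ← Submodule.Quotient.mk_add,
      Submodule.Quotient.eq]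
    intro W _ _ F hF
    simp only [map_sub, map_add, map_smul, freeExt_single]
    rw [hF.lin_m, sub_self]
  · rw [mkQ, mkQ, ← Submodule.Quotient.mk_smul, Submodule.Quotient.eq]
    intro W _ _ F hF
    simp only [map_sub, map_smul, freeExt_single]
    rw [hF.perm, sub_self]

variable {W : Type u} [AddCommGroup W] [Module R W]

/-- The linear map induced by an admissible function. -/
def liftQ {z : O.Ob} {c : Deg N} (F : FreeSym f D z c → W) (hF : IsFam F) : FreeQ f D z c →ₗ[R] W :=
  (famRel f D z c).liftQ (freeExt F) fun v hv => hv W F hF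

theorem liftQ_mkQ {z : O.Ob} {c : Deg N} (F : FreeSym f D z c → W) (hF : IsFam F)
    (t : FreeSym f D z c) : liftQ F hF (mkQ t) = F t := by
  classical
  exact freeExt_single F t

theorem span_mkQ (z : O.Ob) (c : Deg N) :
    Submodule.span R (Set.range (mkQ : FreeSym f D z c → FreeQ f D z c)) = ⊤ := by
  classical
  have h := congrArg (Submodule.map (famRel f D z c).mkQ) (span_single_eq_top (R := R) (FreeSym f D z c))
  rw [Submodule.map_span, Submodule.map_top, Submodule.range_mkQ, ← Set.range_comp] at h
  exact h

/-- A multilinear map from its linearity in each variable. -/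
def multiOfLin {ι : Type} [DecidableEq ι] {V : ι → Type u} [∀ i, AddCommGroup (V i)]
    [∀ i, Module R (V i)] (F : (∀ i, V i) → W)
    (h : ∀ v i (r : R) a b, F (Function.update v i (r • a + b)) =
      r • F (Function.update v i a) + F (Function.update v i b)) : MultilinearMap R V W where
  toFun := F
  map_update_add' v i a b := by
    have h1 := h v i 1 a b
    rw [one_smul, one_smul] at h1
    convert h1
  map_update_smul' v i r a := by
    have h0 := h v i 1 0 0
    rw [one_smul, one_smul, add_zero, left_eq_add] at h0
    have h1 := h v i r a 0
    rw [add_zero, h0, add_zero] at h1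
    convert h1

/-- A linear map from its linearity. -/
def linOfLin {V : Type u} [AddCommGroup V] [Module R V] (F : V → W)
    (h : ∀ (r : R) a b, F (r • a + b) = r • F a + F b) : V →ₗ[R] W where
  toFun := F
  map_add' a b := by
    have h1 := h 1 a b
    rwa [one_smul, one_smul] at h1
  map_smul' r a := by
    have h0 := h 1 0 0
    rw [one_smul, one_smul, add_zero, left_eq_add] at h0
    have h1 := h r a 0
    rwa [add_zero, h0, add_zero] at h1

theorem multi_lin {ι : Type} [DecidableEq ι] {V : ι → Type u} [∀ i, AddCommGroup (V i)]
    [∀ i, Module R (V i)] {W' : Type u} [AddCommGroup W'] [Module R W'] (F : MultilinearMap R V W')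
    (L : W' →ₗ[R] W) (v : ∀ i, V i) (i : ι) (r : R) (a b : V i) :
    L (F (Function.update v i (r • a + b))) =
      r • L (F (Function.update v i a)) + L (F (Function.update v i b)) := by
  rw [MultilinearMap.map_update_add, MultilinearMap.map_update_smul, map_add, map_smul]

variable (f D) in
/-- The classes of the symbols with given sequence of indices `Fin n`, as a multilinear map. -/
def clFin {n : ℕ} (x : Fin n → X) (g : Fin n → Deg N) (z : O.Ob) (h c : Deg N)
    (hc : ∑ i, g i + h = c) : MultilinearMap R (fun i => (D (x i)).X (g i))
      ((O.Hom (fun i => f (x i)) z).X h →ₗ[R] FreeQ f D z c) :=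
  multiOfLin (fun d => linOfLin (fun m => mkQ ⟨n, x, g, h, hc, d, m⟩)
    fun r a b => isFam_mkQ.lin_m (⟨n, x, g, h, hc, d, a⟩ : FreeSym f D z c) r a b)
    fun d i r a b => LinearMap.ext fun m =>
      isFam_mkQ.lin_d (⟨n, x, g, h, hc, d, m⟩ : FreeSym f D z c) i r a b

variable {I I' : Type} [Fintype I] [LinearOrder I] [Fintype I'] [LinearOrder I']

variable (f D) in
/-- The classes of the symbols with sequences of indices in a finite ordered set. -/
def cl (x : I → X) (g : I → Deg N) (z : O.Ob) (h c : Deg N) (hc : ∑ i, g i + h = c) :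
    MultilinearMap R (fun i => (D (x i)).X (g i))
      ((O.Hom (fun i => f (x i)) z).X h →ₗ[R] FreeQ f D z c) :=
  (LinearMap.lcomp R _ (app (O.perm (x := fun i => f (x (chart I i))) (chart I).toEquiv
    (fun _ => rfl) z) h)).compMultilinearMap (multiReindex (chart I).toEquiv
      (clFin f D (fun i => x (chart I i)) (fun i => g (chart I i)) z h c (chart_sum hc)))

/-- The symbol given by an enumeration of the indices. -/
def symOf (x : I → X) (g : I → Deg N) {z : O.Ob} {h c : Deg N} (hc : ∑ i, g i + h = c)
    (d : ∀ i, (D (x i)).X (g i)) (m : (O.Hom (fun i => f (x i)) z).X h) {n : ℕ} (k : Fin n ≃ I) :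
    FreeSym f D z c :=
  ⟨n, fun i => x (k i), fun i => g (k i), h, by rw [Equiv.sum_comp k g]; exact hc,
    fun i => d (k i), app (O.perm k (fun _ => rfl) z) h m⟩

theorem cl_apply (x : I → X) (g : I → Deg N) (z : O.Ob) (h c : Deg N) (hc : ∑ i, g i + h = c)
    (d : ∀ i, (D (x i)).X (g i)) (m : (O.Hom (fun i => f (x i)) z).X h) :
    cl f D x g z h c hc d m = mkQ (symOf x g hc d m (chart I).toEquiv) := rfl

theorem symOf_trans (x : I → X) (g : I → Deg N) {z : O.Ob} {h c : Deg N} (hc : ∑ i, g i + h = c)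
    (d : ∀ i, (D (x i)).X (g i)) (m : (O.Hom (fun i => f (x i)) z).X h) {n n' : ℕ} (k : Fin n ≃ I)
    (e : Fin n' ≃ Fin n) : symOf x g hc d m (e.trans k) = (symOf x g hc d m k).perm e := by
  have h1 := perm_perm O e k (e.trans k) (x := fun i => f (x (k (e i)))) (x' := fun i => f (x (k i)))
    (x'' := fun i => f (x i)) (fun _ => rfl) (fun _ => rfl) (fun _ => rfl) (fun _ => rfl) z h m
  exact congrArg (FreeSym.mk n' (fun i => x (k (e i))) (fun i => g (k (e i))) h _
    (fun i => d (k (e i)))) h1.symm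

theorem mkQ_symOf (x : I → X) (g : I → Deg N) {z : O.Ob} {h c : Deg N} (hc : ∑ i, g i + h = c)
    (d : ∀ i, (D (x i)).X (g i)) (m : (O.Hom (fun i => f (x i)) z).X h) {n : ℕ} (k : Fin n ≃ I) :
    mkQ (symOf x g hc d m k) = sg R (kz k g) • cl f D x g z h c hc d m := by
  have h1 : k = (k.trans (chart I).symm.toEquiv).trans (chart I).toEquiv := by
    ext i; simp
  have h2 : kz k g = kz (k.trans (chart I).symm.toEquiv) (fun i => g (chart I i)) := by
    conv_lhs => rw [h1]
    rw [kz_trans, kz_eq_zero (chart I).toEquiv (chart I).strictMono, add_zero]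
    rfl
  rw [h2]
  conv_lhs => rw [h1]
  rw [symOf_trans]
  exact isFam_mkQ.perm (symOf x g hc d m (chart I).toEquiv) _

theorem cl_perm (e : I ≃ I') (x : I' → X) (g : I' → Deg N) (z : O.Ob) (h c : Deg N)
    (hc : ∑ i, g i + h = c) (hc' : ∑ i, g (e i) + h = c)
    (d : ∀ i, (D (x i)).X (g i)) (m : (O.Hom (fun i => f (x i)) z).X h) :
    cl f D (fun i => x (e i)) (fun i => g (e i)) z h c hc' (fun i => d (e i))
      (app (O.perm e (fun _ => rfl) z) h m) = sg R (kz e g) • cl f D x g z h c hc d m := by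
  have h1 := mkQ_symOf x g hc d m ((chart I).toEquiv.trans e)
  rw [kz_trans, kz_eq_zero (chart I).toEquiv (chart I).strictMono, zero_add] at h1
  rw [← h1, cl_apply]
  have h2 := perm_perm O (chart I).toEquiv e ((chart I).toEquiv.trans e)
    (x := fun i => f (x (e (chart I i)))) (x' := fun i => f (x (e i)))
    (x'' := fun i => f (x i)) (fun _ => rfl) (fun _ => rfl) (fun _ => rfl) (fun _ => rfl) z h m
  exact congrArg (fun m => mkQ (FreeSym.mk _ (fun i => x (e (chart I i)))
    (fun i => g (e (chart I i))) h _ (fun i => d (e (chart I i))) m)) h2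

theorem mkQ_eq_cl {z : O.Ob} {c : Deg N} (t : FreeSym f D z c) :
    mkQ t = cl f D t.x t.g z t.h c t.hc t.d t.m := by
  have h1 := mkQ_symOf t.x t.g t.hc t.d t.m (Equiv.refl (Fin t.n))
  rw [kz_refl, sg_zero, one_smul] at h1
  rw [← h1]
  have h2 := perm_one O (Equiv.refl (Fin t.n)) (fun _ => rfl) (x := fun i => f (t.x i))
    (fun _ => rfl) z t.h t.m
  exact congrArg (fun m => mkQ (FreeSym.mk t.n t.x t.g t.h t.hc t.d m)) h2.symm

theorem lift_cl {z : O.Ob} {h c : Deg N} (F : FreeSym f D z c → W) (hF : IsFam F) (x : I → X)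
    (g : I → Deg N) (hc : ∑ i, g i + h = c) (d : ∀ i, (D (x i)).X (g i))
    (m : (O.Hom (fun i => f (x i)) z).X h) :
    liftQ F hF (cl f D x g z h c hc d m) = F (symOf x g hc d m (chart I).toEquiv) := liftQ_mkQ F hF _

theorem FreeQ_ext {z : O.Ob} {c : Deg N} {φ ψ : FreeQ f D z c →ₗ[R] W}
    (H : ∀ {n : ℕ} (x : Fin n → X) (g : Fin n → Deg N) (h : Deg N) (hc : ∑ i, g i + h = c) d m,
      φ (cl f D x g z h c hc d m) = ψ (cl f D x g z h c hc d m)) : φ = ψ := by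
  refine LinearMap.ext_on_range (span_mkQ z c) fun t => ?_
  rw [mkQ_eq_cl]
  exact H t.x t.g t.h t.hc t.d t.m

variable (f D) in
/-- The classes with one factor in the tensor product of the values of the collection. -/
def clT (x : I → X) (z : O.Ob) (a b c : Deg N) (hc : a + b = c) :
    (tens fun i => D (x i)).X a →ₗ[R] (O.Hom (fun i => f (x i)) z).X b →ₗ[R] FreeQ f D z c :=
  tLift fun g hg => cl f D x g z b c (by rw [hg, hc])

theorem clT_tp (x : I → X) (z : O.Ob) (a b c : Deg N) (hc : a + b = c) (g : I → Deg N)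
    (hg : ∑ i, g i = a) (d : ∀ i, (D (x i)).X (g i)) (m : (O.Hom (fun i => f (x i)) z).X b) :
    clT f D x z a b c hc (tp _ g a hg d) m = cl f D x g z b c (by rw [hg, hc]) d m :=
  LinearMap.congr_fun (tLift_tp _ g hg d) m

theorem clT_perm (e : I ≃ I') (x : I' → X) (z : O.Ob) (a b c : Deg N) (hc : a + b = c)
    (t : (tens fun i => D (x i)).X a) (m : (O.Hom (fun i => f (x i)) z).X b) :
    clT f D (fun i => x (e i)) z a b c hc (tPermX (fun i => D (x i)) e a t)
      (app (O.perm e (fun _ => rfl) z) b m) = clT f D x z a b c hc t m := by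
  suffices H : ((clT f D (fun i => x (e i)) z a b c hc).flip
      (app (O.perm (x := fun i => f (x (e i))) (x' := fun i => f (x i)) e (fun _ => rfl) z) b m)) ∘ₗ
        tPermX (fun i => D (x i)) e a =
      (clT f D x z a b c hc).flip m from LinearMap.congr_fun H t
  refine tp_ext fun g hg d => ?_
  rw [LinearMap.comp_apply, tPermX_tp, map_smul, LinearMap.flip_apply, LinearMap.flip_apply,
    clT_tp, clT_tp, cl_perm, smul_smul, sg_mul_self, one_smul]

/-- The differential of a class, in terms of the tensor products. -/
def delT (x : I → X) (z : O.Ob) (a b c c' : Deg N) (hc : a + b = c) (hc' : c' + 1 = c) :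
    (tens fun i => D (x i)).X a →ₗ[R] (O.Hom (fun i => f (x i)) z).X b →ₗ[R] FreeQ f D z c' :=
  (clT f D x z (a - 1) b c' (by rw [← add_left_inj 1, hc', ← hc]; ring)) ∘ₗ del _ a (a - 1) +
    sg R (par a) • (clT f D x z a (b - 1) c' (by rw [← add_left_inj 1, hc', ← hc]; ring)).compl₂
      (del _ b (b - 1))

theorem delT_apply (x : I → X) (z : O.Ob) (a b c c' : Deg N) (hc : a + b = c) (hc' : c' + 1 = c)
    (t : (tens fun i => D (x i)).X a) (m : (O.Hom (fun i => f (x i)) z).X b) :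
    delT x z a b c c' hc hc' t m =
      clT f D x z (a - 1) b c' (by rw [← add_left_inj 1, hc', ← hc]; ring) (del _ a (a - 1) t) m +
      sg R (par a) • clT f D x z a (b - 1) c' (by rw [← add_left_inj 1, hc', ← hc]; ring) t
        (del _ b (b - 1) m) := rfl

theorem delT_perm (e : I ≃ I') (x : I' → X) (z : O.Ob) (a b c c' : Deg N) (hc : a + b = c)
    (hc' : c' + 1 = c) (t : (tens fun i => D (x i)).X a) (m : (O.Hom (fun i => f (x i)) z).X b) :
    delT (f := f) (D := D) (fun i => x (e i)) z a b c c' hc hc' (tPermX (fun i => D (x i)) e a t)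
      (app (O.perm e (fun _ => rfl) z) b m) = delT x z a b c c' hc hc' t m := by
  have h1 := tPermX_del (fun i => D (x i)) e a (a - 1) t
  have h2 := app_del (O.perm (x := fun i => f (x (e i))) (x' := fun i => f (x i)) e (fun _ => rfl) z)
    b (b - 1) m
  rw [delT_apply, delT_apply, ← clT_perm e x z (a - 1), ← clT_perm e x z a, ← h2]
  exact congrArg (fun s => clT f D (fun i => x (e i)) z (a - 1) b c' _ s _ + _) h1.symm

/-- The differential of a symbol. -/
def symDel {z : O.Ob} {c : Deg N} (c' : Deg N) (hc : c' + 1 = c) (t : FreeSym f D z c) :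
    FreeQ f D z c' :=
  delT t.x z _ t.h c c' t.hc hc (tp (fun i => D (t.x i)) t.g _ rfl t.d) t.m

theorem symDel_eq {z : O.Ob} {c : Deg N} (c' : Deg N) (hc : c' + 1 = c) (t : FreeSym f D z c)
    (a : Deg N) (ha : ∑ i, t.g i = a) : symDel c' hc t =
      delT t.x z a t.h c c' (by rw [← ha, t.hc]) hc (tp (fun i => D (t.x i)) t.g a ha t.d) t.m := by
  subst ha; rfl

theorem isFam_symDel {z : O.Ob} {c : Deg N} (c' : Deg N) (hc : c' + 1 = c) :
    IsFam (symDel c' hc : FreeSym f D z c → FreeQ f D z c') := by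
  refine ⟨fun t i r a b => ?_, fun t r a b => ?_, fun t n e => ?_⟩
  · exact multi_lin (tp (fun i => D (t.x i)) t.g _ rfl)
      ((delT t.x z _ t.h c c' t.hc hc).flip t.m) t.d i r a b
  · exact (map_add _ _ _).trans (congrArg (· + _) (map_smul _ _ _))
  · rw [symDel_eq c' hc _ _ (Equiv.sum_comp e t.g), symDel_eq c' hc t _ rfl, ← delT_perm e]
    rw [tPermX_tp, map_smul, LinearMap.smul_apply, smul_smul, sg_mul_self, one_smul]
    rfl

variable (f D) in
/-- The differential of the free algebra on generators. -/
def delQ (z : O.Ob) (c c' : Deg N) : FreeQ f D z c →ₗ[R] FreeQ f D z c' :=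
  if hc : c' + 1 = c then liftQ (symDel c' hc) (isFam_symDel c' hc) else 0

theorem delQ_cl (x : I → X) (z : O.Ob) (a b c c' : Deg N) (hc : a + b = c) (hc' : c' + 1 = c)
    (g : I → Deg N) (hg : ∑ i, g i = a) (d : ∀ i, (D (x i)).X (g i))
    (m : (O.Hom (fun i => f (x i)) z).X b) :
    delQ f D z c c' (cl f D x g z b c (by rw [hg, hc]) d m) =
      delT x z a b c c' hc hc' (tp (fun i => D (x i)) g a hg d) m := by
  rw [delQ, dif_pos hc', lift_cl, symDel_eq c' hc' _ a ((Equiv.sum_comp (chart I).toEquiv g).trans hg),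
    ← delT_perm (chart I).toEquiv, tPermX_tp, kz_eq_zero (chart I).toEquiv (chart I).strictMono,
    sg_zero, one_smul]
  rfl

theorem delQ_clT (x : I → X) (z : O.Ob) (a b c c' : Deg N) (hc : a + b = c) (hc' : c' + 1 = c)
    (t : (tens fun i => D (x i)).X a) (m : (O.Hom (fun i => f (x i)) z).X b) :
    delQ f D z c c' (clT f D x z a b c hc t m) = delT x z a b c c' hc hc' t m := by
  suffices H : delQ f D z c c' ∘ₗ (clT f D x z a b c hc).flip m = (delT x z a b c c' hc hc').flip m
    from LinearMap.congr_fun H t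
  refine tp_ext fun g hg d => ?_
  rw [LinearMap.comp_apply, LinearMap.flip_apply, clT_tp, delQ_cl x z a b c c' hc hc' g hg]
  rfl

theorem delQ_delQ (z : O.Ob) (c c' c'' : Deg N) (q : FreeQ f D z c) :
    delQ f D z c' c'' (delQ f D z c c' q) = 0 := by
  by_cases hc : c' + 1 = c
  · by_cases hc' : c'' + 1 = c'
    · suffices H : delQ f D z c' c'' ∘ₗ delQ f D z c c' = 0 from LinearMap.congr_fun H q
      refine FreeQ_ext fun x g h hs d m => ?_
      rw [LinearMap.comp_apply, delQ_cl x z _ h c c' hs hc g rfl, delT_apply, map_add, map_smul,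
        delQ_clT _ _ _ _ _ _ _ hc', delQ_clT _ _ _ _ _ _ _ hc', delT_apply, delT_apply, del_del,
        del_del, map_zero, map_zero]
      simp only [smul_zero, add_zero, LinearMap.zero_apply, zero_add]
      rw [← add_smul, par_sub_one, sg_add, sg_one, mul_neg_one, neg_add_cancel, zero_smul]
    · rw [delQ, dif_neg hc']; rfl
  · rw [delQ, delQ, dif_neg hc, LinearMap.zero_apply, map_zero]

variable (f D) in
/-- The complexes that underlie the free algebra on generators. -/
def cxQ (z : O.Ob) : Ch R N :=
  mkCh (FreeQ f D z) (delQ f D z) (fun a b h => by rw [delQ, dif_neg h]) (delQ_delQ z)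

end FreeByGenerators

/-! ### The action of multimorphisms on the free algebra -/

/-- The family `g` of families, as a family over the lexicographic sum of the index sets `I j`. -/
notation "lexFam(" I "," g ")" => fun q : Σₗ j, I j => g (Sigma.fst (ofLex q)) (Sigma.snd (ofLex q))

section FreeByGeneratorsMulti

variable {O : DGMulticat R N} {X : Type u} {f : X → O.Ob}
  {D : X → Ch R N} {W : Type u} [AddCommGroup W] [Module R W] {J : Type} [Fintype J] [LinearOrder J]

theorem lex_update [DecidableEq J] {I : J → Type} [∀ j, DecidableEq (I j)] [DecidableEq (Σₗ j, I j)]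
    {V : ∀ j, I j → Type u} (v : ∀ j i, V j i) (j₀ : J) (i₀ : I j₀) (a : V j₀ i₀) :
    (fun q : Σₗ j, I j => Function.update v j₀ (Function.update (v j₀) i₀ a) (ofLex q).1 (ofLex q).2) =
      Function.update (β := fun q : Σₗ j, I j => V (ofLex q).1 (ofLex q).2)
        (fun q => v (ofLex q).1 (ofLex q).2) (toLex ⟨j₀, i₀⟩) a := by
  funext q
  obtain ⟨j, i⟩ := q
  change Function.update v j₀ (Function.update (v j₀) i₀ a) j i =
    Function.update (β := fun q : Σₗ j, I j => V (ofLex q).1 (ofLex q).2)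
        (fun q => v (ofLex q).1 (ofLex q).2) (toLex ⟨j₀, i₀⟩) a (toLex ⟨j, i⟩)
  have h0 := Function.update_self (β := fun q : Σₗ j, I j => V (ofLex q).1 (ofLex q).2)
    (toLex ⟨j₀, i₀⟩) a (fun q => v (ofLex q).1 (ofLex q).2)
  have h1 : ∀ q : Σₗ j, I j, q ≠ toLex ⟨j₀, i₀⟩ → _ := fun q hq =>
    Function.update_of_ne (β := fun q : Σₗ j, I j => V (ofLex q).1 (ofLex q).2) hq a
      (fun q => v (ofLex q).1 (ofLex q).2)
  by_cases hj : j = j₀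
  · subst hj
    rw [Function.update_self]
    by_cases hi : i = i₀
    · subst hi
      rw [Function.update_self]
      exact h0.symm
    · rw [Function.update_of_ne hi]
      refine (h1 (toLex ⟨j, i⟩) fun h => hi ?_).symm
      exact eq_of_heq (Sigma.mk.inj (toLex.injective h)).2
  · rw [Function.update_of_ne hj]
    refine (h1 (toLex ⟨j, i⟩) fun h => hj ?_).symm
    exact (Sigma.mk.inj (toLex.injective h)).1

variable {y : J → O.Ob} {c : J → Deg N}

/-- A function on families of symbols that is multilinear and equivariant is admissible in each
variable. -/
theorem isFam_slot (F : (∀ j, FreeSym f D (y j) (c j)) → W)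
    (hlin : ∀ s : ∀ j, FreeSym f D (y j) (c j), ∃ (A : Type u) (_ : AddCommGroup A) (_ : Module R A)
      (L : MultilinearMap R (fun q : Σₗ j, Fin (s j).n =>
        (D ((s (ofLex q).1).x (ofLex q).2)).X ((s (ofLex q).1).g (ofLex q).2)) (A →ₗ[R] W))
      (K : MultilinearMap R (fun j => (O.Hom (fun i => f ((s j).x i)) (y j)).X (s j).h) A),
      ∀ (d : ∀ j i, (D ((s j).x i)).X ((s j).g i)) (m : ∀ j, (O.Hom (fun i => f ((s j).x i)) (y j)).X (s j).h),
        F (fun j => ((s j).withD (d j)).withM (m j)) = L (fun q => d (ofLex q).1 (ofLex q).2) (K m))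
    (hperm : ∀ (s : ∀ j, FreeSym f D (y j) (c j)) (n : J → ℕ) (e : ∀ j, Fin (n j) ≃ Fin (s j).n),
      F (fun j => (s j).perm (e j)) = sg R (∑ j, kz (e j) (s j).g) • F s)
    [DecidableEq J] (j : J) (s : ∀ j, FreeSym f D (y j) (c j)) :
    IsFam (fun t => F (Function.update s j t)) := by
  have upd : ∀ (s : ∀ j, FreeSym f D (y j) (c j)) (d : ∀ i, (D ((s j).x i)).X ((s j).g i))
      (m : (O.Hom (fun i => f ((s j).x i)) (y j)).X (s j).h),
      Function.update s j (((s j).withD d).withM m) = fun k =>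
        ((s k).withD (Function.update (fun k => (s k).d) j d k)).withM
          (Function.update (fun k => (s k).m) j m k) := by
    intro s d m
    funext k
    by_cases hk : k = j
    · subst hk; rw [Function.update_self, Function.update_self, Function.update_self]
    · rw [Function.update_of_ne hk, Function.update_of_ne hk, Function.update_of_ne hk]
      rfl
  have upd1 : ∀ (s : ∀ j, FreeSym f D (y j) (c j)) (d : ∀ i, (D ((s j).x i)).X ((s j).g i)),
      Function.update s j ((s j).withD d) = fun k =>
        ((s k).withD (Function.update (fun k => (s k).d) j d k)).withM ((s k).m) := by
    intro s d
    refine (upd s d (s j).m).trans (funext fun k => ?_)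
    rw [Function.update_eq_self j fun k => (s k).m]
  have upd2 : ∀ (s : ∀ j, FreeSym f D (y j) (c j)) (m : (O.Hom (fun i => f ((s j).x i)) (y j)).X (s j).h),
      Function.update s j ((s j).withM m) = fun k =>
        ((s k).withD ((s k).d)).withM (Function.update (fun k => (s k).m) j m k) := by
    intro s m
    refine (upd s (s j).d m).trans (funext fun k => ?_)
    rw [Function.update_eq_self j fun k => (s k).d]
  have aux1 : ∀ (s : ∀ j, FreeSym f D (y j) (c j)) (t : FreeSym f D (y j) (c j)), s j = t →
      ∀ (i : Fin t.n) (r : R) (a b : (D (t.x i)).X (t.g i)),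
      F (Function.update s j (t.withD (Function.update t.d i (r • a + b)))) =
        r • F (Function.update s j (t.withD (Function.update t.d i a))) +
          F (Function.update s j (t.withD (Function.update t.d i b))) := by
    rintro s t rfl i r a b
    obtain ⟨A, _, _, L, K, hF⟩ := hlin s
    rw [upd1, upd1, upd1, hF _ (fun k => (s k).m), hF _ (fun k => (s k).m), hF _ (fun k => (s k).m)]
    have h1 := fun a => lex_update (I := fun j => Fin (s j).n)
      (V := fun j i => (D ((s j).x i)).X ((s j).g i)) (fun k => (s k).d) j i a
    have h2 := multi_lin L (LinearMap.applyₗ (K fun k => (s k).m))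
      (fun q : Σₗ j, Fin (s j).n => (s (ofLex q).1).d (ofLex q).2) (toLex ⟨j, i⟩) r a b
    have h3 := fun a => congrArg (fun v => L v (K fun k => (s k).m)) (h1 a)
    exact (h3 (r • a + b)).trans (h2.trans
      (congrArg₂ (fun u v => r • u + v) (h3 a) (h3 b)).symm)
  have aux2 : ∀ (s : ∀ j, FreeSym f D (y j) (c j)) (t : FreeSym f D (y j) (c j)), s j = t →
      ∀ (r : R) (a b : (O.Hom (fun i => f (t.x i)) (y j)).X t.h),
      F (Function.update s j (t.withM (r • a + b))) =
        r • F (Function.update s j (t.withM a)) + F (Function.update s j (t.withM b)) := by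
    rintro s t rfl r a b
    obtain ⟨A, _, _, L, K, hF⟩ := hlin s
    rw [upd2, upd2, upd2, hF (fun k => (s k).d), hF (fun k => (s k).d), hF (fun k => (s k).d)]
    exact multi_lin K (L fun q => (s (ofLex q).1).d (ofLex q).2) (fun k => (s k).m) j r a b
  have aux3 : ∀ (s : ∀ j, FreeSym f D (y j) (c j)) (t : FreeSym f D (y j) (c j)), s j = t →
      ∀ {n : ℕ} (e : Fin n ≃ Fin t.n), F (Function.update s j (t.perm e)) = sg R (kz e t.g) • F s := by
    rintro s t rfl n e
    have h1 : ∀ k, ∃ (n' : ℕ) (e' : Fin n' ≃ Fin (s k).n),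
        Function.update s j ((s j).perm e) k = (s k).perm e' ∧
          kz e' (s k).g = if k = j then kz e (s j).g else 0 := by
      intro k
      by_cases hk : k = j
      · subst hk
        exact ⟨n, e, Function.update_self .., (if_pos rfl).symm⟩
      · refine ⟨_, Equiv.refl _, ?_, by rw [if_neg hk, kz_refl]⟩
        rw [Function.update_of_ne hk]
        exact congrArg (FreeSym.mk (s k).n (s k).x (s k).g (s k).h (s k).hc (s k).d)
          (perm_one O (Equiv.refl _) (fun _ => rfl) (x := fun i => f ((s k).x i)) (fun _ => rfl) (y k) (s k).h (s k).m).symm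
    choose n' e' h2 h3 using h1
    rw [funext h2, hperm, Finset.sum_congr rfl fun k _ => h3 k, Finset.sum_ite_eq',
      if_pos (Finset.mem_univ _)]
  refine ⟨fun t i r a b => ?_, fun t r a b => ?_, fun t n e => ?_⟩
  · have := aux1 (Function.update s j t) t (Function.update_self ..) i r a b
    simpa only [Function.update_idem] using this
  · have := aux2 (Function.update s j t) t (Function.update_self ..) r a b
    simpa only [Function.update_idem] using this
  · have := aux3 (Function.update s j t) t (Function.update_self ..) e
    simpa only [Function.update_idem] using this

/-- The multilinear map on the free algebra that is induced by a multilinear and equivariant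
function on families of symbols. -/
def multiLiftQ (F : (∀ j, FreeSym f D (y j) (c j)) → W)
    (hF : ∀ [DecidableEq J] (j : J) (s : ∀ j, FreeSym f D (y j) (c j)),
      IsFam (fun t => F (Function.update s j t))) :
    MultilinearMap R (fun j => FreeQ f D (y j) (c j)) W :=
  multiQuot (Z := fun j => famRel f D (y j) (c j)) F fun j s _ n hn => hn W _ (hF j s)

theorem multiLiftQ_mkQ (F : (∀ j, FreeSym f D (y j) (c j)) → W)
    (hF : ∀ [DecidableEq J] (j : J) (s : ∀ j, FreeSym f D (y j) (c j)),
      IsFam (fun t => F (Function.update s j t))) (s : ∀ j, FreeSym f D (y j) (c j)) :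
    multiLiftQ F hF (fun j => mkQ (s j)) = F s := by
  classical
  exact (multiQuot_mk (Z := fun j => famRel f D (y j) (c j)) F (fun j s _ n hn => hn W _ (hF j s)) _).trans (multiFree_single F s)

/-- The sign exponent of the reordering of `⨂ j, (D j ⊗ m j)` into `⨂ j, D j ⊗ ⨂ j, m j`, where
`D j` has parity `a j` and `m j` has degree `h j`. -/
def tw (h : J → Deg N) (a : J → ZMod 2) : ZMod 2 :=
  ∑ j, ∑ j', if j < j' then par (h j) * a j' else 0

theorem sum_lex_add {n : J → ℕ} {g : ∀ j, Fin (n j) → Deg N} {h c : J → Deg N} {l e : Deg N}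
    (hc : ∀ j, ∑ i, g j i + h j = c j) (he : ∑ j, c j + l = e) :
    ∑ q : Σₗ j, Fin (n j), g (ofLex q).1 (ofLex q).2 + (∑ j, h j + l) = e := by
  rw [sum_lex, ← add_assoc, ← Finset.sum_add_distrib, ← he]
  exact congrArg (· + l) (Finset.sum_congr rfl fun j _ => hc j)

/-- The operation on a family of symbols. -/
def symAct {z : O.Ob} (l e : Deg N) (he : ∑ j, c j + l = e) (s : ∀ j, FreeSym f D (y j) (c j)) :
    (O.Hom y z).X l →ₗ[R] FreeQ f D z e :=
  sg R (tw (fun j => (s j).h) fun j => ∑ i, par ((s j).g i)) •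
    (cl f D (fun q : Σₗ j, Fin (s j).n => (s (ofLex q).1).x (ofLex q).2)
      (fun q => (s (ofLex q).1).g (ofLex q).2) z (∑ j, (s j).h + l) e
        (sum_lex_add (fun j => (s j).hc) he) (fun q => (s (ofLex q).1).d (ofLex q).2)) ∘ₗ
      O.comp (fun j => (s j).h) l _ rfl fun j => (s j).m

theorem isFam_symAct {z : O.Ob} (l e : Deg N) (he : ∑ j, c j + l = e) [DecidableEq J] (j : J)
    (s : ∀ j, FreeSym f D (y j) (c j)) :
    IsFam (fun t => symAct (z := z) l e he (Function.update s j t)) := by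
  refine isFam_slot _ (fun s => ⟨_, inferInstance, inferInstance,
    sg R (tw (fun j => (s j).h) fun j => ∑ i, par ((s j).g i)) •
      (LinearMap.llcomp R _ _ _).compMultilinearMap
        (cl f D (fun q : Σₗ j, Fin (s j).n => (s (ofLex q).1).x (ofLex q).2)
        (fun q => (s (ofLex q).1).g (ofLex q).2) z (∑ j, (s j).h + l) e
          (sum_lex_add (fun j => (s j).hc) he)), O.comp (fun j => (s j).h) l _ rfl,
    fun d m => rfl⟩) (fun s n k => ?_) j s
  refine LinearMap.ext fun p => ?_
  have h1 := O.comp_perm_inner k (fun j => (s j).h) l _ rfl (fun j => (s j).m) p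
    (x := fun j i => f ((s j).x i)) (y := y) (z := z)
  have h2 := cl_perm (f := f) (D := D) (lexInner k) (fun q : Σₗ j, Fin (s j).n => (s (ofLex q).1).x (ofLex q).2)
      (fun q => (s (ofLex q).1).g (ofLex q).2) z (∑ j, (s j).h + l) e
        (sum_lex_add (fun j => (s j).hc) he)
        (sum_lex_add (n := n) (g := fun j i => (s j).g (k j i)) (fun j => by rw [Equiv.sum_comp (k j)]; exact (s j).hc) he)
        (fun q => (s (ofLex q).1).d (ofLex q).2) (O.comp (fun j => (s j).h) l _ rfl (fun j => (s j).m) p)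
  rw [kz_lexInner] at h2
  have h3 : (tw (fun j => (s j).h) fun j => ∑ i, par ((s j).g (k j i))) =
      tw (fun j => (s j).h) fun j => ∑ i, par ((s j).g i) :=
    congrArg (tw _) (funext fun j => Equiv.sum_comp (k j) fun i => par ((s j).g i))
  refine (congrArg₂ (fun a b => sg R a • cl f D
    (fun q : Σₗ j, Fin (n j) => (s (ofLex q).1).x (k (ofLex q).1 (ofLex q).2))
    (fun q => (s (ofLex q).1).g (k (ofLex q).1 (ofLex q).2)) z (∑ j, (s j).h + l) e
    (sum_lex_add (n := n) (g := fun j i => (s j).g (k j i)) (fun j => by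
      rw [Equiv.sum_comp (k j)]; exact (s j).hc) he)
    (fun q => (s (ofLex q).1).d (k (ofLex q).1 (ofLex q).2)) b) h3 h1).trans ?_
  refine (congrArg _ h2).trans ?_
  rw [LinearMap.smul_apply, smul_comm]
  rfl

variable (f D) in
/-- The operations of the free algebra on generators. -/
def actQ (y : J → O.Ob) (z : O.Ob) (c : J → Deg N) (l e : Deg N) (he : ∑ j, c j + l = e) :
    MultilinearMap R (fun j => FreeQ f D (y j) (c j)) ((O.Hom y z).X l →ₗ[R] FreeQ f D z e) :=
  multiLiftQ (symAct l e he) (isFam_symAct l e he)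

variable {I : J → Type} [∀ j, Fintype (I j)] [∀ j, LinearOrder (I j)]

theorem sum_lex_add' {g : ∀ j, I j → Deg N} {h c : J → Deg N} {l hl e : Deg N}
    (hc : ∀ j, ∑ i, g j i + h j = c j) (he : ∑ j, c j + l = e) (hhl : ∑ j, h j + l = hl) :
    ∑ q : Σₗ j, I j, g (ofLex q).1 (ofLex q).2 + hl = e := by
  rw [sum_lex, ← hhl, ← add_assoc, ← Finset.sum_add_distrib, ← he]
  exact congrArg (· + l) (Finset.sum_congr rfl fun j _ => hc j)

theorem actQ_cl (x : ∀ j, I j → X) (y : J → O.Ob) (z : O.Ob) (g : ∀ j, I j → Deg N) (h c : J → Deg N)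
    (l hl e : Deg N) (hc : ∀ j, ∑ i, g j i + h j = c j) (he : ∑ j, c j + l = e)
    (hhl : ∑ j, h j + l = hl)
    (d : ∀ j i, (D (x j i)).X (g j i)) (m : ∀ j, (O.Hom (fun i => f (x j i)) (y j)).X (h j))
    (p : (O.Hom y z).X l) :
    actQ f D y z c l e he (fun j => cl f D (x j) (g j) (y j) (h j) (c j) (hc j) (d j) (m j)) p =
      sg R (tw h fun j => ∑ i, par (g j i)) •
        cl f D lexFam(I, x) (fun q => g (ofLex q).1 (ofLex q).2) z
          hl e (sum_lex_add' hc he hhl) (fun q => d (ofLex q).1 (ofLex q).2)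
          (O.comp h l hl hhl m p) := by
  subst hhl
  refine (LinearMap.congr_fun (multiLiftQ_mkQ (symAct l e he) (isFam_symAct l e he)
    fun j => symOf (x j) (g j) (hc j) (d j) (m j) (chart (I j)).toEquiv) p).trans ?_
  have h1 := O.comp_perm_inner (fun j => (chart (I j)).toEquiv) h l _ rfl m p
    (x := fun j i => f (x j i)) (y := y) (z := z)
  have h2 := cl_perm (f := f) (D := D) (lexInner fun j => (chart (I j)).toEquiv)
      lexFam(I, x)
      (fun q => g (ofLex q).1 (ofLex q).2) z (∑ j, h j + l) e
        (sum_lex_add' hc he rfl)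
        (sum_lex_add' (g := fun j i => g j (chart (I j) i))
          (fun j => by rw [← hc j]; exact congrArg (· + h j) (Equiv.sum_comp (chart (I j)).toEquiv (g j))) he rfl)
        (fun q => d (ofLex q).1 (ofLex q).2) (O.comp h l _ rfl m p)
  rw [kz_lexInner, Finset.sum_eq_zero fun j _ => kz_eq_zero _ (chart (I j)).strictMono _, sg_zero,
    one_smul] at h2
  have h3 : (tw h fun j => ∑ i, par (g j (chart (I j) i))) = tw h fun j => ∑ i, par (g j i) :=
    congrArg (tw _) (funext fun j => Equiv.sum_comp (chart (I j)).toEquiv fun i => par (g j i))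
  exact (congrArg₂ (fun a b => sg R a • cl f D _ _ z _ e _ _ b) h3 h1).trans (congrArg _ h2)

end FreeByGeneratorsMulti

/-! ### Koszul signs of nested tensor products -/

section TwistSigns

variable {N : ℕ} {J J' : Type} [Fintype J] [LinearOrder J] [Fintype J'] [LinearOrder J']

theorem tw_lex {I : J → Type} [∀ j, Fintype (I j)] [∀ j, LinearOrder (I j)] (h : ∀ j, I j → Deg N)
    (a : ∀ j, I j → ZMod 2) :
    tw lexFam(I, h) (fun q => a (ofLex q).1 (ofLex q).2) =
      ∑ j, tw (h j) (a j) + ∑ j, ∑ j', if j < j' then (∑ i, par (h j i)) * ∑ i, a j' i else 0 := by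
  unfold tw
  rw [sum_lex, ← Finset.sum_add_distrib]
  refine Finset.sum_congr rfl fun j _ => ?_
  have h1 : ∀ i : I j, (∑ q : Σₗ j, I j, if toLex ⟨j, i⟩ < q then
      par (h (ofLex (toLex (⟨j, i⟩ : Σ j, I j))).1 (ofLex (toLex (⟨j, i⟩ : Σ j, I j))).2) *
        a (ofLex q).1 (ofLex q).2 else 0) =
      (∑ i', if i < i' then par (h j i) * a j i' else 0) +
        ∑ j', if j < j' then par (h j i) * ∑ i', a j' i' else 0 := by
    intro i
    rw [sum_lex, ← Finset.add_sum_erase _ _ (Finset.mem_univ j),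
      ← Finset.add_sum_erase (a := j) Finset.univ (fun j' => if j < j' then par (h j i) * ∑ i', a j' i' else 0)
        (Finset.mem_univ j), if_neg (lt_irrefl j), zero_add]
    refine congrArg₂ (· + ·) (Finset.sum_congr rfl fun i' _ => ?_)
      (Finset.sum_congr rfl fun j' hj => ?_)
    · exact if_congr lex_lt_iff rfl rfl
    · have hne := (Finset.ne_of_mem_erase hj).symm
      by_cases hlt : j < j'
      · rw [if_pos hlt, Finset.mul_sum]
        exact Finset.sum_congr rfl fun i' _ => if_pos ((lex_lt_iff_of_ne hne).2 hlt)
      · rw [if_neg hlt]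
        exact Finset.sum_eq_zero fun i' _ => if_neg fun h => hlt ((lex_lt_iff_of_ne hne).1 h)
  refine (Finset.sum_congr rfl fun i _ => h1 i).trans ?_
  rw [Finset.sum_add_distrib]
  congr 1
  rw [Finset.sum_comm]
  refine Finset.sum_congr rfl fun j' _ => ?_
  by_cases hj : j < j'
  · simp only [if_pos hj, Finset.sum_mul]
  · simp only [if_neg hj, Finset.sum_const_zero]

/-- Compatibility of the sign of the reordering `tw` with permutations of the factors. -/
theorem kz_add_tw (e : J ≃ J') (h c : J' → Deg N) (a : J' → ZMod 2)
    (hc : ∀ j, a j + par (h j) = par (c j)) (g : J' → Deg N) (hg : ∀ j, par (g j) = a j) :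
    tw (fun j => h (e j)) (fun j => a (e j)) + kz e h + kz e g = kz e c + tw h a := by
  have h1 : tw h a = ∑ j, ∑ j', if e j < e j' then par (h (e j)) * a (e j') else 0 := by
    unfold tw
    rw [← Equiv.sum_comp e]
    exact Finset.sum_congr rfl fun j _ => (Equiv.sum_comp e _).symm
  have h2 : tw h a + tw (fun j => h (e j)) (fun j => a (e j)) =
      ∑ j, ∑ j', if j < j' ∧ e j' < e j then par (h (e j)) * a (e j') + par (h (e j')) * a (e j) else 0 := by
    have h3 : ∑ j, ∑ j', (if j < j' ∧ e j' < e j then par (h (e j)) * a (e j') + par (h (e j')) * a (e j) else 0) =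
        ∑ j, ∑ j', ((if j < j' ∧ e j' < e j then par (h (e j)) * a (e j') else 0) +
          if j' < j ∧ e j < e j' then par (h (e j)) * a (e j') else 0) := by
      simp only [Finset.sum_add_distrib]
      rw [Finset.sum_comm (f := fun j j' => if j' < j ∧ e j < e j' then par (h (e j)) * a (e j') else 0),
        ← Finset.sum_add_distrib]
      refine Finset.sum_congr rfl fun j _ => ?_
      rw [← Finset.sum_add_distrib]
      refine Finset.sum_congr rfl fun j' _ => ?_
      split_ifs <;> simp
    rw [h1, h3]
    unfold tw
    rw [← Finset.sum_add_distrib]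
    refine Finset.sum_congr rfl fun j _ => ?_
    rw [← Finset.sum_add_distrib]
    refine Finset.sum_congr rfl fun j' _ => ?_
    by_cases hj : j = j'
    · subst hj; simp
    · have h3 : e j ≠ e j' := fun h => hj (e.injective h)
      rcases lt_or_gt_of_ne hj with h2 | h2 <;> rcases lt_or_gt_of_ne h3 with h3 | h3 <;>
        simp [h2, h3, h2.not_gt, h3.not_gt, CharTwo.add_self_eq_zero]
  have h3 : kz e c = kz e h + kz e g + (tw h a + tw (fun j => h (e j)) (fun j => a (e j))) := by
    rw [h2]
    unfold kz
    rw [← Finset.sum_add_distrib, ← Finset.sum_add_distrib]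
    refine Finset.sum_congr rfl fun j _ => ?_
    rw [← Finset.sum_add_distrib, ← Finset.sum_add_distrib]
    refine Finset.sum_congr rfl fun j' _ => ?_
    split_ifs
    · rw [← hc, ← hc, hg, hg]; ring
    · simp
  have h4 := CharTwo.add_self_eq_zero (tw h a)
  linear_combination -h3 - h4

theorem tw_add_left (h h' : J → Deg N) (a : J → ZMod 2) (j : J)
    (hh : ∀ i, par (h' i) = par (h i) + if i = j then 1 else 0) :
    tw h' a = tw h a + ∑ i, if j < i then a i else 0 := by
  unfold tw
  simp only [hh]
  rw [sum_ite_shift', sum_ite_point']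

theorem tw_add_right (h : J → Deg N) (a a' : J → ZMod 2) (j : J)
    (ha : ∀ i, a' i = a i + if i = j then 1 else 0) : tw h a' = tw h a + before h j := by
  unfold tw
  simp only [ha]
  rw [sum_ite_shift, sum_ite_point]
  rfl

theorem before_lex {I : J → Type} [∀ j, Fintype (I j)] [∀ j, LinearOrder (I j)]
    (g : (Σₗ j, I j) → Deg N) (j : J) (i : I j) :
    before g (toLex ⟨j, i⟩) = before (fun i => g (toLex ⟨j, i⟩)) i +
      ∑ j', if j' < j then ∑ i', par (g (toLex ⟨j', i'⟩)) else 0 := by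
  unfold before
  rw [sum_lex, ← Finset.add_sum_erase _ _ (Finset.mem_univ j),
    ← Finset.add_sum_erase (a := j) Finset.univ
      (fun j' => if j' < j then ∑ i', par (g (toLex ⟨j', i'⟩)) else 0) (Finset.mem_univ j),
    if_neg (lt_irrefl j), zero_add]
  refine congrArg₂ (· + ·) (Finset.sum_congr rfl fun i' _ => ?_)
    (Finset.sum_congr rfl fun j' hj => ?_)
  · exact if_congr lex_lt_iff rfl rfl
  · have hne := Finset.ne_of_mem_erase hj
    by_cases hlt : j' < j
    · rw [if_pos hlt]
      exact Finset.sum_congr rfl fun i' _ => if_pos ((lex_lt_iff_of_ne hne).2 hlt)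
    · rw [if_neg hlt]
      exact Finset.sum_eq_zero fun i' _ => if_neg fun h => hlt ((lex_lt_iff_of_ne hne).1 h)

end TwistSigns

section FreeAlgebraLaws

variable {O : DGMulticat R N} {X : Type u} {f : X → O.Ob}
  {D : X → Ch R N} {W : Type u} [AddCommGroup W] [Module R W] {J J' : Type} [Fintype J]
  [LinearOrder J] [Fintype J'] [LinearOrder J']

theorem span_cl (z : O.Ob) (c : Deg N) :
    Submodule.span R {q : FreeQ f D z c | ∃ (n : ℕ) (x : Fin n → X) (g : Fin n → Deg N) (h : Deg N)
      (hc : ∑ i, g i + h = c) (d : ∀ i, (D (x i)).X (g i))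
      (m : (O.Hom (fun i => f (x i)) z).X h), q = cl f D x g z h c hc d m} = ⊤ := by
  refine top_unique ((span_mkQ z c).symm.le.trans (Submodule.span_mono ?_))
  rintro _ ⟨t, rfl⟩
  exact ⟨t.n, t.x, t.g, t.h, t.hc, t.d, t.m, mkQ_eq_cl t⟩

theorem multi_ext_cl {y : J → O.Ob} {c : J → Deg N}
    {F G : MultilinearMap R (fun j => FreeQ f D (y j) (c j)) W}
    (H : ∀ (n : J → ℕ) (x : ∀ j, Fin (n j) → X) (g : ∀ j, Fin (n j) → Deg N) (h : J → Deg N)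
      (hc : ∀ j, ∑ i, g j i + h j = c j) (d : ∀ j i, (D (x j i)).X (g j i))
      (m : ∀ j, (O.Hom (fun i => f (x j i)) (y j)).X (h j)),
      F (fun j => cl f D (x j) (g j) (y j) (h j) (c j) (hc j) (d j) (m j)) =
        G (fun j => cl f D (x j) (g j) (y j) (h j) (c j) (hc j) (d j) (m j))) : F = G := by
  classical
  refine MultilinearMap.ext fun v => ?_
  refine multi_induction (R := R) Finset.univ _ (fun j _ => span_cl (y j) (c j)) (fun v => F v = G v)
    (fun v j _ => by rw [MultilinearMap.map_update_zero, MultilinearMap.map_update_zero])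
    (fun v j _ a b ha hb => by rw [MultilinearMap.map_update_add, MultilinearMap.map_update_add, ha, hb])
    (fun v j _ r a ha => by rw [MultilinearMap.map_update_smul, MultilinearMap.map_update_smul, ha])
    (fun v hv => ?_) v
  choose n x g h hc d m hq using fun j => hv j (Finset.mem_univ j)
  obtain rfl := funext hq
  exact H n x g h hc d m

theorem cl_congr {I : Type} [Fintype I] [LinearOrder I] (x : I → X) {g g' : I → Deg N} {z : O.Ob}
    {h h' c c' : Deg N} (hc : ∑ i, g i + h = c) (hc' : ∑ i, g' i + h' = c') (hg : g = g')
    (hh : h = h') {d : ∀ i, (D (x i)).X (g i)} {d' : ∀ i, (D (x i)).X (g' i)}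
    (hd : ∀ i, tr (D (x i)) _ _ (d i) = d' i) {m : (O.Hom (fun i => f (x i)) z).X h}
    {m' : (O.Hom (fun i => f (x i)) z).X h'} (hm : tr _ _ _ m = m') :
    tr (cxQ f D z) c c' (cl f D x g z h c hc d m) = cl f D x g' z h' c' hc' d' m' := by
  subst hg hh hc hc'
  simp only [tr_self] at hd hm
  obtain rfl := funext hd
  subst hm
  exact tr_self (cxQ f D z) _ _

theorem lexUnitLeft_strictMono (I : Type) [Fintype I] [LinearOrder I] :
    StrictMono (lexUnitLeft I) := by
  rintro ⟨⟨⟩, p⟩ ⟨⟨⟩, q⟩ hpq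
  exact (lex_lt_iff (I := fun _ : Unit => I)).1 hpq

theorem actQ_one (y : O.Ob) (h : Deg N) (hc : ∑ _ : Unit, h + 0 = h) (a : FreeQ f D y h) :
    actQ f D (fun _ => y) y (fun _ => h) 0 h hc (fun _ : Unit => a) (O.one y) = a := by
  suffices H : (LinearMap.applyₗ (O.one y)).compMultilinearMap
      (actQ f D (fun _ => y) y (fun _ : Unit => h) 0 h hc) =
      MultilinearMap.ofSubsingleton R _ _ () LinearMap.id from
    MultilinearMap.congr_fun H fun _ => a
  refine multi_ext_cl fun n x g k hk d m => ?_
  refine (actQ_cl x (fun _ => y) y g k (fun _ => h) 0 (k ()) h hk hc (by simp) d m (O.one y)).trans ?_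
  have h1 : (tw k fun j => ∑ i, par (g j i)) = 0 :=
    Finset.sum_eq_zero fun j _ => Finset.sum_eq_zero fun j' _ => if_neg (lt_irrefl _)
  have h2 := O.comp_one (fun i => f (x () i)) y (k ()) (by simp) (m ())
  have h3 := cl_perm (f := f) (D := D) (lexUnitLeft (Fin (n ()))) (x ()) (g ()) y (k ()) h (hk ())
    (by rw [Equiv.sum_comp (lexUnitLeft (Fin (n ()))) (g ())]; exact hk ()) (d ()) (m ())
  rw [kz_eq_zero _ (lexUnitLeft_strictMono _), sg_zero, one_smul] at h3
  refine Eq.trans ?_ h3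
  rw [h1, sg_zero, one_smul]
  exact congrArg _ h2

theorem actQ_perm {y : J' → O.Ob} {z : O.Ob} (e : J ≃ J') (c : J' → Deg N) (l b : Deg N)
    (hb : ∑ j, c j + l = b) (hb' : ∑ j, c (e j) + l = b) (a : ∀ j, FreeQ f D (y j) (c j))
    (p : (O.Hom y z).X l) :
    actQ f D (fun j => y (e j)) z (fun j => c (e j)) l b hb' (fun j => a (e j))
        (app (O.perm (x := fun j => y (e j)) e (fun _ => rfl) z) l p) =
      sg R (kz e c) • actQ f D y z c l b hb a p := by
  suffices H : (LinearMap.applyₗ (app (O.perm (x := fun j => y (e j)) e (fun _ => rfl) z) l p)).compMultilinearMap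
      (multiReindex (V := fun j => FreeQ f D (y j) (c j)) e
        (actQ f D (fun j => y (e j)) z (fun j => c (e j)) l b hb')) =
      sg R (kz e c) • (LinearMap.applyₗ p).compMultilinearMap (actQ f D y z c l b hb) from
    MultilinearMap.congr_fun H a
  refine multi_ext_cl fun n x g k hk d m => ?_
  refine (actQ_cl (fun j => x (e j)) (fun j => y (e j)) z (fun j => g (e j)) (fun j => k (e j))
    (fun j => c (e j)) l _ b (fun j => hk (e j)) hb' (congrArg (· + l) (Equiv.sum_comp e k))
    (fun j => d (e j)) (fun j => m (e j)) _).trans ?_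
  refine Eq.trans ?_ (congrArg (sg R (kz e c) • ·)
    (actQ_cl x y z g k c l _ b hk hb rfl d m p)).symm
  have h1 := O.comp_perm_outer e k l _ rfl (congrArg (· + l) (Equiv.sum_comp e k)) m p
    (x := fun j i => f (x j i))
  have h2 := cl_perm (f := f) (D := D) (lexOuter e fun j => Fin (n j))
    (fun q : Σₗ j, Fin (n j) => x (ofLex q).1 (ofLex q).2) (fun q => g (ofLex q).1 (ofLex q).2) z
    (∑ j, k j + l) b (sum_lex_add' hk hb rfl)
    (sum_lex_add' (fun j => hk (e j)) hb' (congrArg (· + l) (Equiv.sum_comp e k)))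
    (fun q => d (ofLex q).1 (ofLex q).2) (O.comp k l _ rfl m p)
  have h2 := h2.trans (congrArg (fun s => sg R s • cl f D
    (fun q : Σₗ j, Fin (n j) => x (ofLex q).1 (ofLex q).2) (fun q => g (ofLex q).1 (ofLex q).2) z
    (∑ j, k j + l) b (sum_lex_add' hk hb rfl) (fun q => d (ofLex q).1 (ofLex q).2)
      (O.comp k l _ rfl m p)) (kz_lexOuter e (fun j => Fin (n j)) fun q => g (ofLex q).1 (ofLex q).2))
  have h3 := kz_add_tw e k c (fun j => ∑ i, par (g j i))
    (fun j => by rw [← hk j, map_add, map_sum]) (fun j => ∑ i, g j i) fun j => map_sum _ _ _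
  rw [smul_smul, ← sg_add, ← h3, add_assoc, sg_add, sg_add, ← smul_smul, ← smul_smul]
  refine congrArg _ ((congrArg _ h1).trans ?_)
  exact (LinearMap.map_smul _ _ _).trans (congrArg _ h2)

end FreeAlgebraLaws

/-! ### Associativity of the action -/

section NestedMultilinear

variable {R : Type u} [CommRing R] {J : Type} {I : J → Type} {V : (Σₗ j, I j) → Type u}
  [∀ q, AddCommGroup (V q)] [∀ q, Module R (V q)] {U : J → Type u} [∀ j, AddCommGroup (U j)]
  [∀ j, Module R (U j)] {W : Type u} [AddCommGroup W] [Module R W]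

theorem nest_update [DecidableEq J] [∀ j, DecidableEq (I j)] [DecidableEq (Σₗ j, I j)]
    (F : ∀ j, (∀ i, V (toLex ⟨j, i⟩)) → U j) (v : ∀ q, V q) (j₀ : J) (i₀ : I j₀)
    (a : V (toLex ⟨j₀, i₀⟩)) :
    (fun j => F j fun i => Function.update v (toLex ⟨j₀, i₀⟩) a (toLex ⟨j, i⟩)) =
      Function.update (fun j => F j fun i => v (toLex ⟨j, i⟩)) j₀
        (F j₀ (Function.update (fun i => v (toLex ⟨j₀, i⟩)) i₀ a)) := by
  funext j
  by_cases hj : j = j₀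
  · subst hj
    rw [Function.update_self]
    refine congrArg (F j) (funext fun i => ?_)
    by_cases hi : i = i₀
    · subst hi
      rw [Function.update_self, Function.update_self]
    · rw [Function.update_of_ne hi, Function.update_of_ne fun h => hi ?_]
      exact eq_of_heq (Sigma.mk.inj (toLex.injective h)).2
  · rw [Function.update_of_ne hj]
    refine congrArg (F j) (funext fun i => ?_)
    rw [Function.update_of_ne fun h => hj ?_]
    exact (Sigma.mk.inj (toLex.injective h)).1

/-- The composite of multilinear maps, as a multilinear map in all variables together. -/
def multiNest (G : MultilinearMap R U W)
    (F : ∀ j, MultilinearMap R (fun i => V (toLex ⟨j, i⟩)) (U j)) : MultilinearMap R V W where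
  toFun v := G fun j => F j fun i => v (toLex ⟨j, i⟩)
  map_update_add' v q a b := by
    classical
    obtain ⟨⟨j₀, i₀⟩, rfl⟩ := toLex.surjective q
    have h := fun a => congrArg G (nest_update (fun j => F j) v j₀ i₀ a)
    have h1 := h (a + b)
    rw [MultilinearMap.map_update_add, MultilinearMap.map_update_add] at h1
    have h2 := h1.trans (congrArg₂ (· + ·) (h a) (h b)).symm
    convert h2
  map_update_smul' v q r a := by
    classical
    obtain ⟨⟨j₀, i₀⟩, rfl⟩ := toLex.surjective q
    have h := fun a => congrArg G (nest_update (fun j => F j) v j₀ i₀ a)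
    have h1 := h (r • a)
    rw [MultilinearMap.map_update_smul, MultilinearMap.map_update_smul] at h1
    have h2 := h1.trans (congrArg (r • ·) (h a)).symm
    convert h2

end NestedMultilinear

section FreeAlgebraAssoc

variable {O : DGMulticat R N} {X : Type u} {f : X → O.Ob}
  {D : X → Ch R N} {J : Type} [Fintype J] [LinearOrder J] {I : J → Type} [∀ j, Fintype (I j)]
  [∀ j, LinearOrder (I j)]

theorem lexAssoc_strictMono (K : ∀ j, I j → Type) [∀ j i, Fintype (K j i)]
    [∀ j i, LinearOrder (K j i)] : StrictMono (lexAssoc K) := by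
  rintro ⟨j, i, k⟩ ⟨j', i', k'⟩ h
  by_cases hj : j = j'
  · subst hj
    have h := (lex_lt_iff (I := fun j => Σₗ i, K j i)).1 h
    by_cases hi : i = i'
    · subst hi
      exact (lex_lt_iff (J := Σₗ j, I j) (I := fun q => K (ofLex q).1 (ofLex q).2)).2
        ((lex_lt_iff (I := K j)).1 h)
    · refine (lex_lt_iff_of_ne (J := Σₗ j, I j) (I := fun q => K (ofLex q).1 (ofLex q).2) ?_).2
        (lex_lt_iff.2 ((lex_lt_iff_of_ne (I := K j) hi).1 h))
      exact fun h => hi (eq_of_heq (Sigma.mk.inj (toLex.injective h)).2)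
  · have hlt := (lex_lt_iff_of_ne (I := fun j => Σₗ i, K j i) hj).1 h
    refine (lex_lt_iff_of_ne (J := Σₗ j, I j) (I := fun q => K (ofLex q).1 (ofLex q).2) ?_).2
      ((lex_lt_iff_of_ne hj).2 hlt)
    exact fun h => hj (Sigma.mk.inj (toLex.injective h)).1

theorem sg_smul_of_eq_zero {V : Type*} [AddCommGroup V] [Module R V] {s : ZMod 2} (h : s = 0)
    (v : V) : sg R s • v = v := by rw [h, sg_zero, one_smul]

theorem prod_sg (s : J → ZMod 2) : ∏ j, sg R (s j) = sg R (∑ j, s j) := (sg_sum _).symm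

theorem actQ_actQ {x : ∀ j, I j → O.Ob} {y : J → O.Ob} {z : O.Ob}
    (c : ∀ j, I j → Deg N) (g : J → Deg N) (l : Deg N) (cg : J → Deg N) (gl e : Deg N)
    (h₁ : ∀ j, ∑ i, c j i + g j = cg j) (h₂ : ∑ j, cg j + l = e)
    (h₃ : ∑ j, g j + l = gl) (h₄ : ∑ q : Σₗ j, I j, c (ofLex q).1 (ofLex q).2 + gl = e)
    (a : ∀ j i, FreeQ f D (x j i) (c j i)) (b : ∀ j, (O.Hom (x j) (y j)).X (g j))
    (p : (O.Hom y z).X l) :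
    actQ f D y z cg l e h₂
        (fun j => actQ f D (x j) (y j) (c j) (g j) (cg j) (h₁ j) (a j) (b j)) p =
      sg R (∑ j, ∑ j', if j < j' then par (g j) * ∑ i, par (c j' i) else 0) •
        actQ f D lexFam(I, x) z
          (fun q => c (ofLex q).1 (ofLex q).2) gl e h₄ (fun q => a (ofLex q).1 (ofLex q).2)
          (O.comp g l gl h₃ b p) := by
  suffices H : multiNest (V := fun q : Σₗ j, I j => FreeQ f D (x (ofLex q).1 (ofLex q).2) (c (ofLex q).1 (ofLex q).2))
      (U := fun j => FreeQ f D (y j) (cg j))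
      ((LinearMap.applyₗ p).compMultilinearMap (actQ f D y z cg l e h₂))
      (fun j => (LinearMap.applyₗ (b j)).compMultilinearMap
        (actQ f D (x j) (y j) (c j) (g j) (cg j) (h₁ j))) =
      sg R (∑ j, ∑ j', if j < j' then par (g j) * ∑ i, par (c j' i) else 0) •
        (LinearMap.applyₗ (O.comp g l gl h₃ b p)).compMultilinearMap
        (actQ f D lexFam(I, x) z
          (fun q => c (ofLex q).1 (ofLex q).2) gl e h₄) from
    MultilinearMap.congr_fun H fun q => a (ofLex q).1 (ofLex q).2
  refine multi_ext_cl fun n u k h hh d m => ?_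
  have s1 := fun j => actQ_cl (fun i => u (toLex ⟨j, i⟩)) (x j) (y j) (fun i => k (toLex ⟨j, i⟩))
    (fun i => h (toLex ⟨j, i⟩)) (c j) (g j) _ (cg j) (fun i => hh (toLex ⟨j, i⟩)) (h₁ j) rfl
    (fun i => d (toLex ⟨j, i⟩)) (fun i => m (toLex ⟨j, i⟩)) (b j)
  have s2 := congrArg (fun v => actQ f D y z cg l e h₂ v p) (funext s1)
  have s3 := (actQ f D y z cg l e h₂).map_smul_univ
    (fun j => sg R (tw (fun i => h (toLex ⟨j, i⟩)) fun i => ∑ i', par (k (toLex ⟨j, i⟩) i')))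
    (fun j => cl f D (fun q : Σₗ i : I j, Fin (n (toLex ⟨j, i⟩)) => u (toLex ⟨j, (ofLex q).1⟩) (ofLex q).2)
      (fun q => k (toLex ⟨j, (ofLex q).1⟩) (ofLex q).2) (y j) (∑ i, h (toLex ⟨j, i⟩) + g j) (cg j)
      (sum_lex_add' (fun i => hh (toLex ⟨j, i⟩)) (h₁ j) rfl)
      (fun q => d (toLex ⟨j, (ofLex q).1⟩) (ofLex q).2)
      (O.comp (fun i => h (toLex ⟨j, i⟩)) (g j) _ rfl (fun i => m (toLex ⟨j, i⟩)) (b j)))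
  have hs : ∑ j, (∑ i, h (toLex ⟨j, i⟩) + g j) + l = ∑ q, h q + gl := by
    rw [sum_lex, ← h₃, Finset.sum_add_distrib, add_assoc]
  have s4 := actQ_cl (fun j (q : Σₗ i : I j, Fin (n (toLex ⟨j, i⟩))) => u (toLex ⟨j, (ofLex q).1⟩) (ofLex q).2)
    y z (fun j q => k (toLex ⟨j, (ofLex q).1⟩) (ofLex q).2) (fun j => ∑ i, h (toLex ⟨j, i⟩) + g j) cg l
    (∑ q, h q + gl) e (fun j => sum_lex_add' (fun i => hh (toLex ⟨j, i⟩)) (h₁ j) rfl) h₂ hs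
    (fun j q => d (toLex ⟨j, (ofLex q).1⟩) (ofLex q).2)
    (fun j => O.comp (fun i => h (toLex ⟨j, i⟩)) (g j) _ rfl (fun i => m (toLex ⟨j, i⟩)) (b j)) p
  have s5 := actQ_cl u lexFam(I, x) z k h
    (fun q => c (ofLex q).1 (ofLex q).2) gl _ e hh h₄ rfl d m (O.comp g l gl h₃ b p)
  have s6 := O.comp_comp (fun j i => h (toLex ⟨j, i⟩)) g l (fun j => ∑ i, h (toLex ⟨j, i⟩) + g j) gl
    (∑ q, h q + gl) (fun _ => rfl) hs h₃ rfl (fun j i => m (toLex ⟨j, i⟩)) b p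
    (x := fun j i i' => f (u (toLex ⟨j, i⟩) i'))
  have s7 := cl_perm (f := f) (D := D) (lexAssoc fun j i => Fin (n (toLex ⟨j, i⟩)))
    (fun r : Σₗ q : Σₗ j, I j, Fin (n q) => u (ofLex r).1 (ofLex r).2)
    (fun r => k (ofLex r).1 (ofLex r).2) z (∑ q, h q + gl) e (sum_lex_add' hh h₄ rfl)
    (sum_lex_add' (fun j => sum_lex_add' (fun i => hh (toLex ⟨j, i⟩)) (h₁ j) rfl) h₂ hs)
    (fun r => d (ofLex r).1 (ofLex r).2) (O.comp h gl (∑ q, h q + gl) rfl m (O.comp g l gl h₃ b p))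
  have s8 : kz (lexAssoc fun j i => Fin (n (toLex ⟨j, i⟩)))
      (fun r : Σₗ q : Σₗ j, I j, Fin (n q) => k (ofLex r).1 (ofLex r).2) = 0 :=
    kz_eq_zero _ (lexAssoc_strictMono fun j i => Fin (n (toLex ⟨j, i⟩))) _
  have s7 := s7.trans (sg_smul_of_eq_zero s8 _)
  have s9 : (∑ j, tw (fun i => h (toLex ⟨j, i⟩)) fun i => ∑ i', par (k (toLex ⟨j, i⟩) i')) +
      ((tw (fun j => ∑ i, h (toLex ⟨j, i⟩) + g j)
        fun j => ∑ q : Σₗ i : I j, Fin (n (toLex ⟨j, i⟩)), par (k (toLex ⟨j, (ofLex q).1⟩) (ofLex q).2)) +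
      ∑ j, ∑ j', if j < j' then par (g j) * ∑ i, par (h (toLex ⟨j', i⟩)) else 0) =
      (∑ j, ∑ j', if j < j' then par (g j) * ∑ i, par (c j' i) else 0) +
        tw h fun q => ∑ i, par (k q i) := by
    have t1 := tw_lex (fun j i => h (toLex ⟨j, i⟩)) fun j i => ∑ i', par (k (toLex ⟨j, i⟩) i')
    have t2 : (tw h fun q => ∑ i, par (k q i)) = _ := t1
    rw [t2]
    unfold tw
    rw [← Finset.sum_add_distrib, ← Finset.sum_add_distrib, ← Finset.sum_add_distrib,
      ← Finset.sum_add_distrib]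
    refine Finset.sum_congr rfl fun j _ => ?_
    rw [← Finset.sum_add_distrib, add_left_comm, ← Finset.sum_add_distrib]
    congr 1
    refine Finset.sum_congr rfl fun j' _ => ?_
    by_cases hj : j < j'
    · simp only [if_pos hj]
      have t3 : ∑ i, par (c j' i) =
          ∑ i, par (h (toLex ⟨j', i⟩)) + ∑ i, ∑ i', par (k (toLex ⟨j', i⟩) i') := by
        rw [← Finset.sum_add_distrib]
        refine Finset.sum_congr rfl fun i _ => ?_
        have := congrArg par (hh (toLex ⟨j', i⟩))
        rw [map_add, map_sum] at this
        exact this.symm.trans (add_comm _ _)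
      have t4 : (∑ q : Σₗ i : I j', Fin (n (toLex ⟨j', i⟩)),
          par (k (toLex ⟨j', (ofLex q).1⟩) (ofLex q).2)) =
          ∑ i, ∑ i', par (k (toLex ⟨j', i⟩) i') := sum_lex _
      have t5 : par (∑ i, h (toLex ⟨j, i⟩) + g j) = ∑ i, par (h (toLex ⟨j, i⟩)) + par (g j) := by
        rw [map_add, map_sum]
      rw [t3, t5]
      refine (congrArg (fun t => (_ + par (g j)) * t + _) t4).trans ?_
      ring
    · simp only [if_neg hj, add_zero]
  refine s2.trans ((LinearMap.congr_fun s3 p).trans ?_)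
  refine Eq.trans ?_ (congrArg (sg R _ • ·) s5).symm
  rw [prod_sg]
  refine (congrArg (sg R _ • ·) (s4.trans (congrArg (sg R _ • ·) ((congrArg _ s6).trans
    ((LinearMap.map_smul _ _ _).trans (congrArg (sg R _ • ·) s7)))))).trans ?_
  simp only [smul_smul, ← sg_add]
  exact congrArg (fun s => sg R s • cl f D (fun r : Σₗ q : Σₗ j, I j, Fin (n q) => u (ofLex r).1 (ofLex r).2)
    (fun r => k (ofLex r).1 (ofLex r).2) z (∑ q, h q + gl) e (sum_lex_add' hh h₄ rfl)
    (fun r => d (ofLex r).1 (ofLex r).2)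
    (O.comp h gl (∑ q, h q + gl) rfl m (O.comp g l gl h₃ b p))) s9

end FreeAlgebraAssoc

/-! ### The differential of the free algebra -/

section FreeAlgebraDifferential

variable {O : DGMulticat R N} {X : Type u} {f : X → O.Ob}
  {D : X → Ch R N} {J : Type} [Fintype J] [LinearOrder J] {I : J → Type} [∀ j, Fintype (I j)]
  [∀ j, LinearOrder (I j)]

theorem delQ_cl_sum {I : Type} [Fintype I] [LinearOrder I] (x : I → X) (g : I → Deg N) (z : O.Ob)
    (h c c' : Deg N) (hc : ∑ i, g i + h = c) (hc' : c' + 1 = c) (h₁ : ∀ i, ∑ k, low g i k + h = c')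
    (h₂ : ∑ i, g i + (h - 1) = c') (d : ∀ i, (D (x i)).X (g i))
    (m : (O.Hom (fun i => f (x i)) z).X h) :
    delQ f D z c c' (cl f D x g z h c hc d m) =
      ∑ i, sg R (before g i) • cl f D x (low g i) z h c' (h₁ i)
        (fun k => dmap (fun i => D (x i)) g (low g i) i k (d k)) m +
      sg R (∑ i, par (g i)) • cl f D x g z (h - 1) c' h₂ d (del _ h (h - 1) m) := by
  rw [delQ_cl x z _ h c c' hc hc' g rfl, delT_apply, del_tp _ (sub_add_cancel _ _), map_sum,
    LinearMap.sum_apply, map_sum, clT_tp]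
  congr 1
  refine Finset.sum_congr rfl fun i _ => ?_
  rw [map_smul, LinearMap.smul_apply, clT_tp]

theorem dmap_lex (K : (Σₗ j, I j) → Ch R N) (G : (Σₗ j, I j) → Deg N) (j : J) (i i' : I j)
    (v : (K (toLex ⟨j, i'⟩)).X (G (toLex ⟨j, i'⟩))) :
    tr (K (toLex ⟨j, i'⟩)) _ _ (dmap (fun i => K (toLex ⟨j, i⟩)) (fun i => G (toLex ⟨j, i⟩))
      (low (fun i => G (toLex ⟨j, i⟩)) i) i i' v) =
      dmap K G (low G (toLex ⟨j, i⟩)) (toLex ⟨j, i⟩) (toLex ⟨j, i'⟩) v := by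
  by_cases hi : i' = i
  · subst hi
    rw [dmap_self, dmap_self]
    exact tr_del _ ((low_self (fun i => G (toLex ⟨j, i⟩)) i').trans (low_self G _).symm) v
  · have h' : (toLex ⟨j, i'⟩ : Σₗ j, I j) ≠ toLex ⟨j, i⟩ :=
      fun h => hi (eq_of_heq (Sigma.mk.inj (toLex.injective h)).2)
    rw [dmap_ne _ _ _ hi, dmap_ne _ _ _ h']
    exact tr_tr (K (toLex ⟨j, i'⟩)) (low_ne (fun i => G (toLex ⟨j, i⟩)) hi).symm v

theorem low_lex (G : (Σₗ j, I j) → Deg N) (j : J) (i i' : I j) :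
    low (fun i => G (toLex ⟨j, i⟩)) i i' = low G (toLex ⟨j, i⟩) (toLex ⟨j, i'⟩) := by
  by_cases hi : i' = i
  · subst hi
    rw [low_self, low_self]
  · rw [low_ne _ hi, low_ne _ fun h => hi ?_]
    exact eq_of_heq (Sigma.mk.inj (toLex.injective h)).2

theorem cl_congr' {I : Type} [Fintype I] [LinearOrder I] (x : I → X) {g g' : I → Deg N} {z : O.Ob}
    {h c : Deg N} (hc : ∑ i, g i + h = c) (hc' : ∑ i, g' i + h = c) (hg : g = g')
    {d : ∀ i, (D (x i)).X (g i)} {d' : ∀ i, (D (x i)).X (g' i)}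
    (hd : ∀ i, tr (D (x i)) _ _ (d i) = d' i) (m : (O.Hom (fun i => f (x i)) z).X h) :
    cl f D x g z h c hc d m = cl f D x g' z h c hc' d' m := by
  subst hg
  simp only [tr_self] at hd
  obtain rfl := funext hd
  rfl

variable (f D) in
/-- Transport of elements of the free algebra along an equality of degrees. -/
def trQ (z : O.Ob) (c c' : Deg N) : FreeQ f D z c →ₗ[R] FreeQ f D z c' := tr (cxQ f D z) c c'

variable (f D) in
/-- The differential of the free algebra in position `j`, and transport in the other positions. -/
def dQ (y : J → O.Ob) (c c' : J → Deg N) (j i : J) :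
    FreeQ f D (y i) (c i) →ₗ[R] FreeQ f D (y i) (c' i) := dmap (fun i => cxQ f D (y i)) c c' j i

theorem dQ_self (y : J → O.Ob) (c c' : J → Deg N) (j : J) :
    dQ f D y c c' j j = delQ f D (y j) (c j) (c' j) := dmap_self _ _ _ _

theorem dQ_ne (y : J → O.Ob) (c c' : J → Deg N) {i j : J} (h : i ≠ j) :
    dQ f D y c c' j i = trQ f D (y i) (c i) (c' i) := dmap_ne _ _ _ h

theorem trQ_self (z : O.Ob) (c : Deg N) (q : FreeQ f D z c) : trQ f D z c c q = q :=
  tr_self (cxQ f D z) _ q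

theorem trQ_cl {I : Type} [Fintype I] [LinearOrder I] (x : I → X) {g g' : I → Deg N} {z : O.Ob}
    {h h' c c' : Deg N} (hc : ∑ i, g i + h = c) (hc' : ∑ i, g' i + h' = c') (hg : g = g')
    (hh : h = h') {d : ∀ i, (D (x i)).X (g i)} {d' : ∀ i, (D (x i)).X (g' i)}
    (hd : ∀ i, tr (D (x i)) _ _ (d i) = d' i) {m : (O.Hom (fun i => f (x i)) z).X h}
    {m' : (O.Hom (fun i => f (x i)) z).X h'} (hm : tr _ _ _ m = m') :
    trQ f D z c c' (cl f D x g z h c hc d m) = cl f D x g' z h' c' hc' d' m' :=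
  cl_congr x hc hc' hg hh hd hm

variable {y : J → O.Ob} {z : O.Ob} {c : J → Deg N} {l e : Deg N}
  {x : ∀ j, I j → X} {g : ∀ j, I j → Deg N} {h : J → Deg N}

theorem dmap_cl (hc : ∀ j, ∑ i, g j i + h j = c j)
    (d : ∀ j i, (D (x j i)).X (g j i)) (m : ∀ j, (O.Hom (fun i => f (x j i)) (y j)).X (h j))
    [DecidableEq J] (j : J) (i : I j)
    (h₁ : ∀ j', ∑ i', low lexFam(I, g) (toLex ⟨j, i⟩)
      (toLex ⟨j', i'⟩) + h j' = low c j j')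
    (h₂ : ∑ i', low (g j) i i' + h j = low c j j) :
    Function.update (fun i => dQ f D y c (low c j) j i
      (cl f D (x i) (g i) (y i) (h i) (c i) (hc i) (d i) (m i))) j
      (cl f D (x j) (low (g j) i) (y j) (h j) (low c j j) h₂
        (fun k => dmap (fun i => D (x j i)) (g j) (low (g j) i) i k (d j k)) (m j)) =
    fun j' => cl f D (x j') (fun i' => low lexFam(I, g)
      (toLex ⟨j, i⟩) (toLex ⟨j', i'⟩)) (y j') (h j') (low c j j') (h₁ j')
      (fun i' => dmap lexFam(I, fun j i => D (x j i))
        lexFam(I, g) (low lexFam(I, g)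
      (toLex ⟨j, i⟩)) (toLex ⟨j, i⟩) (toLex ⟨j', i'⟩) (d j' i')) (m j') := by
  funext j'
  by_cases hj : j' = j
  · subst hj
    rw [Function.update_self]
    exact cl_congr' (x j') h₂ (h₁ j')
      (funext fun i' => low_lex lexFam(I, g) j' i i')
      (fun i' => dmap_lex lexFam(I, fun j i => D (x j i))
        lexFam(I, g) j' i i' (d j' i')) (m j')
  · rw [Function.update_of_ne hj, dQ_ne _ _ _ hj]
    have hne : ∀ i', (toLex ⟨j', i'⟩ : Σₗ j, I j) ≠ toLex ⟨j, i⟩ :=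
      fun i' h => hj (Sigma.mk.inj (toLex.injective h)).1
    refine trQ_cl (x j') (hc j') (h₁ j') (funext fun i' => ?_) rfl (fun i' => ?_) (tr_self _ _ _)
    · exact (low_ne lexFam(I, g) (hne i')).symm
    · rw [dmap_ne _ _ _ (hne i')]
      rfl

theorem dmap_cl' (hc : ∀ j, ∑ i, g j i + h j = c j)
    (d : ∀ j i, (D (x j i)).X (g j i)) (m : ∀ j, (O.Hom (fun i => f (x j i)) (y j)).X (h j))
    [DecidableEq J] (j : J)
    (h₁ : ∀ j', ∑ i', g j' i' + low h j j' = low c j j') (h₂ : ∑ i', g j i' + (h j - 1) = low c j j) :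
    Function.update (fun i => dQ f D y c (low c j) j i
      (cl f D (x i) (g i) (y i) (h i) (c i) (hc i) (d i) (m i))) j
      (cl f D (x j) (g j) (y j) (h j - 1) (low c j j) h₂ (d j) (del _ (h j) (h j - 1) (m j))) =
    fun j' => cl f D (x j') (g j') (y j') (low h j j') (low c j j') (h₁ j') (d j')
      (dmap (fun j => O.Hom (fun i => f (x j i)) (y j)) h (low h j) j j' (m j')) := by
  funext j'
  by_cases hj : j' = j
  · subst hj
    rw [Function.update_self, dmap_self]
    have := trQ_cl (x j') h₂ (h₁ j') rfl (low_self h j').symm (fun i => tr_self _ _ _)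
      (tr_del _ (low_self h j').symm (m j')) (d := d j') (d' := d j')
    exact (trQ_self _ _ _).symm.trans this
  · rw [Function.update_of_ne hj, dQ_ne _ _ _ hj, dmap_ne _ _ _ hj]
    exact trQ_cl (x j') (hc j') (h₁ j') rfl (low_ne h hj).symm (fun i => tr_self _ _ _) rfl

theorem actQ_dmap (he : ∑ j, c j + l = e) (hc : ∀ j, ∑ i, g j i + h j = c j)
    (d : ∀ j i, (D (x j i)).X (g j i)) (m : ∀ j, (O.Hom (fun i => f (x j i)) (y j)).X (h j))
    (p : (O.Hom y z).X l) (j : J)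
    (k₁ : ∀ q, ∑ k, low lexFam(I, g) q k + (∑ j, h j + l) = e - 1)
    (k₂ : ∑ q : Σₗ j, I j, g (ofLex q).1 (ofLex q).2 + (∑ j, h j + l - 1) = e - 1) :
    sg R (before c j) • actQ f D y z (low c j) l (e - 1) (sum_low_add he j)
        (fun i => dQ f D y c (low c j) j i
          (cl f D (x i) (g i) (y i) (h i) (c i) (hc i) (d i) (m i))) p =
      ∑ i, sg R (tw h (fun j => ∑ i, par (g j i)) +
        before lexFam(I, g) (toLex ⟨j, i⟩)) •
        cl f D lexFam(I, x)
          (low lexFam(I, g) (toLex ⟨j, i⟩)) z (∑ j, h j + l) (e - 1)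
          (k₁ _) (fun q => dmap lexFam(I, fun j i => D (x j i))
            lexFam(I, g) _ (toLex ⟨j, i⟩) q (d (ofLex q).1 (ofLex q).2))
          (O.comp h l _ rfl m p) +
      sg R (tw h (fun j => ∑ i, par (g j i)) + ∑ q : Σₗ j, I j, par (g (ofLex q).1 (ofLex q).2) +
        before h j) •
        cl f D lexFam(I, x)
          lexFam(I, g) z (∑ j, h j + l - 1) (e - 1) k₂
          (fun q => d (ofLex q).1 (ofLex q).2)
          (O.comp (low h j) l _ (sum_low_add rfl j)
            (fun i => dmap (fun j => O.Hom (fun i => f (x j i)) (y j)) h (low h j) j i (m i)) p) := by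
  have hcj : low c j j + 1 = c j := by rw [low_self, sub_add_cancel]
  have a1 : ∀ i, ∑ k, low (g j) i k + h j = low c j j := fun i => by
    rw [sum_low, low_self, ← hc j]; ring
  have a2 : ∑ i, g j i + (h j - 1) = low c j j := by rw [low_self, ← hc j]; ring
  have a3 : ∀ i j', ∑ i', low lexFam(I, g) (toLex ⟨j, i⟩)
      (toLex ⟨j', i'⟩) + h j' = low c j j' := by
    intro i j'
    by_cases hj : j' = j
    · subst hj
      rw [← a1 i]
      exact congrArg (· + h j') (Finset.sum_congr rfl fun i' _ =>
        (low_lex lexFam(I, g) j' i i').symm)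
    · rw [low_ne _ hj, ← hc j']
      refine congrArg (· + h j') (Finset.sum_congr rfl fun i' _ => ?_)
      exact low_ne lexFam(I, g)
        fun h => hj (Sigma.mk.inj (toLex.injective h)).1
  have a4 : ∀ j', ∑ i', g j' i' + low h j j' = low c j j' := by
    intro j'
    by_cases hj : j' = j
    · subst hj; rw [low_self, a2]
    · rw [low_ne _ hj, low_ne _ hj, hc]
  have s1 := delQ_cl_sum (f := f) (D := D) (x j) (g j) (y j) (h j) (c j) (low c j j) (hc j) hcj a1 a2
    (d j) (m j)
  have s2 := (Function.update_eq_self j (fun i => dQ f D y c (low c j) j i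
          (cl f D (x i) (g i) (y i) (h i) (c i) (hc i) (d i) (m i)))).symm
  have s3 : dQ f D y c (low c j) j j
      (cl f D (x j) (g j) (y j) (h j) (c j) (hc j) (d j) (m j)) = _ := (LinearMap.congr_fun (dQ_self y c (low c j) j) _).trans s1
  rw [s3] at s2
  have s4 := congrArg (fun v => actQ f D y z (low c j) l (e - 1) (sum_low_add he j) v p) s2
  simp only [MultilinearMap.map_update_add, MultilinearMap.map_update_sum,
    MultilinearMap.map_update_smul, dmap_cl hc d m j _ (a3 _) (a1 _), dmap_cl' hc d m j a4 a2,
    LinearMap.add_apply, LinearMap.sum_apply, LinearMap.smul_apply] at s4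
  rw [s4, smul_add, Finset.smul_sum]
  have b0 : ∀ q : Σₗ j, I j, low lexFam(I, g) q = _ := fun q => rfl
  have b1 : ∑ q : Σₗ j, I j, par (g (ofLex q).1 (ofLex q).2) = ∑ j, ∑ i, par (g j i) := sum_lex _
  have b2 : ∀ j, par (c j) = ∑ i, par (g j i) + par (h j) := fun j => by
    rw [← hc j, map_add, map_sum]
  have b3 : before c j = (∑ j', if j' < j then ∑ i, par (g j' i) else 0) + before h j := by
    unfold before
    rw [← Finset.sum_add_distrib]
    refine Finset.sum_congr rfl fun j' _ => ?_
    split_ifs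
    · exact b2 j'
    · rw [add_zero]
  refine congrArg₂ (· + ·) (Finset.sum_congr rfl fun i _ => ?_) ?_
  · have t1 := actQ_cl x y z (fun j' i' => low lexFam(I, g)
      (toLex ⟨j, i⟩) (toLex ⟨j', i'⟩)) h (low c j) l _ (e - 1) (a3 i) (sum_low_add he j) rfl
      (fun j' i' => dmap lexFam(I, fun j i => D (x j i))
        lexFam(I, g) (low lexFam(I, g)
      (toLex ⟨j, i⟩)) (toLex ⟨j, i⟩) (toLex ⟨j', i'⟩) (d j' i')) m p
    refine (congrArg (fun v => sg R (before c j) • sg R (before (g j) i) • v) t1).trans ?_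
    have t2 : (tw h fun j' => ∑ i', par (low lexFam(I, g)
        (toLex ⟨j, i⟩) (toLex ⟨j', i'⟩))) = tw h (fun j => ∑ i, par (g j i)) + before h j := by
      refine tw_add_right h _ _ j fun j' => ?_
      have t3 : ∀ i', par (low lexFam(I, g) (toLex ⟨j, i⟩)
          (toLex ⟨j', i'⟩)) = par (g j' i') + if (toLex ⟨j', i'⟩ : Σₗ j, I j) = toLex ⟨j, i⟩ then 1 else 0 :=
        fun i' => par_low _ _ _
      rw [Finset.sum_congr rfl fun i' _ => t3 i', Finset.sum_add_distrib]
      congr 1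
      by_cases hj : j' = j
      · subst hj
        rw [if_pos rfl, Finset.sum_eq_single i, if_pos rfl]
        · exact fun i' _ hi => if_neg fun h => hi (eq_of_heq (Sigma.mk.inj (toLex.injective h)).2)
        · exact fun h => absurd (Finset.mem_univ _) h
      · rw [if_neg hj]
        exact Finset.sum_eq_zero fun i' _ => if_neg fun h => hj (Sigma.mk.inj (toLex.injective h)).1
    rw [t2, smul_smul, smul_smul, ← sg_add, ← sg_add]
    have t4 : before lexFam(I, g) (toLex ⟨j, i⟩) =
        before (g j) i + ∑ j', if j' < j then ∑ i, par (g j' i) else 0 := before_lex _ j i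
    have t5 : before c j + before (g j) i + (tw h (fun j => ∑ i, par (g j i)) + before h j) =
        tw h (fun j => ∑ i, par (g j i)) +
          before lexFam(I, g) (toLex ⟨j, i⟩) := by
      have := CharTwo.add_self_eq_zero (before h j)
      rw [t4, b3]
      linear_combination this
    rw [add_assoc] at t5 ⊢
    rw [t5]
    rfl
  · have t1 := actQ_cl x y z g (low h j) (low c j) l _ (e - 1) a4 (sum_low_add he j) (sum_low_add rfl j)
      d (fun i => dmap (fun j => O.Hom (fun i => f (x j i)) (y j)) h (low h j) j i (m i)) p
    refine (congrArg (fun v => sg R (before c j) • sg R (∑ i, par (g j i)) • v) t1).trans ?_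
    have t2 := tw_add_left h (low h j) (fun j => ∑ i, par (g j i)) j fun i => par_low h j i
    have t3 : ∑ j', ∑ i, par (g j' i) = (∑ j', if j' < j then ∑ i, par (g j' i) else 0) +
        ∑ i, par (g j i) + ∑ j', if j < j' then ∑ i, par (g j' i) else 0 := by
      have t4 : ∑ i, par (g j i) = ∑ j', if j' = j then ∑ i, par (g j' i) else 0 := by
        rw [Finset.sum_ite_eq', if_pos (Finset.mem_univ _)]
      rw [t4, ← Finset.sum_add_distrib, ← Finset.sum_add_distrib]
      refine Finset.sum_congr rfl fun j' _ => ?_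
      rcases lt_trichotomy j' j with hj | hj | hj
      · simp [hj, hj.ne, hj.not_gt]
      · simp [hj]
      · simp [hj, hj.ne', hj.not_gt]
    rw [smul_smul, smul_smul, ← sg_add, ← sg_add]
    refine congrArg (fun s => sg R s • _) ?_
    rw [t2, b1, t3, b3]
    ring

theorem del_actQ {y : J → O.Ob} {z : O.Ob} (c : J → Deg N) (l e : Deg N) (he : ∑ j, c j + l = e)
    (a : ∀ j, FreeQ f D (y j) (c j)) (p : (O.Hom y z).X l) :
    delQ f D z e (e - 1) (actQ f D y z c l e he a p) =
      ∑ j, sg R (before c j) • actQ f D y z (low c j) l (e - 1) (sum_low_add he j)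
        (fun i => dmap (fun i => cxQ f D (y i)) c (low c j) j i (a i)) p +
      sg R (∑ j, par (c j)) • actQ f D y z c (l - 1) (e - 1) (sum_add_low he) a
        (del _ l (l - 1) p) := by
  suffices H : (delQ f D z e (e - 1)).compMultilinearMap
      ((LinearMap.applyₗ p).compMultilinearMap (actQ f D y z c l e he)) =
      ∑ j, sg R (before c j) • ((LinearMap.applyₗ p).compMultilinearMap
        (actQ f D y z (low c j) l (e - 1) (sum_low_add he j))).compLinearMap
        (fun i => dQ f D y c (low c j) j i) +
      sg R (∑ j, par (c j)) • (LinearMap.applyₗ (del _ l (l - 1) p)).compMultilinearMap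
        (actQ f D y z c (l - 1) (e - 1) (sum_add_low he)) by
    have H := MultilinearMap.congr_fun H a
    rw [add_apply, sum_apply] at H
    exact H
  refine multi_ext_cl fun n x g h hc d m => ?_
  rw [add_apply, sum_apply]
  set G : (Σₗ j, Fin (n j)) → Deg N := fun q => g (ofLex q).1 (ofLex q).2 with hG
  have hcj : ∀ j, low c j j + 1 = c j := fun j => by rw [low_self, sub_add_cancel]
  have s1 := congrArg (delQ f D z e (e - 1)) (actQ_cl x y z g h c l _ e hc he rfl d m p)
  have k1 : ∀ q, ∑ k, low G q k + (∑ j, h j + l) = e - 1 := fun q =>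
    sum_low_add (sum_lex_add' hc he rfl) q
  have k2 : ∑ q, G q + (∑ j, h j + l - 1) = e - 1 := sum_add_low (sum_lex_add' hc he rfl)
  have s2 := delQ_cl_sum (f := f) (D := D) (fun q : Σₗ j, Fin (n j) => x (ofLex q).1 (ofLex q).2) G z
    (∑ j, h j + l) e (e - 1) (sum_lex_add' hc he rfl) (sub_add_cancel _ _) k1 k2
    (fun q => d (ofLex q).1 (ofLex q).2) (O.comp h l _ rfl m p)
  have hlow : ∀ j, sg R (before c j) • actQ f D y z (low c j) l (e - 1) (sum_low_add he j)
        (fun i => dQ f D y c (low c j) j i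
          (cl f D (x i) (g i) (y i) (h i) (c i) (hc i) (d i) (m i))) p = _ :=
    fun j => actQ_dmap he hc d m p j k1 k2
  have s3 := actQ_cl x y z g h c (l - 1) _ (e - 1) hc (sum_add_low he) (sum_add_low rfl) d m
    (del _ l (l - 1) p)
  refine s1.trans (((map_smul (delQ f D z e (e - 1)) _ _).trans (congrArg (sg R _ • ·) s2)).trans ?_)
  refine Eq.trans ?_ (congrArg₂ (· + ·) (Finset.sum_congr rfl fun j _ => hlow j)
    (congrArg (sg R (∑ j, par (c j)) • ·) s3)).symm
  have s4 := O.del_comp h l _ rfl m p (x := fun j i => f (x j i)) (y := y) (z := z)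
  have s5 := congrArg (cl f D (fun q : Σₗ j, Fin (n j) => x (ofLex q).1 (ofLex q).2) G z
    (∑ j, h j + l - 1) (e - 1) k2 (fun q => d (ofLex q).1 (ofLex q).2)) s4
  simp only [map_add, map_sum, map_smul] at s5
  refine (congrArg (fun v => sg R _ • (_ + sg R _ • v)) s5).trans ?_
  simp only [smul_add, Finset.smul_sum, smul_smul, ← sg_add]
  rw [sum_lex, Finset.sum_add_distrib, ← add_assoc]
  refine congrArg₂ (· + ·) (congrArg₂ (· + ·) rfl (Finset.sum_congr rfl fun j _ => ?_)) ?_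
  · rw [add_assoc]
  · have b2 : ∑ j, par (c j) = ∑ q, par (G q) + ∑ j, par (h j) := by
      have b1 : ∑ q, par (G q) = ∑ j, ∑ i, par (g j i) := sum_lex _
      rw [b1, ← Finset.sum_add_distrib]
      exact Finset.sum_congr rfl fun j _ => by rw [← hc j, map_add, map_sum]
    refine congrArg (fun s => sg R s • _) ?_
    rw [b2]
    ring

variable (f D) in
/-- The free `O`-algebra on the direct image of the collection `D` along `f`, by generators and
relations. -/
def algQ : DGAlg O where
  obj z := cxQ f D z
  act {J _ _ y z} g h c hc := actQ f D y z g h c hc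
  del_act g h c hc a m := del_actQ g h c hc a m
  act_one y h hc a := actQ_one y h hc a
  act_act c g h cg gh e h₁ h₂ h₃ h₄ a b p := actQ_actQ c g h cg gh e h₁ h₂ h₃ h₄ a b p
  act_perm e g h c hc hc' a m := actQ_perm e g h c hc hc' a m

end FreeAlgebraDifferential

/-! ### Reindexing of morphisms in a PROP -/

section Reindexing

variable {M : DGMulticat R N}
  {I I' I'' B : Type} [Fintype I] [LinearOrder I] [Fintype I'] [LinearOrder I'] [Fintype I'']
  [LinearOrder I''] [Fintype B] [LinearOrder B]

/-- The bijection of a fibre of the inverse of a bijection with a point. -/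
def fibSymm (e : I ≃ I') (j : I) : {i // e.symm i = j} ≃ Unit where
  toFun _ := ()
  invFun _ := ⟨e j, e.symm_apply_apply j⟩
  left_inv i := Subtype.ext ((Equiv.symm_apply_eq e).1 i.2).symm
  right_inv _ := rfl

theorem fibSymm_eq (e : I ≃ I') (j : I) (i : {i // e.symm i = j}) : i.1 = e j :=
  (Equiv.symm_apply_eq e).1 i.2

/-- The permutation morphism, in the PROP of a multicategory, between two sequences that differ by
a bijection `e` of the index sets. -/
def reMor {a : I' → M.Ob} {a' : I → M.Ob} (e : I ≃ I') (h : ∀ i, a' i = a (e i)) :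
    (propHom M a a').X 0 :=
  propIn (e.symm : I' → I) 0 (tp (fibHom M e.symm a a') (fun _ => 0) 0 (by simp) fun j =>
    app (M.perm (x := fun i : {i // e.symm i = j} => a i.1) (x' := fun _ : Unit => a' j)
      (fibSymm e j) (fun i => by rw [h, fibSymm_eq e j i]) (a' j)) 0 (M.one (a' j)))

/-- The bijection of fibres that is induced by a bijection `e`. -/
def fibE (e : I ≃ I') (f : I' → B) (k : B) : {i // f (e i) = k} ≃ {i // f i = k} :=
  e.subtypeEquiv fun _ => Iff.rfl

/-- The reindexing of the factor over `k` of a morphism in the PROP of a multicategory. -/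
def permE (e : I ≃ I') (f : I' → B) (a : I' → M.Ob) (b : B → M.Ob) (k : B) :
    fibHom M f a b k ⟶ fibHom M (fun i => f (e i)) (fun i => a (e i)) b k :=
  M.perm (fibE e f k) (fun _ => rfl) (b k)

/-- The precomposition of the morphisms in the PROP of a multicategory with permutations. -/
def hPerm (e : I ≃ I') (a : I' → M.Ob) (b : B → M.Ob) (γ : Deg N) :
    (propHom M a b).X γ →ₗ[R] (propHom M (fun i => a (e i)) b).X γ :=
  ∑ f : I' → B, propIn (fun i => f (e i)) γ ∘ₗ
    app (tMap fun k => permE e f a b k) γ ∘ₗ propCo f γ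

theorem hPerm_in (e : I ≃ I') (a : I' → M.Ob) (b : B → M.Ob) (γ : Deg N) (f : I' → B)
    (g : B → Deg N) (hg : ∑ k, g k = γ) (m : ∀ k, (fibHom M f a b k).X (g k)) :
    hPerm e a b γ (propIn f γ (tp _ g γ hg m)) = propIn (fun i => f (e i)) γ
      (tp (fibHom M (fun i => f (e i)) (fun i => a (e i)) b) g γ hg
        fun k => app (permE e f a b k) (g k) (m k)) := by
  rw [hPerm, LinearMap.sum_apply, Finset.sum_eq_single f]
  · rw [LinearMap.comp_apply, LinearMap.comp_apply, propCo_self, tMap_tp]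
  · intro f' _ hf
    rw [LinearMap.comp_apply, LinearMap.comp_apply, propCo_ne hf, map_zero, map_zero]
  · exact fun h => absurd (Finset.mem_univ _) h

theorem prop_tp_ext {a : I → M.Ob} {b : B → M.Ob} {γ : Deg N} {W : Type u} [AddCommGroup W]
    [Module R W] {φ ψ : (propHom M a b).X γ →ₗ[R] W}
    (H : ∀ (f : I → B) (g : B → Deg N) (hg : ∑ k, g k = γ) (m : ∀ k, (fibHom M f a b k).X (g k)),
      φ (propIn f γ (tp _ g γ hg m)) = ψ (propIn f γ (tp _ g γ hg m))) : φ = ψ := by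
  refine propIn_ext fun f x => ?_
  suffices h : φ ∘ₗ propIn f γ = ψ ∘ₗ propIn f γ from LinearMap.congr_fun h x
  exact tp_ext fun g hg m => H f g hg m

theorem propIn_congr {a : I → M.Ob} {b : B → M.Ob} {f f' : I → B} (hf : ∀ i, f i = f' i)
    (γ : Deg N) (g : B → Deg N) (hg : ∑ k, g k = γ) (m : ∀ k, (fibHom M f' a b k).X (g k))
    (e : ∀ k, {i // f i = k} ≃ {i // f' i = k}) (he : ∀ k i, (e k i).1 = i.1) :
    propIn f γ (tp (fibHom M f a b) g γ hg fun k =>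
      app (M.perm (e k) (fun i => by rw [he]) (b k)) (g k) (m k)) =
      propIn f' γ (tp _ g γ hg m) := by
  obtain rfl : f = f' := funext hf
  refine congrArg (fun m => propIn f γ (tp (fibHom M f a b) g γ hg m)) (funext fun k => ?_)
  exact perm_one M _ (fun i => Subtype.ext (he k i)) _ _ _ _

theorem reMor_comp (e : I ≃ I') (a : I' → M.Ob) (b : B → M.Ob) (γ : Deg N) (h0 : 0 + γ = γ)
    (v : (propHom M a b).X γ) :
    propComp a (fun i => a (e i)) b 0 γ γ h0 (reMor e fun _ => rfl) (hPerm e a b γ v) = v := by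
  suffices H : propComp a (fun i => a (e i)) b 0 γ γ h0 (reMor e fun _ => rfl) ∘ₗ hPerm e a b γ =
      LinearMap.id from LinearMap.congr_fun H v
  refine prop_tp_ext fun f g hg m => ?_
  rw [LinearMap.comp_apply, hPerm_in, reMor, propComp_in]
  rw [grp_tp (compOps e.symm (fun i => f (e i)) a (fun i => a (e i)) b) 0 γ γ h0 (fun _ => 0)
    (by simp) _ g hg _ g (by simp) hg, gsg_zero_left, sg_zero, one_smul, LinearMap.id_apply]
  let ε : ∀ k, {i // f (e (e.symm i)) = k} ≃ {i // f i = k} :=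
    fun k => Equiv.subtypeEquivRight fun i => by rw [Equiv.apply_symm_apply]
  refine Eq.trans ?_ (propIn_congr (fun i => by rw [Equiv.apply_symm_apply]) γ g hg m ε fun _ _ => rfl)
  refine congrArg (fun m => propIn (fun i => f (e (e.symm i))) γ (tp (fibHom M _ a b) g γ hg m))
    (funext fun k => ?_)
  rw [compOps_op]
  have s₁ := comp_perm_inner' (M := M)
    (x₁ := fun (j : {j // f (e j) = k}) (i : {i // e.symm i = j.1}) => a i.1)
    (x := fun (j : {j // f (e j) = k}) (_ : Unit) => a (e j.1))
    (y := fun j : {j // f (e j) = k} => a (e j.1))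
    (z := b k) (fun j => fibSymm e j.1) (fun j i => by rw [fibSymm_eq e j.1 i]) (fun _ => 0) (g k) (g k)
    (by simp) (fun j => M.one (a (e j.1))) (app (permE e f a b k) (g k) (m k))
  have s₂ := M.one_comp (fun j : {j // f (e j) = k} => a (e j.1)) (b k) (g k) (by simp)
    (app (permE e f a b k) (g k) (m k))
  have s₃ := perm_perm M (lexUnitRight {j // f (e j) = k}) (fibE e f k)
    ((lexUnitRight {j // f (e j) = k}).trans (fibE e f k)) (x := fun q => a (e (ofLex q).1.1))
    (x' := fun j => a (e j.1)) (x'' := fun i => a i.1) (fun _ => rfl) (fun _ => rfl) (fun _ => rfl)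
    (fun _ => rfl) (b k) (g k) (m k)
  refine (congrArg (app (M.perm (fibEquiv e.symm (fun i => f (e i)) k) (fun _ => rfl) (b k)) (g k))
    (s₁.trans (congrArg _ (s₂.trans s₃)))).trans ?_
  have s₄ := perm_penta M (fibEquiv e.symm (fun i => f (e i)) k)
    (lexInner fun j : {j // f (e j) = k} => fibSymm e j.1)
    ((lexUnitRight {j // f (e j) = k}).trans (fibE e f k)) (ε k) (Equiv.refl {i // f i = k})
    (x := fun i => a i.1)
    (x₁ := fun q : Σₗ j : {j // f (e j) = k}, {i // e.symm i = j.1} => a (ofLex q).2.1)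
    (x₂ := fun q : Σₗ j : {j // f (e j) = k}, Unit => a (e (ofLex q).1.1)) (x₃ := fun i => a i.1)
    (x₄ := fun i => a i.1) (fun _ => rfl)
    (fun q => congrArg a (fibSymm_eq e (ofLex q).1.1 (ofLex q).2)) (fun _ => rfl) (fun _ => rfl)
    (fun _ => rfl) (fun i => Subtype.ext (Equiv.apply_symm_apply e i.1)) (b k) (g k) (m k)
  exact s₄.trans (congrArg _ (perm_one M (x := fun i : {i // f i = k} => a i.1) _ (fun _ => rfl)
    (fun _ => rfl) (b k) (g k) _))

theorem propAct_reMor (X : DGAlg M) (e : I ≃ I') (a : I' → M.Ob) (γ : Deg N) (h0 : γ + 0 = γ)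
    (t : (tens fun i => X.obj (a i)).X γ) :
    propAct X a (fun i => a (e i)) γ 0 γ h0 t (reMor e fun _ => rfl) =
      tPermX (fun i => X.obj (a i)) e γ t := by
  suffices H : (propAct X a (fun i => a (e i)) γ 0 γ h0).flip (reMor e fun _ => rfl) =
      tPermX (fun i => X.obj (a i)) e γ from LinearMap.congr_fun H t
  refine tp_ext fun g hg d => ?_
  have hs : ∀ j, ∑ i : {i // e.symm i = j}, g i.1 + 0 = g (e j) := fun j => by
    rw [add_zero, Fintype.sum_eq_single (⟨e j, e.symm_apply_apply j⟩ : {i // e.symm i = j})]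
    exact fun i hi => absurd (Subtype.ext (fibSymm_eq e j i)) hi
  rw [LinearMap.flip_apply, reMor, propAct_in, tPermX_tp,
    grp_tp (actOps X e.symm a fun i => a (e i)) γ 0 γ h0 g hg d (fun _ => 0) (by simp) _
      (fun i => g (e i)) hs (sum_reindex e hg)]
  refine congrArg₂ (fun s v => sg R s • tp (fun i => X.obj (a (e i))) (fun i => g (e i)) γ
    (sum_reindex e hg) v) ?_ (funext fun j => ?_)
  · simp only [gsg, map_zero, zero_mul, ite_self, Finset.sum_const_zero, add_zero]
    unfold kz
    rw [← Equiv.sum_comp e, Finset.sum_congr rfl fun i _ => (Equiv.sum_comp e _).symm,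
      Finset.sum_comm]
    refine Finset.sum_congr rfl fun i _ => Finset.sum_congr rfl fun j _ => ?_
    rw [Equiv.symm_apply_apply, Equiv.symm_apply_apply, mul_comm]
    exact if_congr and_comm rfl rfl
  · rw [actOps_op]
    have hu : ∑ _ : Unit, g (e j) + 0 = g (e j) := by simp
    have s₁ := X.act_perm (x := fun i : {i // e.symm i = j} => a i.1) (y := a (e j)) (fibSymm e j).symm
      (fun i => g i.1) 0 (g (e j)) (hs j) hu (fun i => d i.1)
      (app (M.perm (x := fun i : {i // e.symm i = j} => a i.1) (x' := fun _ : Unit => a (e j))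
        (fibSymm e j) (fun i => by rw [fibSymm_eq e j i]) (a (e j))) 0 (M.one (a (e j))))
    rw [kz_unit, sg_zero, one_smul] at s₁
    have s₂ := X.act_one (a (e j)) (g (e j)) hu (d (e j))
    have s₃ := (perm_perm M (fibSymm e j).symm (fibSymm e j) (Equiv.refl _)
      (x := fun _ : Unit => a (e j)) (x' := fun i : {i // e.symm i = j} => a i.1)
      (x'' := fun _ : Unit => a (e j)) (fun _ => rfl) (fun i => by rw [fibSymm_eq e j i])
      (fun _ => rfl) (fun _ => rfl) (a (e j)) 0 (M.one (a (e j)))).trans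
        (perm_one M _ (fun _ => rfl) _ _ _ _)
    exact s₁.symm.trans ((congrArg (X.act (x := fun _ : Unit => a (e j)) (fun _ => g (e j)) 0
      (g (e j)) hu (fun _ => d (e j))) s₃).trans s₂)

theorem propAct_hPerm (X : DGAlg M) (e : I ≃ I') (a : I' → M.Ob) (b : B → M.Ob) (γ c ε : Deg N)
    (h : γ + c = ε) (t : (tens fun i => X.obj (a i)).X γ) (v : (propHom M a b).X c) :
    propAct X (fun i => a (e i)) b γ c ε h (tPermX (fun i => X.obj (a i)) e γ t) (hPerm e a b c v) =
      propAct X a b γ c ε h t v := by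
  have h1 := propAct_assoc X a (fun i => a (e i)) b γ 0 c γ c ε (add_zero γ) h (zero_add c) h t
    (reMor e fun _ => rfl) (hPerm e a b c v)
  rwa [propAct_reMor, reMor_comp] at h1

theorem propMap_reMor {O : DGMulticat R N} (π : DGMultifunctor M O) {a : I' → M.Ob} {a' : I → M.Ob}
    (e : I ≃ I') (h : ∀ i, a' i = a (e i)) :
    app (propMap π a a') 0 (reMor e h) = reMor e fun i => congrArg π.obj (h i) := by
  rw [reMor, propMap_in]
  refine congrArg (propIn _ 0) ((tMap_tp _ _ _ _ _).trans ?_)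
  refine congrArg (tp _ _ _ _) (funext fun j => ?_)
  exact (map_perm' π (fibSymm e j) _ _ _ _).trans (congrArg _ (π.map_one _))

theorem tPermX_trans (K : I'' → Ch R N) (e : I ≃ I') (e' : I' ≃ I'') (γ : Deg N)
    (t : (tens K).X γ) :
    tPermX K (e.trans e') γ t = tPermX (fun i => K (e' i)) e γ (tPermX K e' γ t) := by
  suffices H : tPermX K (e.trans e') γ = tPermX (fun i => K (e' i)) e γ ∘ₗ tPermX K e' γ from
    LinearMap.congr_fun H t
  refine tp_ext fun g hg d => ?_
  refine (tPermX_tp K (e.trans e') γ g hg d).trans ?_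
  refine Eq.trans ?_ (congrArg (tPermX (fun i => K (e' i)) e γ) (tPermX_tp K e' γ g hg d)).symm
  have h1 := tPermX_tp (fun i => K (e' i)) e γ (fun i => g (e' i)) (sum_reindex e' hg) fun i => d (e' i)
  refine Eq.trans ?_ ((map_smul _ _ _).trans (congrArg (sg R (kz e' g) • ·) h1)).symm
  rw [smul_smul, ← sg_add, kz_trans, add_comm]
  rfl

theorem hPerm_trans (e : I ≃ I') (e' : I' ≃ I'') (a : I'' → M.Ob) (b : B → M.Ob) (γ : Deg N)
    (v : (propHom M a b).X γ) :
    hPerm (e.trans e') a b γ v = hPerm e (fun i => a (e' i)) b γ (hPerm e' a b γ v) := by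
  suffices H : hPerm (e.trans e') a b γ = hPerm e (fun i => a (e' i)) b γ ∘ₗ hPerm e' a b γ from
    LinearMap.congr_fun H v
  refine prop_tp_ext fun f g hg m => ?_
  refine (hPerm_in (e.trans e') a b γ f g hg m).trans ?_
  refine Eq.trans ?_ (congrArg (hPerm e (fun i => a (e' i)) b γ) (hPerm_in e' a b γ f g hg m)).symm
  refine Eq.trans ?_ (hPerm_in e (fun i => a (e' i)) b γ (fun i => f (e' i)) g hg _).symm
  refine congrArg (fun m => propIn (fun i => f (e' (e i))) γ
    (tp (fibHom M (fun i => f (e' (e i))) (fun i => a (e' (e i))) b) g γ hg m)) (funext fun k => ?_)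
  exact (perm_perm M (fibE e (fun i => f (e' i)) k) (fibE e' f k) (fibE (e.trans e') f k) _ _
    (fun _ => rfl) (fun _ => rfl) _ _ _).symm

theorem tMap_tPermX {K L : I' → Ch R N} (φ : ∀ i, K i ⟶ L i) (e : I ≃ I') (γ : Deg N)
    (t : (tens K).X γ) :
    app (tMap fun i => φ (e i)) γ (tPermX K e γ t) = tPermX L e γ (app (tMap φ) γ t) := by
  suffices H : app (tMap fun i => φ (e i)) γ ∘ₗ tPermX K e γ = tPermX L e γ ∘ₗ app (tMap φ) γ from
    LinearMap.congr_fun H t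
  refine tp_ext fun g hg d => ?_
  rw [LinearMap.comp_apply, LinearMap.comp_apply, tPermX_tp, map_smul, tMap_tp, tMap_tp, tPermX_tp]

theorem propAct_reMor_map {O : DGMulticat R N} {X : DGAlg M} {Y : DGAlg O} {f : M.Ob → O.Ob}
    (φ : ∀ x, X.obj x ⟶ Y.obj (f x)) {a : I' → M.Ob} {a' : I → M.Ob} (e : I ≃ I')
    (h : ∀ i, a' i = a (e i)) (γ : Deg N) (h0 : γ + 0 = γ) (t : (tens fun i => X.obj (a i)).X γ) :
    app (tMap fun i => φ (a' i)) γ (propAct X a a' γ 0 γ h0 t (reMor e h)) =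
      propAct Y (fun i => f (a i)) (fun i => f (a' i)) γ 0 γ h0 (app (tMap fun i => φ (a i)) γ t)
        (reMor e fun i => congrArg f (h i)) := by
  obtain rfl : a' = fun i => a (e i) := funext h
  have h1 := propAct_reMor Y e (fun i => f (a i)) γ h0 (app (tMap fun i => φ (a i)) γ t)
  rw [propAct_reMor]
  exact (tMap_tPermX (fun i => φ (a i)) e γ t).trans h1.symm

end Reindexing

/-! ### Balanced maps -/

section BalancedMaps

variable {O : DGMulticat R N} {X : Type u} [LinearOrder X]
  {f : X → O.Ob} {D : X → Ch R N} {W : Type u} [AddCommGroup W] [Module R W]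
  {J : Type} [Fintype J] [LinearOrder J] {y : J → O.Ob} {c : Deg N}

variable (f D W y c) in
/-- A linear function on `D (x 1) ⊗ ⋯ ⊗ D (x n)` and on the morphisms to `y` in the PROP of `O`,
for every non-decreasing sequence `x`, which is balanced with respect to permutations. -/
structure BalancedMap where
  L : ∀ {n : ℕ} (x : Fin n → X) (_ : Monotone x) (a b : Deg N) (_ : a + b = c),
    (tens fun i => D (x i)).X a →ₗ[R] (propHom O (fun i => f (x i)) y).X b →ₗ[R] W
  perm : ∀ {m n : ℕ} (e : Fin m ≃ Fin n) (x : Fin n → X) (hx : Monotone x)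
    (he : Monotone fun i => x (e i)) (a b : Deg N) (h : a + b = c) (t : (tens fun i => D (x i)).X a)
    (v : (propHom O (fun i => f (x i)) y).X b),
    L (fun i => x (e i)) he a b h (tPermX (fun i => D (x i)) e a t)
      (hPerm e (fun i => f (x i)) y b v) = L x hx a b h t v

namespace BalancedMap

variable (Λ : BalancedMap f D W y c) {I I' : Type} [Fintype I] [LinearOrder I] [Fintype I']
  [LinearOrder I']

/-- An enumeration of the index set that sorts a sequence. -/
def sorting (x : I → X) : Fin (Fintype.card I) ≃ I :=
  (Tuple.sort fun i => x (chart I i)).trans (chart I).toEquiv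

theorem monotone_sorting (x : I → X) : Monotone fun i => x (sorting x i) :=
  Tuple.monotone_sort fun i => x (chart I i)

/-- The extension of a balanced function to all sequences. -/
def ext (x : I → X) (a b : Deg N) (h : a + b = c) :
    (tens fun i => D (x i)).X a →ₗ[R] (propHom O (fun i => f (x i)) y).X b →ₗ[R] W :=
  (Λ.L (fun i => x (sorting x i)) (monotone_sorting x) a b h).compl₁₂
    (tPermX (fun i => D (x i)) (sorting x) a) (hPerm (sorting x) (fun i => f (x i)) y b)

theorem ext_eq {n : ℕ} (x : I → X) (e : Fin n ≃ I) (he : Monotone fun i => x (e i)) (a b : Deg N)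
    (h : a + b = c) (t : (tens fun i => D (x i)).X a) (v : (propHom O (fun i => f (x i)) y).X b) :
    Λ.ext x a b h t v = Λ.L (fun i => x (e i)) he a b h (tPermX (fun i => D (x i)) e a t)
      (hPerm e (fun i => f (x i)) y b v) := by
  suffices H : ∀ (m : ℕ) (k : Fin m ≃ I) (hk : Monotone fun i => x (k i)) (τ : Fin m ≃ Fin n),
      k = τ.trans e → Λ.L (fun i => x (k i)) hk a b h (tPermX (fun i => D (x i)) k a t)
        (hPerm k (fun i => f (x i)) y b v) = Λ.L (fun i => x (e i)) he a b h
          (tPermX (fun i => D (x i)) e a t) (hPerm e (fun i => f (x i)) y b v) from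
    H _ _ (monotone_sorting x) ((sorting x).trans e.symm) (by ext i; simp)
  rintro m k hk τ rfl
  refine Eq.trans ?_ (Λ.perm τ (fun i => x (e i)) he hk a b h _ _)
  exact congrArg₂ (fun t v => Λ.L (fun i => x (e (τ i))) hk a b h t v)
    (tPermX_trans (fun i => D (x i)) τ e a t) (hPerm_trans τ e (fun i => f (x i)) y b v)

theorem ext_perm (e : I ≃ I') (x : I' → X) (a b : Deg N) (h : a + b = c)
    (t : (tens fun i => D (x i)).X a) (v : (propHom O (fun i => f (x i)) y).X b) :
    Λ.ext (fun i => x (e i)) a b h (tPermX (fun i => D (x i)) e a t)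
      (hPerm e (fun i => f (x i)) y b v) = Λ.ext x a b h t v := by
  let s := sorting fun i => x (e i)
  refine Eq.trans ?_ (Λ.ext_eq x (s.trans e) (monotone_sorting fun i => x (e i)) a b h t v).symm
  exact congrArg₂ (fun t v => Λ.L (fun i => x (e (s i))) (monotone_sorting fun i => x (e i)) a b h t v)
    (tPermX_trans (fun i => D (x i)) s e a t).symm (hPerm_trans s e (fun i => f (x i)) y b v).symm

theorem ext_of_monotone {n : ℕ} (x : Fin n → X) (hx : Monotone x) (a b : Deg N) (h : a + b = c)
    (t : (tens fun i => D (x i)).X a) (v : (propHom O (fun i => f (x i)) y).X b) :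
    Λ.ext x a b h t v = Λ.L x hx a b h t v :=
  (Λ.ext_eq x (Equiv.refl _) hx a b h t v).trans (Λ.perm (Equiv.refl _) x hx hx a b h t v)

end BalancedMap

end BalancedMaps

section ConcatenatedMorphisms

variable {O : DGMulticat R N}
  {J : Type} [Fintype J] [LinearOrder J] {y : J → O.Ob}
  {I I' : J → Type} [∀ j, Fintype (I j)] [∀ j, LinearOrder (I j)] [∀ j, Fintype (I' j)]
  [∀ j, LinearOrder (I' j)]

/-- The fibres of the projection of an ordered sum. -/
def fibLex (I : J → Type) (k : J) : {q : Σₗ j, I j // (ofLex q).1 = k} ≃ I k where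
  toFun q := q.2 ▸ (ofLex q.1).2
  invFun i := ⟨toLex ⟨k, i⟩, rfl⟩
  left_inv := by rintro ⟨⟨j, i⟩, rfl⟩; rfl
  right_inv _ := rfl

theorem fibLex_eq {V : Type*} (F : ∀ j, I j → V) (k : J) (q : {q : Σₗ j, I j // (ofLex q).1 = k}) :
    F (ofLex q.1).1 (ofLex q.1).2 = F k (fibLex I k q) := by
  obtain ⟨⟨j, i⟩, rfl⟩ := q
  rfl

/-- The morphism in the PROP of a multicategory that consists of multimorphisms with consecutive
inputs. -/
def lexMor (x : ∀ j, I j → O.Ob) (h : J → Deg N) (b : Deg N) (hb : ∑ j, h j = b) :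
    MultilinearMap R (fun j => (O.Hom (x j) (y j)).X (h j))
      ((propHom O lexFam(I, x) y).X b) :=
  (propIn (fun q : Σₗ j, I j => (ofLex q).1) b).compMultilinearMap
    ((tp (fibHom O (fun q : Σₗ j, I j => (ofLex q).1)
      lexFam(I, x) y) h b hb).compLinearMap
      fun j => app (O.perm (fibLex I j) (fibLex_eq x j) (y j)) (h j))

theorem hPerm_lexMor (e : ∀ j, I j ≃ I' j) (x : ∀ j, I' j → O.Ob) (h : J → Deg N) (b : Deg N)
    (hb : ∑ j, h j = b) (m : ∀ j, (O.Hom (x j) (y j)).X (h j)) :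
    hPerm (lexInner e) lexFam(I', x) y b (lexMor x h b hb m) =
      lexMor (fun j i => x j (e j i)) h b hb
        fun j => app (O.perm (e j) (fun _ => rfl) (y j)) (h j) (m j) := by
  refine (hPerm_in (lexInner e) lexFam(I', x) y b _ h hb _).trans ?_
  refine congrArg (fun m => propIn (fun q : Σₗ j, I j => (ofLex q).1) b
    (tp (fibHom O (fun q : Σₗ j, I j => (ofLex q).1)
      (fun q : Σₗ j, I j => x (ofLex q).1 (e _ (ofLex q).2)) y) h b hb m)) (funext fun k => ?_)
  have h1 := perm_perm O (fibE (lexInner e) (fun q : Σₗ j, I' j => (ofLex q).1) k) (fibLex I' k)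
    ((fibE (lexInner e) (fun q : Σₗ j, I' j => (ofLex q).1) k).trans (fibLex I' k))
    (x := fun q => x (ofLex q.1).1 (e _ (ofLex q.1).2))
    (x' := fun q => x (ofLex q.1).1 (ofLex q.1).2) (x'' := x k) (fun _ => rfl) (fibLex_eq x k)
    (fun q => fibLex_eq (fun j i => x j (e j i)) k q |>.trans (by
      obtain ⟨⟨j, i⟩, rfl⟩ := q; rfl)) (fun _ => rfl) (y k) (h k) (m k)
  have h2 := perm_perm O (fibLex I k) (e k)
    ((fibE (lexInner e) (fun q : Σₗ j, I' j => (ofLex q).1) k).trans (fibLex I' k))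
    (x := fun q : {q : Σₗ j, I j // (ofLex q).1 = k} => x (ofLex q.1).1 (e _ (ofLex q.1).2))
    (x' := fun i => x k (e k i)) (x'' := x k) (fibLex_eq (fun j i => x j (e j i)) k) (fun _ => rfl)
    (fun q => fibLex_eq (fun j i => x j (e j i)) k q |>.trans (by
      obtain ⟨⟨j, i⟩, rfl⟩ := q; rfl)) (fun q => by
      obtain ⟨⟨j, i⟩, rfl⟩ := q; rfl) (y k) (h k) (m k)
  exact h1.trans h2.symm

/-- The reordering of an index set by the fibres of a map. -/
def fibSort {I : Type} (k : I → J) : (Σₗ j, {i // k i = j}) ≃ I where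
  toFun q := (ofLex q).2.1
  invFun i := toLex ⟨k i, ⟨i, rfl⟩⟩
  left_inv := by rintro ⟨j, ⟨i, rfl⟩⟩; rfl
  right_inv _ := rfl

theorem hPerm_fibSort {I : Type} [Fintype I] [LinearOrder I] (k : I → J) (x : I → O.Ob)
    (h : J → Deg N) (b : Deg N) (hb : ∑ j, h j = b) (m : ∀ j, (fibHom O k x y j).X (h j)) :
    hPerm (fibSort k) x y b (propIn k b (tp (fibHom O k x y) h b hb m)) =
      lexMor (fun j (i : {i // k i = j}) => x i.1) h b hb m := by
  refine (hPerm_in (fibSort k) x y b k h hb m).trans ?_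
  have hf : ∀ q : Σₗ j, {i // k i = j}, k (fibSort k q) = (ofLex q).1 := fun q => (ofLex q).2.2
  let ε : ∀ j, {q // k (fibSort k q) = j} ≃ {q : Σₗ j, {i // k i = j} // (ofLex q).1 = j} :=
    fun j => Equiv.subtypeEquivRight fun q => by rw [hf]
  refine Eq.trans ?_ (propIn_congr (a := fun q => x (fibSort k q)) hf b h hb
    (fun j => app (O.perm (fibLex (fun j => {i // k i = j}) j)
      (fibLex_eq (fun j (i : {i // k i = j}) => x i.1) j) (y j)) (h j) (m j)) ε fun _ _ => rfl)
  refine congrArg (fun m => propIn (fun q => k (fibSort k q)) b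
    (tp (fibHom O (fun q => k (fibSort k q)) (fun q => x (fibSort k q)) y) h b hb m))
    (funext fun j => ?_)
  exact (perm_perm O (ε j) (fibLex (fun j => {i // k i = j}) j) (fibE (fibSort k) k j)
    (x'' := fun i : {i // k i = j} => x i.1) _ _ _ (fun q => by
      obtain ⟨⟨j', ⟨i, rfl⟩⟩, rfl⟩ := q; rfl) (y j) (h j) (m j)).symm

/-- The Koszul sign of the grouping of a tensor product by the fibres of a map. -/
theorem kz_fibSort {I : Type} [Fintype I] [LinearOrder I] (k : I → J) (g : I → Deg N)
    (h : J → Deg N) :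
    gsg k g h + (tw h (fun j => ∑ i : {i // k i = j}, par (g i.1)) + kz (fibSort k) g) = 0 := by
  have h1 : tw h (fun j => ∑ i : {i // k i = j}, par (g i.1)) =
      ∑ j, ∑ i, if j < k i then par (h j) * par (g i) else 0 := by
    refine Finset.sum_congr rfl fun j _ => ?_
    rw [← sum_fib k fun j' i => if j < j' then par (h j) * par (g i) else 0]
    refine Finset.sum_congr rfl fun j' _ => ?_
    split_ifs
    · rw [Finset.mul_sum]
    · rw [Finset.sum_const_zero]
  have h2 : kz (fibSort k) g =
      ∑ i, ∑ i', if i < i' ∧ k i' < k i then par (g i) * par (g i') else 0 := by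
    unfold kz
    rw [Finset.sum_comm, ← Equiv.sum_comp (fibSort k)]
    refine Finset.sum_congr rfl fun q _ => ?_
    rw [← Equiv.sum_comp (fibSort k)]
    refine Finset.sum_congr rfl fun q' _ => ?_
    rw [mul_comm]
    refine if_congr ?_ rfl rfl
    obtain ⟨j, ⟨i, rfl⟩⟩ := q
    obtain ⟨j', ⟨i', rfl⟩⟩ := q'
    rw [and_comm]
    refine and_congr_right fun (hi : i < i') => ?_
    refine Sigma.Lex.lt_def.trans ⟨?_, fun h => Or.inl h⟩
    rintro (h | ⟨h, h'⟩)
    · exact h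
    · exfalso
      refine lt_asymm hi ?_
      have key : ∀ (j : J) (u : {i // k i = j}) (j' : J) (e : j = j') (v : {i // k i = j'}),
          e ▸ u < v → u.1 < v.1 := by
        rintro j u _ rfl v h
        exact h
      exact key _ _ _ h _ h'
  rw [h1, h2, gsg]
  have h3 : ∀ a b : ZMod 2, a + b + (b + a) = 0 := by decide
  exact h3 _ _

end ConcatenatedMorphisms

/-! ### Extension of balanced maps to the free algebra -/

section BalancedExtension

variable {O : DGMulticat R N} {X : Type u} [LinearOrder X]
  {f : X → O.Ob} {D : X → Ch R N} {W : Type u} [AddCommGroup W] [Module R W]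
  {J : Type} [Fintype J] [LinearOrder J] {y : J → O.Ob} {c : Deg N}

namespace BalancedMap

variable (Λ : BalancedMap f D W y c)

/-- The value of a balanced map on a family of sequences, which are concatenated. -/
def cat {I : J → Type} [∀ j, Fintype (I j)] [∀ j, LinearOrder (I j)] (x : ∀ j, I j → X)
    (g : ∀ j, I j → Deg N) (h : J → Deg N) (a b : Deg N) (hab : a + b = c)
    (ha : ∑ q : Σₗ j, I j, g (ofLex q).1 (ofLex q).2 = a) (hb : ∑ j, h j = b) :
    MultilinearMap R (fun q : Σₗ j, I j => (D (x (ofLex q).1 (ofLex q).2)).X (g (ofLex q).1 (ofLex q).2))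
      ((propHom O (fun q : Σₗ j, I j => f (x (ofLex q).1 (ofLex q).2)) y).X b →ₗ[R] W) :=
  sg R (tw h fun j => ∑ i, par (g j i)) •
    (Λ.ext lexFam(I, x) a b hab).compMultilinearMap
      (tp lexFam(I, fun j i => D (x j i))
        (fun q => g (ofLex q).1 (ofLex q).2) a ha)

theorem cat_perm {I I' : J → Type} [∀ j, Fintype (I j)] [∀ j, LinearOrder (I j)]
    [∀ j, Fintype (I' j)] [∀ j, LinearOrder (I' j)] (e : ∀ j, I j ≃ I' j) (x : ∀ j, I' j → X)
    (g : ∀ j, I' j → Deg N) (h : J → Deg N) (a b a' b' : Deg N) (hab : a + b = c) (hab' : a' + b' = c)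
    (ha : ∑ q : Σₗ j, I' j, g (ofLex q).1 (ofLex q).2 = a) (hb : ∑ j, h j = b)
    (ha' : ∑ q : Σₗ j, I j, g (ofLex q).1 (e _ (ofLex q).2) = a') (hb' : ∑ j, h j = b')
    (d : ∀ j i, (D (x j i)).X (g j i)) (m : ∀ j, (O.Hom (fun i => f (x j i)) (y j)).X (h j)) :
    Λ.cat (fun j i => x j (e j i)) (fun j i => g j (e j i)) h a' b' hab' ha' hb'
        (fun q => d (ofLex q).1 (e _ (ofLex q).2))
        (lexMor (fun j i => f (x j (e j i))) h b' hb' fun j => app (O.perm (e j) (fun _ => rfl) (y j)) (h j) (m j)) =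
      sg R (∑ j, kz (e j) (g j)) • Λ.cat x g h a b hab ha hb (fun q => d (ofLex q).1 (ofLex q).2)
        (lexMor (fun j i => f (x j i)) h b hb m) := by
  obtain rfl : a' = a :=
    ha'.symm.trans (sum_reindex (lexInner e) (g := fun q => g (ofLex q).1 (ofLex q).2) ha)
  obtain rfl : b' = b := hb'.symm.trans hb
  have h1 := Λ.ext_perm (lexInner e) lexFam(I', x) a' b' hab
    (tp lexFam(I', fun j i => D (x j i)) (fun q => g (ofLex q).1 (ofLex q).2) a' ha
      fun q => d (ofLex q).1 (ofLex q).2) (lexMor (fun j i => f (x j i)) h b' hb m)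
  have h2 := tPermX_tp lexFam(I', fun j i => D (x j i)) (lexInner e) a'
    (fun q => g (ofLex q).1 (ofLex q).2) ha fun q => d (ofLex q).1 (ofLex q).2
  have h3 : (tw h fun j => ∑ i, par (g j (e j i))) = tw h fun j => ∑ i, par (g j i) :=
    congrArg (tw h) (funext fun j => Equiv.sum_comp (e j) fun i => par (g j i))
  have h4 := LinearMap.congr_fun (map_smul (Λ.ext
    (fun q : Σₗ j, I j => x (ofLex q).1 (e _ (ofLex q).2)) a' b' hab') (sg R (∑ j, kz (e j) (g j)))
      (tp (fun q : Σₗ j, I j => D (x (ofLex q).1 (e _ (ofLex q).2)))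
        (fun q => g (ofLex q).1 (e _ (ofLex q).2)) a' ha' fun q => d (ofLex q).1 (e _ (ofLex q).2)))
      (lexMor (fun j i => f (x j (e j i))) h b' hb' fun j => app (O.perm (e j) (fun _ => rfl) (y j)) (h j) (m j))
  have h6 := congrArg₂ (fun t v => Λ.ext (fun q : Σₗ j, I j => x (ofLex q).1 (e _ (ofLex q).2)) a' b' hab' t v)
    (h2.trans (congrArg (fun s => sg R s • tp (fun q : Σₗ j, I j => D (x (ofLex q).1 (e _ (ofLex q).2)))
        (fun q => g (ofLex q).1 (e _ (ofLex q).2)) a' ha' fun q => d (ofLex q).1 (e _ (ofLex q).2))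
      (kz_lexInner e fun q => g (ofLex q).1 (ofLex q).2))) (hPerm_lexMor e (fun j i => f (x j i)) h b' hb m)
  have h5 := congrArg (sg R (∑ j, kz (e j) (g j)) • ·) (h4.symm.trans (h6.symm.trans h1))
  rw [LinearMap.smul_apply] at h5
  simp only [smul_smul, sg_mul_self, one_smul] at h5
  refine (congrArg (fun s => sg R s • Λ.ext (fun q : Σₗ j, I j => x (ofLex q).1 (e _ (ofLex q).2)) a' b' hab'
    (tp (fun q : Σₗ j, I j => D (x (ofLex q).1 (e _ (ofLex q).2)))
      (fun q => g (ofLex q).1 (e _ (ofLex q).2)) a' ha' fun q => d (ofLex q).1 (e _ (ofLex q).2))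
    (lexMor (fun j i => f (x j (e j i))) h b' hb' fun j =>
      app (O.perm (e j) (fun _ => rfl) (y j)) (h j) (m j))) h3).trans ?_
  refine (congrArg (sg R (tw h fun j => ∑ i, par (g j i)) • ·) h5).trans ?_
  rw [smul_comm]
  rfl

theorem sum_fam {c' : J → Deg N} (hc' : ∑ j, c' j = c) (s : ∀ j, FreeSym f D (y j) (c' j)) :
    ∑ q : Σₗ j, Fin (s j).n, (s (ofLex q).1).g (ofLex q).2 + ∑ j, (s j).h = c := by
  rw [sum_lex, ← Finset.sum_add_distrib, ← hc']
  exact Finset.sum_congr rfl fun j _ => (s j).hc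

/-- The value of a balanced map on a family of symbols. -/
def fam {c' : J → Deg N} (hc' : ∑ j, c' j = c) (s : ∀ j, FreeSym f D (y j) (c' j)) : W :=
  Λ.cat (fun j => (s j).x) (fun j => (s j).g) (fun j => (s j).h) _ _ (sum_fam hc' s) rfl rfl
    (fun q => (s (ofLex q).1).d (ofLex q).2)
    (lexMor (fun j i => f ((s j).x i)) (fun j => (s j).h) _ rfl fun j => (s j).m)

theorem fam_mk {c' : J → Deg N} (hc' : ∑ j, c' j = c) (n : J → ℕ) (x : ∀ j, Fin (n j) → X)
    (g : ∀ j, Fin (n j) → Deg N) (h : J → Deg N) (hc : ∀ j, ∑ i, g j i + h j = c' j)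
    (H : ∑ q : Σₗ j, Fin (n j), g (ofLex q).1 (ofLex q).2 + ∑ j, h j = c)
    (d : ∀ j i, (D (x j i)).X (g j i)) (m : ∀ j, (O.Hom (fun i => f (x j i)) (y j)).X (h j)) :
    Λ.fam hc' (fun j => ⟨n j, x j, g j, h j, hc j, d j, m j⟩) =
      Λ.cat x g h _ _ H rfl rfl (fun q => d (ofLex q).1 (ofLex q).2)
        (lexMor (fun j i => f (x j i)) h _ rfl m) := rfl

theorem fam_perm {c' : J → Deg N} (hc' : ∑ j, c' j = c) (s : ∀ j, FreeSym f D (y j) (c' j))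
    (n : J → ℕ) (e : ∀ j, Fin (n j) ≃ Fin (s j).n) :
    Λ.fam hc' (fun j => (s j).perm (e j)) = sg R (∑ j, kz (e j) (s j).g) • Λ.fam hc' s :=
  Λ.cat_perm e (fun j => (s j).x) (fun j => (s j).g) (fun j => (s j).h) _ _ _ _
    (sum_fam hc' s) (sum_fam hc' fun j => (s j).perm (e j)) rfl rfl rfl rfl
    (fun j => (s j).d) fun j => (s j).m

theorem isFam_fam {c' : J → Deg N} (hc' : ∑ j, c' j = c) [DecidableEq J] (j : J)
    (s : ∀ j, FreeSym f D (y j) (c' j)) :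
    IsFam (fun t => Λ.fam hc' (Function.update s j t)) :=
  isFam_slot (Λ.fam hc') (fun s => ⟨_, inferInstance, inferInstance,
    Λ.cat (fun j => (s j).x) (fun j => (s j).g) (fun j => (s j).h) _ _ (sum_fam hc' s) rfl rfl,
    lexMor (fun j i => f ((s j).x i)) (fun j => (s j).h) _ rfl, fun d m =>
      Λ.fam_mk hc' (fun j => (s j).n) (fun j => (s j).x) (fun j => (s j).g) (fun j => (s j).h)
        (fun j => (s j).hc) (sum_fam hc' s) d m⟩)
    (Λ.fam_perm hc') j s

/-- The map on the tensor product of the values of the free algebra that extends a balanced map. -/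
def onFree : (tens fun j => (algQ f D).obj (y j)).X c →ₗ[R] W :=
  tLift (K := fun j => cxQ f D (y j)) fun c' hc' => multiLiftQ (Λ.fam hc') (Λ.isFam_fam hc')

theorem onFree_cl {I : J → Type} [∀ j, Fintype (I j)] [∀ j, LinearOrder (I j)] (x : ∀ j, I j → X)
    (g : ∀ j, I j → Deg N) (h : J → Deg N) (a b : Deg N) (hab : a + b = c)
    (ha : ∑ q : Σₗ j, I j, g (ofLex q).1 (ofLex q).2 = a) (hb : ∑ j, h j = b) (c' : J → Deg N)
    (hc' : ∑ j, c' j = c) (hc : ∀ j, ∑ i, g j i + h j = c' j)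
    (d : ∀ j i, (D (x j i)).X (g j i)) (m : ∀ j, (O.Hom (fun i => f (x j i)) (y j)).X (h j)) :
    Λ.onFree (tp (fun j => (algQ f D).obj (y j)) c' c hc' fun j =>
      cl f D (x j) (g j) (y j) (h j) (c' j) (hc j) (d j) (m j)) =
      Λ.cat x g h a b hab ha hb (fun q => d (ofLex q).1 (ofLex q).2)
        (lexMor (fun j i => f (x j i)) h b hb m) := by
  refine (tLift_tp (K := fun j => cxQ f D (y j)) _ c' hc' _).trans ?_
  refine (multiLiftQ_mkQ (Λ.fam hc') (Λ.isFam_fam hc') fun j =>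
    symOf (x j) (g j) (hc j) (d j) (m j) (chart (I j)).toEquiv).trans ?_
  refine (Λ.cat_perm (fun j => (chart (I j)).toEquiv) x g h a b _ _ hab
    (sum_fam hc' fun j => symOf (x j) (g j) (hc j) (d j) (m j) (chart (I j)).toEquiv) ha hb rfl rfl
    d m).trans ?_
  have h1 : ∑ j, kz (chart (I j)).toEquiv (g j) = 0 :=
    Finset.sum_eq_zero fun j _ => kz_eq_zero _ (chart (I j)).strictMono _
  refine (congrArg (fun s => sg R s • Λ.cat x g h a b hab ha hb (fun q => d (ofLex q).1 (ofLex q).2)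
    (lexMor (fun j i => f (x j i)) h b hb m)) h1).trans ?_
  rw [sg_zero, one_smul]

end BalancedMap

theorem sum_unit_zero (γ : Deg N) : ∑ _ : Unit, γ + 0 = γ := by simp

variable (f D) in
/-- The inclusion of the generators in the free algebra. -/
def genQ (x : X) : D x ⟶ (algQ f D).obj (f x) :=
  mkHom (fun γ => LinearMap.applyₗ (O.one (f x)) ∘ₗ
    (MultilinearMap.ofSubsingleton R ((D x).X γ) _ ()).symm
      (cl f D (fun _ : Unit => x) (fun _ => γ) (f x) 0 γ (sum_unit_zero γ))) fun γ γ' q => by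
    by_cases h : γ' + 1 = γ
    · have h' : γ - 1 = γ' := by rw [← h, add_sub_cancel_right]
      subst h'
      have h0 : ∀ i : Unit, ∑ k, low (fun _ : Unit => γ) i k + 0 = γ - 1 := fun i => by
        simp [low_self]
      refine Eq.trans ?_ (delQ_cl_sum (f := f) (D := D) (fun _ : Unit => x) (fun _ => γ) (f x) 0 γ (γ - 1)
        (sum_unit_zero γ) (sub_add_cancel _ _) h0 (by simp; ring) (fun _ => q) (O.one (f x))).symm
      rw [O.del_one, map_zero, smul_zero, add_zero, Fintype.sum_unique]
      have h1 : before (fun _ : Unit => γ) default = 0 := by simp [before]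
      rw [h1, sg_zero, one_smul]
      exact (cl_congr' (f := f) (D := D) (fun _ : Unit => x) (h0 ()) (sum_unit_zero _) (funext fun i => low_self _ i)
        (fun i => (congrArg (tr (D x) _ _) (LinearMap.congr_fun (dmap_self (fun _ : Unit => D x)
          (fun _ => γ) (low (fun _ => γ) ()) ()) q)).trans
            (tr_del (D x) (low_self (fun _ : Unit => γ) ()) q)) _).symm
    · rw [del_shape _ γ γ' h, del_shape _ γ γ' h]
      simp

theorem actQ_genQ {I : Type} [Fintype I] [LinearOrder I] (x : I → X) (z : O.Ob) (g : I → Deg N)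
    (h e : Deg N) (he : ∑ i, g i + h = e) (d : ∀ i, (D (x i)).X (g i))
    (p : (O.Hom (fun i => f (x i)) z).X h) :
    (algQ f D).act (x := fun i => f (x i)) g h e he (fun i => app (genQ f D (x i)) (g i) (d i)) p =
      cl f D x g z h e he d p := by
  refine (actQ_cl (f := f) (D := D) (I := fun _ => Unit) (fun i _ => x i) (fun i => f (x i)) z
    (fun i _ => g i) (fun _ => 0) g h h e (fun i => sum_unit_zero (g i)) he (by simp) (fun i _ => d i)
    (fun i => O.one (f (x i))) p).trans ?_
  have h1 := O.one_comp (fun i => f (x i)) z h (by simp) p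
  have h2 := cl_perm (f := f) (D := D) (lexUnitRight I) x g z h e he
    (by rw [Equiv.sum_comp (lexUnitRight I) g]; exact he) d p
  rw [kz_eq_zero (lexUnitRight I) (fun q q' hq => by
    rcases Sigma.Lex.lt_def.1 hq with h | ⟨_, h⟩
    · exact h
    · exact absurd h (lt_irrefl _)) g, sg_zero, one_smul] at h2
  refine Eq.trans ?_ h2
  have h3 : (tw (fun _ : I => (0 : Deg N)) fun i => ∑ _ : Unit, par (g i)) = 0 := by
    simp [tw]
  rw [h3, sg_zero, one_smul]
  exact congrArg _ h1

namespace BalancedMap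

variable (Λ : BalancedMap f D W y c)

theorem onFree_propAct {I : Type} [Fintype I] [LinearOrder I] (x : I → X) (a b : Deg N)
    (h : a + b = c) (t : (tens fun i => D (x i)).X a) (v : (propHom O (fun i => f (x i)) y).X b) :
    Λ.onFree (propAct (algQ f D) (fun i => f (x i)) y a b c h
      (app (tMap fun i => genQ f D (x i)) a t) v) = Λ.ext x a b h t v := by
  have h1 : ∀ t, Λ.onFree ∘ₗ propAct (algQ f D) (fun i => f (x i)) y a b c h
      (app (tMap fun i => genQ f D (x i)) a t) = Λ.ext x a b h t := by
    intro t
    suffices H : (LinearMap.llcomp R _ _ _ Λ.onFree) ∘ₗ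
        propAct (algQ f D) (fun i => f (x i)) y a b c h ∘ₗ app (tMap fun i => genQ f D (x i)) a =
          Λ.ext x a b h from LinearMap.congr_fun H t
    refine tp_ext fun g hg d => prop_tp_ext fun k l hl m => ?_
    have e0 : ∑ j, fibDeg k g l j = c := by rw [sum_fibDeg, hg, hl, h]
    have e1 := propAct_in (algQ f D) (fun i => f (x i)) y a b c h
      (tp (fun i => (algQ f D).obj (f (x i))) g a hg fun i => app (genQ f D (x i)) (g i) (d i)) k
      (tp _ l b hl m)
    have e2 := grp_tp (actOps (algQ f D) k (fun i => f (x i)) y) a b c h g hg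
      (fun i => app (genQ f D (x i)) (g i) (d i)) l hl m (fibDeg k g l) (fibDeg_eq k g l) e0
    have e3 : ∀ j, (actOps (algQ f D) k (fun i => f (x i)) y).op j (fun i => g i.1) (l j)
        (fibDeg k g l j) (fibDeg_eq k g l j) (fun i => app (genQ f D (x i.1)) (g i.1) (d i.1)) (m j) = _ :=
      fun j => actQ_genQ (fun i : {i // k i = j} => x i.1) (y j) (fun i => g i.1) (l j)
        (fibDeg k g l j) (fibDeg_eq k g l j) (fun i => d i.1) (m j)
    have e4 := Λ.onFree_cl (I := fun j => {i // k i = j}) (fun j i => x i.1) (fun j i => g i.1) l a b h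
      (sum_reindex (fibSort k) hg) hl (fibDeg k g l) e0 (fibDeg_eq k g l) (fun j i => d i.1) m
    have e5 := Λ.ext_perm (fibSort k) x a b h (tp (fun i => D (x i)) g a hg d) (propIn k b (tp _ l b hl m))
    have e6 := LinearMap.congr_fun (map_smul (Λ.ext (fun q => x (fibSort k q)) a b h) (sg R (kz (fibSort k) g))
      (tp (fun q => D (x (fibSort k q))) (fun q => g (fibSort k q)) a (sum_reindex (fibSort k) hg)
        fun q => d (fibSort k q))) (lexMor (fun j (i : {i // k i = j}) => f (x i.1)) l b hl m)
    have e7 := congrArg₂ (fun t v => Λ.ext (fun q => x (fibSort k q)) a b h t v)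
      (tPermX_tp (fun i => D (x i)) (fibSort k) a g hg d) (hPerm_fibSort k (fun i => f (x i)) l b hl m)
    refine Eq.trans ?_ ((e6.symm.trans (e7.symm.trans e5)))
    refine (congrArg (fun t => Λ.onFree (propAct (algQ f D) (fun i => f (x i)) y a b c h t
      (propIn k b (tp _ l b hl m)))) (tMap_tp (fun i => genQ f D (x i)) a g hg d)).trans ?_
    refine (congrArg Λ.onFree ((e1.trans e2).trans (congrArg (fun w => sg R (gsg k g l) •
      tp (fun j => (algQ f D).obj (y j)) (fibDeg k g l) c e0 w) (funext e3)))).trans ?_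
    refine (map_smul _ _ _).trans ((congrArg (sg R (gsg k g l) • ·) e4).trans ?_)
    have h3 : ∀ {a b c : ZMod 2} (_ : a + (b + c) = 0), a + b = c := by decide
    have e8 := h3 (kz_fibSort k g l)
    refine Eq.trans ?_ (congrArg (fun s => sg R s • Λ.ext (fun q => x (fibSort k q)) a b h
      (tp (fun q => D (x (fibSort k q))) (fun q => g (fibSort k q)) a (sum_reindex (fibSort k) hg)
        fun q => d (fibSort k q)) (lexMor (fun j (i : {i // k i = j}) => f (x i.1)) l b hl m)) e8)
    have h4 : ∀ (s t : ZMod 2) (w : W), sg R s • sg R t • w = sg R (s + t) • w := fun s t w => by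
      rw [sg_add, mul_smul]
    exact h4 _ _ _
  exact LinearMap.congr_fun (h1 t) v

/-- A balanced map extends uniquely to the tensor products of the values of an algebra with the
universal property of the free algebra on the generators. -/
theorem exists_extension (B : DGAlg O) (φ : ∀ x, D x ⟶ B.obj (f x)) (F : B ⟶ algQ f D)
    (hF : ∀ x, φ x ≫ F.hom (f x) = genQ f D x) :
    ∃ θ : (tens fun j => B.obj (y j)).X c →ₗ[R] W, ∀ {n : ℕ} (x : Fin n → X) (hx : Monotone x)
      (a b : Deg N) (h : a + b = c) (t : (tens fun i => D (x i)).X a)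
      (v : (propHom O (fun i => f (x i)) y).X b),
      θ (propAct B (fun i => f (x i)) y a b c h (app (tMap fun i => φ (x i)) a t) v) =
        Λ.L x hx a b h t v := by
  refine ⟨Λ.onFree ∘ₗ app (tMap fun j => F.hom (y j)) c, fun x hx a b h t v => ?_⟩
  refine (congrArg Λ.onFree (propAct_map F (fun i => f (x i)) y a b c h _ v)).trans ?_
  refine Eq.trans ?_ ((Λ.onFree_propAct x a b h t v).trans (Λ.ext_of_monotone x hx a b h t v))
  have h1 : (fun i => φ (x i) ≫ F.hom (f (x i))) = fun i => genQ f D (x i) := funext fun i => hF (x i)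
  have h2 := congrArg (fun ψ => app (tMap ψ) a t) h1
  refine congrArg (fun t => Λ.onFree (propAct (algQ f D) (fun i => f (x i)) y a b c h t v)) (Eq.trans ?_ h2)
  exact (congrArg (fun ψ => app ψ a t) (tMap_comp (fun i => φ (x i)) fun i => F.hom (f (x i)))).symm

end BalancedMap

end BalancedExtension

/-! ### The universal property of the free algebra -/

section UniversalProperty

variable {O : DGMulticat R N} {X : Type u}
  {f : X → O.Ob} {D : X → Ch R N} {B : DGAlg O} (φ : ∀ x, D x ⟶ B.obj (f x))

/-- The value of a symbol in an algebra. -/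
def symVal {z : O.Ob} {c : Deg N} (t : FreeSym f D z c) : (B.obj z).X c :=
  B.act (x := fun i => f (t.x i)) t.g t.h c t.hc (fun i => app (φ (t.x i)) (t.g i) (t.d i)) t.m

theorem isFam_symVal {z : O.Ob} {c : Deg N} : IsFam (symVal φ (z := z) (c := c)) := by
  refine ⟨fun t i r a b => ?_, fun t r a b => ?_, fun t n e => ?_⟩
  · exact multi_lin ((B.act (x := fun i => f (t.x i)) (y := z) t.g t.h c t.hc).compLinearMap
      fun i => app (φ (t.x i)) (t.g i)) (LinearMap.applyₗ t.m) t.d i r a b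
  · exact ((B.act (x := fun i => f (t.x i)) (y := z) t.g t.h c t.hc
      fun i => app (φ (t.x i)) (t.g i) (t.d i)).map_add _ _).trans
        (congrArg (· + _) (LinearMap.map_smul _ r a))
  · exact B.act_perm e t.g t.h c t.hc _ (fun i => app (φ (t.x i)) (t.g i) (t.d i)) t.m

theorem liftQ_symVal {I : Type} [Fintype I] [LinearOrder I] (x : I → X) (g : I → Deg N) (z : O.Ob)
    (h c : Deg N) (hc : ∑ i, g i + h = c) (d : ∀ i, (D (x i)).X (g i))
    (m : (O.Hom (fun i => f (x i)) z).X h) :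
    liftQ (symVal φ) (isFam_symVal φ) (cl f D x g z h c hc d m) =
      B.act (x := fun i => f (x i)) g h c hc (fun i => app (φ (x i)) (g i) (d i)) m := by
  refine (liftQ_mkQ _ _ _).trans ((B.act_perm (chart I).toEquiv g h c hc _
    (fun i => app (φ (x i)) (g i) (d i)) m).trans ?_)
  rw [kz_eq_zero _ (chart I).strictMono, sg_zero, one_smul]

/-- The chain maps from the free algebra that extend maps on the generators. -/
def foldX (z : O.Ob) : cxQ f D z ⟶ B.obj z :=
  mkHom (fun c => liftQ (symVal φ) (isFam_symVal φ)) fun c c' q => by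
    by_cases hc : c' + 1 = c
    · obtain rfl : c - 1 = c' := by rw [← hc, add_sub_cancel_right]
      suffices H : liftQ (symVal φ) (isFam_symVal φ) ∘ₗ delQ f D z c (c - 1) =
          del (B.obj z) c (c - 1) ∘ₗ liftQ (symVal φ) (isFam_symVal φ) from LinearMap.congr_fun H q
      refine FreeQ_ext fun x g h hc' d m => ?_
      rw [LinearMap.comp_apply, LinearMap.comp_apply, delQ_cl_sum x g z h c (c - 1) hc' hc
        (fun i => sum_low_add hc' i) (sum_add_low hc'), map_add, map_sum, liftQ_symVal, B.del_act,
        map_smul, liftQ_symVal]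
      refine congrArg₂ (· + ·) (Finset.sum_congr rfl fun i _ => ?_) rfl
      rw [map_smul, liftQ_symVal]
      refine congrArg (fun v => sg R (before g i) • B.act (x := fun i => f (x i)) (low g i) h (c - 1)
        (sum_low_add hc' i) v m) (funext fun k => ?_)
      exact app_dmap (fun k => φ (x k)) g (low g i) i k (d k)
    · rw [del_shape _ c c' hc, del_shape _ c c' hc]
      exact map_zero (liftQ (symVal φ) (isFam_symVal φ))

theorem foldX_cl {I : Type} [Fintype I] [LinearOrder I] (x : I → X) (g : I → Deg N) (z : O.Ob)
    (h c : Deg N) (hc : ∑ i, g i + h = c) (d : ∀ i, (D (x i)).X (g i))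
    (m : (O.Hom (fun i => f (x i)) z).X h) :
    app (foldX φ z) c (cl f D x g z h c hc d m) =
      B.act (x := fun i => f (x i)) g h c hc (fun i => app (φ (x i)) (g i) (d i)) m :=
  liftQ_symVal φ x g z h c hc d m

theorem foldX_act {J : Type} [Fintype J] [LinearOrder J] (y : J → O.Ob) (z : O.Ob) (c : J → Deg N)
    (l e : Deg N) (he : ∑ j, c j + l = e) (q : ∀ j, FreeQ f D (y j) (c j)) (p : (O.Hom y z).X l) :
    app (foldX φ z) e (actQ f D y z c l e he q p) =
      B.act c l e he (fun j => app (foldX φ (y j)) (c j) (q j)) p := by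
  suffices H : (app (foldX φ z) e ∘ₗ LinearMap.applyₗ p).compMultilinearMap (actQ f D y z c l e he) =
      (LinearMap.applyₗ p).compMultilinearMap ((B.act c l e he).compLinearMap fun j =>
        (app (foldX φ (y j)) (c j) : FreeQ f D (y j) (c j) →ₗ[R] _)) from MultilinearMap.congr_fun H q
  refine multi_ext_cl fun n x g h hc d m => ?_
  have h1 := actQ_cl (f := f) (D := D) x y z g h c l _ e hc he rfl d m p
  refine (congrArg (app (foldX φ z) e) h1).trans ((map_smul _ _ _).trans ?_)
  refine (congrArg _ (foldX_cl φ _ _ _ _ _ _ _ _)).trans ?_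
  refine ((congrArg (fun v => B.act c l e he v p) (funext fun j =>
    foldX_cl φ (x j) (g j) (y j) (h j) (c j) (hc j) (d j) (m j))).trans ?_).symm
  exact B.act_act g h l c _ e hc he rfl (sum_lex_add' hc he rfl)
    (fun j i => app (φ (x j i)) (g j i) (d j i)) m p

/-- The morphism from the free algebra that extends maps on the generators. -/
def foldQ : algQ f D ⟶ B where
  hom := foldX φ
  map_act g h c hc a m := foldX_act φ _ _ g h c hc a m

theorem genQ_foldQ (x : X) : genQ f D x ≫ (foldQ φ).hom (f x) = φ x := by
  refine hom_ext_app fun γ d => ?_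
  refine (foldX_cl φ (fun _ : Unit => x) (fun _ => γ) (f x) 0 γ (sum_unit_zero γ) (fun _ => d)
    (O.one (f x))).trans ?_
  exact B.act_one (f x) γ (sum_unit_zero γ) (app (φ x) γ d)

/-- The universal property of the free algebra on the direct image of a collection. -/
structure IsFreeOn : Prop where
  lift : ∀ (Q : DGAlg O) (ψ : ∀ x, D x ⟶ Q.obj (f x)), ∃ F : B ⟶ Q, ∀ x, φ x ≫ F.hom (f x) = ψ x
  uniq : ∀ (Q : DGAlg O) (F G : B ⟶ Q), (∀ x, φ x ≫ F.hom (f x) = φ x ≫ G.hom (f x)) → F = G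

variable {φ}

theorem IsFreeOn.foldX_surjective (h : IsFreeOn φ) (z : O.Ob) (c : Deg N)
    (b : (B.obj z).X c) : ∃ q : FreeQ f D z c, app (foldX φ z) c q = b := by
  obtain ⟨F, hF⟩ := h.lift (algQ f D) (genQ f D)
  have h1 : F ≫ foldQ φ = 𝟙 B := h.uniq _ _ _ fun x => by
    refine (Category.assoc (φ x) (F.hom (f x)) ((foldQ φ).hom (f x))).symm.trans ?_
    rw [hF, genQ_foldQ]
    exact (Category.comp_id _).symm
  exact ⟨app (F.hom z) c b, congrArg (fun G : B ⟶ B => app (G.hom z) c b) h1⟩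

variable [LinearOrder X] {J : Type} [Fintype J] [LinearOrder J] {y : J → O.Ob} {c : Deg N}

theorem tp_act_eq {I : J → Type} [∀ j, Fintype (I j)] [∀ j, LinearOrder (I j)] (B : DGAlg O)
    (x : ∀ j, I j → O.Ob) (g : ∀ j, I j → Deg N) (h c' : J → Deg N) (a b : Deg N) (hab : a + b = c)
    (ha : ∑ q : Σₗ j, I j, g (ofLex q).1 (ofLex q).2 = a) (hb : ∑ j, h j = b)
    (hc : ∀ j, ∑ i, g j i + h j = c' j) (hc' : ∑ j, c' j = c)
    (d : ∀ j i, (B.obj (x j i)).X (g j i)) (m : ∀ j, (O.Hom (x j) (y j)).X (h j)) :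
    ∃ s : ZMod 2, tp (fun j => B.obj (y j)) c' c hc' (fun j => B.act (g j) (h j) (c' j) (hc j) (d j) (m j)) =
      sg R s • propAct B lexFam(I, x) y a b c hab
        (tp (fun q : Σₗ j, I j => B.obj (x (ofLex q).1 (ofLex q).2)) (fun q => g (ofLex q).1 (ofLex q).2) a ha
          fun q => d (ofLex q).1 (ofLex q).2) (lexMor x h b hb m) := by
  let k : (Σₗ j, I j) → J := fun q => (ofLex q).1
  let x' : (Σₗ j, I j) → O.Ob := fun q => x (ofLex q).1 (ofLex q).2
  have hs : ∀ j, ∑ q : {q : Σₗ j, I j // k q = j}, g (ofLex q.1).1 (ofLex q.1).2 + h j = c' j := fun j => by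
    rw [← hc j, ← Equiv.sum_comp (fibLex I j)]
    exact congrArg (· + h j) (Finset.sum_congr rfl fun q _ => fibLex_eq g j q)
  refine ⟨gsg k (fun q => g (ofLex q).1 (ofLex q).2) h, ?_⟩
  have e1 := propAct_in B x' y a b c hab
    (tp (fun q => B.obj (x' q)) (fun q => g (ofLex q).1 (ofLex q).2) a ha
      fun q => d (ofLex q).1 (ofLex q).2) k (tp (fibHom O k x' y) h b hb
        fun j => app (O.perm (fibLex I j) (fibLex_eq x j) (y j)) (h j) (m j))
  have e2 := grp_tp (actOps B k x' y) a b c hab (fun q => g (ofLex q).1 (ofLex q).2) ha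
    (fun q => d (ofLex q).1 (ofLex q).2) h hb
    (fun j => app (O.perm (fibLex I j) (fibLex_eq x j) (y j)) (h j) (m j)) c' hs hc'
  refine Eq.trans ?_ (congrArg (sg R _ • ·) (e1.trans e2).symm)
  simp only [smul_smul, sg_mul_self, one_smul]
  refine congrArg (tp (fun j => B.obj (y j)) c' c hc') (funext fun j => ?_)
  have hst : StrictMono (fibLex I j).symm := fun i i' hi => lex_lt_iff.2 hi
  have e3 := B.act_perm (x := fun q : {q : Σₗ j, I j // k q = j} => x' q.1) (y := y j) (fibLex I j).symm
    (fun q => g (ofLex q.1).1 (ofLex q.1).2) (h j) (c' j) (hs j) (hc j)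
    (fun q => d (ofLex q.1).1 (ofLex q.1).2) (app (O.perm (fibLex I j) (fibLex_eq x j) (y j)) (h j) (m j))
  rw [kz_eq_zero _ hst, sg_zero, one_smul] at e3
  refine Eq.trans ?_ e3
  have e4 := (perm_perm O (fibLex I j).symm (fibLex I j) (Equiv.refl _) (x := x j)
    (x' := fun q : {q : Σₗ j, I j // k q = j} => x' q.1) (x'' := x j) (fun _ => rfl) (fibLex_eq x j)
    (fun _ => rfl) (fun _ => rfl) (y j) (h j) (m j)).trans (perm_one O _ (fun _ => rfl) _ _ _ _)
  exact congrArg (B.act (x := x j) (y := y j) (g j) (h j) (c' j) (hc j) (d j)) e4.symm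

/-- The tensor products of the values of a free algebra are spanned by the images of the tensors over
non-decreasing sequences of generators, since permutations sort the sequences. -/
theorem IsFreeOn.tens_induction (h : IsFreeOn φ) (S : Submodule R ((tens fun j => B.obj (y j)).X c))
    (H : ∀ {n : ℕ} (x : Fin n → X) (_ : Monotone x) (a b : Deg N) (h : a + b = c)
      (t : (tens fun i => D (x i)).X a) (v : (propHom O (fun i => f (x i)) y).X b),
      propAct B (fun i => f (x i)) y a b c h (app (tMap fun i => φ (x i)) a t) v ∈ S)
    (t : (tens fun j => B.obj (y j)).X c) : t ∈ S := by
  have H' : ∀ {I : Type} [Fintype I] [LinearOrder I] (x : I → X) (a b : Deg N) (h : a + b = c)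
      (t : (tens fun i => D (x i)).X a) (v : (propHom O (fun i => f (x i)) y).X b),
      propAct B (fun i => f (x i)) y a b c h (app (tMap fun i => φ (x i)) a t) v ∈ S := by
    intro I _ _ x a b h t v
    let e := BalancedMap.sorting x
    have h1 := propAct_hPerm B e (fun i => f (x i)) y a b c h (app (tMap fun i => φ (x i)) a t) v
    rw [← h1, ← tMap_tPermX]
    exact H (fun i => x (e i)) (BalancedMap.monotone_sorting x) a b h _ _
  suffices H : S.mkQ = 0 from (Submodule.Quotient.mk_eq_zero S).1 (LinearMap.congr_fun H t)
  refine tp_ext fun c' hc' b => ?_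
  choose q hq using fun j => h.foldX_surjective (y j) (c' j) (b j)
  obtain rfl := funext hq
  suffices H : (S.mkQ).compMultilinearMap ((tp (fun j => B.obj (y j)) c' c hc').compLinearMap fun j =>
      (app (foldX φ (y j)) (c' j) : FreeQ f D (y j) (c' j) →ₗ[R] _)) = 0 from
    MultilinearMap.congr_fun H q
  refine multi_ext_cl fun n x g h hc d m => ?_
  refine (Submodule.Quotient.mk_eq_zero S).2 ?_
  have e1 := fun j => foldX_cl φ (x j) (g j) (y j) (h j) (c' j) (hc j) (d j) (m j)
  have e0 : (∑ q : Σₗ j, Fin (n j), g (ofLex q).1 (ofLex q).2) + ∑ j, h j = c := by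
    rw [sum_lex, ← Finset.sum_add_distrib, ← hc']
    exact Finset.sum_congr rfl fun j _ => hc j
  obtain ⟨s, hs⟩ := tp_act_eq B (fun j i => f (x j i)) g h c' _ _ e0 rfl rfl hc hc'
    (fun j i => app (φ (x j i)) (g j i) (d j i)) m
  have e2 := (congrArg (tp (fun j => B.obj (y j)) c' c hc') (funext e1)).trans hs
  refine (congrArg (· ∈ S) e2).mpr (S.smul_mem _ ?_)
  have e3 := H' (fun q : Σₗ j, Fin (n j) => x (ofLex q).1 (ofLex q).2) _ _ e0
    (tp _ _ _ rfl fun q => d (ofLex q).1 (ofLex q).2) (lexMor (fun j i => f (x j i)) h _ rfl m)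
  rw [tMap_tp] at e3
  exact e3

end UniversalProperty

/-! ### Normal forms for comparison maps -/

section NormalForms

theorem exists_factor {V V' W : Type u} [AddCommGroup V] [Module R V] [AddCommGroup V'] [Module R V']
    [AddCommGroup W] [Module R W] (ψ : V →ₗ[R] V') (hψ : Function.Surjective ψ) (g : V →ₗ[R] W)
    (h : ∀ v, ψ v = 0 → g v = 0) : ∃ L : V' →ₗ[R] W, ∀ v, L (ψ v) = g v := by
  refine ⟨(LinearMap.ker ψ).liftQ g h ∘ₗ (ψ.quotKerEquivOfSurjective hψ).symm.toLinearMap, fun v => ?_⟩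
  have h1 : (ψ.quotKerEquivOfSurjective hψ).symm (ψ v) = Submodule.Quotient.mk v := by
    rw [LinearEquiv.symm_apply_eq]
    rfl
  exact congrArg ((LinearMap.ker ψ).liftQ g h) h1

variable {M Q : DGMulticat R N} [LinearOrder M.Ob]

theorem rearrangement_eq {m n : ℕ} (e : Fin m ≃ Fin n) (x : Fin n → M.Ob) (hx : Monotone x)
    (he : Monotone fun i => x (e i)) :
    (⟨m, fun i => x (e i), he⟩ : (propCat M).Ob) = ⟨n, x, hx⟩ := by
  obtain rfl : m = n := by simpa using Fintype.card_congr e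
  have h1 : (fun i => x (e i)) = x := Tuple.unique_monotone (σ := e) (τ := Equiv.refl _) he hx
  exact congrArg (Sigma.mk m) (Subtype.ext h1)

/-- The complexes of morphisms in a PROP from the images of the objects of `propCat M`. -/
abbrev vHom (f : M.Ob → Q.Ob) {J : Type} [Fintype J] [LinearOrder J] (y : J → Q.Ob)
    (x : (propCat M).Ob) : Ch R N := propHom Q (fun i => f (x.2.1 i)) y

/-- The pure tensors of elements of a module over `propCat M` and morphisms in a PROP. -/
def sTen (S : DGMod (propCat M)) (f : M.Ob → Q.Ob) {J : Type} [Fintype J] [LinearOrder J]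
    (y : J → Q.Ob) (x : (propCat M).Ob) (a b c : Deg N) (hc : a + b = c) :
    (S.obj x).X a →ₗ[R] (vHom f y x).X b →ₗ[R] (sumTen S.obj (vHom f y)).X c :=
  stX S.obj (vHom f y) x a b c hc

/-- The comparison map `κ`, from tensors over the ground ring to a free algebra, is surjective, and
its kernel is the kernel of a normal form `nf` with respect to the relations `r s ⊗ v = r ⊗ s v`. -/
theorem comparison_normalForm {f : M.Ob → Q.Ob} {J : Type} [Fintype J] [LinearOrder J] {y : J → Q.Ob}
    {C : DGAlg M} {B : DGAlg Q} {φ : ∀ x, C.obj x ⟶ B.obj (f x)} (hφ : IsFreeOn φ)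
    {S : DGMod (propCat M)} (ψ : S ⟶ propMod C) (hψ : ∀ x a, Function.Surjective (app (ψ.hom x) a))
    (ν : ∀ x a, (S.obj x).X a →ₗ[R] (S.obj x).X a)
    (hν : ∀ x a r, app (ψ.hom x) a (ν x a r) = app (ψ.hom x) a r)
    (hν' : ∀ x a r, app (ψ.hom x) a r = 0 → ν x a r = 0)
    (hspan : ∀ x : (propCat M).Ob, Submodule.span R
      (Set.range fun σ : autSeq x.2.1 => permMor (M := M) x.2.1 σ.1 σ.2) = ⊤)
    (va : ∀ {x x' : (propCat M).Ob} (b : Deg N), ((propCat M).Hom x x').X 0 →ₗ[R]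
      (propHom Q (fun i => f (x'.2.1 i)) y).X b →ₗ[R] (propHom Q (fun i => f (x.2.1 i)) y).X b)
    (va_va : ∀ {x x' x'' : (propCat M).Ob} (b : Deg N) (s : ((propCat M).Hom x x').X 0)
      (s' : ((propCat M).Hom x' x'').X 0) (v : (propHom Q (fun i => f (x''.2.1 i)) y).X b),
      va b s (va b s' v) = va b ((propCat M).comp 0 0 0 (add_zero 0) s s') v)
    (va_re : ∀ {x x' : (propCat M).Ob} (b : Deg N) (e : Fin x'.1 ≃ Fin x.1)
      (h : ∀ i, x'.2.1 i = x.2.1 (e i)) (v : (propHom Q (fun i => f (x'.2.1 i)) y).X b),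
      va (x := x) (x' := x') b (reMor e h) v = propComp (fun i => f (x.2.1 i)) (fun i => f (x'.2.1 i)) y
        0 b b (zero_add b) (reMor e fun i => congrArg f (h i)) v)
    {ι : (propCat M).Ob → Deg N → Type u}
    (ε : ∀ {x b}, ι x b → (propHom Q (fun i => f (x.2.1 i)) y).X b)
    (hε : ∀ (x : (propCat M).Ob) (b : Deg N), Submodule.span R {v | ∃ (s : ((propCat M).Hom x x).X 0)
      (i : ι x b), v = va b s (ε i)} = ⊤) {c : Deg N}
    (nf : (sumTen S.obj (vHom f y)).X c →ₗ[R]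
      (sumTen S.obj (vHom f y)).X c)
    (hnf : ∀ (x : (propCat M).Ob) (a b : Deg N) (h : a + b = c) (r : (S.obj x).X a)
      (s : ((propCat M).Hom x x).X 0) (i : ι x b), nf (sTen S f y x a b c h r (va b s (ε i))) =
        sTen S f y x a b c h
          (ν x a (S.act a 0 a (add_zero a) r s)) (ε i))
    (κ : (sumTen S.obj (vHom f y)).X c →ₗ[R]
      (tens fun j => B.obj (y j)).X c)
    (hκ : ∀ (x : (propCat M).Ob) (a b : Deg N) (h : a + b = c) (r : (S.obj x).X a)
      (v : (propHom Q (fun i => f (x.2.1 i)) y).X b), κ (sTen S f y x a b c h r v) =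
        propAct B (fun i => f (x.2.1 i)) y a b c h
          (app (tMap fun i => φ (x.2.1 i)) a (app (ψ.hom x) a r)) v) :
    Function.Surjective κ ∧ (∀ q, κ (nf q) = κ q) ∧ ∀ q, κ q = 0 → nf q = 0 := by
  refine ⟨fun t => ?_, fun q => ?_, fun q hq => ?_⟩
  · refine hφ.tens_induction (LinearMap.range κ) (fun {n} x hx a b h t v => ?_) t
    obtain ⟨r, hr⟩ := hψ ⟨n, x, hx⟩ a t
    refine ⟨sTen S f y ⟨n, x, hx⟩ a b c h r v, (hκ ⟨n, x, hx⟩ a b h r v).trans ?_⟩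
    exact congrArg (fun t => propAct B (fun i => f (x i)) y a b c h
      (app (tMap fun i => φ (x i)) a t) v) hr
  · suffices H : κ ∘ₗ nf = κ from LinearMap.congr_fun H q
    refine stX_ext fun x a b h r v => ?_
    suffices H : ((κ ∘ₗ nf) ∘ₗ sTen S f y x a b c h r) = κ ∘ₗ sTen S f y x a b c h r from
      LinearMap.congr_fun H v
    refine LinearMap.ext_on (hε x b) ?_
    rintro _ ⟨s, i, rfl⟩
    have h1 := (congrArg κ (hnf x a b h r s i)).trans (hκ x a b h _ _)
    refine h1.trans (Eq.trans ?_ (hκ x a b h r _).symm)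
    rw [hν]
    have h2 := ψ.map_act (x := x) (y := x) a 0 a (add_zero a) r s
    refine (congrArg (fun t => propAct B (fun i => f (x.2.1 i)) y a b c h
      (app (tMap fun i => φ (x.2.1 i)) a t) (ε i)) h2).trans ?_
    let L₁ : ((propCat M).Hom x x).X 0 →ₗ[R] (tens fun j => B.obj (y j)).X c :=
      (propAct B (fun i => f (x.2.1 i)) y a b c h).flip (ε i) ∘ₗ app (tMap fun i => φ (x.2.1 i)) a ∘ₗ
        (propMod C).act (x := x) (y := x) a 0 a (add_zero a) (app (ψ.hom x) a r)
    let L₂ : ((propCat M).Hom x x).X 0 →ₗ[R] (tens fun j => B.obj (y j)).X c :=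
      propAct B (fun i => f (x.2.1 i)) y a b c h
        (app (tMap fun i => φ (x.2.1 i)) a (app (ψ.hom x) a r)) ∘ₗ (va (x := x) (x' := x) b).flip (ε i)
    suffices H : L₁ = L₂ from LinearMap.congr_fun H s
    refine LinearMap.ext_on (hspan x) ?_
    rintro _ ⟨σ, rfl⟩
    have h0 : ∀ i, x.2.1 i = x.2.1 (σ.1.symm i) := fun i => (σ⁻¹).2 i |>.symm
    have h3 := propAct_reMor_map (f := f) φ σ.1.symm h0 a (add_zero a) (app (ψ.hom x) a r)
    have h4 := va_re (x := x) (x' := x) b σ.1.symm h0 (ε i)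
    have h5 := propAct_assoc B (fun i => f (x.2.1 i)) (fun i => f (x.2.1 i)) y a 0 b a b c
      (add_zero a) h (zero_add b) h (app (tMap fun i => φ (x.2.1 i)) a (app (ψ.hom x) a r))
      (reMor σ.1.symm fun i => congrArg f (h0 i)) (ε i)
    refine (congrArg (fun t => propAct B (fun i => f (x.2.1 i)) y a b c h t (ε i)) h3).trans ?_
    exact h5.trans (congrArg (propAct B (fun i => f (x.2.1 i)) y a b c h
      (app (tMap fun i => φ (x.2.1 i)) a (app (ψ.hom x) a r))) h4.symm)
  · have move : ∀ (x₁ x₂ : (propCat M).Ob), x₁ = x₂ → ∀ (a b : Deg N) (h : a + b = c)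
        (r : (S.obj x₂).X a) (m : ((propCat M).Hom x₂ x₁).X 0)
        (w : (propHom Q (fun i => f (x₁.2.1 i)) y).X b),
        nf (sTen S f y x₁ a b c h (S.act a 0 a (add_zero a) r m) w) =
          nf (sTen S f y x₂ a b c h r (va b m w)) := by
      rintro x _ rfl a b h r m w
      suffices H : nf ∘ₗ sTen S f y x a b c h (S.act a 0 a (add_zero a) r m) =
          nf ∘ₗ sTen S f y x a b c h r ∘ₗ va b m from LinearMap.congr_fun H w
      refine LinearMap.ext_on (hε x b) ?_
      rintro _ ⟨s, i, rfl⟩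
      refine (hnf x a b h _ s i).trans (Eq.trans ?_ (congrArg (fun v => nf (sTen S f y x a b c h r v))
        (va_va b m s (ε i))).symm)
      refine Eq.trans ?_ (hnf x a b h r _ i).symm
      have h1 := S.act_act a 0 0 a 0 a (add_zero a) (add_zero a) (add_zero 0) (add_zero a) r m s
      exact congrArg (fun r => sTen S f y x a b c h (ν x a r) (ε i)) h1
    have hker : ∀ (x : (propCat M).Ob) (a b : Deg N) (h : a + b = c) (r : (S.obj x).X a),
        app (ψ.hom x) a r = 0 → nf ∘ₗ sTen S f y x a b c h r = 0 := by
      intro x a b h r hr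
      refine LinearMap.ext_on (hε x b) ?_
      rintro _ ⟨s, i, rfl⟩
      have h1 := ψ.map_act (x := x) (y := x) a 0 a (add_zero a) r s
      have h2 : (propMod C).act (x := x) (y := x) a 0 a (add_zero a) (app (ψ.hom x) a r) s = 0 := by
        rw [hr, map_zero]
        rfl
      refine (hnf x a b h r s i).trans ?_
      rw [hν' x a _ (h1.trans h2), map_zero]
      rfl
    choose L hL using fun (x : (propCat M).Ob) (a b : Deg N) (h : a + b = c) =>
      exists_factor (app (ψ.hom x) a) (hψ x a)
        ((LinearMap.llcomp R _ _ _ nf) ∘ₗ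
          sTen S f y x a b c h) (hker x a b h)
    let Λ : BalancedMap f C.obj ((sumTen S.obj (vHom f y)).X c) y c :=
      { L := fun {n} x hx a b h => L ⟨n, x, hx⟩ a b h
        perm := by
          intro m n e x hx he a b h t v
          obtain ⟨r, rfl⟩ := hψ ⟨n, x, hx⟩ a t
          have h1 := ψ.map_act (x := ⟨n, x, hx⟩) (y := ⟨m, fun i => x (e i), he⟩) a 0 a (add_zero a) r
            (reMor e fun _ => rfl)
          have h2 := h1.trans (propAct_reMor C e x a (add_zero a) (app (ψ.hom ⟨n, x, hx⟩) a r))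
          have h3 := LinearMap.congr_fun (hL ⟨m, fun i => x (e i), he⟩ a b h
            (S.act (x := ⟨n, x, hx⟩) (y := ⟨m, fun i => x (e i), he⟩) a 0 a (add_zero a) r
              (reMor e fun _ => rfl))) (hPerm e (fun i => f (x i)) y b v)
          refine (congrArg (fun t => L ⟨m, fun i => x (e i), he⟩ a b h t
            (hPerm e (fun i => f (x i)) y b v)) h2.symm).trans (h3.trans ?_)
          refine (move _ _ (rearrangement_eq e x hx he) a b h r (reMor e fun _ => rfl)
            (hPerm e (fun i => f (x i)) y b v)).trans ?_
          have h4 := va_re (x := ⟨n, x, hx⟩) (x' := ⟨m, fun i => x (e i), he⟩) b e (fun _ => rfl)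
            (hPerm e (fun i => f (x i)) y b v)
          have h5 := h4.trans (reMor_comp e (fun i => f (x i)) y b (zero_add b) v)
          refine (congrArg (fun v => nf (sTen S f y ⟨n, x, hx⟩ a b c h r v)) h5).trans ?_
          exact (LinearMap.congr_fun (hL ⟨n, x, hx⟩ a b h r) v).symm }
    obtain ⟨F, hF⟩ := hφ.lift (algQ f C.obj) (genQ f C.obj)
    obtain ⟨θ, hθ⟩ := Λ.exists_extension B φ F hF
    suffices H : θ ∘ₗ κ = nf by rw [← H, LinearMap.comp_apply, hq, map_zero]
    refine stX_ext fun x a b h r v => ?_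
    refine (congrArg θ (hκ x a b h r v)).trans ((hθ x.2.1 x.2.2 a b h (app (ψ.hom x) a r) v).trans ?_)
    exact LinearMap.congr_fun (hL x a b h r) v

end NormalForms

/-! ### The comparison of the free resolutions -/

section ComparisonOfSimplices

variable {M O : DGMulticat R N}

theorem isFreeOn_algFree (D : M.Ob → Ch R N) :
    IsFreeOn (O := M) (f := fun x => x) (B := (algFree M).obj D) ((algAdj M).unit.app D) where
  lift Q ψ := ⟨((algAdj M).homEquiv D Q).symm ψ, fun x =>
    congrFun (((algAdj M).homEquiv_unit _ _ _).symm.trans (((algAdj M).homEquiv D Q).apply_symm_apply ψ)) x⟩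
  uniq Q F G h := ((algAdj M).homEquiv D Q).injective
    (((algAdj M).homEquiv_unit _ _ _).trans ((funext h).trans ((algAdj M).homEquiv_unit _ _ _).symm))

theorem isFreeOn_opAdj (π : DGMultifunctor M O) (D : M.Ob → Ch R N) :
    IsFreeOn (O := O) (f := π.obj) (B := (colPush π.obj ⋙ algFree O).obj D)
      ((opAdj π).unit.app D) where
  lift Q ψ := ⟨((opAdj π).homEquiv D Q).symm ψ, fun x =>
    congrFun (((opAdj π).homEquiv_unit _ _ _).symm.trans (((opAdj π).homEquiv D Q).apply_symm_apply ψ)) x⟩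
  uniq Q F G h := ((opAdj π).homEquiv D Q).injective
    (((opAdj π).homEquiv_unit _ _ _).trans ((funext h).trans ((opAdj π).homEquiv_unit _ _ _).symm))

theorem tensPt_bijective (K : Ch R N) (γ : Deg N) : Function.Bijective (app (tensPt K) γ) := by
  have hs : ∑ _ : Fin 1, γ = γ := by simp
  let ι : K.X γ →ₗ[R] (tens fun _ : Fin 1 => K).X γ :=
    (MultilinearMap.ofSubsingleton R (K.X γ) _ (0 : Fin 1)).symm (tp (fun _ : Fin 1 => K) (fun _ => γ) γ hs)
  have h1 : ∀ x, app (tensPt K) γ (ι x) = x := fun x =>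
    (tensPtX_tp K γ (fun _ => γ) hs fun _ => x).trans (tr_self K γ x)
  have h2 : ∀ t, ι (app (tensPt K) γ t) = t := by
    intro t
    suffices H : ι ∘ₗ app (tensPt K) γ = LinearMap.id from LinearMap.congr_fun H t
    refine tp_ext fun g h x => (congrArg ι (tensPtX_tp K γ g h x)).trans ?_
    have hg : g 0 = γ := by rw [← h, Fin.sum_univ_one]
    refine (tp_congr (K := fun _ : Fin 1 => K) h hs (funext fun j => ?_) fun j => ?_).symm
    · rw [Subsingleton.elim j 0, hg]
    · obtain rfl : j = 0 := Subsingleton.elim _ _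
      rfl
  exact ⟨Function.LeftInverse.injective h2, fun x => ⟨_, h1 x⟩⟩

variable [LinearOrder M.Ob] [LinearOrder O.Ob] [Unique O.Ob]
  (π : DGMultifunctor M O) (hπ : Monotone π.obj) (A : DGAlg M)

/-- The `M`-algebra of `n`-simplices of the resolution of an algebra. -/
abbrev algRsl (n : ℕ) : DGAlg M := resObj (algFree M) (algForget M) A n

/-- The comparison of the resolutions of the module associated to an algebra and of the algebra. -/
def rslCmp (n : ℕ) : freeRes(propMod A) n ⟶
    propMod (algRsl A n) :=
  resCmp (algAdj M) (modAdj (propCat M)) (P := algProp M) (T := colTens M) (Iso.refl _) A n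

section
variable (M)

/-- `freeCmp` for algebras and modules over the PROP category. -/
def freeAlgCmp (D : M.Ob → Ch R N) : freeMod ((colTens M).obj D) ⟶ propMod ((algFree M).obj D) :=
  freeCmp (algAdj M) (modAdj (propCat M)) (P := algProp M) (T := colTens M)
    (Iso.refl (algForget M ⋙ colTens M)) D

theorem freeAlgCmp_fm (D : M.Ob → Ch R N) (y x : (propCat M).Ob) (a b c : Deg N) (h : a + b = c)
    (d : (tens fun i => D (x.2.1 i)).X a) (v : ((propCat M).Hom x y).X b) :
    app ((freeAlgCmp M D).hom y) c (fm (𝒞 := propCat M) ((colTens M).obj D) y x a b c h d v) =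
      propAct ((algFree M).obj D) x.2.1 y.2.1 a b c h
        (app (tMap fun i => (algAdj M).unit.app D (x.2.1 i)) a d) v :=
  modAdj_symm_fm (𝒞 := propCat M) (A := propMod ((algFree M).obj D))
    ((colTens M).map ((algAdj M).unit.app D) ≫
      (Iso.refl (algForget M ⋙ colTens M)).inv.app ((algFree M).obj D)) y x a b c h d v
end

theorem rslCmp_eq (n : ℕ) : rslCmp A (n + 1) = (modFree (propCat M)).map
    ((fun x => (rslCmp A n).hom x) : (freeRes(propMod A) n).obj ⟶
      (colTens M).obj (algRsl A n).obj) ≫ freeAlgCmp M (algRsl A n).obj := by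
  have h : (modForget (propCat M)).map (rslCmp A n) ≫
      (Iso.refl (algForget M ⋙ colTens M)).hom.app (algRsl A n) = ((fun x => (rslCmp A n).hom x) : (freeRes(propMod A) n).obj ⟶
      (colTens M).obj (algRsl A n).obj) := Category.comp_id _
  exact congrArg (fun g => (modFree (propCat M)).map g ≫ freeAlgCmp M (algRsl A n).obj) h

theorem rslCmp_succ (n : ℕ) {x y : (propCat M).Ob} (a b c : Deg N) (h : a + b = c)
    (r : (rOb (propMod A) n x).X a) (v : ((propCat M).Hom x y).X b) :
    app ((rslCmp A (n + 1)).hom y) c (rTen (propMod A) n a b c h r v) =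
      propAct (algRsl A (n + 1)) x.2.1 y.2.1 a b c h
        (app (tMap fun i => (algAdj M).unit.app (algRsl A n).obj (x.2.1 i)) a
          (app ((rslCmp A n).hom x) a r)) v := by
  rw [rslCmp_eq]
  have h1 := modFree_map_fm (𝒞 := propCat M) (D := (freeRes(propMod A) n).obj)
    (D' := (colTens M).obj (algRsl A n).obj) (fun x => (rslCmp A n).hom x) y x a b c h r v
  have h2 := freeAlgCmp_fm M (algRsl A n).obj y x a b c h (app ((rslCmp A n).hom x) a r) v
  exact (congrArg (app ((freeAlgCmp M (algRsl A n).obj).hom y) c) h1).trans h2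

theorem EssBasis.span_eq_top {𝒞 𝒟 : DGCat R N} {p : DGFunctor 𝒞 𝒟} {y₀ : 𝒟.Ob} (B : EssBasis p y₀)
    (x : 𝒞.Ob) (z : Option 𝒞.Ob) (b : Deg N) : Submodule.span R {v | ∃ (s : (𝒞.Hom x x).X 0)
      (i : B.ι x z b), v = vComp p y₀ 0 b b (zero_add b) s (B.e i)} = ⊤ := by
  refine top_unique fun v _ => B.induction (P := fun v => v ∈ Submodule.span R _) v
    (Submodule.zero_mem _) (fun v v' => Submodule.add_mem _) fun s i => Submodule.subset_span ⟨s, i, rfl⟩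

theorem sTen_eq_fm (S : DGMod (propCat M)) (x x' : (propCat M).Ob) (a b c : Deg N) (h : a + b = c)
    (r : (S.obj x').X a) (v : ((propCat M).Hom x' x).X b) :
    sTen S (fun x => x) x.2.1 x' a b c h r v = fm (𝒞 := propCat M) S.obj x x' a b c h r v := rfl

set_option maxHeartbeats 1000000 in
variable {A} in
/-- The map from the iterated free `PM`-module to the tensor powers of the iterated free `M`-algebra
is surjective, and its kernel is that of the normal form. -/
theorem rslCmp_normalForm (B : EssBasis (propFunctor π hπ) (propUnit O))
    (hspan : ∀ x : (propCat M).Ob, Submodule.span R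
      (Set.range fun σ : autSeq x.2.1 => permMor (M := M) x.2.1 σ.1 σ.2) = ⊤) (n : ℕ) (x : (propCat M).Ob) (a : Deg N) :
    Function.Surjective (app ((rslCmp A n).hom x) a) ∧
    (∀ r, app ((rslCmp A n).hom x) a (nfR (propMod A) B n x a r) = app ((rslCmp A n).hom x) a r) ∧
    ∀ r, app ((rslCmp A n).hom x) a r = 0 → nfR (propMod A) B n x a r = 0 := by
  induction n generalizing x a with
  | zero => exact ⟨fun t => ⟨t, rfl⟩, fun r => rfl, fun r hr => hr⟩
  | succ n ih =>
    refine comparison_normalForm (M := M) (Q := M) (f := fun x => x) (J := Fin x.1) (y := x.2.1)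
      (C := algRsl A n) (B := (algFree M).obj (algRsl A n).obj)
      (φ := (algAdj M).unit.app (algRsl A n).obj) (isFreeOn_algFree (algRsl A n).obj)
      (S := freeRes(propMod A) n)
      (rslCmp A n) (fun x a => (ih x a).1) (nfR (propMod A) B n) (fun x a => (ih x a).2.1)
      (fun x a => (ih x a).2.2) hspan
      (fun {x₁ x₂} b => (propCat M).comp (x := x₁) (y := x₂) (z := x) 0 b b (zero_add b))
      ?_ ?_ (ι := fun x' b => B.ι x' (some x) b) (fun {x' b} i => B.e i)
      ?_ (c := a) (nfQ (propMod A) B n (some x) a) ?_ (app ((rslCmp A (n + 1)).hom x) a) ?_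
    · exact fun {x₁ x₂ x₃} b s s' v => ((propCat M).comp_comp 0 0 b 0 b b (add_zero 0) (zero_add b)
        (zero_add b) (zero_add b) s s' v).symm
    · exact fun b e h v => rfl
    · exact fun x' b => B.span_eq_top x' (some x) b
    · exact fun x' a' b h r s i => nfQ_qTen (z := some x) B n a' b a h r s i
    · intro x' a' b h r v
      have e := sTen_eq_fm (freeRes(propMod A) n)
        x x' a' b a h r v
      have h1 := rslCmp_succ A n a' b a h r v
      have h2 := (congrArg (app ((rslCmp A (n + 1)).hom x) a) e)
      have h3 := h2.trans h1
      exact h3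

end ComparisonOfSimplices

/-! ### The comparison of the bar constructions -/

section ComparisonOfBars

variable {M O : DGMulticat R N}
  [LinearOrder M.Ob] [LinearOrder O.Ob] [Unique O.Ob]
  (π : DGMultifunctor M O) (hπ : Monotone π.obj) (A : DGAlg M)

section
variable (D : M.Ob → Ch R N)

/-- `relCmp` for the left Kan extensions of free objects. -/
def freeLanCmp : (colPush (propFunctor π hπ).obj ⋙ modFree (propCat O)).obj ((colTens M).obj D) ⟶
    propMod ((colPush π.obj ⋙ algFree O).obj D) :=
  relCmp (opAdj π) (catAdj (propFunctor π hπ)) (P := algProp M) (P' := algProp O) (T := colTens M)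
    (Iso.refl (algForget M ⋙ colTens M)) (propRes π hπ) D

set_option maxHeartbeats 1000000 in
theorem freeLanCmp_lanGen (x : (propCat M).Ob) (a b c : Deg N) (h : a + b = c)
    (d : (tens fun i => D (x.2.1 i)).X a)
    (v : ((propCat O).Hom ((propFunctor π hπ).obj x) (propUnit O)).X b) :
    app ((freeLanCmp π hπ D).hom (propUnit O)) c
      (lanGen (propFunctor π hπ) ((colTens M).obj D) (propUnit O) x a b c h d v) =
      propAct ((colPush π.obj ⋙ algFree O).obj D) (fun i => π.obj (x.2.1 i))
        (fun _ : Fin 1 => default) a b c h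
        (app (tMap fun i => (opAdj π).unit.app D (x.2.1 i)) a d) v := by
  let ψ : (colTens M).obj D ⟶ (modRes (propFunctor π hπ) ⋙ modForget (propCat M)).obj
      (propMod ((colPush π.obj ⋙ algFree O).obj D)) :=
    fun x => tMap fun i => (opAdj π).unit.app D (x.2.1 i)
  have e : freeLanCmp π hπ D = ((catAdj (propFunctor π hπ)).homEquiv _ _).symm ψ :=
    congrArg ((catAdj (propFunctor π hπ)).homEquiv _ _).symm
      (funext fun x => hom_ext_app fun _ _ => rfl)
  rw [e]
  exact catAdj_symm_lanGen (propFunctor π hπ) (C := (colTens M).obj D)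
    (B := propMod ((colPush π.obj ⋙ algFree O).obj D)) ψ (propUnit O) x a b c h d v
end

/-- The comparison of the bar constructions. -/
def lanCmp : lanBar (propFunctor π hπ) (propUnit O) (propMod A) ⟶
    barCx (algAdj M) (opAdj π) (algForget O ⋙ Pi.eval _ default) A :=
  barCmp (algAdj M) (modAdj (propCat M)) (opAdj π) (catAdj (propFunctor π hπ))
      (P := algProp M) (P' := algProp O) (T := colTens M) (Iso.refl (algForget M ⋙ colTens M)) (propRes π hπ)
      (E₁ := algForget O ⋙ Pi.eval _ default) (E₂ := modForget (propCat O) ⋙ Pi.eval _ (propUnit O))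
      (propEval O) A

theorem lanCmp_f (n : ℕ) : (lanCmp π hπ A).f n =
    ((colPush (propFunctor π hπ).obj ⋙ modFree (propCat O)).map
    ((fun x => (rslCmp A n).hom x) : (freeRes(propMod A) n).obj ⟶
      (colTens M).obj (algRsl A n).obj)).hom (propUnit O) ≫
        (freeLanCmp π hπ (algRsl A n).obj).hom (propUnit O) ≫
        tensPt (((colPush π.obj ⋙ algFree O).obj (algRsl A n).obj).obj default) := by
  have h : (modForget (propCat M)).map (rslCmp A n) ≫
      (Iso.refl (algForget M ⋙ colTens M)).hom.app (algRsl A n) = ((fun x => (rslCmp A n).hom x) : (freeRes(propMod A) n).obj ⟶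
      (colTens M).obj (algRsl A n).obj) := Category.comp_id _
  have h2 := congrArg (fun g => ((colPush (propFunctor π hπ).obj ⋙ modFree (propCat O)).map g).hom (propUnit O) ≫
    (freeLanCmp π hπ (algRsl A n).obj).hom (propUnit O) ≫
        tensPt (((colPush π.obj ⋙ algFree O).obj (algRsl A n).obj).obj default)) h
  refine Eq.trans ?_ h2
  exact Category.assoc _ _ _

theorem lanCmp_lanGen (n : ℕ) (x : (propCat M).Ob) (a b c : Deg N) (h : a + b = c)
    (r : (rOb (propMod A) n x).X a)
    (v : ((propCat O).Hom ((propFunctor π hπ).obj x) (propUnit O)).X b) :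
    app ((lanCmp π hπ A).f n) c (lanGen (propFunctor π hπ)
      (freeRes(propMod A) n).obj (propUnit O) x a b c h r v) =
      app (tensPt (((colPush π.obj ⋙ algFree O).obj (algRsl A n).obj).obj default)) c
        (propAct ((colPush π.obj ⋙ algFree O).obj (algRsl A n).obj) (fun i => π.obj (x.2.1 i))
          (fun _ : Fin 1 => default) a b c h
          (app (tMap fun i => (opAdj π).unit.app (algRsl A n).obj (x.2.1 i)) a
            (app ((rslCmp A n).hom x) a r)) v) := by
  rw [lanCmp_f]
  have h1 := lanGen_map (propFunctor π hπ) (C := (freeRes(propMod A) n).obj)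
    (C' := (colTens M).obj (algRsl A n).obj) (fun x => (rslCmp A n).hom x) (propUnit O) x a b c h r v
  have h2 := freeLanCmp_lanGen π hπ (algRsl A n).obj x a b c h (app ((rslCmp A n).hom x) a r) v
  exact congrArg (app (tensPt (((colPush π.obj ⋙ algFree O).obj (algRsl A n).obj).obj default)) c)
    ((congrArg (app ((freeLanCmp π hπ (algRsl A n).obj).hom (propUnit O)) c) h1).trans h2)

/-- The comparison of the `n`-simplices, as a map to the tensor product with one factor. -/
def lanCmpQ (n : ℕ) (c : Deg N) :
    (qOb (propFunctor π hπ) (propUnit O) (propMod A) n none).X c →ₗ[R]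
      (tens fun _ : Fin 1 => ((colPush π.obj ⋙ algFree O).obj (algRsl A n).obj).obj default).X c :=
  (LinearEquiv.ofBijective _ (tensPt_bijective
    (((colPush π.obj ⋙ algFree O).obj (algRsl A n).obj).obj default) c)).symm.toLinearMap ∘ₗ
  app ((lanCmp π hπ A).f n) c ∘ₗ
    (simEquiv (propFunctor π hπ) (propUnit O) (propMod A) n c).toLinearMap

theorem tensPt_lanCmpQ (n : ℕ) (c : Deg N) (q) :
    app (tensPt (((colPush π.obj ⋙ algFree O).obj (algRsl A n).obj).obj default)) c
      (lanCmpQ π hπ A n c q) = app ((lanCmp π hπ A).f n) c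
        (simEquiv (propFunctor π hπ) (propUnit O) (propMod A) n c q) :=
  (LinearEquiv.ofBijective _ (tensPt_bijective
    (((colPush π.obj ⋙ algFree O).obj (algRsl A n).obj).obj default) c)).apply_symm_apply _

theorem lanCmpQ_qTen (n : ℕ) (x : (propCat M).Ob) (a b c : Deg N) (h : a + b = c)
    (r : (rOb (propMod A) n x).X a)
    (v : ((propCat O).Hom ((propFunctor π hπ).obj x) (propUnit O)).X b) :
    lanCmpQ π hπ A n c (qTen (propFunctor π hπ) (propUnit O) (propMod A) n (z := none) a b c h r v) =
      propAct ((colPush π.obj ⋙ algFree O).obj (algRsl A n).obj) (fun i => π.obj (x.2.1 i))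
        (fun _ : Fin 1 => default) a b c h
        (app (tMap fun i => (opAdj π).unit.app (algRsl A n).obj (x.2.1 i)) a
          (app ((rslCmp A n).hom x) a r)) v := by
  refine (tensPt_bijective _ c).1 ((tensPt_lanCmpQ π hπ A n c _).trans ?_)
  exact (congrArg (app ((lanCmp π hπ A).f n) c)
    (simEquiv_qTen (propFunctor π hπ) (propUnit O) (propMod A) n a b c h r v)).trans
      (lanCmp_lanGen π hπ A n x a b c h r v)

/-- The source of `lanCmpQ`, with the morphisms of the PROP category of `O` unfolded. -/
abbrev lanSrc (n : ℕ) : Ch R N :=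
  sumTen (freeRes(propMod A) n).obj
    (vHom (Q := O) π.obj fun _ : Fin 1 => default)

/-- The comparison of the `n`-simplices on `lanSrc`. -/
def lanCmpS (n : ℕ) (c : Deg N) : (lanSrc π A n).X c →ₗ[R]
    (tens fun _ : Fin 1 => ((colPush π.obj ⋙ algFree O).obj (algRsl A n).obj).obj default).X c :=
  lanCmpQ π hπ A n c

theorem sTen_eq_qTen (n : ℕ) (x : (propCat M).Ob) (a b c : Deg N) (h : a + b = c)
    (r : (rOb (propMod A) n x).X a)
    (v : (propHom O (fun i => π.obj (x.2.1 i)) fun _ : Fin 1 => default).X b) :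
    sTen (freeRes(propMod A) n) π.obj
      (fun _ : Fin 1 => default) x a b c h r v =
      qTen (propFunctor π hπ) (propUnit O) (propMod A) n (z := none) a b c h r v := by
  with_unfolding_all rfl

set_option maxHeartbeats 1000000 in
theorem lanCmpS_sTen (n : ℕ) (x : (propCat M).Ob) (a b c : Deg N) (h : a + b = c)
    (r : (rOb (propMod A) n x).X a)
    (v : (propHom O (fun i => π.obj (x.2.1 i)) fun _ : Fin 1 => default).X b) :
    lanCmpS π hπ A n c (sTen (freeRes(propMod A) n) π.obj
      (fun _ : Fin 1 => default) x a b c h r v) =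
      propAct ((colPush π.obj ⋙ algFree O).obj (algRsl A n).obj) (fun i => π.obj (x.2.1 i))
        (fun _ : Fin 1 => default) a b c h
        (app (tMap fun i => (opAdj π).unit.app (algRsl A n).obj (x.2.1 i)) a
          (app ((rslCmp A n).hom x) a r)) v :=
  (congrArg (lanCmpS π hπ A n c) (sTen_eq_qTen π hπ A n x a b c h r v)).trans
    (lanCmpQ_qTen π hπ A n x a b c h r v)

variable {A} in
/-- The normal form on `lanSrc`. -/
def nfS (B : EssBasis (propFunctor π hπ) (propUnit O)) (n : ℕ) (c : Deg N) :
    (lanSrc π A n).X c →ₗ[R] (lanSrc π A n).X c :=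
  nfQ (propMod A) B n none c

/-- The action of the PROP category of `M` on the morphisms to the unit of that of `O`. -/
def unitComp {x x' : (propCat M).Ob} (b : Deg N) : ((propCat M).Hom x x').X 0 →ₗ[R]
    (propHom O (fun i => π.obj (x'.2.1 i)) fun _ : Fin 1 => default).X b →ₗ[R]
      (propHom O (fun i => π.obj (x.2.1 i)) fun _ : Fin 1 => default).X b :=
  vComp (propFunctor π hπ) (propUnit O) (x := x) (y := x') (z := none) 0 b b (zero_add b)

theorem unitComp_unitComp {x x' x'' : (propCat M).Ob} (b : Deg N) (s : ((propCat M).Hom x x').X 0)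
    (s' : ((propCat M).Hom x' x'').X 0)
    (v : (propHom O (fun i => π.obj (x''.2.1 i)) fun _ : Fin 1 => default).X b) :
    unitComp π hπ b s (unitComp π hπ b s' v) =
      unitComp π hπ b ((propCat M).comp 0 0 0 (add_zero 0) s s') v :=
  (vComp_assoc (propFunctor π hπ) (propUnit O) (w := none) 0 0 b 0 b b
    (add_zero 0) (zero_add b) (zero_add b) (zero_add b) s s' v).symm

theorem unitComp_reMor {x x' : (propCat M).Ob} (b : Deg N) (e : Fin x'.1 ≃ Fin x.1)
    (h : ∀ i, x'.2.1 i = x.2.1 (e i))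
    (v : (propHom O (fun i => π.obj (x'.2.1 i)) fun _ : Fin 1 => default).X b) :
    unitComp π hπ b (reMor e h) v = propComp (fun i => π.obj (x.2.1 i)) (fun i => π.obj (x'.2.1 i))
      (fun _ : Fin 1 => default) 0 b b (zero_add b) (reMor e fun i => congrArg π.obj (h i)) v :=
  congrArg (fun m => propComp (fun i => π.obj (x.2.1 i)) (fun i => π.obj (x'.2.1 i))
    (fun _ : Fin 1 => default) 0 b b (zero_add b) m v) (propMap_reMor π e h)

theorem span_unitComp (B : EssBasis (propFunctor π hπ) (propUnit O)) (x : (propCat M).Ob) (b : Deg N) :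
    Submodule.span R {v : (propHom O (fun i => π.obj (x.2.1 i)) fun _ : Fin 1 => default).X b |
      ∃ (s : ((propCat M).Hom x x).X 0) (i : B.ι x none b), v = unitComp π hπ b s (B.e i)} = ⊤ :=
  B.span_eq_top x none b

set_option maxHeartbeats 1000000 in
variable {A} in
theorem nfS_sTen (B : EssBasis (propFunctor π hπ) (propUnit O)) (n : ℕ) (x : (propCat M).Ob)
    (a b c : Deg N) (h : a + b = c) (r : (rOb (propMod A) n x).X a) (s : ((propCat M).Hom x x).X 0)
    (i : B.ι x none b) :
    nfS π hπ B n c (sTen (freeRes(propMod A) n) π.obj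
      (fun _ : Fin 1 => default) x a b c h r
        (unitComp π hπ b s (B.e i))) =
      sTen (freeRes(propMod A) n) π.obj
        (fun _ : Fin 1 => default) x a b c h (nfR (propMod A) B n x a (rAct (propMod A) n a 0 a (add_zero a) r s)) (B.e i) :=
  nfQ_qTen (z := none) B n a b c h r s i

set_option maxHeartbeats 1000000 in
variable {A} in
theorem lanCmpS_normalForm (B : EssBasis (propFunctor π hπ) (propUnit O))
    (hspan : ∀ x : (propCat M).Ob, Submodule.span R
      (Set.range fun σ : autSeq x.2.1 => permMor (M := M) x.2.1 σ.1 σ.2) = ⊤) (n : ℕ) (c : Deg N) :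
    Function.Surjective (lanCmpS π hπ A n c) ∧
      (∀ q, lanCmpS π hπ A n c (nfS π hπ B n c q) = lanCmpS π hπ A n c q) ∧
      ∀ q, lanCmpS π hπ A n c q = 0 → nfS π hπ B n c q = 0 := by
  refine comparison_normalForm (M := M) (Q := O) (f := π.obj) (J := Fin 1) (y := fun _ => default)
      (C := algRsl A n) (B := (colPush π.obj ⋙ algFree O).obj (algRsl A n).obj)
      (φ := (opAdj π).unit.app (algRsl A n).obj) (isFreeOn_opAdj π (algRsl A n).obj)
      (S := freeRes(propMod A) n)
      (rslCmp A n) (fun x a => (rslCmp_normalForm π hπ B hspan n x a).1) (nfR (propMod A) B n)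
      (fun x a => (rslCmp_normalForm π hπ B hspan n x a).2.1)
      (fun x a => (rslCmp_normalForm π hπ B hspan n x a).2.2) hspan
      (fun {x₁ x₂} b => unitComp π hπ (x := x₁) (x' := x₂) b) (unitComp_unitComp π hπ)
      (unitComp_reMor π hπ) (ι := fun x' b => B.ι x' none b) (fun {x' b} i => B.e i)
      (span_unitComp π hπ B) (c := c) (nfS π hπ B n c) ?_ (lanCmpS π hπ A n c) ?_
  · intro x' a' b h r s i
    exact nfS_sTen π hπ B n x' a' b c h r s i
  · intro x' a' b h r v
    exact lanCmpS_sTen π hπ A n x' a' b c h r v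

set_option maxHeartbeats 1000000 in
variable {A} in
/-- The comparison of the `n`-simplices is surjective, and its kernel is that of the normal form. -/
theorem lanCmp_normalForm (B : EssBasis (propFunctor π hπ) (propUnit O))
    (hspan : ∀ x : (propCat M).Ob, Submodule.span R
      (Set.range fun σ : autSeq x.2.1 => permMor (M := M) x.2.1 σ.1 σ.2) = ⊤) (n : ℕ) (c : Deg N) :
    Function.Surjective (app ((lanCmp π hπ A).f n) c) ∧
    ∀ q, app ((lanCmp π hπ A).f n) c (simEquiv (propFunctor π hπ) (propUnit O) (propMod A) n c q) = 0 ↔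
      nfQ (propMod A) B n none c q = 0 := by
  obtain ⟨h1, h2, h3⟩ := lanCmpS_normalForm π hπ B hspan n c
  have hT := tensPt_bijective (((colPush π.obj ⋙ algFree O).obj (algRsl A n).obj).obj default) c
  refine ⟨fun t => ?_, fun q => ⟨fun hq => ?_, fun hq => ?_⟩⟩
  · obtain ⟨t, rfl⟩ := hT.2 t
    obtain ⟨q, rfl⟩ := h1 t
    exact ⟨_, (tensPt_lanCmpQ π hπ A n c q).symm⟩
  · exact h3 q (hT.1 ((tensPt_lanCmpQ π hπ A n c q).trans (hq.trans (map_zero _).symm)))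
  · have h4 : lanCmpQ π hπ A n c q = 0 :=
      (h2 q).symm.trans ((congrArg (lanCmpS π hπ A n c) hq).trans (map_zero _))
    exact (tensPt_lanCmpQ π hπ A n c q).symm.trans ((congrArg _ h4).trans (map_zero _))

end ComparisonOfBars

/-! ### Bases of complexes with an action -/

section ActBases

/-- A homogeneous basis of a complex `K` with an action of a module `S`, with a differential that
lowers the rank. -/
structure ActBasis (K : Ch R N) {S : Type u} [AddCommGroup S] [Module R S]
    (act : ∀ b, S →ₗ[R] K.X b →ₗ[R] K.X b) where
  ι : Deg N → Type u
  e : ∀ {b}, ι b → K.X b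
  rk : ∀ {b}, ι b → ℕ
  dec : ∀ b, K.X b →ₗ[R] (ι b →₀ S)
  dec_act : ∀ {b} (s : S) (i : ι b), dec b (act b s (e i)) = Finsupp.single i s
  sum_dec : ∀ {b} (v : K.X b), (dec b v).sum (fun i s => act b s (e i)) = v
  del_e : ∀ {b} (i : ι b), del K b (b - 1) (e i) ∈ Submodule.span R
    {v | ∃ (s : S) (j : ι (b - 1)), rk j < rk i ∧ v = act (b - 1) s (e j)}

variable {K : Ch R N} {S : Type u} [AddCommGroup S] [Module R S]
  {act : ∀ b, S →ₗ[R] K.X b →ₗ[R] K.X b}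

theorem act_tr {a b : Deg N} (h : a = b) (s : S) (v : K.X a) :
    act b s (tr K a b v) = tr K a b (act a s v) := by
  subst h
  rw [tr_self, tr_self]

/-- A basis of a complex from a basis of its `ℤ`-graded pieces, that is bounded below. -/
def ActBasis.ofGraded {G : Type} (g : Module.Basis G R S) (ι : ℤ → Type u)
    (e : ∀ n : ℤ, ι n → K.X (n : Deg N)) (m : ℤ) (hm : ∀ n < m, IsEmpty (ι n))
    (hdel : ∀ n i, del K (n : Deg N) ((n - 1 : ℤ) : Deg N) (e n i) ∈
      Submodule.span R (Set.range fun p : ι (n - 1) × G => act _ (g p.2) (e (n - 1) p.1)))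
    (bas : ∀ γ : Deg N, Module.Basis (Σ n : {n : ℤ // (n : Deg N) = γ}, ι n.1 × G) R (K.X γ))
    (hbas : ∀ γ p, bas γ p = tr K (p.1.1 : Deg N) γ (act _ (g p.2.2) (e p.1.1 p.2.1))) :
    ActBasis K act where
  ι γ := Σ n : {n : ℤ // (n : Deg N) = γ}, ι n.1
  e i := tr K _ _ (e i.1.1 i.2)
  rk i := (i.1.1 - m).toNat
  dec γ := (bas γ).constr R fun p => Finsupp.single ⟨p.1, p.2.1⟩ (g p.2.2)
  dec_act {γ} s i := by
    suffices H : ((bas γ).constr R fun p => Finsupp.single ⟨p.1, p.2.1⟩ (g p.2.2)) ∘ₗ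
        (act γ).flip (tr K _ _ (e i.1.1 i.2)) = Finsupp.lsingle i from LinearMap.congr_fun H s
    refine g.ext fun σ => ?_
    have h1 := hbas γ ⟨i.1, i.2, σ⟩
    have h2 := (act_tr (act := act) i.1.2 (g σ) (e i.1.1 i.2)).trans h1.symm
    refine (congrArg ((bas γ).constr R _) h2).trans ?_
    exact (bas γ).constr_basis R _ _
  sum_dec {γ} v := by
    suffices H : Finsupp.lsum R (fun i : Σ n : {n : ℤ // (n : Deg N) = γ}, ι n.1 =>
        (act γ).flip (tr K _ _ (e i.1.1 i.2))) ∘ₗ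
        ((bas γ).constr R fun p => Finsupp.single ⟨p.1, p.2.1⟩ (g p.2.2)) = LinearMap.id from
      LinearMap.congr_fun H v
    refine (bas γ).ext fun p => ?_
    rw [LinearMap.comp_apply, Module.Basis.constr_basis, Finsupp.lsum_single]
    exact (act_tr (act := act) p.1.2 (g p.2.2) (e p.1.1 p.2.1)).trans (hbas γ p).symm
  del_e {γ} := by
    rintro ⟨⟨n, rfl⟩, i⟩
    have hn : ((n - 1 : ℤ) : Deg N) = (n : Deg N) - 1 := by push_cast; rfl
    have h1 := Submodule.mem_map_of_mem (f := tr K ((n - 1 : ℤ) : Deg N) ((n : Deg N) - 1)) (hdel n i)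
    rw [Submodule.map_span, tr_del K hn] at h1
    rw [tr_self]
    refine Submodule.span_mono ?_ h1
    rintro _ ⟨_, ⟨⟨j, σ⟩, rfl⟩, rfl⟩
    refine ⟨g σ, ⟨⟨n - 1, hn⟩, j⟩, ?_, (act_tr hn _ _).symm⟩
    have h2 : m ≤ n - 1 := not_lt.1 fun h => (hm _ h).false j
    change (n - 1 - m).toNat < (n - m).toNat
    omega

/-- The empty basis of a zero complex. -/
def ActBasis.ofZero (h : ∀ b (v : K.X b), v = 0) : ActBasis K act where
  ι _ := PEmpty
  e i := i.elim
  rk i := i.elim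
  dec _ := 0
  dec_act _ i := i.elim
  sum_dec v := (h _ _).trans (h _ _).symm
  del_e i := i.elim

end ActBases

section DiagonalBasis

variable {𝒞 : DGCat R N}

/-- The basis of the endomorphisms of an object, concentrated in degree zero, that consists of the
identity. -/
def diagBasis (x : 𝒞.Ob) (h0 : ∀ b, b ≠ 0 → ∀ m : (𝒞.Hom x x).X b, m = 0) :
    ActBasis (𝒞.Hom x x) (fun b => 𝒞.comp (x := x) (y := x) (z := x) 0 b b (zero_add b)) where
  ι b := ULift (PLift (b = 0))
  e {b} _ := tr _ 0 b (𝒞.one x)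
  rk _ := 0
  dec b := if h : b = 0 then Finsupp.lsingle ⟨⟨h⟩⟩ ∘ₗ tr _ b 0 else 0
  dec_act {b} s i := by
    obtain ⟨⟨rfl⟩⟩ := i
    rw [dif_pos rfl, tr_self]
    refine (congrArg _ (𝒞.comp_one 0 (zero_add 0) s)).trans ?_
    exact congrArg (Finsupp.single _) (tr_self _ _ s)
  sum_dec {b} v := by
    by_cases h : b = 0
    · subst h
      rw [dif_pos rfl]
      refine (Finsupp.sum_single_index (h := fun _ s => 𝒞.comp (x := x) (y := x) (z := x) 0 0 0
        (zero_add 0) s (tr _ 0 0 (𝒞.one x))) (LinearMap.map_zero₂ _ _)).trans ?_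
      rw [tr_self, tr_self]
      exact 𝒞.comp_one 0 (zero_add 0) v
    · exact (h0 b h _).trans (h0 b h _).symm
  del_e {b} i := by
    obtain ⟨⟨rfl⟩⟩ := i
    rw [tr_self, 𝒞.del_one]
    exact zero_mem _

end DiagonalBasis

/-! ### Morphisms to the unit of the PROP of an operad -/

section MorphismsToUnit

variable (O : DGMulticat R N) [Unique O.Ob] (n : ℕ)

/-- The operations of arity `n` of an operad. -/
abbrev operCx : Ch R N := O.Hom (fun _ : Fin n => default) default

/-- The morphisms, in the PROP of an operad, from the sequence of length `n` to that of length one. -/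
abbrev unitHom : Ch R N :=
  propHom O (fun _ : Fin n => default) (fun _ : Fin 1 => default)

/-- The bijection of the fibre of a map to a point with the source. -/
def fibTop (f : Fin n → Fin 1) (j : Fin 1) : Fin n ≃ {i // f i = j} where
  toFun i := ⟨i, Subsingleton.elim _ _⟩
  invFun i := i.1
  left_inv _ := rfl
  right_inv _ := rfl

/-- The factors of a morphism in the PROP to a sequence of length one. -/
def unitFac (f : Fin n → Fin 1) (j : Fin 1) :
    fibHom O f (fun _ => default) (fun _ : Fin 1 => default) j ⟶ operCx O n :=
  O.perm (fibTop n f j) (fun _ => rfl) default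

theorem unitFac_bijective (f : Fin n → Fin 1) (j : Fin 1) (γ : Deg N) :
    Function.Bijective (app (unitFac O n f j) γ) := by
  refine Function.bijective_iff_has_inverse.2
    ⟨app (O.perm (fibTop n f j).symm (fun _ => rfl) default) γ, fun v => ?_, fun v => ?_⟩
  · exact (perm_perm O _ _ (Equiv.refl _) _ _ (fun _ => rfl) (fun _ => rfl) _ _ _).trans
      (perm_one O _ (fun _ => rfl) _ _ _ _)
  · exact (perm_perm O _ _ (Equiv.refl _) _ _ (fun _ => rfl) (fun _ => rfl) _ _ _).trans
      (perm_one O _ (fun _ => rfl) _ _ _ _)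

theorem tMap_bijective {J : Type} [Fintype J] [LinearOrder J] {K L : J → Ch R N} (φ : ∀ j, K j ⟶ L j)
    (hφ : ∀ j γ, Function.Bijective (app (φ j) γ)) (γ : Deg N) :
    Function.Bijective (app (tMap φ) γ) := by
  let ψ : ∀ j a, (L j).X a →ₗ[R] (K j).X a := fun j a => (LinearEquiv.ofBijective _ (hφ j a)).symm.toLinearMap
  let T : (tens L).X γ →ₗ[R] (tens K).X γ :=
    tLift fun g h => (tp K g γ h).compLinearMap fun j => ψ j (g j)
  refine Function.bijective_iff_has_inverse.2 ⟨T, fun t => ?_, fun t => ?_⟩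
  · suffices H : T ∘ₗ app (tMap φ) γ = LinearMap.id from LinearMap.congr_fun H t
    refine tp_ext fun g h x => ?_
    rw [LinearMap.comp_apply, tMap_tp, tLift_tp]
    exact congrArg (tp K g γ h) (funext fun j => (LinearEquiv.ofBijective _ (hφ j (g j))).symm_apply_apply _)
  · suffices H : app (tMap φ) γ ∘ₗ T = LinearMap.id from LinearMap.congr_fun H t
    refine tp_ext fun g h x => ?_
    rw [LinearMap.comp_apply, tLift_tp]
    refine (tMap_tp _ _ _ _ _).trans ?_
    exact congrArg (tp L g γ h) (funext fun j => (LinearEquiv.ofBijective _ (hφ j (g j))).apply_symm_apply _)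

/-- The operation that corresponds to a morphism to a sequence of length one. -/
def unitOper (γ : Deg N) : (unitHom O n).X γ →ₗ[R] (operCx O n).X γ :=
  app (tensPt (operCx O n)) γ ∘ₗ app (tMap (unitFac O n 0)) γ ∘ₗ propCo (0 : Fin n → Fin 1) γ

theorem unitOper_bijective (γ : Deg N) : Function.Bijective (unitOper O n γ) := by
  refine (tensPt_bijective _ γ).comp ((tMap_bijective _ (unitFac_bijective O n 0) γ).comp ?_)
  refine Function.bijective_iff_has_inverse.2 ⟨propIn 0 γ, fun v => ?_, fun v => propCo_self _ _ _⟩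
  suffices H : propIn (0 : Fin n → Fin 1) γ ∘ₗ propCo 0 γ = LinearMap.id from LinearMap.congr_fun H v
  refine propIn_ext fun f x => ?_
  obtain rfl : f = 0 := Subsingleton.elim _ _
  exact congrArg (propIn 0 γ) (propCo_self _ _ _)

theorem del_unitOper (γ γ' : Deg N) (v : (unitHom O n).X γ) :
    unitOper O n γ' (del _ γ γ' v) = del _ γ γ' (unitOper O n γ v) := by
  have h1 : propCo (0 : Fin n → Fin 1) γ' (del (unitHom O n) γ γ' v) = del _ γ γ' (propCo 0 γ v) := rfl
  refine (congrArg (fun t => app (tensPt (operCx O n)) γ' (app (tMap (unitFac O n 0)) γ' t)) h1).trans ?_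
  exact (congrArg (app (tensPt (operCx O n)) γ') (app_del _ γ γ' _)).trans (app_del _ γ γ' _)

/-- The action of permutations on the operations. -/
abbrev operPerm (σ : Equiv.Perm (Fin n)) (γ : Deg N) : (operCx O n).X γ →ₗ[R] (operCx O n).X γ :=
  app (O.perm σ (fun _ => rfl) default) γ

theorem operPerm_operPerm (σ τ : Equiv.Perm (Fin n)) (γ : Deg N) (v : (operCx O n).X γ) :
    operPerm O n σ γ (operPerm O n τ γ v) = operPerm O n (τ * σ) γ v :=
  perm_perm O _ _ _ _ _ _ (fun _ => rfl) _ _ _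

theorem unitOper_hPerm (τ : Equiv.Perm (Fin n)) (γ : Deg N) (v : (unitHom O n).X γ) :
    unitOper O n γ (hPerm τ (fun _ => default) (fun _ : Fin 1 => default) γ v) =
      operPerm O n τ γ (unitOper O n γ v) := by
  suffices H : unitOper O n γ ∘ₗ hPerm τ (fun _ => default) (fun _ : Fin 1 => default) γ =
      operPerm O n τ γ ∘ₗ unitOper O n γ from LinearMap.congr_fun H v
  refine prop_tp_ext fun f g hg m => ?_
  obtain rfl : f = 0 := Subsingleton.elim _ _
  have h1 : ∀ (m : ∀ k, (fibHom O (0 : Fin n → Fin 1) (fun _ => default) (fun _ => default) k).X (g k)),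
      unitOper O n γ (propIn 0 γ (tp _ g γ hg m)) = tr _ (g 0) γ (app (unitFac O n 0 0) (g 0) (m 0)) := by
    intro m
    refine (congrArg (fun t => app (tensPt (operCx O n)) γ (app (tMap (unitFac O n 0)) γ t))
      (propCo_self _ _ _)).trans ?_
    refine (congrArg (app (tensPt (operCx O n)) γ) (tMap_tp _ _ _ _ _)).trans ?_
    exact tensPtX_tp _ _ _ _ _
  refine (congrArg (unitOper O n γ) (hPerm_in τ _ _ γ 0 g hg m)).trans ?_
  refine (h1 _).trans ?_
  refine Eq.trans ?_ (congrArg (operPerm O n τ γ) (h1 m)).symm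
  refine Eq.trans ?_ (app_tr _ _ _ _).symm
  refine congrArg (tr _ (g 0) γ) ?_
  let e : Fin n ≃ {i // (0 : Fin n → Fin 1) i = 0} :=
    (fibTop n (fun i => (0 : Fin n → Fin 1) (τ i)) 0).trans (fibE τ (0 : Fin n → Fin 1) 0)
  refine (perm_perm O (fibTop n (fun i => (0 : Fin n → Fin 1) (τ i)) 0) (fibE τ (0 : Fin n → Fin 1) 0) e
    (fun _ => rfl) (fun _ => rfl) (fun _ => rfl) (fun _ => rfl) _ _ (m 0)).trans ?_
  exact (perm_perm O τ (fibTop n 0 0) e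
    (fun _ => rfl) (fun _ => rfl) (fun _ => rfl) (fun _ => rfl) _ _ (m 0)).symm

theorem unitOper_reMor (τ : Equiv.Perm (Fin n)) (γ : Deg N) (v : (unitHom O n).X γ) :
    unitOper O n γ (propComp (fun _ => default) (fun _ => default) (fun _ : Fin 1 => default) 0 γ γ
      (zero_add γ) (reMor τ.symm fun _ => rfl) v) = operPerm O n τ γ (unitOper O n γ v) := by
  obtain ⟨w, hw⟩ := (unitOper_bijective O n γ).2 (operPerm O n τ γ (unitOper O n γ v))
  have h1 : hPerm τ.symm (fun _ => default) (fun _ : Fin 1 => default) γ w = v := by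
    refine (unitOper_bijective O n γ).1 ((unitOper_hPerm O n τ.symm γ w).trans ?_)
    refine (congrArg (operPerm O n τ.symm γ) hw).trans ((operPerm_operPerm O n _ _ γ _).trans ?_)
    exact perm_one O _ (fun i => τ.apply_symm_apply i) _ _ _ _
  rw [← hw, ← h1]
  exact congrArg (unitOper O n γ) (reMor_comp τ.symm (fun _ => default) (fun _ : Fin 1 => default) γ _ w)

end MorphismsToUnit

/-! ### Bases from the freeness hypothesis -/

section FreeMorphisms

theorem nonempty_actBasis_of_bddBelowFree {K : Ch R N} {S : Type u} [AddCommGroup S] [Module R S]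
    {act : ∀ b, S →ₗ[R] K.X b →ₗ[R] K.X b} {G : Type} (g : Module.Basis G R S)
    {ρ : G → ∀ γ, K.X γ →ₗ[R] K.X γ} (hact : ∀ b σ v, act b (g σ) v = ρ σ b v)
    (h : BddBelowFree K ρ) : Nonempty (ActBasis K act) := by
  obtain ⟨ι, e, ⟨m, hm⟩, hdel, hbas⟩ := h
  refine ⟨ActBasis.ofGraded g ι e m hm (fun n i => ?_)
    (fun γ => Module.Basis.mk (hbas γ).1 (hbas γ).2.ge) fun γ p => ?_⟩
  · simp only [hact]
    exact hdel n i
  · rw [Module.Basis.mk_apply, hact]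

/-- The decomposition of the elements of a group with respect to representatives of the cosets of a
subgroup. -/
def cosetEquiv {G : Type} [Group G] (H : Subgroup G) : G ≃ (G ⧸ H) × H where
  toFun σ := (σ, ⟨(σ : G ⧸ H).out⁻¹ * σ, QuotientGroup.eq.1 (QuotientGroup.out_eq' _)⟩)
  invFun p := p.1.out * p.2
  left_inv σ := mul_inv_cancel_left _ _
  right_inv p := by
    have h : ((p.1.out * p.2 : G) : G ⧸ H) = p.1 :=
      (QuotientGroup.mk_mul_of_mem _ p.2.2).trans (QuotientGroup.out_eq' _)
    exact Prod.ext h (Subtype.ext (by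
      change (↑(p.1.out * p.2 : G) : G ⧸ H).out⁻¹ * (p.1.out * p.2) = p.2
      rw [h, inv_mul_cancel_left]))

/-- The reindexing of a basis over a group by a basis over a subgroup, with coset representatives. -/
def cosetIndex {n : ℕ} (H : Subgroup (Equiv.Perm (Fin n))) {T : Type} (ι : T → Type u) :
    (Σ t : T, ι t × Equiv.Perm (Fin n)) ≃ Σ t : T, (ι t × (Equiv.Perm (Fin n) ⧸ H)) × H :=
  Equiv.sigmaCongrRight fun t => ((Equiv.refl (ι t)).prodCongr
    (cosetEquiv H)).trans (Equiv.prodAssoc _ _ _).symm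

variable (O : DGMulticat R N) [Unique O.Ob]

/-- A basis of `O(n)` over `R[Sₙ]`, together with representatives of the cosets of a subgroup `H`,
is a basis of the morphisms to the unit over `R[H]`. -/
theorem nonempty_actBasis_unitHom {n : ℕ} (a : Fin n → O.Ob) (H : Subgroup (Equiv.Perm (Fin n)))
    {S : Type u} [AddCommGroup S] [Module R S] (g : Module.Basis H R S)
    {act : ∀ b, S →ₗ[R] (propHom O a fun _ : Fin 1 => default).X b →ₗ[R]
      (propHom O a fun _ : Fin 1 => default).X b}
    (hact : ∀ b (σ : H) v, act b (g σ) v = propComp a a (fun _ : Fin 1 => default) 0 b b (zero_add b)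
      (reMor σ.1.symm fun _ => Subsingleton.elim _ _) v)
    (h : BddBelowFree (operCx O n) (operPerm O n)) : Nonempty (ActBasis _ act) := by
  obtain rfl : a = fun _ => default := funext fun i => Unique.eq_default _
  obtain ⟨ι, e, ⟨m, hm⟩, hdel, hbas⟩ := h
  let θ : ∀ γ, (unitHom O n).X γ ≃ₗ[R] (operCx O n).X γ := fun γ =>
    LinearEquiv.ofBijective _ (unitOper_bijective O n γ)
  have hθ : ∀ γ (σ : H) v, θ γ (act γ (g σ) v) = operPerm O n σ.1 γ (θ γ v) := fun γ σ v =>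
    (congrArg (unitOper O n γ) (hact γ σ v)).trans (unitOper_reMor O n σ.1 γ v)
  let e' : ∀ k : ℤ, ι k × (Equiv.Perm (Fin n) ⧸ H) → (unitHom O n).X (k : Deg N) := fun k p =>
    (θ k).symm (operPerm O n p.2.out k (e k p.1))
  have he' : ∀ (k : ℤ) i (σ : Equiv.Perm (Fin n)), (θ k).symm (operPerm O n σ k (e k i)) =
      act k (g (cosetEquiv H σ).2)
        (e' k (i, (cosetEquiv H σ).1)) := by
    intro k i σ
    rw [LinearEquiv.symm_apply_eq, hθ, LinearEquiv.apply_symm_apply, operPerm_operPerm]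
    exact congrArg (fun τ => operPerm O n τ k (e k i)) ((cosetEquiv H).symm_apply_apply σ).symm
  refine ⟨ActBasis.ofGraded g (fun k => ι k × (Equiv.Perm (Fin n) ⧸ H)) e' m
    (fun k hk => ⟨fun p => (hm k hk).false p.1⟩) (fun k i => ?_)
    (fun γ => ((Module.Basis.mk (hbas γ).1 (hbas γ).2.ge).map (θ γ).symm).reindex
      (cosetIndex H fun k : {k : ℤ // (k : Deg N) = γ} => ι k.1)) fun γ p => ?_⟩
  · have h1 : del _ (k : Deg N) ((k - 1 : ℤ) : Deg N) (e' k i) =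
        (θ _).symm (operPerm O n i.2.out _ (del _ (k : Deg N) ((k - 1 : ℤ) : Deg N) (e k i.1))) := by
      refine (LinearEquiv.eq_symm_apply _).2 ((del_unitOper O n _ _ _).trans ?_)
      refine (congrArg (del _ _ _) ((θ k).apply_symm_apply _)).trans ?_
      exact (app_del _ _ _ _).symm
    have h2 := Submodule.mem_map_of_mem
      (f := (θ ((k - 1 : ℤ) : Deg N)).symm.toLinearMap ∘ₗ operPerm O n i.2.out _) (hdel k i.1)
    rw [Submodule.map_span] at h2
    rw [h1]
    refine Submodule.span_mono ?_ h2
    rintro _ ⟨_, ⟨⟨j, σ⟩, rfl⟩, rfl⟩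
    refine ⟨((j, (cosetEquiv H (σ * i.2.out)).1), (cosetEquiv H (σ * i.2.out)).2), (he' (k - 1) j _).symm.trans ?_⟩
    exact congrArg (θ ((k - 1 : ℤ) : Deg N)).symm (operPerm_operPerm O n _ _ _ _).symm
  · obtain ⟨p, rfl⟩ := (cosetIndex H fun k : {k : ℤ // (k : Deg N) = γ} => ι k.1).surjective p
    obtain ⟨⟨k, rfl⟩, i, σ⟩ := p
    rw [Module.Basis.reindex_apply, Equiv.symm_apply_apply, Module.Basis.map_apply, Module.Basis.mk_apply]
    refine (congrArg (θ k).symm (tr_self _ _ _)).trans ((he' k i σ).trans ?_)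
    exact (tr_self _ _ _).symm

end FreeMorphisms

section ExistenceOfBasis

variable {M O : DGMulticat R N}
  [LinearOrder M.Ob] [LinearOrder O.Ob] [Unique O.Ob]

theorem unitHom_eq_zero_of_isEmpty {a : Fin 0 → O.Ob} {b : Fin 1 → O.Ob} (γ : Deg N)
    (v : (propHom O a b).X γ) : v = 0 := by
  suffices H : (LinearMap.id : (propHom O a b).X γ →ₗ[R] _) = 0 from LinearMap.congr_fun H v
  refine prop_tp_ext fun f g hg m => ?_
  exact (congrArg (propIn f γ) (tp_zero _ 0 (O.hom_empty _ _ _ _))).trans (map_zero _)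

theorem nonempty_actBasis (π : DGMultifunctor M O) (hπ : Monotone π.obj)
    (h : FreenessHypothesis M O) (x : (propCat M).Ob) (z : Option (propCat M).Ob) :
    ∃ V : ActBasis (vOb (propFunctor π hπ) (propUnit O) x z)
      (fun b => vComp (propFunctor π hπ) (propUnit O) (x := x) 0 b b (zero_add b)),
      ∀ e : z = some x, ∃ d : V.ι 0, HEq (V.e d) ((propCat M).one x) ∧
        ∀ i : Σ b, V.ι b, i = ⟨0, d⟩ := by
  let g : Module.Basis (autSeq x.2.1) R (((propCat M).Hom x x).X 0) :=
    Module.Basis.mk (h.identity x).1 (h.identity x).2.1.ge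
  have hg : ∀ σ, g σ = permMor (M := M) x.2.1 σ.1 σ.2 := fun σ => Module.Basis.mk_apply _ _ _
  cases z with
  | some y =>
    by_cases e : y = x
    · subst e
      refine ⟨diagBasis y (h.identity y).2.2, fun _ => ⟨⟨⟨rfl⟩⟩, heq_of_eq (tr_self _ _ _), ?_⟩⟩
      rintro ⟨b, ⟨⟨rfl⟩⟩⟩
      rfl
    · obtain ⟨V⟩ := nonempty_actBasis_of_bddBelowFree (K := (propCat M).Hom x y)
        (act := fun b => (propCat M).comp (x := x) (y := x) (z := y) 0 b b (zero_add b)) g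
        (fun b σ v => congrArg (fun s => (propCat M).comp (x := x) (y := x) (z := y) 0 b b (zero_add b) s v)
          (hg σ)) (h.free₁ x y)
      exact ⟨V, fun e' => absurd (Option.some.inj e') e⟩
  | none =>
    suffices H : Nonempty (ActBasis (vOb (propFunctor π hπ) (propUnit O) x none)
        (fun b => vComp (propFunctor π hπ) (propUnit O) (x := x) (y := x) (z := none) 0 b b (zero_add b))) from
      H.elim fun V => ⟨V, fun e => nomatch e⟩
    obtain ⟨n, x, hx⟩ := x
    rcases Nat.eq_zero_or_pos n with rfl | hn
    · exact ⟨ActBasis.ofZero fun b v => unitHom_eq_zero_of_isEmpty b v⟩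
    · refine nonempty_actBasis_unitHom O (fun i => π.obj (x i)) (autSeq x) g (fun b σ v => ?_) (h.free₂ n hn)
      have h1 := (congrArg (app (propMap π x x) 0) (hg σ)).trans (propMap_reMor π σ.1.symm (a := x)
        (a' := x) fun i => ((autSeq x).inv_mem σ.2 i).symm)
      exact congrArg (fun s => propComp (fun i => π.obj (x i)) (fun i => π.obj (x i))
        (fun _ : Fin 1 => default) 0 b b (zero_add b) s v) h1

/-- The freeness hypothesis supplies the bases that the bar construction needs. -/
theorem nonempty_essBasis (π : DGMultifunctor M O) (hπ : Monotone π.obj)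
    (h : FreenessHypothesis M O) : Nonempty (EssBasis (propFunctor π hπ) (propUnit O)) := by
  choose V hV using nonempty_actBasis π hπ h
  choose d hd hd' using fun x => hV x (some x) rfl
  exact ⟨{
    ι := fun x z b => (V x z).ι b
    e := fun {x z b} i => (V x z).e i
    rk := fun {x z b} i => (V x z).rk i
    dec := fun x z b => (V x z).dec b
    dec_comp := fun {x z b} s i => (V x z).dec_act s i
    sum_dec := fun {x z b} v => (V x z).sum_dec v
    hom_eq_zero := fun x => (h.identity x).2.2
    del_e := fun {x z b} i => (V x z).del_e i
    diag := d
    diag_eq := fun {x} => hd' x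
    e_diag := fun x => eq_of_heq (hd x) }⟩

end ExistenceOfBasis

section Comparison

variable {M O : DGMulticat R N}

theorem HomotopyEquiv.quasiIso_of_hom_eq {K L : Ch R N} {f : K ⟶ L}
    (h : ∃ e : HomotopyEquiv K L, e.hom = f) : QuasiIso f := by
  obtain ⟨e, rfl⟩ := h
  exact e.quasiIso_hom

end Comparison

end

theorem proposition5p1 {R : Type u} [CommRing R] (N : ℕ) (M O : DGMulticat R N)
    [LinearOrder M.Ob] [LinearOrder O.Ob] [Unique O.Ob] (π : DGMultifunctor M O) (A : DGAlg M)
    (h : FreenessHypothesis M O) :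
    Nonempty (HomotopyEquiv
      (catLan (propFunctor π (fun _ _ _ => (Subsingleton.elim _ _).le)) (propMod A) (propUnit O))
      (opLan π A default)) ∧
    QuasiIso (cmpLan π (fun _ _ _ => (Subsingleton.elim _ _).le) A) ∧
    ∀ m : ℕ, QuasiIso (cmpFil π (fun _ _ _ => (Subsingleton.elim _ _).le) A m) := by
  have hπ : Monotone π.obj := fun _ _ _ => (Subsingleton.elim _ _).le
  obtain ⟨B⟩ := nonempty_essBasis π hπ h
  have H := lanCmp_normalForm (A := A) π hπ B fun x => (h.identity x).2.1
  obtain ⟨⟨e, he⟩, h2⟩ := exists_homotopyEquiv_of_nf (lanCmp π hπ A) B (fun n c => (H n c).1)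
    fun n c => (H n c).2
  exact ⟨⟨e⟩, HomotopyEquiv.quasiIso_of_hom_eq ⟨e, he⟩, fun m => HomotopyEquiv.quasiIso_of_hom_eq (h2 m)⟩

end
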